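/- **Setting.** Let $r_0>0$, $M_0\ge 1$, $M_1>1$, $\theta_0\in(0,\pi/2)$. For vectors $|\cdot|$ is the Euclidean norm and for $3\times3$ matrices $|A|=(\sum_{i,j}A_{ij}^2)^{1/2}$. Let $\Omega\subset\mathbb R^3$ be a bounded domain with $\operatorname{diam}\Omega\le M_1r_0$. *Polyhedra.* A polyhedron is a set $D\subset\mathbb R^3$ homeomorphic to a closed ball, whose boundary is a finite union of faces, i.e. closed plane regions bounded by simple closed polygons, with pairwise disjoint relative interiors. Every side of a face is also a side of another face (if a side of a face borders several other faces, it is subdivided by corners with angle $\pi$). The sides of the faces are the edges of $D$, and their corners are the vertices of $D$. *Lipschitz boundaries.* An open set $U\subset\mathbb R^d$, $d\in\{2,3\}$, has Lipschitz boundary with constants $r_0,M_0$ if for every $P\in\partial U$ there are Cartesian coordinates $x=(x',x_d)$ with origin $P$ in which $U\cap R=\{x\in R: x_d>g(x')\}$, where $R=[-r_0,r_0]^{d-1}\times[-2M_0r_0,2M_0r_0]$, $g(0)=0$ and $\sup|g|+r_0\operatorname{Lip}(g)\le M_0r_0$ on $[-r_0,r_0]^{d-1}$. *The class.* $\mathcal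 P$ is the class of polyhedra $D\subset\Omega$ such that: $\operatorname{dist}(D,\partial\Omega)\ge r_0$; every dihedral angle of $D$ (at the edges) and every internal angle of a face of $D$ lies in $(\theta_0,\pi-\theta_0)\cup(\pi+\theta_0,2\pi-\theta_0)$; every edge has length at least $r_0$; $\Omega\setminus D$ has Lipschitz boundary with constants $r_0,M_0$; and so has each face (its relative interior) in its plane. *The triangles.* For $D_0\in\mathcal P$ let $h_0=\frac{r_0}{2}\tan\gamma$ with $\gamma=\min\{\theta_0/3,\ \pi/2-\arctan M_0\}$, and let $\mathcal T_0$ be the family of all isosceles triangles with basis an edge $\sigma$ of a face $F$ of $D_0$ and third vertex $M-h_0n$, where $M$ is the midpoint of $\sigma$ and $n$ is the unit outer normal to $F$ at $M$ in the plane of $F$. Let $\mathcal W=\{x:\operatorname{dist}(x,D_0)<r_0/4\}$. Write $d_H=d_H(\partial D_0,\partial D_1)$ for the Hausdorff distance. **Theorem.** There are positive constants $c$, $C_4$, $\widetilde C$, depending only on $M_0,M_1,\theta_0$, such that the following holds for all $r_0$, $\Omega$ as above and all $D_0,D_1\in\mathcal P$ with $d_H\le c\,r_0$. $D_0$ and $D_1$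 have the same number $N$ of vertices, and these can be ordered as $V_1^{D_0},\dots,V_N^{D_0}$ and $V_1^{D_1},\dots,V_N^{D_1}$ so that $|V_i^{D_0}-V_i^{D_1}|\le C_4d_H$ for every $i$ and edges and faces of $D_0$ and $D_1$ correspond to each other through their vertices. Moreover there is a (continuous) vector field $\mathcal U\in W^{1,\infty}(\mathbb R^3,\mathbb R^3)$ such that 1. $\mathcal U(V_i^{D_0})=V_i^{D_1}-V_i^{D_0}$ for $i=1,\dots,N$; 2. $\operatorname{supp}\mathcal U\subset\overline{\mathcal W}$; 3. $\mathcal U$ is affine on each $T\in\mathcal T_0$; 4. $\|\mathcal U\|_\infty+r_0\|D\mathcal U\|_\infty\le\widetilde C\,d_H$; and, if in addition $d_H\le\frac{1}{3\widetilde C}r_0$, then $\|D\mathcal U\|_\infty\le\frac13$ and the maps $\Phi_t=\mathrm{Id}+t\,\mathcal U$ satisfy $\Phi_1(D_0)=D_1$ and, for every $t\in[0,1]$: 5. $\Phi_t$ is a bijection of $\Omega$ onto $\Omega$, Lipschitz together with its inverse, $\Phi_t\in W^{1,\infty}(\Omega,\Omega)$ and $D\Phi_t=I_3+t\,D\mathcal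 U$; 6. $\|D\Phi_t\|_\infty\le\sqrt3+\frac13$; 7. $\frac12\le\det D\Phi_t\le\frac32$ a.e. in $\Omega$, $(D\Phi_t)^{-1}=I_3-t\,D\mathcal U\,(D\Phi_t)^{-1}$ a.e. in $\Omega$, and $\|(D\Phi_t)^{-1}\|_\infty\le\frac32$, where in this last bound matrices are measured by the operator norm associated with the Euclidean norm; 8. $|\det D\Phi_t-1-t\operatorname{div}\mathcal U|\le 6t^2|D\mathcal U|^2+6t^3|D\mathcal U|^3$ a.e. in $\Omega$. -/

import Mathlib

open MeasureTheory Filter Topology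
open scoped ENNReal ContDiff

noncomputable section

/-- Euclidean three-space. -/
abbrev E3 : Type := EuclideanSpace ℝ (Fin 3)

/-! ### Polygons and polyhedra -/

/-- `F` is the closed plane region bounded by the simple closed polygon with consecutive corners
`v 0, v 1, …, v (n - 1)` (indices modulo `n`). Relative interior and relative boundary are taken
in the plane `affineSpan ℝ F`. A compact plane set with nonempty interior whose boundary is a
Jordan polygon is the closed Jordan region of that polygon; so `F` is simply connected.
Flat corners (internal angle `π`) are not excluded here. -/
structure IsPolygonalRegion (F : Set E3) (n : ℕ) (v : ZMod n → E3) : Prop where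
  three_le : 3 ≤ n
  plane : Module.finrank ℝ (affineSpan ℝ F).direction = 2
  compact : IsCompact F
  corners_injective : Function.Injective v
  simple : ∀ k l : ZMod n, k ≠ l →
    segment ℝ (v k) (v (k + 1)) ∩ segment ℝ (v l) (v (l + 1)) ⊆
      {v k, v (k + 1)} ∩ {v l, v (l + 1)}
  relInterior_nonempty : (intrinsicInterior ℝ F).Nonempty
  relBoundary : intrinsicFrontier ℝ F = ⋃ k : ZMod n, segment ℝ (v k) (v (k + 1))

/-- A polyhedron: a set homeomorphic to a closed ball whose boundary is a finite union of closed
simply connected plane polygonal regions (the faces) with disjoint relative interiors.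
The corners of the faces are listed in such a way that every side of a face is also a side of
another face (where a side of a face is shared by several other faces, it is subdivided by flat
corners); hence the edges of the polyhedron are the sides of its faces, and its vertices are the
corners of its faces. -/
structure Polyhedron where
  carrier : Set E3
  homeomorphic_ball : Nonempty (carrier ≃ₜ Metric.closedBall (0 : E3) 1)
  numFaces : ℕ
  face : Fin numFaces → Set E3
  numSides : Fin numFaces → ℕ
  corner : (j : Fin numFaces) → ZMod (numSides j) → E3
  face_polygonal : ∀ j, IsPolygonalRegion (face j) (numSides j) (corner j)
  boundary_eq : frontier carrier = ⋃ j, face j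
  faces_disjoint : ∀ i j, i ≠ j →
    Disjoint (intrinsicInterior ℝ (face i)) (intrinsicInterior ℝ (face j))
  sides_shared : ∀ i (k : ZMod (numSides i)), ∃ j, j ≠ i ∧ ∃ l : ZMod (numSides j),
    segment ℝ (corner i k) (corner i (k + 1)) = segment ℝ (corner j l) (corner j (l + 1))

namespace Polyhedron

/-- The `k`-th side of the `j`-th face, as a segment. -/
def side (D : Polyhedron) (j : Fin D.numFaces) (k : ZMod (D.numSides j)) : Set E3 :=
  segment ℝ (D.corner j k) (D.corner j (k + 1))

/-- The midpoint of the `k`-th side of the `j`-th face. -/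
def sideMid (D : Polyhedron) (j : Fin D.numFaces) (k : ZMod (D.numSides j)) : E3 :=
  midpoint ℝ (D.corner j k) (D.corner j (k + 1))

/-- The set of vertices. -/
def vertices (D : Polyhedron) : Set E3 := {p | ∃ j k, D.corner j k = p}

/-- `a` and `b` are the endpoints of an edge. -/
def IsEdge (D : Polyhedron) (a b : E3) : Prop := ∃ j k, D.side j k = segment ℝ a b

/-- `A` is the set of vertices of a face. -/
def IsFaceVertexSet (D : Polyhedron) (A : Set E3) : Prop := ∃ j, Set.range (D.corner j) = A

/-- `n` is the unit outer normal, in the plane of the `j`-th face `F`, to `F` at the midpoint of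
its `k`-th side. -/
structure IsOuterNormal (D : Polyhedron) (j : Fin D.numFaces) (k : ZMod (D.numSides j))
    (n : E3) : Prop where
  mem_direction : n ∈ (affineSpan ℝ (D.face j)).direction
  unit : ‖n‖ = 1
  orthogonal : inner ℝ n (D.corner j (k + 1) - D.corner j k) = 0
  outward : ∀ᶠ t : ℝ in 𝓝[>] 0, D.sideMid j k + t • n ∉ D.face j

/-- The family of the isosceles triangles having as basis an edge `σ` of a face `F`, and as third
vertex `M - h • n`, where `M` is the midpoint of `σ` and `n` is the unit outer normal to `F` at `M`
in the plane of `F`. -/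
def triangles (D : Polyhedron) (h : ℝ) : Set (Set E3) :=
  {T | ∃ j k n, D.IsOuterNormal j k n ∧
    T = convexHull ℝ {D.corner j k, D.corner j (k + 1), D.sideMid j k - h • n}}

end Polyhedron

/-! ### Angles -/

open Classical in
/-- The angle at `p` of a set `S` that near `p`, in the plane through `p` spanned by `u` and `w`,
is one of the two sectors bounded by the rays from `p` in the directions `u` and `w`: the convex
angle if `S` contains the convex sector near `p`, the reflex angle otherwise. -/
def sectorAngle (S : Set E3) (p u w : E3) : ℝ :=
  if ∃ ε : ℝ, 0 < ε ∧ ∀ s ∈ Set.Icc (0 : ℝ) ε, ∀ t ∈ Set.Icc (0 : ℝ) ε,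
      p + s • u + t • w ∈ S
  then InnerProductGeometry.angle u w
  else 2 * Real.pi - InnerProductGeometry.angle u w

/-- Non-degenerate angles: `(θ₀, π - θ₀) ∪ (π + θ₀, 2π - θ₀)`. -/
def nondegenerateAngles (θ₀ : ℝ) : Set ℝ :=
  Set.Ioo θ₀ (Real.pi - θ₀) ∪ Set.Ioo (Real.pi + θ₀) (2 * Real.pi - θ₀)

namespace Polyhedron

/-- The internal angle of the `j`-th face at its `k`-th corner. -/
def internalAngle (D : Polyhedron) (j : Fin D.numFaces) (k : ZMod (D.numSides j)) : ℝ :=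
  sectorAngle (D.face j) (D.corner j k)
    (D.corner j (k + 1) - D.corner j k) (D.corner j (k - 1) - D.corner j k)

/-- `α` is the dihedral angle of `D` at the edge shared by two different faces: the angle, measured
in `D` at the midpoint of the edge, between the inner normals to the edge in the two faces. -/
def IsDihedralAngle (D : Polyhedron) (α : ℝ) : Prop :=
  ∃ i j k l n n', i ≠ j ∧ D.side i k = D.side j l ∧
    D.IsOuterNormal i k n ∧ D.IsOuterNormal j l n' ∧
    α = sectorAngle D.carrier (D.sideMid i k) (-n) (-n')

end Polyhedron

/-! ### Lipschitz boundaries -/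

/-- The first `d` coordinates. -/
def firstCoords {d : ℕ} (x : EuclideanSpace ℝ (Fin (d + 1))) : EuclideanSpace ℝ (Fin d) :=
  WithLp.toLp 2 fun i : Fin d => x i.castSucc

/-- The cube `[-r, r] ^ d`. -/
def coordCube (d : ℕ) (r : ℝ) : Set (EuclideanSpace ℝ (Fin d)) := {y | ∀ i, |y i| ≤ r}

/-- The box `[-r, r] ^ d × [-M r, M r]`. -/
def coordBox (d : ℕ) (r M : ℝ) : Set (EuclideanSpace ℝ (Fin (d + 1))) :=
  {x | firstCoords x ∈ coordCube d r ∧ |x (Fin.last d)| ≤ M * r}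

/-- `S`, a portion of the boundary of a `(d + 1)`-dimensional set `U` (relatively open in its affine
span), is of Lipschitz class with constants `r₀`, `M₀`: near each `P ∈ S`, in Cartesian coordinates
`e` of the affine span of `U` with origin `P`, `U ∩ R_{r₀, 2 M₀}` is the part of the box above the
graph of `g`, with `g 0 = 0` and `‖g‖_{C^{0,1}} = sup |g| + r₀ Lip g ≤ M₀ r₀`. -/
def LipschitzPortion (d : ℕ) (U S : Set E3) (r₀ M₀ : ℝ) : Prop :=
  ∀ P ∈ S, ∃ e : EuclideanSpace ℝ (Fin (d + 1)) →ᵃⁱ[ℝ] E3,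
    e 0 = P ∧ Set.range e = (affineSpan ℝ U : Set E3) ∧
    ∃ g : EuclideanSpace ℝ (Fin d) → ℝ,
      g 0 = 0 ∧
      (∃ A L : ℝ, 0 ≤ A ∧ 0 ≤ L ∧
        (∀ y ∈ coordCube d r₀, |g y| ≤ A) ∧
        (∀ y ∈ coordCube d r₀, ∀ z ∈ coordCube d r₀, |g y - g z| ≤ L * dist y z) ∧
        A + r₀ * L ≤ M₀ * r₀) ∧
      e ⁻¹' U ∩ coordBox d r₀ (2 * M₀) =
        {x ∈ coordBox d r₀ (2 * M₀) | g (firstCoords x) < x (Fin.last d)}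

/-! ### The class of polyhedra -/

/-- The a priori assumptions on the bounded domain `Ω`. -/
structure AdmissibleDomain (r₀ M₁ : ℝ) (Ω : Set E3) : Prop where
  isOpen : IsOpen Ω
  connected : IsConnected Ω
  bounded : Bornology.IsBounded Ω
  diam_le : Metric.diam Ω ≤ M₁ * r₀

/-- The class of non-degenerate polyhedra contained in `Ω`. -/
structure PolyhedralClass (r₀ θ₀ M₀ : ℝ) (Ω : Set E3) (D : Polyhedron) : Prop where
  subset : D.carrier ⊆ Ω
  strict_inclusion : ∀ x ∈ D.carrier, ∀ y ∈ frontier Ω, r₀ ≤ dist x y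
  dihedral : ∀ α, D.IsDihedralAngle α → α ∈ nondegenerateAngles θ₀
  edge_length : ∀ j (k : ZMod (D.numSides j)), r₀ ≤ dist (D.corner j k) (D.corner j (k + 1))
  face_angle : ∀ j (k : ZMod (D.numSides j)), D.internalAngle j k ∈ nondegenerateAngles θ₀
  lipschitz : LipschitzPortion 2 (Ω \ D.carrier) (frontier (Ω \ D.carrier)) r₀ M₀
  face_lipschitz : ∀ j, LipschitzPortion 1 (intrinsicInterior ℝ (D.face j))
    (intrinsicFrontier ℝ (D.face j)) r₀ M₀

/-- The height `h₀ = (r₀ / 2) tan γ`, `γ = min {θ₀ / 3, π / 2 - arctan M₀}`, of the triangles. -/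
def triangleHeight (r₀ θ₀ M₀ : ℝ) : ℝ :=
  r₀ / 2 * Real.tan (min (θ₀ / 3) (Real.pi / 2 - Real.arctan M₀))

/-! ### Sobolev vector fields and matrix norms -/

/-- The Frobenius norm `|A| = (∑ A_{ij} ^ 2) ^ (1/2)`. -/
def frobNorm (A : Matrix (Fin 3) (Fin 3) ℝ) : ℝ := √(∑ i, ∑ j, A i j ^ 2)

/-- The operator norm of `A` with respect to the Euclidean norm. -/
def opNorm (A : Matrix (Fin 3) (Fin 3) ℝ) : ℝ :=
  ‖Matrix.toEuclideanCLM (n := Fin 3) (𝕜 := ℝ) A‖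

/-- `f` belongs to `W^{1,∞}(O, ℝ³)`, with weak Jacobian matrix `A`, `A_{ij} = ∂f_i / ∂x_j`. -/
structure HasW1InfDeriv (O : Set E3) (f : E3 → E3) (A : E3 → Matrix (Fin 3) (Fin 3) ℝ) :
    Prop where
  memLp : MemLp f ∞ (volume.restrict O)
  deriv_memLp : ∀ i j, MemLp (fun x => A x i j) ∞ (volume.restrict O)
  weak_deriv : ∀ φ : E3 → ℝ, ContDiff ℝ ∞ φ → HasCompactSupport φ → tsupport φ ⊆ O → ∀ i j,
    ∫ x in O, f x i * fderiv ℝ φ x (EuclideanSpace.single j 1) = - ∫ x in O, A x i j * φ x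

/-- `Φ_t = Id + t U`. -/
def homotopyMap (U : E3 → E3) (t : ℝ) (x : E3) : E3 := x + t • U x

/-- The matrix field `I + t A`. -/
def homotopyJac (A : E3 → Matrix (Fin 3) (Fin 3) ℝ) (t : ℝ) (x : E3) :
    Matrix (Fin 3) (Fin 3) ℝ := 1 + t • A x

/-- `f` maps `Ω` onto `Ω` bijectively, and is Lipschitz on `Ω` together with its inverse. -/
def IsBiLipschitzSelfMap (Ω : Set E3) (f : E3 → E3) : Prop :=
  Set.BijOn f Ω Ω ∧ ∃ K : ℝ, 0 < K ∧ ∀ x ∈ Ω, ∀ y ∈ Ω,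
    dist (f x) (f y) ≤ K * dist x y ∧ dist x y ≤ K * dist (f x) (f y)

end

/-!
The whole argument rests on the fact that the boundary surface of a polyhedron of the class is
locally the graph of a Lipschitz function, with a uniform constant, and so is the boundary of each
face in its plane. The projection to the base of the graph is bi-Lipschitz on the surface. Therefore
the surface near a point well inside a face is nothing but that face
(`NicePolyhedron.mem_face_of_disc`), near a point well inside an edge it is the union of the two
faces that share the edge (`NicePolyhedron.mem_faces_of_near_hinge`), and distinct vertices are at a
definite distance (`NicePolyhedron.vertex_dist`).

*Combinatorial equivalence.* Let two polyhedra have close boundaries. Along an edge two planes meet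
at an angle bounded away from `0` and `π`, so an edge of one polyhedron cannot lie near a point well
inside a face of the other, where the boundary is nearly flat
(`NicePolyhedron.exists_no_edge_near_disc`). Hence edges are close to edges. At a vertex two edges
meet transversally, so a vertex cannot lie near a point well inside an edge of the other polyhedron
(`NicePolyhedron.exists_no_vertex_near_edge`). Hence vertices are close to vertices, and since
vertices are separated, this is a bijection. It takes the ends of an edge to the ends of an edge
(`NicePolyhedron.exists_side_of_side`). Walking inside a face along its sides, one stays close to a
single face of the other polyhedron, to which the corresponding sides belong
(`NicePolyhedron.exists_face_of_sides`).

*The vector field.* On the sides of a face the displacement of the vertices is interpolated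
linearly. It is extended to the triangles over the sides by the affine map that is constant along
the normal of the side. Triangles over adjacent sides leave an angle at their common corner, and
triangles over nonadjacent sides have a definite distance
(`NicePolygon.dist_sideTriangle_adjacent`, `NicePolygon.dist_sideTriangle_nonadjacent`), so this is a
Lipschitz field on their union, with constant proportional to the displacement. It is extended to
the plane of the face, and then the displaced points are projected to the plane of the corresponding
face; the projection changes nothing on the sides and keeps the field affine on the triangles
(`NicePolygon.exists_face_field`). The fields on the faces agree on the edges. They form a Lipschitz
field on the boundary surface, which is extended to space and cut off
(`NicePolyhedron.exists_field`).

*The image.* If the distance of the boundaries is small, the field `U` is a contraction, so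
`x ↦ x + U x` is a homeomorphism of space, and it induces a homeomorphism from the plane of each face
to the plane of the corresponding face. A homeomorphism that maps the boundary of one regular closed
set onto that of another maps the first set onto the second if the boundary has locally two sides
and the two sets do not cover the space (`eq_of_frontier_eq`). Applied in the planes of the faces
this shows that faces are mapped onto faces (`NicePolyhedron.image_face`), and applied in space, that
the polyhedron is mapped onto the other one (`NicePolyhedron.image_carrier`).

*The homotopy.* A Lipschitz field has its partial derivatives, which exist almost everywhere, as
weak derivatives (`LipschitzWith.hasW1InfDeriv`). The remaining estimates concern the matrices
`1 + t • A` with entries of `A` at most `1 / 12` in absolute value.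
-/


open scoped RealInnerProductSpace

/-! ### Charts of Lipschitz boundaries -/

theorem firstCoords_apply {d : ℕ} (x : EuclideanSpace ℝ (Fin (d + 1))) (i : Fin d) :
    firstCoords x i = x i.castSucc := rfl

theorem firstCoords_add {d : ℕ} (x y : EuclideanSpace ℝ (Fin (d + 1))) :
    firstCoords (x + y) = firstCoords x + firstCoords y := by
  ext i; simp [firstCoords_apply]

theorem firstCoords_sub {d : ℕ} (x y : EuclideanSpace ℝ (Fin (d + 1))) :
    firstCoords (x - y) = firstCoords x - firstCoords y := by
  ext i; simp [firstCoords_apply]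

theorem firstCoords_smul {d : ℕ} (c : ℝ) (x : EuclideanSpace ℝ (Fin (d + 1))) :
    firstCoords (c • x) = c • firstCoords x := by
  ext i; simp [firstCoords_apply]

/-- The point with first coordinates `y` and last coordinate `s`. -/
noncomputable def joinCoords {d : ℕ} (y : EuclideanSpace ℝ (Fin d)) (s : ℝ) :
    EuclideanSpace ℝ (Fin (d + 1)) :=
  WithLp.toLp 2 (Fin.snoc (α := fun _ => ℝ) y s)

@[simp] theorem firstCoords_joinCoords {d : ℕ} (y : EuclideanSpace ℝ (Fin d)) (s : ℝ) :
    firstCoords (joinCoords y s) = y := by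
  ext i; simp [firstCoords, joinCoords]

@[simp] theorem joinCoords_last {d : ℕ} (y : EuclideanSpace ℝ (Fin d)) (s : ℝ) :
    joinCoords y s (Fin.last d) = s := by
  simp [joinCoords]

theorem joinCoords_firstCoords {d : ℕ} (x : EuclideanSpace ℝ (Fin (d + 1))) :
    joinCoords (firstCoords x) (x (Fin.last d)) = x := by
  ext i
  refine Fin.lastCases ?_ (fun i => ?_) i
  · simp
  · simp [joinCoords, firstCoords]

theorem norm_sq_eq_firstCoords {d : ℕ} (x : EuclideanSpace ℝ (Fin (d + 1))) :
    ‖x‖ ^ 2 = ‖firstCoords x‖ ^ 2 + x (Fin.last d) ^ 2 := by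
  simp [EuclideanSpace.norm_sq_eq, Fin.sum_univ_castSucc, firstCoords]

theorem norm_firstCoords_le {d : ℕ} (x : EuclideanSpace ℝ (Fin (d + 1))) :
    ‖firstCoords x‖ ≤ ‖x‖ := by
  have := norm_sq_eq_firstCoords x
  exact abs_le_of_sq_le_sq' (by nlinarith [sq_nonneg (x (Fin.last d))]) (norm_nonneg _) |>.2

theorem abs_last_le {d : ℕ} (x : EuclideanSpace ℝ (Fin (d + 1))) :
    |x (Fin.last d)| ≤ ‖x‖ := by
  have := norm_sq_eq_firstCoords x
  exact abs_le_of_sq_le_sq (by nlinarith [sq_nonneg ‖firstCoords x‖]) (norm_nonneg _)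

theorem norm_le_firstCoords_add {d : ℕ} (x : EuclideanSpace ℝ (Fin (d + 1))) :
    ‖x‖ ≤ ‖firstCoords x‖ + |x (Fin.last d)| := by
  have := norm_sq_eq_firstCoords x
  refine abs_le_of_sq_le_sq' ?_ (by positivity) |>.2
  nlinarith [mul_nonneg (norm_nonneg (firstCoords x)) (abs_nonneg (x (Fin.last d))),
    sq_abs (x (Fin.last d))]

theorem continuous_firstCoords {d : ℕ} :
    Continuous (firstCoords : EuclideanSpace ℝ (Fin (d + 1)) → EuclideanSpace ℝ (Fin d)) := by
  unfold firstCoords; fun_prop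

theorem continuous_joinCoords {d : ℕ} :
    Continuous (fun p : EuclideanSpace ℝ (Fin d) × ℝ => joinCoords p.1 p.2) := by
  unfold joinCoords
  refine (PiLp.continuous_toLp 2 _).comp (continuous_pi fun i => ?_)
  refine Fin.lastCases ?_ (fun i => ?_) i
  · simpa using continuous_snd
  · simp only [Fin.snoc_castSucc]; fun_prop

/-- A coordinate system at a point of the boundary portion, restricted to the round cylinder inside
the cube and with the bound on the sum of norms weakened to the Lipschitz bound. -/
theorem LipschitzPortion.exists_chart {d : ℕ} {U S : Set E3} {r M : ℝ} (hr : 0 < r)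
    (h : LipschitzPortion d U S r M) {P : E3} (hP : P ∈ S) :
    ∃ (e : EuclideanSpace ℝ (Fin (d + 1)) →ᵃⁱ[ℝ] E3) (g : EuclideanSpace ℝ (Fin d) → ℝ),
      e 0 = P ∧ Set.range e = (affineSpan ℝ U : Set E3) ∧ g 0 = 0 ∧
      (∀ y z, ‖y‖ ≤ r → ‖z‖ ≤ r → |g y - g z| ≤ M * ‖y - z‖) ∧
      ∀ x, ‖firstCoords x‖ ≤ r → |x (Fin.last d)| ≤ 2 * M * r →
        (e x ∈ U ↔ g (firstCoords x) < x (Fin.last d)) := by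
  obtain ⟨e, he, hrange, g, hg0, ⟨A, L, hA, hL, -, hLip, hAL⟩, hbox⟩ := h P hP
  have hcube : ∀ y : EuclideanSpace ℝ (Fin d), ‖y‖ ≤ r → y ∈ coordCube d r := fun y hy i =>
    (PiLp.norm_apply_le y i).trans hy
  -- `A + r * L ≤ M * r` with `A ≥ 0` bounds the Lipschitz constant
  have hLM : L ≤ M := by
    by_contra hc
    nlinarith
  refine ⟨e, g, he, hrange, hg0, fun y z hy hz => ?_, fun x hx hx' => ?_⟩
  · calc |g y - g z| ≤ L * dist y z := hLip y (hcube y hy) z (hcube z hz)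
      _ ≤ M * ‖y - z‖ := by rw [dist_eq_norm]; gcongr
  · have hxb : x ∈ coordBox d r (2 * M) := ⟨hcube _ hx, hx'⟩
    have := Set.ext_iff.1 hbox x
    simp only [Set.mem_inter_iff, Set.mem_preimage, hxb, and_true, Set.mem_ofPred_eq, true_and] at this
    exact this

/-- The part of a cylinder above a graph is connected: slide vertically, then move over the base. -/
theorem isPreconnected_above {d : ℕ} {g : EuclideanSpace ℝ (Fin d) → ℝ} {a b : ℝ}
    (hg : ContinuousOn g (Metric.ball 0 a)) (hb : ∀ y ∈ Metric.ball 0 a, g y < b) :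
    IsPreconnected {x : EuclideanSpace ℝ (Fin (d + 1)) | ‖firstCoords x‖ < a ∧
      g (firstCoords x) < x (Fin.last d) ∧ x (Fin.last d) < b} := by
  have hpre : IsPreconnected (Metric.ball (0 : EuclideanSpace ℝ (Fin d)) a ×ˢ Set.Ioo (0 : ℝ) 1) :=
    ((convex_ball _ _).prod (convex_Ioo _ _)).isPreconnected
  have hc : ContinuousOn (fun p : EuclideanSpace ℝ (Fin d) × ℝ =>
      joinCoords p.1 (g p.1 + p.2 * (b - g p.1)))
      (Metric.ball (0 : EuclideanSpace ℝ (Fin d)) a ×ˢ Set.Ioo (0 : ℝ) 1) := by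
    have hg' : ContinuousOn (fun p : EuclideanSpace ℝ (Fin d) × ℝ => g p.1)
        (Metric.ball (0 : EuclideanSpace ℝ (Fin d)) a ×ˢ Set.Ioo (0 : ℝ) 1) :=
      hg.comp continuousOn_fst fun p hp => hp.1
    exact continuous_joinCoords.comp_continuousOn (continuousOn_fst.prodMk
      (hg'.add (continuousOn_snd.mul (continuousOn_const.sub hg'))))
  convert hpre.image _ hc using 1
  ext x
  simp only [Set.mem_ofPred_eq, Set.mem_image, Set.mem_prod, Metric.mem_ball, dist_zero_right,
    Set.mem_Ioo, Prod.exists]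
  constructor
  · rintro ⟨h1, h2, h3⟩
    have h4 : 0 < b - g (firstCoords x) := by linarith
    refine ⟨firstCoords x, (x (Fin.last d) - g (firstCoords x)) / (b - g (firstCoords x)),
      ⟨h1, by apply div_pos <;> linarith, by rw [div_lt_one h4]; linarith⟩, ?_⟩
    rw [div_mul_cancel₀ _ h4.ne', add_sub_cancel, joinCoords_firstCoords]
  · rintro ⟨y, t, ⟨h1, h2, h3⟩, rfl⟩
    have h4 := hb y (by simpa using h1)
    simp only [firstCoords_joinCoords, joinCoords_last]
    refine ⟨h1, by nlinarith, by nlinarith⟩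

theorem isPreconnected_below {d : ℕ} {g : EuclideanSpace ℝ (Fin d) → ℝ} {a b : ℝ}
    (hg : ContinuousOn g (Metric.ball 0 a)) (hb : ∀ y ∈ Metric.ball 0 a, -b < g y) :
    IsPreconnected {x : EuclideanSpace ℝ (Fin (d + 1)) | ‖firstCoords x‖ < a ∧
      x (Fin.last d) < g (firstCoords x) ∧ -b < x (Fin.last d)} := by
  have h := isPreconnected_above (g := fun y => -g (-y)) (a := a) (b := b)
    (hg.comp continuousOn_neg (fun y hy => by simpa using hy)).neg
    (fun y hy => by have := hb (-y) (by simpa using hy); linarith)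
  have h2 := h.image _ (continuous_neg.continuousOn)
  convert h2 using 1
  have hn : ∀ x : EuclideanSpace ℝ (Fin (d + 1)), firstCoords (-x) = - firstCoords x := fun x => by
    ext i; simp [firstCoords_apply]
  ext x
  simp only [Set.image_neg_eq_neg, Set.mem_neg, Set.mem_ofPred_eq, hn, norm_neg, neg_neg, PiLp.neg_apply]
  constructor <;> rintro ⟨h1, h2, h3⟩ <;> exact ⟨h1, by linarith, by linarith⟩

theorem continuousOn_of_chart {d : ℕ} {g : EuclideanSpace ℝ (Fin d) → ℝ} {r M : ℝ}
    (hM : 0 ≤ M) (h : ∀ y z, ‖y‖ ≤ r → ‖z‖ ≤ r → |g y - g z| ≤ M * ‖y - z‖) :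
    ContinuousOn g (Metric.closedBall 0 r) := by
  refine (LipschitzOnWith.of_dist_le_mul (K := ⟨M, hM⟩) fun y hy z hz => ?_).continuousOn
  rw [Real.dist_eq, dist_eq_norm]
  exact h y z (by simpa using hy) (by simpa using hz)

/-! ### Relative interior and boundary of a closed plane set -/

theorem mem_intrinsicInterior_iff_exists_ball {F : Set E3} {x : E3} :
    x ∈ intrinsicInterior ℝ F ↔ x ∈ affineSpan ℝ F ∧ ∃ ε > 0, ∀ y ∈ affineSpan ℝ F,
      dist y x < ε → y ∈ F := by
  rw [mem_intrinsicInterior]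
  constructor
  · rintro ⟨y, hy, rfl⟩
    obtain ⟨ε, hε, h⟩ := Metric.mem_nhds_iff.1 (mem_interior_iff_mem_nhds.1 hy)
    exact ⟨y.2, ε, hε, fun z hz hd => h (show (⟨z, hz⟩ : affineSpan ℝ F) ∈ Metric.ball y ε from hd)⟩
  · rintro ⟨hx, ε, hε, h⟩
    refine ⟨⟨x, hx⟩, mem_interior_iff_mem_nhds.2 (Metric.mem_nhds_iff.2 ⟨ε, hε, ?_⟩), rfl⟩
    rintro ⟨z, hz⟩ hd
    exact h z hz hd

theorem mem_face_iff {F : Set E3} (hF : IsClosed F) {x : E3} :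
    x ∈ F ↔ x ∈ intrinsicInterior ℝ F ∨ x ∈ intrinsicFrontier ℝ F := by
  have h := intrinsicInterior_union_intrinsicFrontier (𝕜 := ℝ) F
  have h2 : intrinsicClosure ℝ F = F := IsClosed.intrinsicClosure (hF.preimage continuous_subtype_val)
  rw [h2] at h
  rw [← Set.mem_union, h]

theorem not_mem_intrinsicFrontier {F : Set E3} {x : E3} (h : x ∈ intrinsicInterior ℝ F) :
    x ∉ intrinsicFrontier ℝ F := by
  rw [← intrinsicClosure_sdiff_intrinsicInterior]
  exact fun h' => h'.2 h

/-- A connected plane set that avoids the relative boundary and meets the set lies in its relative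
interior. -/
theorem IsPreconnected.subset_intrinsicInterior {F Y : Set E3} (hF : IsClosed F)
    (hY : IsPreconnected Y) (hYs : Y ⊆ affineSpan ℝ F) (hd : Disjoint Y (intrinsicFrontier ℝ F))
    {x : E3} (hx : x ∈ Y) (hxF : x ∈ F) : Y ⊆ intrinsicInterior ℝ F := by
  classical
  -- `Y ∩ F` is open in `Y`, because its points are relatively interior, and closed
  have key : ∀ y ∈ Y, y ∈ F → ∃ ε > 0, ∀ z ∈ Y, dist z y < ε → z ∈ F := by
    intro y hy hyF
    have : y ∈ intrinsicInterior ℝ F := ((mem_face_iff hF).1 hyF).resolve_right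
      (Set.disjoint_left.1 hd hy)
    obtain ⟨-, ε, hε, h⟩ := mem_intrinsicInterior_iff_exists_ball.1 this
    exact ⟨ε, hε, fun z hz => h z (hYs hz)⟩
  have hsub : Y ⊆ F := by
    choose! ε hε h using key
    set O : Set E3 := ⋃ y ∈ Y ∩ F, Metric.ball y (ε y) with hO
    have hOo : IsOpen O := isOpen_biUnion fun y _ => Metric.isOpen_ball
    by_contra hc
    obtain ⟨z, hzY, hzF⟩ := Set.not_subset.1 hc
    obtain ⟨w, hwY, hwO, hwF⟩ := hY O Fᶜ hOo hF.isOpen_compl (fun y hy => by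
      by_cases hyF : y ∈ F
      · exact Or.inl (Set.mem_biUnion ⟨hy, hyF⟩ (Metric.mem_ball_self (hε y hy hyF)))
      · exact Or.inr hyF) ⟨x, hx, Set.mem_biUnion ⟨hx, hxF⟩ (Metric.mem_ball_self (hε x hx hxF))⟩
      ⟨z, hzY, hzF⟩
    simp only [hO, Set.mem_iUnion] at hwO
    obtain ⟨y, ⟨hy, hyF⟩, hwy⟩ := hwO
    exact hwF (h y hy hyF w hwY hwy)
  exact fun y hy => ((mem_face_iff hF).1 (hsub hy)).resolve_right (Set.disjoint_left.1 hd hy)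

/-! ### Charts at a boundary point -/

/-- `e` and `g` form a chart at `P` of the portion of boundary of `U`: in the coordinates `e` the
set `U` lies above the graph of the `M`-Lipschitz function `g`. -/
structure IsChart (d : ℕ) (U : Set E3) (P : E3) (r M : ℝ)
    (e : EuclideanSpace ℝ (Fin (d + 1)) →ᵃⁱ[ℝ] E3) (g : EuclideanSpace ℝ (Fin d) → ℝ) : Prop where
  map_zero : e 0 = P
  range_eq : Set.range e = (affineSpan ℝ U : Set E3)
  g_zero : g 0 = 0
  lip : ∀ y z, ‖y‖ ≤ r → ‖z‖ ≤ r → |g y - g z| ≤ M * ‖y - z‖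
  mem_iff : ∀ x, ‖firstCoords x‖ ≤ r → |x (Fin.last d)| ≤ 2 * M * r →
        (e x ∈ U ↔ g (firstCoords x) < x (Fin.last d))

namespace IsChart

variable {d : ℕ} {U S : Set E3} {P : E3} {r M : ℝ}
  {e : EuclideanSpace ℝ (Fin (d + 1)) →ᵃⁱ[ℝ] E3} {g : EuclideanSpace ℝ (Fin d) → ℝ}

theorem abs_g_le (h : IsChart d U P r M e g) (hr : 0 < r) {y : EuclideanSpace ℝ (Fin d)}
    (hy : ‖y‖ ≤ r) : |g y| ≤ M * ‖y‖ := by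
  simpa [h.g_zero] using h.lip y 0 hy (by simpa using hr.le)

/-- The graph lies in the closure of the set above it. -/
theorem exists_mem_near (h : IsChart d U P r M e g) (hr : 0 < r) (hM : 0 < M)
    {x : EuclideanSpace ℝ (Fin (d + 1))} (hx : ‖firstCoords x‖ ≤ r)
    (hxg : x (Fin.last d) = g (firstCoords x)) {ε : ℝ} (hε : 0 < ε) :
    ∃ z ∈ U, dist z (e x) < ε := by
  have hs : 0 < min (ε / 2) (M * r) := lt_min (by linarith) (by positivity)
  set s := min (ε / 2) (M * r)
  have hb := h.abs_g_le hr hx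
  have hb2 : M * ‖firstCoords x‖ ≤ M * r := by gcongr
  refine ⟨e (joinCoords (firstCoords x) (x (Fin.last d) + s)), ?_, ?_⟩
  · rw [h.mem_iff _ (by simpa using hx) ?_]
    · simp [hxg, hs]
    · rw [joinCoords_last, hxg]
      have : s ≤ M * r := min_le_right _ _
      rw [abs_le] at hb ⊢
      constructor <;> linarith
  · rw [e.isometry.dist_eq, dist_eq_norm]
    have h1 := norm_le_firstCoords_add (joinCoords (firstCoords x) (x (Fin.last d) + s) - x)
    rw [firstCoords_sub, firstCoords_joinCoords, sub_self, norm_zero, PiLp.sub_apply,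
      joinCoords_last, add_sub_cancel_left, abs_of_pos hs] at h1
    have : s ≤ ε / 2 := min_le_left _ _
    linarith

/-- Points strictly below the graph have a neighbourhood in the coordinate space below it. -/
theorem eventually_below (h : IsChart d U P r M e g) (hM : 0 < M)
    {x : EuclideanSpace ℝ (Fin (d + 1))} (hx : ‖firstCoords x‖ < r)
    (hxl : |x (Fin.last d)| < 2 * M * r) (hxg : x (Fin.last d) < g (firstCoords x)) :
    ∀ᶠ y in 𝓝 x, e y ∉ U := by
  have hc := (continuousOn_of_chart hM.le h.lip).continuousAt
    (Metric.closedBall_mem_nhds_of_mem (by simpa using hx))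
  have hlc : Continuous fun y : EuclideanSpace ℝ (Fin (d + 1)) => y (Fin.last d) := by fun_prop
  have h1 : ∀ᶠ y in 𝓝 x, y (Fin.last d) < g (firstCoords y) :=
    (hlc.continuousAt).eventually_lt (hc.comp continuous_firstCoords.continuousAt) hxg
  have h2 : ∀ᶠ y in 𝓝 x, ‖firstCoords y‖ < r :=
    (continuous_firstCoords.norm.continuousAt).eventually_lt continuousAt_const hx
  have h3 : ∀ᶠ y : EuclideanSpace ℝ (Fin (d + 1)) in 𝓝 x, |y (Fin.last d)| < 2 * M * r :=
    (hlc.abs.continuousAt).eventually_lt continuousAt_const hxl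
  filter_upwards [h1, h2, h3] with y hy1 hy2 hy3
  rw [h.mem_iff y hy2.le hy3.le]
  exact hy1.le.not_gt

end IsChart

theorem LipschitzPortion.exists_isChart {d : ℕ} {U S : Set E3} {r M : ℝ} (hr : 0 < r)
    (h : LipschitzPortion d U S r M) {P : E3} (hP : P ∈ S) : ∃ e g, IsChart d U P r M e g := by
  obtain ⟨e, g, h1, h2, h3, h4, h5⟩ := h.exists_chart hr hP
  exact ⟨e, g, h1, h2, h3, h4, h5⟩

/-- In a chart, the boundary portion lies on the graph. -/
theorem LipschitzPortion.eq_graph {d : ℕ} {U S : Set E3} {P : E3} {r M : ℝ}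
    {e : EuclideanSpace ℝ (Fin (d + 1)) →ᵃⁱ[ℝ] E3} {g : EuclideanSpace ℝ (Fin d) → ℝ}
    (hr : 0 < r) (hM : 0 < M) (h : LipschitzPortion d U S r M) (hdis : Disjoint S U)
    (hc : IsChart d U P r M e g) {x : EuclideanSpace ℝ (Fin (d + 1))} (hxS : e x ∈ S)
    (hx : ‖firstCoords x‖ < r) (hxl : |x (Fin.last d)| < 2 * M * r) :
    x (Fin.last d) = g (firstCoords x) := by
  have h1 : ¬ g (firstCoords x) < x (Fin.last d) := by
    rw [← hc.mem_iff x hx.le hxl.le]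
    exact Set.disjoint_left.1 hdis hxS
  refine le_antisymm (not_lt.1 h1) (not_lt.1 fun h2 => ?_)
  obtain ⟨ε, hε, hball⟩ := Metric.eventually_nhds_iff.1 (hc.eventually_below hM hx hxl h2)
  -- the chart at `e x` shows that points of `U` accumulate there
  obtain ⟨e', g', hc'⟩ := h.exists_isChart hr hxS
  obtain ⟨z, hzU, hz⟩ := hc'.exists_mem_near (x := 0) hr hM (by
    have : firstCoords (0 : EuclideanSpace ℝ (Fin (d + 1))) = 0 := by ext; simp [firstCoords_apply]
    simp [this, hr.le]) (by
    have : firstCoords (0 : EuclideanSpace ℝ (Fin (d + 1))) = 0 := by ext; simp [firstCoords_apply]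
    simp [this, hc'.g_zero]) hε
  rw [hc'.map_zero] at hz
  obtain ⟨y, rfl⟩ : z ∈ Set.range e := by
    rw [hc.range_eq]; exact subset_affineSpan ℝ U hzU
  rw [e.isometry.dist_eq] at hz
  exact hball hz hzU

/-! ### Nondegenerate plane polygons -/

/-- A plane polygonal region with side lengths at least `r`, boundary of Lipschitz class, and
corners that are neither flat nor sharp. The field `angle` retains from the assumption on internal
angles only that the sides at a corner are transversal; it does not distinguish convex corners from
reflex ones. -/
structure NicePolygon (r θ M : ℝ) (F : Set E3) (n : ℕ) (v : ZMod n → E3) : Prop where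
  r_pos : 0 < r
  one_le : 1 ≤ M
  θ_pos : 0 < θ
  θ_lt : θ < Real.pi / 2
  region : IsPolygonalRegion F n v
  lip : LipschitzPortion 1 (intrinsicInterior ℝ F) (intrinsicFrontier ℝ F) r M
  len : ∀ k, r ≤ dist (v k) (v (k + 1))
  angle : ∀ k, |⟪v (k + 1) - v k, v (k - 1) - v k⟫| ≤
    Real.cos θ * (‖v (k + 1) - v k‖ * ‖v (k - 1) - v k‖)

namespace NicePolygon

variable {r θ M : ℝ} {F : Set E3} {n : ℕ} {v : ZMod n → E3}

theorem isClosed (h : NicePolygon r θ M F n v) : IsClosed F := h.region.compact.isClosed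

theorem corner_mem (h : NicePolygon r θ M F n v) (k : ZMod n) : v k ∈ intrinsicFrontier ℝ F := by
  rw [h.region.relBoundary]
  exact Set.mem_iUnion.2 ⟨k, left_mem_segment ℝ _ _⟩

theorem side_subset (h : NicePolygon r θ M F n v) (k : ZMod n) :
    segment ℝ (v k) (v (k + 1)) ⊆ intrinsicFrontier ℝ F := by
  rw [h.region.relBoundary]
  exact Set.subset_iUnion (fun k => segment ℝ (v k) (v (k + 1))) k

theorem frontier_subset (h : NicePolygon r θ M F n v) : intrinsicFrontier ℝ F ⊆ F :=
  fun _ hx => (mem_face_iff h.isClosed).2 (Or.inr hx)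

theorem sub_mem (_h : NicePolygon r θ M F n v) {x y : E3} (hx : x ∈ F) (hy : y ∈ F) :
    x - y ∈ (affineSpan ℝ F).direction :=
  AffineSubspace.vsub_mem_direction (subset_affineSpan ℝ F hx) (subset_affineSpan ℝ F hy)

theorem add_mem (_h : NicePolygon r θ M F n v) {x w : E3} (hx : x ∈ F)
    (hw : w ∈ (affineSpan ℝ F).direction) : x + w ∈ affineSpan ℝ F := by
  rw [add_comm]
  exact AffineSubspace.vadd_mem_of_mem_direction hw (subset_affineSpan ℝ F hx)

/-- The relative interior of the polygon spans its plane, so a chart has the whole plane as range. -/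
theorem chart_range (h : NicePolygon r θ M F n v) {P : E3}
    {e : EuclideanSpace ℝ (Fin 2) →ᵃⁱ[ℝ] E3} {g : EuclideanSpace ℝ (Fin 1) → ℝ}
    (hc : IsChart 1 (intrinsicInterior ℝ F) P r M e g) :
    Set.range e = (affineSpan ℝ F : Set E3) := by
  have hle : affineSpan ℝ (intrinsicInterior ℝ F) ≤ affineSpan ℝ F :=
    affineSpan_mono ℝ intrinsicInterior_subset
  have hr := hc.range_eq
  have hdir : Module.finrank ℝ (affineSpan ℝ (intrinsicInterior ℝ F)).direction = 2 := by
    have h1 : (affineSpan ℝ (intrinsicInterior ℝ F)) = (⊤ : AffineSubspace ℝ _).map e.toAffineMap := by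
      apply SetLike.coe_injective
      rw [← hr]
      simp
    rw [h1, AffineSubspace.map_direction, AffineSubspace.direction_top]
    have : e.toAffineMap.linear = e.linearIsometry.toLinearMap := rfl
    rw [this, Submodule.map_top, LinearMap.finrank_range_of_inj e.linearIsometry.injective]
    simp
  have : affineSpan ℝ (intrinsicInterior ℝ F) = affineSpan ℝ F := by
    refine AffineSubspace.eq_of_direction_eq_of_nonempty_of_le ?_ ?_ hle
    · exact Submodule.eq_of_le_of_finrank_eq (AffineSubspace.direction_le hle)
        (by rw [hdir, h.region.plane])
    · rw [affineSpan_nonempty]; exact h.region.relInterior_nonempty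
  rw [hr, this]

/-- Cartesian coordinates `p`, `q` of the plane at a boundary point, in which the boundary is a
graph over `p` with slopes at most `M`, and `q` points into the polygon. The sets `A` and `B` are
the connected regions above and below the graph. -/
theorem exists_frame (h : NicePolygon r θ M F n v) {P : E3} (hP : P ∈ intrinsicFrontier ℝ F) :
    ∃ p q : E3, p ∈ (affineSpan ℝ F).direction ∧ q ∈ (affineSpan ℝ F).direction ∧ ‖p‖ = 1 ∧
      ‖q‖ = 1 ∧ ⟪p, q⟫ = 0 ∧
      (∀ w ∈ (affineSpan ℝ F).direction, w = ⟪p, w⟫ • p + ⟪q, w⟫ • q) ∧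
      (∀ x ∈ intrinsicFrontier ℝ F, ∀ y ∈ intrinsicFrontier ℝ F,
        |⟪p, x - P⟫| < r → |⟪q, x - P⟫| < 2 * M * r → |⟪p, y - P⟫| < r →
        |⟪q, y - P⟫| < 2 * M * r → |⟪q, x - y⟫| ≤ M * |⟪p, x - y⟫|) ∧
      (∀ s, 0 < s → s < 2 * M * r → P + s • q ∈ intrinsicInterior ℝ F ∧ P - s • q ∉ F) ∧
      ∃ A B : Set E3, IsPreconnected A ∧ IsPreconnected B ∧ A ⊆ affineSpan ℝ F ∧
        B ⊆ affineSpan ℝ F ∧ Disjoint A (intrinsicFrontier ℝ F) ∧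
        Disjoint B (intrinsicFrontier ℝ F) ∧
        ∀ x ∈ affineSpan ℝ F, dist x P < r → x ∉ intrinsicFrontier ℝ F → x ∈ A ∪ B := by
  have hr := h.r_pos
  have hM : 0 < M := by linarith [h.one_le]
  obtain ⟨e, g, hc⟩ := h.lip.exists_isChart hr hP
  have hrange := h.chart_range hc
  have hdis : Disjoint (intrinsicFrontier ℝ F) (intrinsicInterior ℝ F) :=
    Set.disjoint_right.2 fun x hx => not_mem_intrinsicFrontier hx
  -- the boundary is exactly the graph
  have hbd : ∀ x : EuclideanSpace ℝ (Fin 2), ‖firstCoords x‖ < r → |x (Fin.last 1)| < 2 * M * r →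
      (e x ∈ intrinsicFrontier ℝ F ↔ x (Fin.last 1) = g (firstCoords x)) := by
    intro x hx hxl
    refine ⟨fun hx' => h.lip.eq_graph hr hM hdis hc hx' hx hxl, fun hxg => ?_⟩
    have h1 : e x ∈ F := by
      rw [← h.isClosed.closure_eq, Metric.mem_closure_iff]
      intro ε hε
      obtain ⟨z, hz, hd⟩ := hc.exists_mem_near hr hM hx.le hxg hε
      exact ⟨z, intrinsicInterior_subset hz, by rwa [dist_comm]⟩
    refine ((mem_face_iff h.isClosed).1 h1).resolve_left fun h2 => ?_
    rw [hc.mem_iff x hx.le hxl.le] at h2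
    exact h2.ne' hxg
  set L := e.linearIsometry with hL
  have heL : ∀ x, e x = P + L x := by
    intro x
    have := e.map_vadd 0 x
    simp only [vadd_eq_add, add_zero, hc.map_zero] at this
    rw [this, add_comm]
  set p₀ : EuclideanSpace ℝ (Fin 2) := EuclideanSpace.single 0 1
  set q₀ : EuclideanSpace ℝ (Fin 2) := EuclideanSpace.single 1 1
  have hmemW : ∀ x, L x ∈ (affineSpan ℝ F).direction := by
    intro x
    have h1 : e x ∈ affineSpan ℝ F := by
      have : e x ∈ Set.range e := ⟨x, rfl⟩
      rwa [hrange] at this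
    have h2 : P ∈ affineSpan ℝ F := subset_affineSpan ℝ F (h.frontier_subset hP)
    have := AffineSubspace.vsub_mem_direction h1 h2
    simpa [heL] using this
  have hWL : ∀ w ∈ (affineSpan ℝ F).direction, ∃ x, L x = w := by
    intro w hw
    have h1 : P + w ∈ Set.range e := by
      rw [hrange]; exact h.add_mem (h.frontier_subset hP) hw
    obtain ⟨x, hx⟩ := h1
    exact ⟨x, by rw [heL] at hx; exact add_left_cancel hx⟩
  have hp : ∀ x, ⟪L p₀, L x⟫ = x 0 := fun x => by
    rw [L.inner_map_map]
    simp [p₀, PiLp.inner_apply, PiLp.single_apply]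
  have hq : ∀ x, ⟪L q₀, L x⟫ = x 1 := fun x => by
    rw [L.inner_map_map]
    simp [q₀, PiLp.inner_apply, PiLp.single_apply]
  have hfn : ∀ x : EuclideanSpace ℝ (Fin 2), ‖firstCoords x‖ = |x 0| := fun x => by
    simp [EuclideanSpace.norm_eq, firstCoords_apply, Real.sqrt_sq_eq_abs]
  have hlast : (Fin.last 1) = (1 : Fin 2) := rfl
  refine ⟨L p₀, L q₀, hmemW _, hmemW _, ?_, ?_, ?_, ?_, ?_, ?_, ?_⟩
  · rw [L.norm_map]; simp [p₀]
  · rw [L.norm_map]; simp [q₀]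
  · rw [hp]; simp [q₀]
  · intro w hw
    obtain ⟨x, rfl⟩ := hWL w hw
    rw [hp, hq, ← map_smul, ← map_smul, ← map_add]
    congr 1
    ext i
    fin_cases i <;> simp [p₀, q₀]
  · intro x hx y hy hxp hxq hyp hyq
    have hPF := h.frontier_subset hP
    obtain ⟨x', hx'⟩ := hWL _ (h.sub_mem (h.frontier_subset hx) hPF)
    obtain ⟨y', hy'⟩ := hWL _ (h.sub_mem (h.frontier_subset hy) hPF)
    rw [← hx', hp] at hxp
    rw [← hx', hq] at hxq
    rw [← hy', hp] at hyp
    rw [← hy', hq] at hyq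
    have hxy : x - y = L (x' - y') := by rw [map_sub, hx', hy']; abel
    rw [hxy, hp, hq]
    have ex : e x' = x := by rw [heL, hx']; abel
    have ey : e y' = y := by rw [heL, hy']; abel
    have gx := (hbd x' (by rwa [hfn]) hxq).1 (by rwa [ex])
    have gy := (hbd y' (by rwa [hfn]) hyq).1 (by rwa [ey])
    have := hc.lip (firstCoords x') (firstCoords y') (by rw [hfn]; exact hxp.le)
      (by rw [hfn]; exact hyp.le)
    rw [← gx, ← gy, ← firstCoords_sub, hfn] at this
    simpa using this
  · intro s hs hs2
    have h0 : firstCoords (s • q₀ : EuclideanSpace ℝ (Fin 2)) = 0 := by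
      ext i; fin_cases i; simp [firstCoords_apply, q₀]
    have h1 : firstCoords (-(s • q₀) : EuclideanSpace ℝ (Fin 2)) = 0 := by
      ext i; fin_cases i; simp [firstCoords_apply, q₀]
    constructor
    · rw [← map_smul, ← heL, hc.mem_iff _ (by simp [h0, hr.le]) ?_, h0, hc.g_zero]
      · simp [q₀, hs]
      · simp only [PiLp.smul_apply, q₀, hlast, PiLp.single_apply, if_true, smul_eq_mul,
          mul_one]
        rw [abs_of_pos hs]; exact hs2.le
    · have e1 : P - s • L q₀ = e (-(s • q₀)) := by rw [heL, map_neg, map_smul, sub_eq_add_neg]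
      have e2 : (-(s • q₀) : EuclideanSpace ℝ (Fin 2)) (Fin.last 1) = -s := by
        simp [q₀]
      have e3 : |(-(s • q₀) : EuclideanSpace ℝ (Fin 2)) (Fin.last 1)| < 2 * M * r := by
        rw [e2, abs_neg, abs_of_pos hs]; exact hs2
      rw [e1, mem_face_iff h.isClosed, hc.mem_iff _ (by simp [h1, hr.le]) e3.le,
        hbd _ (by simp [h1, hr]) e3, h1, hc.g_zero, e2]
      intro hh
      rcases hh with hh | hh <;> linarith
  · have hcont : ContinuousOn g (Metric.ball 0 r) :=
      (continuousOn_of_chart hM.le hc.lip).mono Metric.ball_subset_closedBall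
    have hgb : ∀ y ∈ Metric.ball (0 : EuclideanSpace ℝ (Fin 1)) r, |g y| < 2 * M * r := by
      intro y hy
      have hy' : ‖y‖ < r := by simpa using hy
      have := hc.abs_g_le hr hy'.le
      nlinarith
    refine ⟨e '' {x | ‖firstCoords x‖ < r ∧ g (firstCoords x) < x (Fin.last 1) ∧
        x (Fin.last 1) < 2 * M * r},
      e '' {x | ‖firstCoords x‖ < r ∧ x (Fin.last 1) < g (firstCoords x) ∧
        -(2 * M * r) < x (Fin.last 1)},
      (isPreconnected_above hcont fun y hy => (abs_lt.1 (hgb y hy)).2).image _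
        e.continuous.continuousOn,
      (isPreconnected_below hcont fun y hy => (abs_lt.1 (hgb y hy)).1).image _
        e.continuous.continuousOn, ?_, ?_, ?_, ?_, ?_⟩
    · rw [← hrange]; exact Set.image_subset_range _ _
    · rw [← hrange]; exact Set.image_subset_range _ _
    · rw [Set.disjoint_left]
      rintro _ ⟨x, ⟨h1, h2, h3⟩, rfl⟩ hx
      have h4 := (abs_lt.1 (hgb (firstCoords x) (by simpa using h1))).1
      rw [hbd x h1 (abs_lt.2 ⟨by linarith, h3⟩)] at hx
      linarith
    · rw [Set.disjoint_left]
      rintro _ ⟨x, ⟨h1, h2, h3⟩, rfl⟩ hx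
      have h4 := (abs_lt.1 (hgb (firstCoords x) (by simpa using h1))).2
      rw [hbd x h1 (abs_lt.2 ⟨h3, by linarith⟩)] at hx
      linarith
    · intro x hx hd hxb
      obtain ⟨y, rfl⟩ : x ∈ Set.range e := by rw [hrange]; exact hx
      rw [← hc.map_zero, e.isometry.dist_eq, dist_zero_right] at hd
      have h1 := (norm_firstCoords_le y).trans_lt hd
      have h2 := (abs_last_le y).trans_lt hd
      have h3 : |y (Fin.last 1)| < 2 * M * r := by nlinarith [h.one_le]
      rw [hbd y h1 h3] at hxb
      rcases lt_or_gt_of_ne hxb with h4 | h4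
      · exact Or.inr ⟨y, ⟨h1, h4, (abs_lt.1 h3).1⟩, rfl⟩
      · exact Or.inl ⟨y, ⟨h1, h4, (abs_lt.1 h3).2⟩, rfl⟩

end NicePolygon

/-! ### Segments and directions -/

/-- The unit vector pointing from `a` to `b`. -/
noncomputable def unitDir (a b : E3) : E3 := ‖b - a‖⁻¹ • (b - a)

theorem norm_unitDir {a b : E3} (h : a ≠ b) : ‖unitDir a b‖ = 1 := by
  have : ‖b - a‖ ≠ 0 := by rw [norm_ne_zero_iff, sub_ne_zero]; exact h.symm
  rw [unitDir, norm_smul, norm_inv, norm_norm, inv_mul_cancel₀ this]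

theorem dist_smul_unitDir {a b : E3} (h : a ≠ b) : dist a b • unitDir a b = b - a := by
  have : ‖b - a‖ ≠ 0 := by rw [norm_ne_zero_iff, sub_ne_zero]; exact h.symm
  rw [unitDir, dist_comm, dist_eq_norm, smul_inv_smul₀ this]

theorem unitDir_swap (a b : E3) : unitDir b a = - unitDir a b := by
  rw [unitDir, unitDir, norm_sub_rev, ← smul_neg, neg_sub]

theorem mem_segment_iff_unitDir {a b x : E3} (h : a ≠ b) :
    x ∈ segment ℝ a b ↔ ∃ α, 0 ≤ α ∧ α ≤ dist a b ∧ x = a + α • unitDir a b := by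
  have hd : 0 < dist a b := dist_pos.2 h
  rw [segment_eq_image']
  constructor
  · rintro ⟨s, ⟨h0, h1⟩, rfl⟩
    refine ⟨s * dist a b, by positivity, by nlinarith, ?_⟩
    rw [mul_smul, dist_smul_unitDir h]
  · rintro ⟨α, h0, h1, rfl⟩
    refine ⟨α / dist a b, ⟨by positivity, by rw [div_le_one hd]; exact h1⟩, ?_⟩
    simp only
    rw [← dist_smul_unitDir h, smul_smul, div_mul_cancel₀ _ hd.ne']

theorem segment_param {a b x : E3} (h : a ≠ b) (hx : x ∈ segment ℝ a b) :
    x = a + dist x a • unitDir a b ∧ x = b - dist x b • unitDir a b ∧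
      dist x a + dist x b = dist a b := by
  obtain ⟨α, h0, h1, rfl⟩ := (mem_segment_iff_unitDir h).1 hx
  have hb : b = a + dist a b • unitDir a b := by rw [dist_smul_unitDir h]; abel
  have e1 : dist (a + α • unitDir a b) a = α := by
    rw [dist_eq_norm, add_sub_cancel_left, norm_smul, norm_unitDir h, mul_one, Real.norm_of_nonneg h0]
  have e2 : dist (a + α • unitDir a b) b = dist a b - α := by
    have : a + α • unitDir a b - b = -((dist a b - α) • unitDir a b) := by
      rw [sub_smul, dist_smul_unitDir h]; abel
    rw [dist_eq_norm, this, norm_neg, norm_smul, norm_unitDir h, mul_one,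
      Real.norm_of_nonneg (by linarith)]
  refine ⟨by rw [e1], ?_, by rw [e1, e2]; ring⟩
  rw [e2, sub_smul, dist_smul_unitDir h]
  abel

theorem add_smul_unitDir_mem {a b x : E3} (h : a ≠ b) (hx : x ∈ segment ℝ a b) {ε : ℝ}
    (h1 : -dist x a ≤ ε) (h2 : ε ≤ dist x b) : x + ε • unitDir a b ∈ segment ℝ a b := by
  obtain ⟨e1, e2, e3⟩ := segment_param h hx
  rw [mem_segment_iff_unitDir h]
  refine ⟨dist x a + ε, by linarith, by linarith, ?_⟩
  rw [add_smul, ← add_assoc, ← e1]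

theorem abs_le_add_smul_unitDir_mem {a b x : E3} (h : a ≠ b) (hx : x ∈ segment ℝ a b) {ε τ : ℝ}
    (h1 : τ ≤ dist x a) (h2 : τ ≤ dist x b) (hε : |ε| ≤ τ) :
    x + ε • unitDir a b ∈ segment ℝ a b := by
  rw [abs_le] at hε
  exact add_smul_unitDir_mem h hx (by linarith) (by linarith)

/-! ### Plane polygons near their boundary -/

namespace NicePolygon

variable {r θ M : ℝ} {F : Set E3} {n : ℕ} {v : ZMod n → E3}

theorem corner_ne (h : NicePolygon r θ M F n v) (k : ZMod n) : v k ≠ v (k + 1) := by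
  rw [← dist_pos]; exact h.r_pos.trans_le (h.len k)

theorem cos_lt_one (h : NicePolygon r θ M F n v) : Real.cos θ < 1 := by
  have := Real.cos_lt_cos_of_nonneg_of_le_pi le_rfl (by linarith [h.θ_lt, Real.pi_pos]) h.θ_pos
  rwa [Real.cos_zero] at this

theorem unitDir_mem (h : NicePolygon r θ M F n v) {a b : E3} (ha : a ∈ F) (hb : b ∈ F) :
    unitDir a b ∈ (affineSpan ℝ F).direction :=
  Submodule.smul_mem _ _ (h.sub_mem hb ha)

theorem corner_mem_face (h : NicePolygon r θ M F n v) (k : ZMod n) : v k ∈ F :=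
  h.frontier_subset (h.corner_mem k)

theorem side_subset_face (h : NicePolygon r θ M F n v) (k : ZMod n) :
    segment ℝ (v k) (v (k + 1)) ⊆ F := (h.side_subset k).trans h.frontier_subset

theorem prev_side_subset (h : NicePolygon r θ M F n v) (k : ZMod n) :
    segment ℝ (v k) (v (k - 1)) ⊆ intrinsicFrontier ℝ F := by
  have := h.side_subset (k - 1)
  rwa [sub_add_cancel, segment_symm] at this

theorem prev_ne (h : NicePolygon r θ M F n v) (k : ZMod n) : v k ≠ v (k - 1) := by
  have := h.corner_ne (k - 1)
  rw [sub_add_cancel] at this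
  exact this.symm

theorem prev_len (h : NicePolygon r θ M F n v) (k : ZMod n) : r ≤ dist (v k) (v (k - 1)) := by
  have := h.len (k - 1)
  rwa [sub_add_cancel, dist_comm] at this

theorem abs_inner_unitDir_le (h : NicePolygon r θ M F n v) (k : ZMod n) :
    |⟪unitDir (v k) (v (k + 1)), unitDir (v k) (v (k - 1))⟫| ≤ Real.cos θ := by
  have h1 : 0 < ‖v (k + 1) - v k‖ := by
    rw [← dist_eq_norm, dist_comm]; exact dist_pos.2 (h.corner_ne k)
  have h2 : 0 < ‖v (k - 1) - v k‖ := by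
    rw [← dist_eq_norm, dist_comm]; exact dist_pos.2 (h.prev_ne k)
  rw [unitDir, unitDir, inner_smul_left, inner_smul_right, abs_mul, abs_mul]
  simp only [conj_trivial, abs_inv, abs_norm]
  rw [← mul_assoc, ← mul_inv, ← div_eq_inv_mul, div_le_iff₀ (by positivity)]
  exact h.angle k

theorem corner_mem_side (h : NicePolygon r θ M F n v) {k l : ZMod n}
    (hl : v l ∈ segment ℝ (v k) (v (k + 1))) : l = k ∨ l = k + 1 := by
  by_cases hkl : l = k
  · exact Or.inl hkl
  have := (h.region.simple l k hkl ⟨left_mem_segment ℝ _ _, hl⟩).2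
  rcases this with h1 | h1
  · exact Or.inl (h.region.corners_injective h1)
  · exact Or.inr (h.region.corners_injective h1)

/-- Points of the boundary are separated by a projection to a line, with a Lipschitz bound. -/
theorem exists_proj (h : NicePolygon r θ M F n v) {P : E3} (hP : P ∈ intrinsicFrontier ℝ F) :
    ∃ p : E3, ‖p‖ = 1 ∧ ∀ x ∈ intrinsicFrontier ℝ F, ∀ y ∈ intrinsicFrontier ℝ F,
      dist x P < r → dist y P < r → ‖x - y‖ ≤ (1 + M) * |⟪p, x - y⟫| := by
  obtain ⟨p, q, hp, hq, hp1, hq1, hpq, hexp, ha, -, -⟩ := h.exists_frame hP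
  refine ⟨p, hp1, fun x hx y hy hxP hyP => ?_⟩
  have hr := h.r_pos
  have hM := h.one_le
  have hi : ∀ z : E3, ∀ s : E3, ‖s‖ = 1 → dist z P < r → |⟪s, z - P⟫| < r := fun z s hs hz => by
    have := abs_real_inner_le_norm s (z - P)
    rw [hs, one_mul, ← dist_eq_norm] at this
    exact this.trans_lt hz
  have hr2 : r < 2 * M * r := by nlinarith
  have h1 := ha x hx y hy (hi x p hp1 hxP) ((hi x q hq1 hxP).trans hr2) (hi y p hp1 hyP)
    ((hi y q hq1 hyP).trans hr2)
  have h2 := hexp (x - y) (h.sub_mem (h.frontier_subset hx) (h.frontier_subset hy))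
  calc ‖x - y‖ = ‖⟪p, x - y⟫ • p + ⟪q, x - y⟫ • q‖ := by rw [← h2]
    _ ≤ ‖⟪p, x - y⟫ • p‖ + ‖⟪q, x - y⟫ • q‖ := norm_add_le _ _
    _ = |⟪p, x - y⟫| + |⟪q, x - y⟫| := by rw [norm_smul, norm_smul, hp1, hq1]; simp
    _ ≤ (1 + M) * |⟪p, x - y⟫| := by linarith

/-- Near an interior point of a side, the boundary of the polygon is that side. -/
theorem frontier_near_side (h : NicePolygon r θ M F n v) {k : ZMod n} {P : E3} {τ : ℝ}
    (hP : P ∈ segment ℝ (v k) (v (k + 1))) (hτ : 0 < τ) (hτr : τ ≤ r) (h1 : τ ≤ dist P (v k))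
    (h2 : τ ≤ dist P (v (k + 1))) {x : E3} (hx : x ∈ intrinsicFrontier ℝ F)
    (hxP : dist x P < τ / (1 + M)) :
    ∃ ε, |ε| < τ ∧ x = P + ε • unitDir (v k) (v (k + 1)) := by
  obtain ⟨p, hp1, hp⟩ := h.exists_proj (h.side_subset k hP)
  have hM := h.one_le
  set t := unitDir (v k) (v (k + 1)) with ht
  have htn : ‖t‖ = 1 := norm_unitDir (h.corner_ne k)
  have hmem : ∀ ε : ℝ, |ε| ≤ τ → P + ε • t ∈ intrinsicFrontier ℝ F := fun ε hε =>
    h.side_subset k (abs_le_add_smul_unitDir_mem (h.corner_ne k) hP h1 h2 hε)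
  have hd : ∀ ε : ℝ, dist (P + ε • t) P = |ε| := fun ε => by
    rw [dist_eq_norm, add_sub_cancel_left, norm_smul, htn, mul_one, Real.norm_eq_abs]
  have hτ2 : |τ / 2| = τ / 2 := abs_of_pos (by linarith)
  -- the direction `t` of the side is seen by the projection along `p`
  have hpt : 1 ≤ (1 + M) * |⟪p, t⟫| := by
    have := hp _ (hmem (τ / 2) (by rw [hτ2]; linarith)) _ (h.side_subset k hP)
      (by rw [hd, hτ2]; linarith) (by rw [dist_self]; linarith)
    rw [add_sub_cancel_left, norm_smul, htn, inner_smul_right, abs_mul, Real.norm_eq_abs, hτ2] at this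
    nlinarith
  have hpt0 : ⟪p, t⟫ ≠ 0 := by
    intro h0; rw [h0] at hpt; simp at hpt; linarith
  -- the point of the line with the same projection as `x`
  set ε := ⟪p, x - P⟫ / ⟪p, t⟫ with hε
  have hεl : |ε| < τ := by
    have h3 : |⟪p, x - P⟫| ≤ dist x P := by
      have := abs_real_inner_le_norm p (x - P)
      rwa [hp1, one_mul, ← dist_eq_norm] at this
    have hpos : 0 < |⟪p, t⟫| := abs_pos.2 hpt0
    rw [hε, abs_div, div_lt_iff₀ hpos]
    rw [lt_div_iff₀ (by linarith)] at hxP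
    nlinarith [mul_le_mul_of_nonneg_left hpt (abs_nonneg ⟪p, x - P⟫)]
  refine ⟨ε, hεl, ?_⟩
  have hxr : dist x P < r := hxP.trans_le ((div_le_self hτ.le (by linarith)).trans hτr)
  have := hp x hx _ (hmem ε hεl.le) hxr (by rw [hd]; linarith)
  have h0 : ⟪p, x - (P + ε • t)⟫ = 0 := by
    rw [← sub_sub, inner_sub_right, inner_smul_right, hε, div_mul_cancel₀ _ hpt0, sub_self]
  rw [h0, abs_zero, mul_zero] at this
  exact sub_eq_zero.1 (norm_le_zero_iff.1 this)

/-- Near a corner, the boundary of the polygon consists of the two sides at that corner. -/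
theorem frontier_near_corner (h : NicePolygon r θ M F n v) {k : ZMod n} {x : E3}
    (hx : x ∈ intrinsicFrontier ℝ F) (hxP : dist x (v k) < r / (1 + M)) :
    x ∈ segment ℝ (v k) (v (k + 1)) ∨ x ∈ segment ℝ (v k) (v (k - 1)) := by
  obtain ⟨p, hp1, hp⟩ := h.exists_proj (h.corner_mem k)
  have hM := h.one_le
  have hr := h.r_pos
  set P := v k
  set a := unitDir P (v (k + 1)) with ha
  set b := unitDir P (v (k - 1)) with hb
  have hna : ‖a‖ = 1 := norm_unitDir (h.corner_ne k)
  have hnb : ‖b‖ = 1 := norm_unitDir (h.prev_ne k)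
  have hma : ∀ ε : ℝ, 0 ≤ ε → ε ≤ r → P + ε • a ∈ segment ℝ P (v (k + 1)) := fun ε h0 h1 =>
    (mem_segment_iff_unitDir (h.corner_ne k)).2 ⟨ε, h0, h1.trans (h.len k), rfl⟩
  have hmb : ∀ ε : ℝ, 0 ≤ ε → ε ≤ r → P + ε • b ∈ segment ℝ P (v (k - 1)) := fun ε h0 h1 =>
    (mem_segment_iff_unitDir (h.prev_ne k)).2 ⟨ε, h0, h1.trans (h.prev_len k), rfl⟩
  have hd : ∀ t : E3, ‖t‖ = 1 → ∀ ε : ℝ, 0 ≤ ε → dist (P + ε • t) P = ε := fun t ht ε hε => by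
    rw [dist_eq_norm, add_sub_cancel_left, norm_smul, ht, mul_one, Real.norm_of_nonneg hε]
  -- the directions of both sides are seen by the projection
  have hsl : ∀ t : E3, ‖t‖ = 1 → P + (r / 2) • t ∈ intrinsicFrontier ℝ F →
      1 ≤ (1 + M) * |⟪p, t⟫| := fun t ht hm => by
    have := hp _ hm _ (h.corner_mem k) (by rw [hd t ht _ (by linarith)]; linarith)
      (by rw [dist_self]; linarith)
    rw [add_sub_cancel_left, norm_smul, ht, inner_smul_right, abs_mul, Real.norm_eq_abs,
      abs_of_pos (by linarith : 0 < r / 2)] at this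
    nlinarith
  have hpa := hsl a hna (h.side_subset k (hma _ (by linarith) (by linarith)))
  have hpb := hsl b hnb (h.prev_side_subset k (hmb _ (by linarith) (by linarith)))
  have hpx : |⟪p, x - P⟫| ≤ dist x P := by
    have := abs_real_inner_le_norm p (x - P)
    rwa [hp1, one_mul, ← dist_eq_norm] at this
  rw [lt_div_iff₀ (by linarith)] at hxP
  have hxr : dist x P < r := by nlinarith [dist_nonneg (x := x) (y := P)]
  -- a point of a side with the same projection as `x` is `x`
  have key : ∀ t : E3, ‖t‖ = 1 → 1 ≤ (1 + M) * |⟪p, t⟫| →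
      (∀ ε : ℝ, 0 ≤ ε → ε ≤ r → P + ε • t ∈ intrinsicFrontier ℝ F) →
      ∀ y ∈ intrinsicFrontier ℝ F, dist y P * (1 + M) < r → 0 ≤ ⟪p, y - P⟫ * ⟪p, t⟫ →
      ∃ ε, 0 ≤ ε ∧ ε ≤ r ∧ y = P + ε • t := by
    intro t ht hpt hm y hy hyP hs
    have hpt0 : ⟪p, t⟫ ≠ 0 := by
      intro h0; rw [h0] at hpt; simp at hpt; linarith
    have hpy : |⟪p, y - P⟫| ≤ dist y P := by
      have := abs_real_inner_le_norm p (y - P)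
      rwa [hp1, one_mul, ← dist_eq_norm] at this
    have hyr : dist y P < r := by nlinarith [dist_nonneg (x := y) (y := P)]
    set ε := ⟪p, y - P⟫ / ⟪p, t⟫ with hε
    have hε0 : 0 ≤ ε := by
      rw [hε, ← mul_div_mul_right _ _ hpt0]
      exact div_nonneg hs (mul_self_nonneg _)
    have hεr : ε < r := by
      rw [← abs_of_nonneg hε0, hε, abs_div, div_lt_iff₀ (abs_pos.2 hpt0)]
      nlinarith [mul_le_mul_of_nonneg_left hpt (abs_nonneg ⟪p, y - P⟫), abs_pos.2 hpt0]
    refine ⟨ε, hε0, hεr.le, ?_⟩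
    have := hp y hy _ (hm ε hε0 hεr.le) hyr (by rw [hd t ht ε hε0]; exact hεr)
    have h0 : ⟪p, y - (P + ε • t)⟫ = 0 := by
      rw [← sub_sub, inner_sub_right, inner_smul_right, hε, div_mul_cancel₀ _ hpt0, sub_self]
    rw [h0, abs_zero, mul_zero] at this
    exact sub_eq_zero.1 (norm_le_zero_iff.1 this)
  have hma' : ∀ ε : ℝ, 0 ≤ ε → ε ≤ r → P + ε • a ∈ intrinsicFrontier ℝ F :=
    fun ε h0 h1 => h.side_subset k (hma ε h0 h1)
  have hmb' : ∀ ε : ℝ, 0 ≤ ε → ε ≤ r → P + ε • b ∈ intrinsicFrontier ℝ F :=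
    fun ε h0 h1 => h.prev_side_subset k (hmb ε h0 h1)
  -- the two sides lie on different sides of the corner
  have hopp : ⟪p, a⟫ * ⟪p, b⟫ ≤ 0 := by
    by_contra hc
    push Not at hc
    have hδ : 0 < r / (2 * (1 + M)) := by positivity
    have hδ2 : r / (2 * (1 + M)) * (1 + M) < r := by
      rw [div_mul_eq_mul_div, div_lt_iff₀ (by positivity)]; nlinarith
    obtain ⟨ε, hε0, hεr, he⟩ := key a hna hpa hma' (P + (r / (2 * (1 + M))) • b)
      (hmb' _ hδ.le (by nlinarith)) (by rw [hd b hnb _ hδ.le]; exact hδ2) (by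
        rw [add_sub_cancel_left, inner_smul_right]
        have := mul_pos hδ hc; nlinarith)
    have he' := add_left_cancel he
    have hab : r / (2 * (1 + M)) = ε := by
      have := congrArg norm he'
      rwa [norm_smul, norm_smul, hna, hnb, mul_one, mul_one, Real.norm_of_nonneg hδ.le,
        Real.norm_of_nonneg hε0] at this
    rw [← hab] at he'
    have hba := smul_right_injective E3 hδ.ne' he'
    have h3 := h.abs_inner_unitDir_le k
    change |⟪a, b⟫| ≤ _ at h3
    rw [hba, real_inner_self_eq_norm_sq, hna] at h3
    have := h.cos_lt_one
    norm_num at h3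
    linarith
  have hx1 : dist x P * (1 + M) < r := hxP
  rcases le_total 0 (⟪p, x - P⟫ * ⟪p, a⟫) with hs | hs
  · obtain ⟨ε, h0, h1, rfl⟩ := key a hna hpa hma' x hx hx1 hs
    exact Or.inl (hma ε h0 h1)
  · have hs' : 0 ≤ ⟪p, x - P⟫ * ⟪p, b⟫ := by
      have hpa0 : ⟪p, a⟫ ≠ 0 := by
        intro h0; rw [h0] at hpa; simp at hpa; linarith
      have h3 : 0 ≤ (⟪p, x - P⟫ * ⟪p, a⟫) * (⟪p, a⟫ * ⟪p, b⟫) := mul_nonneg_of_nonpos_of_nonpos hs hopp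
      have h4 : 0 < ⟪p, a⟫ * ⟪p, a⟫ := mul_self_pos.2 hpa0
      by_contra hneg
      push Not at hneg
      nlinarith
    obtain ⟨ε, h0, h1, rfl⟩ := key b hnb hpb hmb' x hx hx1 hs'
    exact Or.inr (hmb ε h0 h1)

theorem prev_mem_iff (_h : NicePolygon r θ M F n v) (k : ZMod n) (x : E3) :
    x ∈ segment ℝ (v k) (v (k - 1)) ↔ x ∈ segment ℝ (v (k - 1)) (v (k - 1 + 1)) := by
  rw [sub_add_cancel, segment_symm]

theorem corner_dist (h : NicePolygon r θ M F n v) {k l : ZMod n} (hkl : l ≠ k) :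
    r / (1 + M) ≤ dist (v l) (v k) := by
  by_contra hc
  push Not at hc
  have hlt : r / (1 + M) ≤ r := div_le_self h.r_pos.le (by linarith [h.one_le])
  rcases h.frontier_near_corner (h.corner_mem l) hc with h1 | h1
  · rcases h.corner_mem_side h1 with h2 | h2
    · exact hkl h2
    · rw [h2, dist_comm] at hc
      linarith [h.len k]
  · rw [h.prev_mem_iff] at h1
    rcases h.corner_mem_side h1 with h2 | h2
    · rw [h2, dist_comm] at hc
      linarith [h.prev_len k]
    · rw [sub_add_cancel] at h2
      exact hkl h2

end NicePolygon

/-! ### Inner normals of a plane polygon -/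

/-- `u` is the unit inner normal of the plane set `F` along its side from `a` to `b`: at depth
governed by the distance `τ` to the end points, the two sides of the segment lie inside and
outside `F`. -/
structure IsInnerNormal (r M : ℝ) (F : Set E3) (a b u : E3) : Prop where
  mem : u ∈ (affineSpan ℝ F).direction
  unit : ‖u‖ = 1
  orth : ⟪unitDir a b, u⟫ = 0
  expand : ∀ w ∈ (affineSpan ℝ F).direction, w = ⟪unitDir a b, w⟫ • unitDir a b + ⟪u, w⟫ • u
  sides : ∀ τ, 0 < τ → τ ≤ r → ∀ P ∈ segment ℝ a b, τ ≤ dist P a → τ ≤ dist P b →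
    ∀ w ∈ (affineSpan ℝ F).direction, ‖w‖ < τ / (1 + M) →
      (0 < ⟪u, w⟫ → P + w ∈ intrinsicInterior ℝ F) ∧ (⟪u, w⟫ < 0 → P + w ∉ F)
  deep : ∀ τ, 0 < τ → τ ≤ r → ∀ P ∈ segment ℝ a b, τ ≤ dist P a → τ ≤ dist P b →
    ∀ β, 0 < β → β < τ / M → P + β • u ∈ intrinsicInterior ℝ F

namespace NicePolygon

variable {r θ M : ℝ} {F : Set E3} {n : ℕ} {v : ZMod n → E3}

/-- A unit vector of the plane of the polygon completes to an orthonormal basis of its direction. -/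
theorem exists_orthogonal (h : NicePolygon r θ M F n v) {t : E3}
    (ht : t ∈ (affineSpan ℝ F).direction) (htn : ‖t‖ = 1) :
    ∃ u ∈ (affineSpan ℝ F).direction, ‖u‖ = 1 ∧ ⟪t, u⟫ = 0 ∧
      ∀ w ∈ (affineSpan ℝ F).direction, w = ⟪t, w⟫ • t + ⟪u, w⟫ • u := by
  obtain ⟨p, q, hp, hq, hp1, hq1, hpq, hexp, -⟩ := h.exists_frame (h.corner_mem 0)
  have hte := hexp t ht
  set a := ⟪p, t⟫
  set b := ⟪q, t⟫
  have hqp : ⟪q, p⟫ = 0 := by rw [real_inner_comm]; exact hpq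
  have hpp : ⟪p, p⟫ = 1 := by rw [real_inner_self_eq_norm_sq, hp1]; norm_num
  have hqq : ⟪q, q⟫ = 1 := by rw [real_inner_self_eq_norm_sq, hq1]; norm_num
  have hab : a ^ 2 + b ^ 2 = 1 := by
    have : ⟪t, t⟫ = 1 := by rw [real_inner_self_eq_norm_sq, htn]; norm_num
    rw [hte] at this
    simp only [inner_add_left, inner_add_right, inner_smul_left, inner_smul_right, hpq, hqp, hpp,
      hqq, conj_trivial] at this
    nlinarith
  have huu : ⟪(-b) • p + a • q, (-b) • p + a • q⟫ = 1 := by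
    simp only [inner_add_left, inner_add_right, inner_smul_left, inner_smul_right, hpq, hqp, hpp,
      hqq, conj_trivial]
    nlinarith
  -- rotate `t = a • p + b • q` by a right angle
  refine ⟨(-b) • p + a • q, Submodule.add_mem _ (Submodule.smul_mem _ _ hp)
    (Submodule.smul_mem _ _ hq), ?_, ?_, ?_⟩
  · rw [real_inner_self_eq_norm_sq] at huu
    nlinarith [norm_nonneg ((-b) • p + a • q)]
  · rw [hte]
    simp only [inner_add_left, inner_add_right, inner_smul_left, inner_smul_right, hpq, hqp, hpp,
      hqq, conj_trivial]
    ring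
  · intro w hw
    have hwe := hexp w hw
    set c := ⟪p, w⟫
    set d := ⟪q, w⟫
    have h1 : ⟪t, w⟫ = a * c + b * d := by
      rw [hte, inner_add_left, inner_smul_left, inner_smul_left]; rfl
    have h2 : ⟪(-b) • p + a • q, w⟫ = -b * c + a * d := by
      rw [inner_add_left, inner_smul_left, inner_smul_left]; rfl
    rw [h1, h2]
    conv_rhs => rw [hte]
    have e1 : (a * c + b * d) * a + (-b * c + a * d) * (-b) = c := by linear_combination c * hab
    have e2 : (a * c + b * d) * b + (-b * c + a * d) * a = d := by linear_combination d * hab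
    calc w = c • p + d • q := hwe
      _ = ((a * c + b * d) * a + (-b * c + a * d) * (-b)) • p +
          ((a * c + b * d) * b + (-b * c + a * d) * a) • q := by rw [e1, e2]
      _ = _ := by module

/-- The open half discs at an interior point of a side avoid the boundary. -/
theorem halfDisc_disjoint (h : NicePolygon r θ M F n v) {k : ZMod n} {P : E3} {τ : ℝ}
    (hP : P ∈ segment ℝ (v k) (v (k + 1))) (hτ : 0 < τ) (hτr : τ ≤ r) (h1 : τ ≤ dist P (v k))
    (h2 : τ ≤ dist P (v (k + 1))) {u : E3} (hu : ⟪unitDir (v k) (v (k + 1)), u⟫ = 0) {w : E3}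
    (hw : ‖w‖ < τ / (1 + M)) (huw : ⟪u, w⟫ ≠ 0) : P + w ∉ intrinsicFrontier ℝ F := by
  intro hb
  obtain ⟨ε, -, he⟩ := h.frontier_near_side hP hτ hτr h1 h2 hb
    (by rwa [dist_eq_norm, add_sub_cancel_left])
  rw [add_left_cancel he, inner_smul_right, real_inner_comm, hu, mul_zero] at huw
  exact huw rfl

/-- At an interior point of a side, exactly one of the two half discs is in the polygon. -/
theorem exists_local_normal (h : NicePolygon r θ M F n v) {k : ZMod n} {P u : E3} {τ : ℝ}
    (hP : P ∈ segment ℝ (v k) (v (k + 1))) (hτ : 0 < τ) (hτr : τ ≤ r) (h1 : τ ≤ dist P (v k))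
    (h2 : τ ≤ dist P (v (k + 1)))
    (hu : ⟪unitDir (v k) (v (k + 1)), u⟫ = 0)
    (hexp : ∀ w ∈ (affineSpan ℝ F).direction,
      w = ⟪unitDir (v k) (v (k + 1)), w⟫ • unitDir (v k) (v (k + 1)) + ⟪u, w⟫ • u) :
    ∃ s : ℝ, (s = 1 ∨ s = -1) ∧ ∀ w ∈ (affineSpan ℝ F).direction, ‖w‖ < τ / (1 + M) →
      (0 < ⟪s • u, w⟫ → P + w ∈ intrinsicInterior ℝ F) ∧ (⟪s • u, w⟫ < 0 → P + w ∉ F) := by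
  obtain ⟨p, q, hp, hq, hp1, hq1, hpq, -, -, hb, -⟩ := h.exists_frame (h.side_subset k hP)
  have hM := h.one_le
  have hr := h.r_pos
  set t := unitDir (v k) (v (k + 1)) with ht
  have htn : ‖t‖ = 1 := norm_unitDir (h.corner_ne k)
  have hPF := h.side_subset_face k hP
  -- a small multiple of the frame direction `q` lies in the half disc
  set s₀ := τ / (2 * (1 + M)) with hs₀
  have hs0 : 0 < s₀ := by positivity
  have hs1 : s₀ < τ / (1 + M) := by
    rw [hs₀]; exact div_lt_div_of_pos_left hτ (by linarith) (by linarith)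
  have hs2 : s₀ ≤ τ := hs1.le.trans (div_le_self hτ.le (by linarith))
  obtain ⟨hq_in, hq_out⟩ := hb s₀ hs0 (by nlinarith)
  -- otherwise `q` is parallel to the side and the point `P + s₀ • q` lies on the side
  have hquz : ⟪u, q⟫ ≠ 0 := by
    intro h0
    have hqe := hexp q hq
    rw [h0, zero_smul, add_zero] at hqe
    have habs : |⟪t, q⟫| ≤ 1 := by
      have := abs_real_inner_le_norm t q
      rwa [htn, hq1, one_mul] at this
    have : P + s₀ • q ∈ intrinsicFrontier ℝ F := by
      rw [hqe, smul_smul]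
      refine h.side_subset k (abs_le_add_smul_unitDir_mem (h.corner_ne k) hP h1 h2 ?_)
      rw [abs_mul, abs_of_pos hs0]; nlinarith
    exact not_mem_intrinsicFrontier hq_in this
  have hnq : ‖s₀ • q‖ < τ / (1 + M) := by
    rw [norm_smul, hq1, mul_one, Real.norm_of_nonneg hs0.le]; exact hs1
  have main : ∀ u' : E3, ⟪t, u'⟫ = 0 → 0 < ⟪u', q⟫ → ∀ w ∈ (affineSpan ℝ F).direction,
      ‖w‖ < τ / (1 + M) →
      (0 < ⟪u', w⟫ → P + w ∈ intrinsicInterior ℝ F) ∧ (⟪u', w⟫ < 0 → P + w ∉ F) := by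
    intro u' hu' hq' w hw hwn
    -- half discs are convex, hence connected, and avoid the boundary
    have hconv : ∀ (S : Set ℝ), Convex ℝ S → IsPreconnected
        ((fun w => P + w) '' {w : E3 | w ∈ (affineSpan ℝ F).direction ∧ ‖w‖ < τ / (1 + M) ∧
          ⟪u', w⟫ ∈ S}) := by
      intro S hS
      have hc : Convex ℝ {w : E3 | w ∈ (affineSpan ℝ F).direction ∧ ‖w‖ < τ / (1 + M) ∧
          ⟪u', w⟫ ∈ S} := by
        have e : {w : E3 | w ∈ (affineSpan ℝ F).direction ∧ ‖w‖ < τ / (1 + M) ∧ ⟪u', w⟫ ∈ S} =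
            ((affineSpan ℝ F).direction : Set E3) ∩ (Metric.ball 0 (τ / (1 + M)) ∩
              (innerₛₗ ℝ u') ⁻¹' S) := by
          ext w; simp
        rw [e]
        exact (Submodule.convex _).inter ((convex_ball _ _).inter (hS.linear_preimage _))
      exact hc.isPreconnected.image _ (by fun_prop)
    have hsubs : ∀ S : Set ℝ, (0 : ℝ) ∉ S → Convex ℝ S → ∀ x : E3,
        x ∈ (affineSpan ℝ F).direction → ‖x‖ < τ / (1 + M) → ⟪u', x⟫ ∈ S → P + x ∈ F →
        ∀ y ∈ (affineSpan ℝ F).direction, ‖y‖ < τ / (1 + M) → ⟪u', y⟫ ∈ S →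
        P + y ∈ intrinsicInterior ℝ F := by
      intro S h0S hS x hxW hxn hxS hxF y hyW hyn hyS
      refine (hconv S hS).subset_intrinsicInterior h.isClosed ?_ ?_ ⟨x, ⟨hxW, hxn, hxS⟩, rfl⟩ hxF
        ⟨y, ⟨hyW, hyn, hyS⟩, rfl⟩
      · rintro _ ⟨z, ⟨hz, -⟩, rfl⟩
        exact h.add_mem hPF hz
      · rw [Set.disjoint_left]
        rintro _ ⟨z, ⟨hz, hzn, hzS⟩, rfl⟩
        exact h.halfDisc_disjoint hP hτ hτr h1 h2 hu' hzn (fun h0 => h0S (h0 ▸ hzS))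
    refine ⟨fun hpos => hsubs (Set.Ioi 0) (by simp) (convex_Ioi _) (s₀ • q)
      (Submodule.smul_mem _ _ hq) hnq ?_ (intrinsicInterior_subset hq_in) w hw hwn hpos,
      fun hneg hwF => hq_out ?_⟩
    · rw [inner_smul_right]; exact mul_pos hs0 hq'
    · have := hsubs (Set.Iio 0) (by simp) (convex_Iio _) w hw hwn hneg hwF (-(s₀ • q))
        (Submodule.neg_mem _ (Submodule.smul_mem _ _ hq)) (by rwa [norm_neg])
        (by rw [inner_neg_right, inner_smul_right]; simp only [Set.mem_Iio]
            have := mul_pos hs0 hq'; linarith)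
      rw [sub_eq_add_neg]
      exact intrinsicInterior_subset this
  rcases lt_or_gt_of_ne hquz with hlt | hgt
  · refine ⟨-1, Or.inr rfl, main _ ?_ ?_⟩
    · rw [inner_smul_right, hu, mul_zero]
    · rw [inner_smul_left]; simpa using hlt
  · refine ⟨1, Or.inl rfl, main _ ?_ ?_⟩
    · rw [inner_smul_right, hu, mul_zero]
    · rw [inner_smul_left]; simpa using hgt

/-- The Lipschitz bound keeps the normal segment at an interior point of a side inside the polygon
up to depth `τ / M`. -/
theorem deep_of_sides (h : NicePolygon r θ M F n v) {k : ZMod n} {u : E3}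
    (huW : u ∈ (affineSpan ℝ F).direction) (hun : ‖u‖ = 1)
    (hut : ⟪unitDir (v k) (v (k + 1)), u⟫ = 0)
    (hexp : ∀ w ∈ (affineSpan ℝ F).direction,
      w = ⟪unitDir (v k) (v (k + 1)), w⟫ • unitDir (v k) (v (k + 1)) + ⟪u, w⟫ • u)
    (hside : ∀ τ, 0 < τ → τ ≤ r → ∀ P ∈ segment ℝ (v k) (v (k + 1)), τ ≤ dist P (v k) →
      τ ≤ dist P (v (k + 1)) → ∀ w ∈ (affineSpan ℝ F).direction, ‖w‖ < τ / (1 + M) →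
      (0 < ⟪u, w⟫ → P + w ∈ intrinsicInterior ℝ F) ∧ (⟪u, w⟫ < 0 → P + w ∉ F)) :
    ∀ τ, 0 < τ → τ ≤ r → ∀ P ∈ segment ℝ (v k) (v (k + 1)), τ ≤ dist P (v k) →
      τ ≤ dist P (v (k + 1)) → ∀ β, 0 < β → β < τ / M → P + β • u ∈ intrinsicInterior ℝ F := by
  have hM := h.one_le
  have hr := h.r_pos
  have hne := h.corner_ne k
  have htW : unitDir (v k) (v (k + 1)) ∈ (affineSpan ℝ F).direction :=
    h.unitDir_mem (h.corner_mem_face k) (h.corner_mem_face (k + 1))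
  have htn : ‖unitDir (v k) (v (k + 1))‖ = 1 := norm_unitDir hne
  set t := unitDir (v k) (v (k + 1)) with ht
  have huu' : ⟪u, u⟫ = 1 := by rw [real_inner_self_eq_norm_sq, hun]; norm_num
  intro τ hτ hτr P hP h1 h2 β hβ hβτ
  obtain ⟨p, q, hp, hq, hp1, hq1, hpq, hpexp, ha, -, -⟩ := h.exists_frame (h.side_subset k hP)
  have hM0 : 0 < M := by linarith
  have hPF := h.side_subset_face k hP
  -- by the Lipschitz bound the vertical segment does not meet the boundary
  have hnb : ∀ β, 0 < β → β < τ / M → P + β • u ∉ intrinsicFrontier ℝ F := by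
    intro β hβ hβτ hb
    rw [lt_div_iff₀ hM0] at hβτ
    have hβr : β < r := by nlinarith
    have hnorm2 : ∀ x ∈ (affineSpan ℝ F).direction, ‖x‖ = 1 → ⟪p, x⟫ ^ 2 + ⟪q, x⟫ ^ 2 = 1 := by
      intro x hx hxn
      have e1 := hpexp x hx
      have e2 : ⟪x, x⟫ = 1 := by rw [real_inner_self_eq_norm_sq, hxn]; norm_num
      nth_rewrite 1 [e1] at e2
      rw [inner_add_left, inner_smul_left, inner_smul_left] at e2
      simp only [conj_trivial] at e2
      nlinarith
    have ht2 := hnorm2 t htW htn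
    -- both `(p, q)` and `(t, u)` are orthonormal bases of the direction of the plane
    have hpu : ⟪p, u⟫ ^ 2 = ⟪q, t⟫ ^ 2 := by
      have e1 := hexp p hp
      have e2 : ⟪p, p⟫ = 1 := by rw [real_inner_self_eq_norm_sq, hp1]; norm_num
      nth_rewrite 1 [e1] at e2
      rw [inner_add_left, inner_smul_left, inner_smul_left, real_inner_comm p t,
        real_inner_comm p u] at e2
      simp only [conj_trivial] at e2
      nlinarith
    have hmem : ∀ ε : ℝ, |ε| ≤ τ → P + ε • t ∈ intrinsicFrontier ℝ F := fun ε hε =>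
      h.side_subset k (abs_le_add_smul_unitDir_mem hne hP h1 h2 hε)
    have hbox : ∀ x : E3, ‖x‖ = 1 → ∀ s : E3, ‖s‖ = 1 → ∀ ε : ℝ, |ε| < r →
        |⟪s, P + ε • x - P⟫| < r := fun x hx s hs ε hε => by
      have := abs_real_inner_le_norm s (P + ε • x - P)
      rw [add_sub_cancel_left, norm_smul, hs, hx, Real.norm_eq_abs, one_mul, mul_one] at this
      rw [add_sub_cancel_left]
      linarith
    have hr2 : r < 2 * M * r := by nlinarith
    have hP0 : ∀ s : E3, |⟪s, P - P⟫| < r := fun s => by simpa using hr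
    -- the side itself is part of the graph, so its slope is at most `M`
    have hslope : |⟪q, t⟫| ≤ M * |⟪p, t⟫| := by
      have hτ2 : |τ / 2| = τ / 2 := abs_of_pos (by linarith)
      have := ha _ (hmem (τ / 2) (by rw [hτ2]; linarith)) P (h.side_subset k hP)
        (hbox t htn p hp1 _ (by rw [hτ2]; linarith))
        ((hbox t htn q hq1 _ (by rw [hτ2]; linarith)).trans hr2) (hP0 p) ((hP0 q).trans hr2)
      rw [add_sub_cancel_left, inner_smul_right, inner_smul_right, abs_mul, abs_mul, hτ2] at this
      nlinarith
    have hpt0 : ⟪p, t⟫ ≠ 0 := by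
      intro h0
      rw [h0] at hslope ht2
      simp only [abs_zero, mul_zero] at hslope
      have := abs_nonpos_iff.1 hslope
      rw [this] at ht2
      norm_num at ht2
    -- the point of the side below or above `P + β • u` in the coordinate `p`; two points of the
    -- graph with the same coordinate `p` coincide
    set ε := β * ⟪p, u⟫ / ⟪p, t⟫ with hε
    have hεl : |ε| < τ := by
      rw [hε, abs_div, abs_mul, abs_of_pos hβ, div_lt_iff₀ (abs_pos.2 hpt0),
        (sq_eq_sq_iff_abs_eq_abs _ _).1 hpu]
      have := abs_pos.2 hpt0
      nlinarith
    have h3 := ha _ hb _ (hmem ε hεl.le) (hbox u hun p hp1 _ (by rw [abs_of_pos hβ]; exact hβr))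
      ((hbox u hun q hq1 _ (by rw [abs_of_pos hβ]; exact hβr)).trans hr2)
      (hbox t htn p hp1 _ (by linarith)) ((hbox t htn q hq1 _ (by linarith)).trans hr2)
    rw [add_sub_add_left_eq_sub] at h3
    have h4 : ⟪p, β • u - ε • t⟫ = 0 := by
      rw [inner_sub_right, inner_smul_right, inner_smul_right, hε, div_mul_cancel₀ _ hpt0, sub_self]
    rw [h4, abs_zero, mul_zero] at h3
    have h5 := abs_nonpos_iff.1 h3
    have h6 := hpexp (β • u - ε • t) (Submodule.sub_mem _ (Submodule.smul_mem _ _ huW)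
      (Submodule.smul_mem _ _ htW))
    rw [h4, h5, zero_smul, zero_smul, add_zero] at h6
    have h7 : ⟪u, β • u - ε • t⟫ = β := by
      rw [inner_sub_right, inner_smul_right, inner_smul_right, huu', real_inner_comm, hut]; ring
    rw [h6, inner_zero_right] at h7
    exact hβ.ne h7
  -- the normal segment is connected, and its points near `P` are inside
  have hYc : IsPreconnected ((fun s : ℝ => P + s • u) '' Set.Ioo 0 (τ / M)) :=
    isPreconnected_Ioo.image _ (by fun_prop)
  set δ := min (τ / (2 * (1 + M))) β with hδ
  have hδ0 : 0 < δ := lt_min (by positivity) hβ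
  have hδ1 : δ < τ / (1 + M) := (min_le_left _ _).trans_lt
    (div_lt_div_of_pos_left hτ (by linarith) (by linarith))
  have hδu : ‖δ • u‖ = δ := by rw [norm_smul, hun, mul_one, Real.norm_of_nonneg hδ0.le]
  have hδuu : ⟪u, δ • u⟫ = δ := by rw [inner_smul_right, huu', mul_one]
  refine hYc.subset_intrinsicInterior h.isClosed ?_ ?_ (x := P + δ • u) ?_ ?_ ⟨β, ⟨hβ, hβτ⟩, rfl⟩
  · rintro _ ⟨s, -, rfl⟩
    exact h.add_mem hPF (Submodule.smul_mem _ _ huW)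
  · rw [Set.disjoint_left]
    rintro _ ⟨s, ⟨hs0, hs1⟩, rfl⟩
    exact hnb s hs0 hs1
  · exact ⟨δ, ⟨hδ0, (min_le_right _ _).trans_lt hβτ⟩, rfl⟩
  · exact intrinsicInterior_subset ((hside τ hτ hτr P hP h1 h2 (δ • u) (Submodule.smul_mem _ _ huW)
      (by rw [hδu]; exact hδ1)).1 (by rw [hδuu]; exact hδ0))

/-- The sign of the normal is the same at all points of a side: a strip parallel to the side connects
them without meeting the boundary. -/
theorem exists_innerNormal (h : NicePolygon r θ M F n v) (k : ZMod n) :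
    ∃ u, IsInnerNormal r M F (v k) (v (k + 1)) u := by
  have hM := h.one_le
  have hr := h.r_pos
  have hne := h.corner_ne k
  set t := unitDir (v k) (v (k + 1)) with ht
  have htn : ‖t‖ = 1 := norm_unitDir hne
  have htW : t ∈ (affineSpan ℝ F).direction := h.unitDir_mem (h.corner_mem_face k)
    (h.corner_mem_face (k + 1))
  obtain ⟨u₀, hu₀W, hu₀n, hu₀t, hexp₀⟩ := h.exists_orthogonal htW htn
  have huu : ⟪u₀, u₀⟫ = 1 := by rw [real_inner_self_eq_norm_sq, hu₀n]; norm_num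
  -- the midpoint fixes the sign
  set Q := midpoint ℝ (v k) (v (k + 1)) with hQ
  have hQs : Q ∈ segment ℝ (v k) (v (k + 1)) := midpoint_mem_segment _ _
  have hQ1 : r / 2 ≤ dist Q (v k) := by
    rw [hQ, dist_midpoint_left, Real.norm_ofNat]; linarith [h.len k]
  have hQ2 : r / 2 ≤ dist Q (v (k + 1)) := by
    rw [hQ, dist_midpoint_right, Real.norm_ofNat]; linarith [h.len k]
  obtain ⟨s, hs, hsQ⟩ := h.exists_local_normal hQs (by linarith) (by linarith) hQ1 hQ2 hu₀t hexp₀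
  have hs2 : s * s = 1 := by rcases hs with rfl | rfl <;> norm_num
  set u := s • u₀ with hu
  have huW : u ∈ (affineSpan ℝ F).direction := Submodule.smul_mem _ _ hu₀W
  have hun : ‖u‖ = 1 := by
    rw [hu, norm_smul, hu₀n]; rcases hs with rfl | rfl <;> norm_num
  have hut : ⟪t, u⟫ = 0 := by rw [hu, inner_smul_right, hu₀t, mul_zero]
  have hexp : ∀ w ∈ (affineSpan ℝ F).direction, w = ⟪t, w⟫ • t + ⟪u, w⟫ • u := by
    intro w hw
    rw [hu, inner_smul_left, smul_smul]
    simp only [conj_trivial]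
    rw [mul_comm s, mul_assoc, hs2, mul_one]
    exact hexp₀ w hw
  have huu' : ⟪u, u⟫ = 1 := by rw [real_inner_self_eq_norm_sq, hun]; norm_num
  have hside : ∀ τ, 0 < τ → τ ≤ r → ∀ P ∈ segment ℝ (v k) (v (k + 1)), τ ≤ dist P (v k) →
      τ ≤ dist P (v (k + 1)) → ∀ w ∈ (affineSpan ℝ F).direction, ‖w‖ < τ / (1 + M) →
      (0 < ⟪u, w⟫ → P + w ∈ intrinsicInterior ℝ F) ∧ (⟪u, w⟫ < 0 → P + w ∉ F) := by
    intro τ hτ hτr P hP h1 h2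
    obtain ⟨s', hs', hsP⟩ := h.exists_local_normal hP hτ hτr h1 h2 hut hexp
    rcases hs' with rfl | rfl
    · simpa using hsP
    exfalso
    -- a thin strip along the side from `Q` to `P` avoids the boundary
    set τ' := min τ (r / 2) with hτ'
    have hτ'0 : 0 < τ' := lt_min hτ (by linarith)
    have hτ'r : τ' ≤ r := (min_le_left _ _).trans hτr
    set δ := τ' / (2 * (1 + M)) with hδ
    have hδ0 : 0 < δ := by positivity
    have hδ1 : δ < τ' / (1 + M) := div_lt_div_of_pos_left hτ'0 (by linarith) (by linarith)
    have hδu : ‖δ • u‖ = δ := by rw [norm_smul, hun, mul_one, Real.norm_of_nonneg hδ0.le]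
    have hδuu : ⟪u, δ • u⟫ = δ := by rw [inner_smul_right, huu', mul_one]
    have hQin : Q + δ • u ∈ intrinsicInterior ℝ F := by
      refine (hsQ _ (Submodule.smul_mem _ _ huW) ?_).1 (by rw [hδuu]; exact hδ0)
      rw [hδu]
      exact hδ1.trans_le (div_le_div_of_nonneg_right (min_le_right _ _) (by linarith))
    have hYc : IsPreconnected ((fun x => x + δ • u) '' segment ℝ Q P) :=
      (convex_segment _ _).isPreconnected.image _ (by fun_prop)
    have hseg : segment ℝ Q P ⊆ segment ℝ (v k) (v (k + 1)) :=
      (convex_segment _ _).segment_subset hQs hP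
    have hYd : Disjoint ((fun x => x + δ • u) '' segment ℝ Q P) (intrinsicFrontier ℝ F) := by
      rw [Set.disjoint_left]
      rintro _ ⟨x, hx, rfl⟩
      obtain ⟨ex1, ex2, ex3⟩ := segment_param hne (hseg hx)
      obtain ⟨eP1, eP2, eP3⟩ := segment_param hne hP
      obtain ⟨eQ1, eQ2, eQ3⟩ := segment_param hne hQs
      -- the distances to the end points are concave along the segment
      have hd : ∀ y ∈ segment ℝ (v k) (v (k + 1)), dist y (v k) = ⟪t, y - v k⟫ := fun y hy => by
        obtain ⟨ey, -, -⟩ := segment_param hne hy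
        conv_rhs => rw [ey]
        rw [add_sub_cancel_left, inner_smul_right, real_inner_self_eq_norm_sq, htn]; ring
      obtain ⟨a, b, ha, hb, hab, rfl⟩ := hx
      have hxd : dist (a • Q + b • P) (v k) = a * dist Q (v k) + b * dist P (v k) := by
        rw [hd _ (hseg ⟨a, b, ha, hb, hab, rfl⟩), hd Q hQs, hd P hP, ← inner_smul_right,
          ← inner_smul_right, ← inner_add_right]
        congr 1
        have : v k = a • v k + b • v k := by rw [← add_smul, hab, one_smul]
        nth_rewrite 1 [this]
        module
      have hm1 : τ' ≤ τ := min_le_left _ _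
      have hm2 : τ' ≤ r / 2 := min_le_right _ _
      have hx1 : τ' ≤ dist (a • Q + b • P) (v k) := by rw [hxd]; nlinarith
      have hx2 : τ' ≤ dist (a • Q + b • P) (v (k + 1)) := by
        have : dist (a • Q + b • P) (v (k + 1)) = a * dist Q (v (k + 1)) + b * dist P (v (k + 1)) := by
          have e1 : a * (dist Q (v k) + dist Q (v (k + 1))) = a * dist (v k) (v (k + 1)) := by rw [eQ3]
          have e2 : b * (dist P (v k) + dist P (v (k + 1))) = b * dist (v k) (v (k + 1)) := by rw [eP3]
          have e3 : a * dist (v k) (v (k + 1)) + b * dist (v k) (v (k + 1)) =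
            dist (v k) (v (k + 1)) := by rw [← add_mul, hab, one_mul]
          linarith
        rw [this]; nlinarith
      exact h.halfDisc_disjoint (hseg ⟨a, b, ha, hb, hab, rfl⟩) hτ'0 hτ'r hx1 hx2 hut
        (by rw [hδu]; exact hδ1) (by rw [hδuu]; exact hδ0.ne')
    have hPin := hYc.subset_intrinsicInterior h.isClosed (by
      rintro _ ⟨x, hx, rfl⟩
      exact h.add_mem (h.side_subset_face k (hseg hx)) (Submodule.smul_mem _ _ huW)) hYd
      ⟨Q, left_mem_segment _ _ _, rfl⟩ (intrinsicInterior_subset hQin)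
      ⟨P, right_mem_segment _ _ _, rfl⟩
    refine (hsP (δ • u) (Submodule.smul_mem _ _ huW) ?_).2 ?_ (intrinsicInterior_subset hPin)
    · rw [hδu]
      exact hδ1.trans_le (div_le_div_of_nonneg_right (min_le_left _ _) (by linarith))
    · rw [inner_smul_left, hδuu]
      simpa using hδ0
  exact ⟨u, huW, hun, hut, hexp, hside, h.deep_of_sides huW hun hut hexp hside⟩

end NicePolygon

/-! ### The triangles over the sides -/

namespace NicePolygon

variable {r θ M : ℝ} {F : Set E3} {n : ℕ} {v : ZMod n → E3}

/-- One of the coordinates of a unit vector of the plane is at least `1 / √2 > 7 / 10`. -/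
theorem seven_tenths_le {a b y : ℝ} (h : 1 ^ 2 = a ^ 2 + b ^ 2) (ha : a ^ 2 ≤ y ^ 2)
    (hb : b ^ 2 ≤ y ^ 2) (hy : 0 ≤ y) : 7 / 10 ≤ y := by
  nlinarith

set_option maxHeartbeats 800000 in
/-- Walking along the boundary graph from a side to a nonadjacent one, the first coordinate
advances along the rest of the first side, a whole further side, and part of the last side.
In the frame `(p, q)` at the point `P` of the side `[a₁, a₀]`, the coordinate `p` increases from
`P` to `a₁`, then along the side `[a₁, a₂]`, and finally along a piece of length `τ'` of the side
`[b₀, b₁]` that ends at `Q`. Along each of the three pieces it grows at a rate of at least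
`7 / (10 * M)`. -/
theorem advance_along_graph (h : NicePolygon r θ M F n v) {P Q p q a₀ a₁ a₂ b₀ b₁ : E3}
    (hp1 : ‖p‖ = 1)
    (hexp : ∀ w ∈ (affineSpan ℝ F).direction, ‖w‖ ^ 2 = ⟪p, w⟫ ^ 2 + ⟪q, w⟫ ^ 2)
    (ha : ∀ x ∈ intrinsicFrontier ℝ F, ∀ y ∈ intrinsicFrontier ℝ F,
        |⟪p, x - P⟫| < r → |⟪q, x - P⟫| < 2 * M * r → |⟪p, y - P⟫| < r →
        |⟪q, y - P⟫| < 2 * M * r → |⟪q, x - y⟫| ≤ M * |⟪p, x - y⟫|)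
    (hq1 : ‖q‖ = 1) (h01 : r ≤ dist a₁ a₀) (h12 : r ≤ dist a₁ a₂) (hb01 : r ≤ dist b₀ b₁)
    (hs1 : segment ℝ a₁ a₀ ⊆ intrinsicFrontier ℝ F) (hs2 : segment ℝ a₁ a₂ ⊆ intrinsicFrontier ℝ F)
    (hs3 : segment ℝ b₀ b₁ ⊆ intrinsicFrontier ℝ F)
    (hang : unitDir a₁ a₂ ≠ unitDir a₁ a₀)
    (hP : P ∈ segment ℝ a₁ a₀) (hQ : Q ∈ segment ℝ b₀ b₁)
    (hQ1 : Q ∉ segment ℝ a₁ a₀) (hQ2 : Q ∈ segment ℝ a₁ a₂ → Q = a₂)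
    (hb : a₂ ∈ segment ℝ b₀ b₁ → a₂ = b₀ ∨ a₂ = b₁) {τ' : ℝ}
    (hτ'0 : τ' ≤ dist Q b₀) (hτ'1 : τ' ≤ dist Q b₁) (hPQ : dist Q P < r)
    (hc : 0 ≤ ⟪p, Q - P⟫) (hpt : ⟪p, unitDir a₁ a₀⟫ ≤ 0) :
    7 / 10 * (r + dist P a₁ + τ') ≤ M * dist Q P := by
  have hM := h.one_le
  have hr := h.r_pos
  have hM0 : 0 < M := by linarith
  have hr2 : r < 2 * M * r := by nlinarith
  have hr0 : 0 < 2 * M * r := hr.trans hr2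
  have hM2 : ∀ x, x < r → M * x < 2 * M * r := fun x hx => by nlinarith
  have hM4 : ∀ x y ε, x ≤ y → y < r → ε ≤ (r - y) / 2 → M * x + ε < 2 * M * r :=
    fun x y ε h1 h2 h3 => by nlinarith
  have hM5 : ∀ x y, x < r → y ≤ x → M * x + M * y < 2 * M * r := fun x y h1 h2 => by nlinarith
  have hne01 : a₁ ≠ a₀ := dist_pos.1 (hr.trans_le h01)
  have hne12 : a₁ ≠ a₂ := dist_pos.1 (hr.trans_le h12)
  have hneb : b₀ ≠ b₁ := dist_pos.1 (hr.trans_le hb01)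
  have hfW : ∀ {x y : E3}, x ∈ intrinsicFrontier ℝ F → y ∈ intrinsicFrontier ℝ F →
      x - y ∈ (affineSpan ℝ F).direction := fun hx hy =>
    h.sub_mem (h.frontier_subset hx) (h.frontier_subset hy)
  have hW : ∀ {x y : E3}, segment ℝ x y ⊆ intrinsicFrontier ℝ F →
      unitDir x y ∈ (affineSpan ℝ F).direction := fun hs =>
    Submodule.smul_mem _ _ (hfW (hs (right_mem_segment _ _ _)) (hs (left_mem_segment _ _ _)))
  -- points of the boundary in the box with the same first coordinate agree
  have hsep : ∀ x ∈ intrinsicFrontier ℝ F, ∀ y ∈ intrinsicFrontier ℝ F,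
        |⟪p, x - P⟫| < r → |⟪q, x - P⟫| < 2 * M * r → |⟪p, y - P⟫| < r →
        |⟪q, y - P⟫| < 2 * M * r → ⟪p, x - P⟫ = ⟪p, y - P⟫ → x = y := by
    intro x hx y hy h1 h2 h3 h4 h5
    have h6 := ha x hx y hy h1 h2 h3 h4
    have h7 : ⟪p, x - y⟫ = 0 := by
      rw [← sub_sub_sub_cancel_right x y P, inner_sub_right, h5, sub_self]
    rw [h7, abs_zero, mul_zero] at h6
    have h8 := hexp (x - y) (hfW hx hy)
    rw [h7, abs_nonpos_iff.1 h6] at h8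
    norm_num at h8
    exact sub_eq_zero.1 h8
  -- directions of sides that meet the box have bounded slope
  have hslope : ∀ d ∈ (affineSpan ℝ F).direction, ‖d‖ = 1 → ∀ z ∈ intrinsicFrontier ℝ F,
      |⟪p, z - P⟫| < r → |⟪q, z - P⟫| < 2 * M * r → ∀ δ : ℝ, δ ≠ 0 →
      z + δ • d ∈ intrinsicFrontier ℝ F → |⟪p, z + δ • d - P⟫| < r →
      |⟪q, z + δ • d - P⟫| < 2 * M * r →
      |⟪q, d⟫| ≤ M * |⟪p, d⟫| ∧ 7 / 10 ≤ M * |⟪p, d⟫| := by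
    intro d hd hdn z hz hz1 hz2 δ hδ hzd h3 h4
    have h5 := ha _ hzd z hz h3 h4 hz1 hz2
    rw [add_sub_cancel_left, inner_smul_right, inner_smul_right, abs_mul, abs_mul] at h5
    have h6 : |⟪q, d⟫| ≤ M * |⟪p, d⟫| := by
      refine le_of_mul_le_mul_left ?_ (abs_pos.2 hδ)
      linarith [mul_left_comm M |δ| |⟪p, d⟫|]
    have h7 := hexp d hd
    rw [hdn] at h7
    refine ⟨h6, ?_⟩
    have h8 : ⟪q, d⟫ ^ 2 ≤ (M * |⟪p, d⟫|) ^ 2 := by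
      rw [← sq_abs ⟪q, d⟫]; gcongr
    have h9 : ⟪p, d⟫ ^ 2 ≤ (M * |⟪p, d⟫|) ^ 2 := by
      rw [mul_pow, sq_abs]
      exact le_mul_of_one_le_left (sq_nonneg _) (one_le_pow₀ hM)
    exact seven_tenths_le h7 h9 h8 (mul_nonneg hM0.le (abs_nonneg _))
  have hbox : ∀ s : E3, ‖s‖ = 1 → ∀ x : E3, |⟪s, x - P⟫| ≤ dist x P := fun s hs x => by
    have := abs_real_inner_le_norm s (x - P)
    rwa [hs, one_mul, ← dist_eq_norm] at this
  obtain ⟨eP1, -, -⟩ := segment_param hne01 hP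
  set t := unitDir a₁ a₀ with ht
  set a := unitDir a₁ a₂ with hadef
  have htn : ‖t‖ = 1 := norm_unitDir hne01
  have han : ‖a‖ = 1 := norm_unitDir hne12
  set ρ := dist P a₁ with hρ
  have hρ0 : 0 ≤ ρ := dist_nonneg
  have hPb := hs1 hP
  have hmem1 : ∀ ε, 0 ≤ ε → ε ≤ r → a₁ + ε • t ∈ segment ℝ a₁ a₀ := fun ε h0 h1 =>
    (mem_segment_iff_unitDir hne01).2 ⟨ε, h0, h1.trans h01, rfl⟩
  set c := ⟪p, Q - P⟫ with hcdef
  have hcr : c ≤ dist Q P := (le_abs_self _).trans (hbox p hp1 Q)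
  have hQb := hs3 hQ
  have hQq : |⟪q, Q - P⟫| ≤ M * c := by
    have := ha Q hQb P hPb ((hbox p hp1 Q).trans_lt hPQ)
      ((hbox q hq1 Q).trans_lt (hPQ.trans hr2)) (by simpa using hr) (by simpa using hr0)
    rwa [abs_of_nonneg hc] at this
  -- slope of the first side
  have hst : |⟪q, t⟫| ≤ M * |⟪p, t⟫| ∧ 7 / 10 ≤ M * |⟪p, t⟫| := by
    have hPle : ρ ≤ dist a₁ a₀ := by
      have := (segment_param hne01 hP).2.2
      linarith [dist_nonneg (x := P) (y := a₀)]
    have key : ∀ δ : ℝ, |δ| = r / 2 → P + δ • t ∈ segment ℝ a₁ a₀ →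
        |⟪q, t⟫| ≤ M * |⟪p, t⟫| ∧ 7 / 10 ≤ M * |⟪p, t⟫| := by
      intro δ hδ hm
      have hd : dist (P + δ • t) P < r := by
        rw [dist_eq_norm, add_sub_cancel_left, norm_smul, htn, mul_one, Real.norm_eq_abs, hδ]
        linarith
      exact hslope t (hW hs1) htn P hPb (by simpa using hr) (by simpa using hr0) δ
        (by rintro rfl; simp at hδ; linarith) (hs1 hm) ((hbox p hp1 _).trans_lt hd)
        ((hbox q hq1 _).trans_lt (hd.trans hr2))
    rcases le_total (r / 2) ρ with h1 | h1
    · refine key (-(r / 2)) (by rw [abs_neg, abs_of_pos (by linarith)]) ?_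
      exact add_smul_unitDir_mem hne01 hP (by linarith) (by linarith [dist_nonneg (x := P) (y := a₀)])
    · refine key (r / 2) (by rw [abs_of_pos (by linarith)]) ?_
      have := (segment_param hne01 hP).2.2
      exact add_smul_unitDir_mem hne01 hP (by linarith) (by linarith)
  rw [abs_of_nonpos hpt] at hst
  set pt := -⟪p, t⟫ with hptdef
  have hpt0 : 0 < pt := by
    exact (mul_pos_iff_of_pos_left hM0).1 (by linarith [hst.2])
  -- coordinates of the first corner
  have hq_t : |⟪q, t⟫| ≤ M * pt := hst.1
  have hp_a1 : ∀ ε : ℝ, ⟪p, a₁ + ε • t - P⟫ = (ρ - ε) * pt := fun ε => by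
    have : a₁ + ε • t - P = (ε - ρ) • t := by
      calc a₁ + ε • t - P = a₁ + ε • t - (a₁ + ρ • t) := by rw [← eP1]
        _ = (ε - ρ) • t := by module
    rw [this, inner_smul_right, hptdef]; ring
  have hq_a1 : ∀ ε : ℝ, |⟪q, a₁ + ε • t - P⟫| ≤ |ρ - ε| * (M * pt) := fun ε => by
    have : a₁ + ε • t - P = (ε - ρ) • t := by
      calc a₁ + ε • t - P = a₁ + ε • t - (a₁ + ρ • t) := by rw [← eP1]
        _ = (ε - ρ) • t := by module
    rw [this, inner_smul_right, abs_mul, abs_sub_comm]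
    gcongr
  -- otherwise `Q` has the same first coordinate as a point between `P` and `a₁`
  have hlt1 : ρ * pt < c := by
    by_contra hcon
    push Not at hcon
    have he0 : 0 ≤ c / pt := by positivity
    have he1 : c / pt ≤ ρ := by rw [div_le_iff₀ hpt0]; exact hcon
    have hmul : c / pt * pt = c := div_mul_cancel₀ _ hpt0.ne'
    have hz : a₁ + (ρ - c / pt) • t ∈ segment ℝ a₁ a₀ :=
      (mem_segment_iff_unitDir hne01).2 ⟨_, by linarith, by
        have := (segment_param hne01 hP).2.2
        linarith [dist_nonneg (x := P) (y := a₀)], rfl⟩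
    have e1 : ⟪p, a₁ + (ρ - c / pt) • t - P⟫ = c := by
      rw [hp_a1, sub_sub_cancel, hmul]
    have e2 := hq_a1 (ρ - c / pt)
    rw [sub_sub_cancel, abs_of_nonneg he0] at e2
    have e3 : c / pt * (M * pt) = M * c := by rw [mul_left_comm, hmul]
    refine hQ1 ?_
    rw [hsep Q hQb _ (hs1 hz) ((hbox p hp1 Q).trans_lt hPQ)
      ((hbox q hq1 Q).trans_lt (hPQ.trans hr2)) (by rw [e1, abs_of_nonneg hc]; linarith)
      ((e2.trans_eq e3).trans_lt (hM2 c (by linarith))) (by rw [e1])]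
    exact hz
  set s₁ := ρ * pt with hs₁
  have hs₁0 : 0 ≤ s₁ := by positivity
  have hp_a0 : ⟪p, a₁ - P⟫ = s₁ := by have := hp_a1 0; simpa using this
  have hq_a0 : |⟪q, a₁ - P⟫| ≤ M * s₁ := by
    have := hq_a1 0
    rw [zero_smul, add_zero, sub_zero, abs_of_nonneg hρ0] at this
    calc _ ≤ _ := this
      _ = _ := by rw [hs₁]; ring
  have ha1b : a₁ ∈ intrinsicFrontier ℝ F := hs1 (left_mem_segment _ _ _)
  have hmem2 : ∀ ε, 0 ≤ ε → ε ≤ dist a₁ a₂ → a₁ + ε • a ∈ segment ℝ a₁ a₂ := fun ε h0 h1 =>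
    (mem_segment_iff_unitDir hne12).2 ⟨ε, h0, h1, rfl⟩
  -- a short step from the first corner along a side stays in the box
  have hstep : ∀ d : E3, ‖d‖ = 1 → ∀ ε : ℝ, 0 ≤ ε → ε ≤ (r - c) / 2 →
      |⟪p, a₁ + ε • d - P⟫| < r ∧ |⟪q, a₁ + ε • d - P⟫| < 2 * M * r := by
    intro d hd ε h0 h1
    have e : a₁ + ε • d - P = (a₁ - P) + ε • d := by abel
    have hpd : |⟪p, ε • d⟫| ≤ ε := by
      have := abs_real_inner_le_norm p (ε • d)
      rwa [hp1, norm_smul, hd, one_mul, mul_one, Real.norm_of_nonneg h0] at this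
    have hqd : |⟪q, ε • d⟫| ≤ ε := by
      have := abs_real_inner_le_norm q (ε • d)
      rwa [hq1, norm_smul, hd, one_mul, mul_one, Real.norm_of_nonneg h0] at this
    rw [e, inner_add_right, inner_add_right, hp_a0]
    constructor
    · refine (abs_add_le _ _).trans_lt ?_
      rw [abs_of_nonneg hs₁0]; linarith
    · exact (abs_add_le _ _).trans_lt ((add_le_add hq_a0 hqd).trans_lt
        (hM4 s₁ c ε hlt1.le (by linarith) h1))
  have hrc : 0 < (r - c) / 2 := by linarith
  have hsa : |⟪q, a⟫| ≤ M * |⟪p, a⟫| ∧ 7 / 10 ≤ M * |⟪p, a⟫| := by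
    obtain ⟨g1, g2⟩ := hstep a han _ hrc.le le_rfl
    exact hslope a (hW hs2) han a₁ ha1b (by rw [hp_a0, abs_of_nonneg hs₁0]; linarith)
      (hq_a0.trans_lt (hM2 s₁ (by linarith))) _ hrc.ne' (hs2 (hmem2 _ hrc.le (by linarith))) g1 g2
  -- the first coordinate keeps increasing beyond the corner
  have hpa0 : 0 < ⟪p, a⟫ := by
    by_contra hcon
    push Not at hcon
    rw [abs_of_nonpos hcon] at hsa
    set pa := -⟪p, a⟫ with hpa
    have hpa' : 0 < pa := by
      exact (mul_pos_iff_of_pos_left hM0).1 (by linarith [hsa.2])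
    -- the two sides at the corner would overlap
    set δ := (r - c) / 2 with hδ
    have hpa1 : pa ≤ 1 := by
      have := abs_real_inner_le_norm p a
      rw [hp1, han, one_mul] at this
      have h3 := neg_le_abs ⟪p, a⟫
      linarith
    have hpt1 : pt ≤ 1 := by
      have := abs_real_inner_le_norm p t
      rw [hp1, htn, one_mul] at this
      have h3 := neg_le_abs ⟪p, t⟫
      linarith
    have hε1 : 0 ≤ δ * pt := by positivity
    have hε2 : 0 ≤ δ * pa := by positivity
    obtain ⟨g1, g2⟩ := hstep a han (δ * pt) hε1 (mul_le_of_le_one_right hrc.le hpt1)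
    obtain ⟨g3, g4⟩ := hstep t htn (δ * pa) hε2 (mul_le_of_le_one_right hrc.le hpa1)
    have heq := hsep _ (hs2 (hmem2 (δ * pt) hε1
      ((mul_le_of_le_one_right hrc.le hpt1).trans (by linarith)))) _
      (hs1 (hmem1 (δ * pa) hε2
        ((mul_le_of_le_one_right hrc.le hpa1).trans (by linarith)))) g1 g2 g3 g4 (by
        rw [hp_a1]
        have : a₁ + (δ * pt) • a - P = (a₁ - P) + (δ * pt) • a := by abel
        rw [this, inner_add_right, hp_a0, inner_smul_right, hs₁]
        have : ⟪p, a⟫ = -pa := by rw [hpa]; ring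
        rw [this]; ring)
    have heq' := add_left_cancel heq
    have hn := congrArg norm heq'
    rw [norm_smul, norm_smul, han, htn, mul_one, mul_one, Real.norm_of_nonneg hε1,
      Real.norm_of_nonneg hε2] at hn
    rw [hn] at heq'
    exact hang (smul_right_injective E3 (mul_pos hrc hpa').ne' heq')
  rw [abs_of_pos hpa0] at hsa
  set pa := ⟪p, a⟫ with hpa
  have hp_a : ∀ ε : ℝ, ⟪p, a₁ + ε • a - P⟫ = s₁ + ε * pa := fun ε => by
    have : a₁ + ε • a - P = (a₁ - P) + ε • a := by abel
    rw [this, inner_add_right, hp_a0, inner_smul_right]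
  have hq_a : ∀ ε : ℝ, 0 ≤ ε → |⟪q, a₁ + ε • a - P⟫| ≤ M * (s₁ + ε * pa) := fun ε h0 => by
    have : a₁ + ε • a - P = (a₁ - P) + ε • a := by abel
    rw [this, inner_add_right, inner_smul_right]
    refine (abs_add_le _ _).trans ?_
    rw [abs_mul, abs_of_nonneg h0]
    have e1 := mul_le_mul_of_nonneg_left hsa.1 h0
    have e2 : M * (s₁ + ε * pa) = M * s₁ + ε * (M * pa) := by ring
    linarith
  set ℓ := dist a₁ a₂ with hℓ
  -- otherwise `Q` has the same first coordinate as a point of the second side other than `a₂`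
  have hle2 : s₁ + ℓ * pa ≤ c := by
    by_contra hcon
    push Not at hcon
    set ε := (c - s₁) / pa with hε
    have hε0 : 0 ≤ ε := div_nonneg (by linarith) hpa0.le
    have hε1 : ε < ℓ := by rw [hε, div_lt_iff₀ hpa0]; linarith
    have hεm : ε * pa = c - s₁ := div_mul_cancel₀ _ hpa0.ne'
    have e1 : ⟪p, a₁ + ε • a - P⟫ = c := by rw [hp_a, hεm]; ring
    have e2 := hq_a ε hε0
    rw [hεm, add_sub_cancel] at e2
    have hz := hmem2 ε hε0 hε1.le
    have hQz := hsep Q hQb _ (hs2 hz) ((hbox p hp1 Q).trans_lt hPQ)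
      ((hbox q hq1 Q).trans_lt (hPQ.trans hr2)) (by rw [e1, abs_of_nonneg hc]; linarith)
      (e2.trans_lt (hM2 c (by linarith))) (by rw [e1])
    have hQa := hQ2 (hQz ▸ hz)
    have : dist Q a₁ = ε := by
      rw [hQz, dist_eq_norm, add_sub_cancel_left, norm_smul, han, mul_one, Real.norm_of_nonneg hε0]
    rw [hQa, dist_comm] at this
    linarith
  have ha2 : a₂ = a₁ + ℓ • a := by rw [dist_smul_unitDir hne12]; abel
  have hp_a2 : ⟪p, a₂ - P⟫ = s₁ + ℓ * pa := by rw [ha2, hp_a]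
  have hq_a2 : |⟪q, a₂ - P⟫| ≤ M * (s₁ + ℓ * pa) := by rw [ha2]; exact hq_a ℓ dist_nonneg
  set s₂ := s₁ + ℓ * pa with hs₂
  have hs₂0 : 0 ≤ s₂ := by positivity
  -- the last side, followed towards the first one
  have hlast : ∀ d : E3, ‖d‖ = 1 → d ∈ (affineSpan ℝ F).direction →
      (∀ ε : ℝ, |ε| ≤ τ' → Q + ε • d ∈ segment ℝ b₀ b₁) →
      (∃ δ : ℝ, |δ| = min (r / 2) ((r - dist Q P) / 2) ∧ Q + δ • d ∈ segment ℝ b₀ b₁) →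
      ⟪p, d⟫ ≤ 0 → 7 / 10 ≤ M * (-⟪p, d⟫) ∧ s₂ ≤ c - τ' * (-⟪p, d⟫) := by
    intro d hd hdW hmemd ⟨δ, hδ, hδm⟩ hpd
    have hδ0 : 0 < |δ| := by rw [hδ]; exact lt_min (by linarith) (by linarith)
    have hδ1 : |δ| ≤ (r - dist Q P) / 2 := by rw [hδ]; exact min_le_right _ _
    have hdist : dist (Q + δ • d) P < r := by
      calc dist (Q + δ • d) P ≤ dist (Q + δ • d) Q + dist Q P := dist_triangle _ _ _
        _ = |δ| + dist Q P := by
          rw [dist_eq_norm, add_sub_cancel_left, norm_smul, hd, mul_one, Real.norm_eq_abs]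
        _ < r := by linarith
    have hsd := hslope d hdW hd Q hQb ((hbox p hp1 Q).trans_lt hPQ)
      ((hbox q hq1 Q).trans_lt (hPQ.trans hr2)) δ (abs_pos.1 hδ0) (hs3 hδm)
      ((hbox p hp1 _).trans_lt hdist) ((hbox q hq1 _).trans_lt (hdist.trans hr2))
    rw [abs_of_nonpos hpd] at hsd
    set pd := -⟪p, d⟫ with hpddef
    have hpd0 : 0 < pd := by
      exact (mul_pos_iff_of_pos_left hM0).1 (by linarith [hsd.2])
    refine ⟨hsd.2, ?_⟩
    by_contra hcon
    push Not at hcon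
    set ε := (c - s₂) / pd with hε
    have hε0 : 0 ≤ ε := div_nonneg (by linarith) hpd0.le
    have hε1 : ε < τ' := by rw [hε, div_lt_iff₀ hpd0]; linarith
    have hεm : ε * pd = c - s₂ := div_mul_cancel₀ _ hpd0.ne'
    have hz := hmemd ε (by rw [abs_of_nonneg hε0]; exact hε1.le)
    have e0 : Q + ε • d - P = (Q - P) + ε • d := by abel
    have e1 : ⟪p, Q + ε • d - P⟫ = s₂ := by
      rw [e0, inner_add_right, inner_smul_right]
      have : ⟪p, d⟫ = -pd := by rw [hpddef]; ring
      rw [this, mul_neg, hεm]; ring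
    have e2 : |⟪q, Q + ε • d - P⟫| ≤ M * c + ε * (M * pd) := by
      rw [e0, inner_add_right, inner_smul_right]
      refine (abs_add_le _ _).trans ?_
      rw [abs_mul, abs_of_nonneg hε0]
      gcongr
      exact hsd.1
    have e3 : ε * (M * pd) = M * (c - s₂) := by rw [mul_left_comm, hεm]
    have ha2z := hsep a₂ (hs2 (right_mem_segment _ _ _)) _ (hs3 hz)
      (by rw [hp_a2, abs_of_nonneg hs₂0]; linarith) (hq_a2.trans_lt (hM2 s₂ (by linarith)))
      (by rw [e1, abs_of_nonneg hs₂0]; linarith)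
      ((e2.trans_eq (by rw [e3])).trans_lt (hM5 c _ (by linarith) (by linarith))) (by rw [hp_a2, e1])
    have hdQ : dist Q a₂ = ε := by
      rw [ha2z, dist_comm, dist_eq_norm, add_sub_cancel_left, norm_smul, hd, mul_one,
        Real.norm_of_nonneg hε0]
    rcases hb (ha2z ▸ hz) with h3 | h3
    · rw [h3] at hdQ; linarith
    · rw [h3] at hdQ; linarith
  have hMc : M * c ≤ M * dist Q P := by gcongr
  -- the three increments of the first coordinate add up to at most `c`, the coordinate of `Q`
  have hfin : ∀ w : ℝ, 7 / 10 ≤ M * w → s₂ ≤ c - τ' * w →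
      7 / 10 * (r + ρ + τ') ≤ M * dist Q P := by
    intro w hw1 hw2
    have g2 : 7 / 10 * ρ ≤ M * (ρ * pt) := by
      have := mul_le_mul_of_nonneg_left hst.2 hρ0
      linarith [mul_left_comm M ρ pt]
    have g3 : 7 / 10 * r ≤ M * (ℓ * pa) := by
      have := mul_le_mul_of_nonneg_left hsa.2 (hr.le.trans h12)
      linarith [mul_left_comm M ℓ pa]
    rcases le_total 0 τ' with hτ' | hτ'
    · have g1 := mul_le_mul_of_nonneg_left (show ρ * pt + ℓ * pa + τ' * w ≤ c by linarith) hM0.le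
      rw [mul_add, mul_add] at g1
      have g4 : 7 / 10 * τ' ≤ M * (τ' * w) := by
        have := mul_le_mul_of_nonneg_left hw1 hτ'
        linarith [mul_left_comm M τ' w]
      linarith
    · have g1 := mul_le_mul_of_nonneg_left hle2 hM0.le
      rw [hs₂, mul_add] at g1
      linarith
  set d := unitDir b₀ b₁ with hd
  have hdn : ‖d‖ = 1 := norm_unitDir hneb
  have hmemd : ∀ ε : ℝ, |ε| ≤ τ' → Q + ε • d ∈ segment ℝ b₀ b₁ := fun ε hε =>
    abs_le_add_smul_unitDir_mem hneb hQ hτ'0 hτ'1 hε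
  have hex : ∃ δ : ℝ, |δ| = min (r / 2) ((r - dist Q P) / 2) ∧ Q + δ • d ∈ segment ℝ b₀ b₁ := by
    have hδ0 : 0 < min (r / 2) ((r - dist Q P) / 2) := lt_min (by linarith) (by linarith)
    have hδ1 : min (r / 2) ((r - dist Q P) / 2) ≤ r / 2 := min_le_left _ _
    have h3 := (segment_param hneb hQ).2.2
    rcases le_total (r / 2) (dist Q b₀) with h1 | h1
    · exact ⟨-min (r / 2) ((r - dist Q P) / 2), by rw [abs_neg, abs_of_pos hδ0],
        add_smul_unitDir_mem hneb hQ (by linarith) (by linarith [dist_nonneg (x := Q) (y := b₁)])⟩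
    · exact ⟨min (r / 2) ((r - dist Q P) / 2), by rw [abs_of_pos hδ0],
        add_smul_unitDir_mem hneb hQ (by linarith [dist_nonneg (x := Q) (y := b₀)]) (by linarith)⟩
  -- orient the last side so that the first coordinate decreases
  rcases le_total ⟪p, d⟫ 0 with h3 | h3
  · obtain ⟨g1, g2⟩ := hlast d hdn (hW hs3) hmemd hex h3
    exact hfin _ g1 g2
  · obtain ⟨g1, g2⟩ := hlast (-d) (by rwa [norm_neg]) (Submodule.neg_mem _ (hW hs3))
      (fun ε hε => by rw [smul_neg, ← neg_smul]; exact hmemd (-ε) (by rwa [abs_neg]))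
      (by obtain ⟨δ, h4, h5⟩ := hex
          exact ⟨-δ, by rwa [abs_neg], by rwa [smul_neg, ← neg_smul, neg_neg]⟩)
      (by rw [inner_neg_right]; linarith)
    exact hfin _ g1 g2

end NicePolygon

/-- The slope of the legs of the triangles over the sides of length `r`; over longer sides the legs
are flatter. -/
noncomputable def baseSlope (θ M : ℝ) : ℝ :=
  Real.tan (min (θ / 3) (Real.pi / 2 - Real.arctan M))

section BaseSlope

variable {θ M : ℝ}

theorem baseAngle_pos (hθ : 0 < θ) : 0 < min (θ / 3) (Real.pi / 2 - Real.arctan M) :=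
  lt_min (by linarith) (by linarith [Real.arctan_lt_pi_div_two M])

theorem baseAngle_lt (hθ' : θ < Real.pi / 2) :
    min (θ / 3) (Real.pi / 2 - Real.arctan M) < Real.pi / 6 :=
  (min_le_left _ _).trans_lt (by linarith)

theorem baseSlope_pos (hθ : 0 < θ) (hθ' : θ < Real.pi / 2) : 0 < baseSlope θ M :=
  Real.tan_pos_of_pos_of_lt_pi_div_two (baseAngle_pos hθ)
    (by linarith [baseAngle_lt (M := M) hθ', Real.pi_pos])

theorem mul_baseSlope_le (hθ : 0 < θ) (hM : 1 ≤ M) : M * baseSlope θ M ≤ 1 := by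
  have hM0 : 0 < M := by linarith
  have ha : 0 < Real.arctan M := by
    rw [← Real.arctan_zero]; exact Real.arctan_strictMono hM0
  have h1 : baseSlope θ M ≤ Real.tan (Real.pi / 2 - Real.arctan M) := by
    refine Real.strictMonoOn_tan.monotoneOn ⟨?_, ?_⟩ ⟨?_, ?_⟩ (min_le_right _ _)
    · linarith [baseAngle_pos (M := M) hθ, Real.pi_pos]
    · exact (min_le_right _ _).trans_lt (by linarith)
    · linarith [Real.arctan_lt_pi_div_two M, Real.pi_pos]
    · linarith
  rw [Real.tan_pi_div_two_sub, Real.tan_arctan] at h1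
  calc M * baseSlope θ M ≤ M * M⁻¹ := by gcongr
    _ = 1 := mul_inv_cancel₀ hM0.ne'

theorem baseSlope_le (hθ : 0 < θ) (hθ' : θ < Real.pi / 2) : baseSlope θ M ≤ 3 / 5 := by
  have h1 : baseSlope θ M ≤ Real.tan (Real.pi / 6) := by
    refine Real.strictMonoOn_tan.monotoneOn ⟨?_, ?_⟩ ⟨?_, ?_⟩ (baseAngle_lt hθ').le <;>
    linarith [baseAngle_pos (M := M) hθ, Real.pi_pos, baseAngle_lt (M := M) hθ']
  rw [Real.tan_pi_div_six] at h1
  refine h1.trans ?_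
  have h3 : (5 : ℝ) / 3 ≤ √3 := Real.le_sqrt_of_sq_le (by norm_num)
  rw [div_le_iff₀ (by positivity)]
  linarith

end BaseSlope

/-- A plane neighbourhood, on the side of `u`, of the segment from `a` to `b` that contains the
isosceles triangle of height `m * (r / 2)`. -/
def sideTriangle (r m : ℝ) (a b u : E3) : Set E3 :=
  {x | ∃ α β : ℝ, x = a + α • unitDir a b + β • u ∧ 0 ≤ β ∧ β ≤ m * α ∧ β ≤ m * (dist a b - α) ∧
    β ≤ m * (r / 2)}

theorem convex_sideTriangle (r m : ℝ) (a b u : E3) : Convex ℝ (sideTriangle r m a b u) := by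
  rintro _ ⟨α, β, rfl, h1, h2, h3, h4⟩ _ ⟨α', β', rfl, h1', h2', h3', h4'⟩ s t hs ht hst
  refine ⟨s * α + t * α', s * β + t * β', ?_, by positivity, by nlinarith, ?_, ?_⟩
  · have : a = s • a + t • a := by rw [← add_smul, hst, one_smul]
    nth_rewrite 5 [this]
    module
  · have e1 := mul_le_mul_of_nonneg_left h3 hs
    have e2 := mul_le_mul_of_nonneg_left h3' ht
    calc _ ≤ _ := add_le_add e1 e2
      _ = m * ((s + t) * dist a b - (s * α + t * α')) := by ring
      _ = _ := by rw [hst, one_mul]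
  · have e1 := mul_le_mul_of_nonneg_left h4 hs
    have e2 := mul_le_mul_of_nonneg_left h4' ht
    calc _ ≤ _ := add_le_add e1 e2
      _ = (s + t) * (m * (r / 2)) := by ring
      _ = _ := by rw [hst, one_mul]

theorem segment_subset_sideTriangle {r m : ℝ} (hr : 0 ≤ r) (hm : 0 ≤ m) {a b : E3} (hab : a ≠ b)
    (u : E3) : segment ℝ a b ⊆ sideTriangle r m a b u := by
  intro x hx
  obtain ⟨α, h0, h1, rfl⟩ := (mem_segment_iff_unitDir hab).1 hx
  exact ⟨α, 0, by simp, le_rfl, by positivity, mul_nonneg hm (by linarith), by positivity⟩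

theorem convexHull_subset_sideTriangle {r m : ℝ} (hr : 0 ≤ r) (hm : 0 ≤ m) {a b : E3}
    (hab : a ≠ b) (hlen : r ≤ dist a b) (u : E3) :
    convexHull ℝ {a, b, midpoint ℝ a b + (m * (r / 2)) • u} ⊆ sideTriangle r m a b u := by
  refine convexHull_min ?_ (convex_sideTriangle _ _ _ _ _)
  have hs := segment_subset_sideTriangle hr hm hab u
  rintro x (rfl | rfl | rfl)
  · exact hs (left_mem_segment _ _ _)
  · exact hs (right_mem_segment _ _ _)
  · refine ⟨dist a b / 2, m * (r / 2), ?_, by positivity, by gcongr, ?_, le_rfl⟩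
    · have : (dist a b / 2) • unitDir a b = (2⁻¹ : ℝ) • (b - a) := by
        rw [← dist_smul_unitDir hab, smul_smul]; ring_nf
      rw [this, midpoint_eq_smul_add]
      simp only [invOf_eq_inv]
      module
    · have : dist a b - dist a b / 2 = dist a b / 2 := by ring
      rw [this]; gcongr

namespace NicePolygon

variable {r θ M : ℝ} {F : Set E3} {n : ℕ} {v : ZMod n → E3}

/-- The sides at a corner do not overlap, since their directions are transversal. -/
theorem unitDir_ne (h : NicePolygon r θ M F n v) (k : ZMod n) :
    unitDir (v k) (v (k + 1)) ≠ unitDir (v k) (v (k - 1)) := by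
  intro he
  have h3 := h.abs_inner_unitDir_le k
  rw [he, real_inner_self_eq_norm_sq, norm_unitDir (h.prev_ne k)] at h3
  have := h.cos_lt_one
  norm_num at h3
  linarith

theorem common_corner (h : NicePolygon r θ M F n v) {k l : ZMod n} (hkl : k ≠ l) {x : E3}
    (hk : x ∈ segment ℝ (v k) (v (k + 1))) (hl : x ∈ segment ℝ (v l) (v (l + 1))) :
    ∃ i, x = v i ∧ (i = k ∨ i = k + 1) ∧ (i = l ∨ i = l + 1) := by
  obtain ⟨h1, h2⟩ := h.region.simple k l hkl ⟨hk, hl⟩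
  have hinj := h.region.corners_injective
  rcases h1 with rfl | rfl
  · exact ⟨k, rfl, Or.inl rfl, by rcases h2 with h2 | h2; exacts [Or.inl (hinj h2), Or.inr (hinj h2)]⟩
  · exact ⟨k + 1, rfl, Or.inr rfl, by
      rcases h2 with h2 | h2; exacts [Or.inl (hinj h2), Or.inr (hinj h2)]⟩

/-- Between points of two nonadjacent sides the boundary runs along a whole further side, so the
Lipschitz bound separates the points. -/
theorem dist_nonadjacent_of_depth (h : NicePolygon r θ M F n v) {k m : ZMod n} (h0 : m ≠ k)
    (h1 : m ≠ k + 1) (h2 : m ≠ k - 1) {P Q : E3} (hP : P ∈ segment ℝ (v k) (v (k + 1)))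
    (hQ : Q ∈ segment ℝ (v m) (v (m + 1))) {τ τ' : ℝ} (hτ0 : τ ≤ dist P (v k))
    (hτ1 : τ ≤ dist P (v (k + 1))) (hτ'0 : τ' ≤ dist Q (v m)) (hτ'1 : τ' ≤ dist Q (v (m + 1)))
    (hPQ : dist Q P < r) : 7 / 10 * (r + τ + τ') ≤ M * dist Q P := by
  obtain ⟨p₀, q, hp, hq, hp1₀, hq1, hpq, hexp₀, ha₀, -, -⟩ := h.exists_frame (h.side_subset k hP)
  have hsq : ∀ w ∈ (affineSpan ℝ F).direction, ‖w‖ ^ 2 = ⟪p₀, w⟫ ^ 2 + ⟪q, w⟫ ^ 2 := by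
    intro w hw
    have e1 := hexp₀ w hw
    rw [← real_inner_self_eq_norm_sq]
    nth_rewrite 1 [e1]
    rw [inner_add_left, inner_smul_left, inner_smul_left]
    simp only [conj_trivial]
    ring
  -- orient the frame so that `Q` lies in the direction of increasing first coordinate
  obtain ⟨p, hp1, hexp, ha, hc⟩ : ∃ p : E3, ‖p‖ = 1 ∧
      (∀ w ∈ (affineSpan ℝ F).direction, ‖w‖ ^ 2 = ⟪p, w⟫ ^ 2 + ⟪q, w⟫ ^ 2) ∧
      (∀ x ∈ intrinsicFrontier ℝ F, ∀ y ∈ intrinsicFrontier ℝ F,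
        |⟪p, x - P⟫| < r → |⟪q, x - P⟫| < 2 * M * r → |⟪p, y - P⟫| < r →
        |⟪q, y - P⟫| < 2 * M * r → |⟪q, x - y⟫| ≤ M * |⟪p, x - y⟫|) ∧ 0 ≤ ⟪p, Q - P⟫ := by
    rcases le_total 0 ⟪p₀, Q - P⟫ with h3 | h3
    · exact ⟨p₀, hp1₀, hsq, ha₀, h3⟩
    · refine ⟨-p₀, by rwa [norm_neg], fun w hw => by rw [inner_neg_left, neg_sq]; exact hsq w hw,
        ?_, by rw [inner_neg_left]; linarith⟩
      simpa only [inner_neg_left, abs_neg] using ha₀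
  have hcc := fun (l : ZMod n) (hl : m ≠ l) (hQl : Q ∈ segment ℝ (v l) (v (l + 1))) =>
    h.common_corner hl hQ hQl
  have hQk : Q ∉ segment ℝ (v k) (v (k + 1)) := by
    intro hQk
    obtain ⟨i, -, rfl | rfl, h4 | h4⟩ := hcc k h0 hQk
    · exact h0 h4
    · exact h1 h4
    · exact h2 (by rw [← h4]; ring)
    · exact h0 (add_right_cancel h4)
  have hlenm := h.len m
  -- the walk leaves the side through the end at which the first coordinate is larger
  rcases le_total ⟪p, unitDir (v (k + 1)) (v k)⟫ 0 with h3 | h3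
  · have := h.advance_along_graph hp1 hexp ha hq1 (a₀ := v k) (a₁ := v (k + 1))
      (a₂ := v (k + 1 + 1)) (by rw [dist_comm]; exact h.len k) (h.len (k + 1)) hlenm
      (by rw [segment_symm]; exact h.side_subset k) (h.side_subset (k + 1)) (h.side_subset m)
      (by have := h.unitDir_ne (k + 1); rwa [add_sub_cancel_right] at this)
      (by rwa [segment_symm]) hQ (by rwa [segment_symm])
      (fun hQl => by
        obtain ⟨i, hi, rfl | rfl, h4 | h4⟩ := hcc (k + 1) h1 hQl
        · exact absurd h4 h1
        · rw [hi, ← h4]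
        · exact absurd (add_right_cancel h4) h0
        · exact absurd (add_right_cancel h4) h1)
      (fun hb => by
        rcases h.corner_mem_side hb with h4 | h4
        · exact Or.inl (by rw [h4])
        · exact Or.inr (by rw [h4])) hτ'0 hτ'1 hPQ hc h3
    linarith
  · have hneg : ⟪p, unitDir (v k) (v (k + 1))⟫ ≤ 0 := by
      rw [unitDir_swap, inner_neg_right]; linarith
    have := h.advance_along_graph hp1 hexp ha hq1 (a₀ := v (k + 1)) (a₁ := v k)
      (a₂ := v (k - 1)) (h.len k) (h.prev_len k) hlenm
      (h.side_subset k) (h.prev_side_subset k) (h.side_subset m) (h.unitDir_ne k).symm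
      hP hQ hQk
      (fun hQl => by
        rw [h.prev_mem_iff] at hQl
        obtain ⟨i, hi, rfl | rfl, h4 | h4⟩ := hcc (k - 1) h2 hQl
        · exact absurd h4 h2
        · rw [sub_add_cancel] at h4; exact absurd h4 h0
        · rw [hi, ← h4]
        · rw [sub_add_cancel] at h4
          exact absurd (by rw [← h4]; ring) h2)
      (fun hb => by
        rcases h.corner_mem_side hb with h4 | h4
        · exact Or.inl (by rw [h4])
        · exact Or.inr (by rw [h4])) hτ'0 hτ'1 hPQ hc hneg
    linarith

/-- The depths of the two points are at most `1 / M` times the distances of their feet `P` and `Q`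
from the corners, so they do not use up the distance between `P` and `Q`. -/
theorem dist_sideTriangle_nonadjacent (h : NicePolygon r θ M F n v) {k m : ZMod n} (h0 : m ≠ k)
    (h1 : m ≠ k + 1) (h2 : m ≠ k - 1) {u u' x y : E3} (hu : ‖u‖ = 1) (hu' : ‖u'‖ = 1)
    (hx : x ∈ sideTriangle r (baseSlope θ M) (v k) (v (k + 1)) u)
    (hy : y ∈ sideTriangle r (baseSlope θ M) (v m) (v (m + 1)) u') :
    2 * r / (5 * M) ≤ dist y x := by
  have hM := h.one_le
  have hr := h.r_pos
  have hs0 := baseSlope_pos (M := M) h.θ_pos h.θ_lt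
  have hs1 := mul_baseSlope_le h.θ_pos hM
  have hs2 := baseSlope_le (M := M) h.θ_pos h.θ_lt
  obtain ⟨α, β, hxe, hβ0, hβ1, hβ2, hβ3⟩ := hx
  obtain ⟨α', β', hye, hβ0', hβ1', hβ2', hβ3'⟩ := hy
  set s := baseSlope θ M
  -- the constraints on the depth place the foot of the normal on the side
  have hα0 : 0 ≤ α := by
    by_contra hc; push Not at hc; nlinarith
  have hα1 : α ≤ dist (v k) (v (k + 1)) := by
    by_contra hc; push Not at hc; nlinarith
  have hα0' : 0 ≤ α' := by
    by_contra hc; push Not at hc; nlinarith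
  have hα1' : α' ≤ dist (v m) (v (m + 1)) := by
    by_contra hc; push Not at hc; nlinarith
  set P := v k + α • unitDir (v k) (v (k + 1)) with hPdef
  set Q := v m + α' • unitDir (v m) (v (m + 1)) with hQdef
  have hP : P ∈ segment ℝ (v k) (v (k + 1)) :=
    (mem_segment_iff_unitDir (h.corner_ne k)).2 ⟨α, hα0, hα1, rfl⟩
  have hQ : Q ∈ segment ℝ (v m) (v (m + 1)) :=
    (mem_segment_iff_unitDir (h.corner_ne m)).2 ⟨α', hα0', hα1', rfl⟩
  have hPd : dist P (v k) = α := by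
    rw [dist_eq_norm, hPdef, add_sub_cancel_left, norm_smul, norm_unitDir (h.corner_ne k), mul_one,
      Real.norm_of_nonneg hα0]
  have hQd : dist Q (v m) = α' := by
    rw [dist_eq_norm, hQdef, add_sub_cancel_left, norm_smul, norm_unitDir (h.corner_ne m), mul_one,
      Real.norm_of_nonneg hα0']
  have hPd2 := (segment_param (h.corner_ne k) hP).2.2
  have hQd2 := (segment_param (h.corner_ne m) hQ).2.2
  set τ := min α (dist (v k) (v (k + 1)) - α) with hτ
  set τ' := min α' (dist (v m) (v (m + 1)) - α') with hτ'
  have hβτ : β ≤ s * τ := by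
    rcases min_choice α (dist (v k) (v (k + 1)) - α) with h3 | h3 <;> rw [hτ, h3] <;> assumption
  have hβτ' : β' ≤ s * τ' := by
    rcases min_choice α' (dist (v m) (v (m + 1)) - α') with h3 | h3 <;> rw [hτ', h3] <;> assumption
  have hdist : dist Q P ≤ dist y x + β + β' := by
    have e1 : dist P x = β := by
      rw [dist_comm, dist_eq_norm, hxe, add_sub_cancel_left, norm_smul, hu, mul_one,
        Real.norm_of_nonneg hβ0]
    have e2 : dist Q y = β' := by
      rw [dist_comm, dist_eq_norm, hye, add_sub_cancel_left, norm_smul, hu', mul_one,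
        Real.norm_of_nonneg hβ0']
    calc dist Q P ≤ dist Q y + dist y x + dist x P := dist_triangle4 _ _ _ _
      _ = _ := by rw [e2, dist_comm x P, e1]; ring
  have hτ0 : 0 ≤ τ := le_min hα0 (by linarith)
  have hτ0' : 0 ≤ τ' := le_min hα0' (by linarith)
  have hMβ : M * β ≤ τ := by
    calc M * β ≤ M * (s * τ) := by gcongr
      _ = (M * s) * τ := by ring
      _ ≤ 1 * τ := by gcongr
      _ = τ := one_mul _
  have hMβ' : M * β' ≤ τ' := by
    calc M * β' ≤ M * (s * τ') := by gcongr
      _ = (M * s) * τ' := by ring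
      _ ≤ 1 * τ' := by gcongr
      _ = τ' := one_mul _
  have hMr : ∀ b, b ≤ s * (r / 2) → M * b ≤ r / 2 := fun b hb => by
    calc M * b ≤ M * (s * (r / 2)) := by gcongr
      _ = (M * s) * (r / 2) := by ring
      _ ≤ 1 * (r / 2) := by gcongr
      _ = r / 2 := one_mul _
  have g1 := hMr β hβ3
  have g2 := hMr β' hβ3'
  rw [div_le_iff₀ (by linarith)]
  clear_value τ τ' P Q s
  rcases lt_or_ge (dist Q P) r with h5 | h5
  · have key := h.dist_nonadjacent_of_depth h0 h1 h2 hP hQ (τ := τ) (τ' := τ')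
      (by rw [hPd, hτ]; exact min_le_left _ _)
      (by rw [hτ]; exact (min_le_right _ _).trans (by linarith))
      (by rw [hQd, hτ']; exact min_le_left _ _)
      (by rw [hτ']; exact (min_le_right _ _).trans (by linarith)) h5
    have e1 : M * dist Q P ≤ M * (dist y x + β + β') := by gcongr
    have e2 : M * (dist y x + β + β') = M * dist y x + M * β + M * β' := by ring
    linarith
  · have e3 : s * (r / 2) ≤ 3 / 10 * r := by nlinarith
    have e4 : 2 / 5 * r ≤ dist y x := by linarith
    have e5 : dist y x ≤ M * dist y x := le_mul_of_one_le_left dist_nonneg hM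
    linarith

/-- The slope of the triangle is at most `1 / M`, the depth to which inner normals stay in `F`. -/
theorem sideTriangle_subset (h : NicePolygon r θ M F n v) {k : ZMod n} {u : E3}
    (hu : IsInnerNormal r M F (v k) (v (k + 1)) u) :
    sideTriangle r (baseSlope θ M) (v k) (v (k + 1)) u ⊆ F := by
  have hM := h.one_le
  have hr := h.r_pos
  have hM0 : 0 < M := by linarith
  have hs0 := baseSlope_pos (M := M) h.θ_pos h.θ_lt
  have hs1 := mul_baseSlope_le h.θ_pos hM
  rintro x ⟨α, β, rfl, hβ0, hβ1, hβ2, hβ3⟩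
  set s := baseSlope θ M
  have hα0 : 0 ≤ α := by
    by_contra hc; push Not at hc; nlinarith
  have hα1 : α ≤ dist (v k) (v (k + 1)) := by
    by_contra hc; push Not at hc; nlinarith
  set P := v k + α • unitDir (v k) (v (k + 1)) with hPdef
  have hP : P ∈ segment ℝ (v k) (v (k + 1)) :=
    (mem_segment_iff_unitDir (h.corner_ne k)).2 ⟨α, hα0, hα1, rfl⟩
  rcases hβ0.eq_or_lt with rfl | hβ
  · rw [zero_smul, add_zero]; exact h.side_subset_face k hP
  have hPd : dist P (v k) = α := by
    rw [dist_eq_norm, hPdef, add_sub_cancel_left, norm_smul, norm_unitDir (h.corner_ne k), mul_one,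
      Real.norm_of_nonneg hα0]
  have hPd2 := (segment_param (h.corner_ne k) hP).2.2
  have hα0' : 0 < α := by
    by_contra hc; push Not at hc; nlinarith
  have hα1' : α < dist (v k) (v (k + 1)) := by
    by_contra hc; push Not at hc; nlinarith
  set τ := min (min α (dist (v k) (v (k + 1)) - α)) r with hτ
  have hτ0 : 0 < τ := lt_min (lt_min hα0' (by linarith)) hr
  have hβτ : β ≤ s * τ := by
    rcases min_choice (min α (dist (v k) (v (k + 1)) - α)) r with h3 | h3
    · rcases min_choice α (dist (v k) (v (k + 1)) - α) with h4 | h4 <;> rw [hτ, h3, h4] <;> assumption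
    · rw [hτ, h3]; nlinarith
  have hβM : β ≤ τ / M := by
    rw [le_div_iff₀ hM0]
    calc β * M ≤ (s * τ) * M := by gcongr
      _ = (M * s) * τ := by ring
      _ ≤ 1 * τ := by gcongr
      _ = τ := one_mul _
  -- the closed normal segment is in the closure of the open one
  have hcl : IsClosed {b : ℝ | P + b • u ∈ F} := h.isClosed.preimage (by fun_prop)
  have hsub : Set.Ioo 0 (τ / M) ⊆ {b : ℝ | P + b • u ∈ F} := fun b hb =>
    show P + b • u ∈ F from intrinsicInterior_subset (hu.deep τ hτ0 (min_le_right _ _) P hP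
      (by rw [hPd]; exact (min_le_left _ _).trans (min_le_left _ _))
      ((min_le_left _ _).trans ((min_le_right _ _).trans (by linarith))) b hb.1 hb.2)
  have := closure_minimal hsub hcl
  rw [closure_Ioo (by positivity : (0 : ℝ) ≠ τ / M)] at this
  exact this ⟨hβ0, hβM⟩

end NicePolygon

/-- Points of the triangle see the corner `a` under an angle at most the base angle. -/
theorem cos_le_of_mem_sideTriangle {r θ M : ℝ} (hθ : 0 < θ) (hθ' : θ < Real.pi / 2) {a b u x : E3}
    (hab : a ≠ b) (hu : ‖u‖ = 1) (hut : ⟪unitDir a b, u⟫ = 0)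
    (hx : x ∈ sideTriangle r (baseSlope θ M) a b u) :
    Real.cos (θ / 3) * ‖x - a‖ ≤ ⟪unitDir a b, x - a⟫ ∧
    Real.cos (θ / 3) * ‖x - b‖ ≤ ⟪unitDir b a, x - b⟫ := by
  obtain ⟨α, β, rfl, hβ0, hβ1, hβ2, hβ3⟩ := hx
  have hs0 := baseSlope_pos (M := M) hθ hθ'
  set γ := min (θ / 3) (Real.pi / 2 - Real.arctan M) with hγ
  have hγ0 := baseAngle_pos (M := M) hθ
  have hγ1 := baseAngle_lt (M := M) hθ'
  rw [← hγ] at hγ0 hγ1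
  have htn : ‖unitDir a b‖ = 1 := norm_unitDir hab
  have hcosγ : 0 < Real.cos γ :=
    Real.cos_pos_of_mem_Ioo ⟨by linarith [Real.pi_pos], by linarith [Real.pi_pos]⟩
  have hcosle : Real.cos (θ / 3) ≤ Real.cos γ :=
    Real.cos_le_cos_of_nonneg_of_le_pi hγ0.le (by linarith [Real.pi_pos]) (min_le_left _ _)
  have hcos3 : 0 ≤ Real.cos (θ / 3) :=
    Real.cos_nonneg_of_mem_Icc ⟨by linarith [Real.pi_pos], by linarith [Real.pi_pos]⟩
  have htan : baseSlope θ M * Real.cos γ = Real.sin γ := by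
    rw [baseSlope, ← hγ, Real.tan_mul_cos hcosγ.ne']
  have htt : ⟪unitDir a b, unitDir a b⟫ = 1 := by rw [real_inner_self_eq_norm_sq, htn]; norm_num
  have huu : ⟪u, u⟫ = 1 := by rw [real_inner_self_eq_norm_sq, hu]; norm_num
  have hut' : ⟪u, unitDir a b⟫ = 0 := by rw [real_inner_comm]; exact hut
  -- the vector with orthogonal components `c` and `β` makes an angle at most `γ` with the side
  have key : ∀ c : ℝ, β ≤ baseSlope θ M * c → ∀ w : E3, ‖w‖ ^ 2 = c ^ 2 + β ^ 2 →
      Real.cos (θ / 3) * ‖w‖ ≤ c := by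
    intro c hc w hw
    have hc0 : 0 ≤ c := by by_contra hcc; push Not at hcc; nlinarith
    refine (mul_le_mul_of_nonneg_right hcosle (norm_nonneg _)).trans ?_
    have h1 : β * Real.cos γ ≤ Real.sin γ * c := by
      calc β * Real.cos γ ≤ (baseSlope θ M * c) * Real.cos γ := by gcongr
        _ = _ := by rw [← htan]; ring
    have h2 : (β * Real.cos γ) ^ 2 ≤ (Real.sin γ * c) ^ 2 := by gcongr
    have h3 : (Real.cos γ * ‖w‖) ^ 2 ≤ c ^ 2 := by
      have h4 := Real.sin_sq_add_cos_sq γ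
      calc (Real.cos γ * ‖w‖) ^ 2 = Real.cos γ ^ 2 * c ^ 2 + (β * Real.cos γ) ^ 2 := by
            rw [mul_pow, hw]; ring
        _ ≤ Real.cos γ ^ 2 * c ^ 2 + (Real.sin γ * c) ^ 2 := by gcongr
        _ = (Real.sin γ ^ 2 + Real.cos γ ^ 2) * c ^ 2 := by ring
        _ = c ^ 2 := by rw [h4, one_mul]
    exact abs_le_of_sq_le_sq' h3 hc0 |>.2
  have hcomb : ∀ c : ℝ, ⟪unitDir a b, c • unitDir a b + β • u⟫ = c ∧
      ‖c • unitDir a b + β • u‖ ^ 2 = c ^ 2 + β ^ 2 := fun c => by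
    rw [← real_inner_self_eq_norm_sq]
    simp only [inner_add_left, inner_add_right, inner_smul_left, inner_smul_right, hut, hut', htt,
      huu, conj_trivial]
    constructor <;> ring
  constructor
  · have e : a + α • unitDir a b + β • u - a = α • unitDir a b + β • u := by abel
    rw [e, (hcomb α).1]
    exact key α hβ1 _ (hcomb α).2
  · have e : a + α • unitDir a b + β • u - b = (-(dist a b - α)) • unitDir a b + β • u := by
      have hb : b = a + dist a b • unitDir a b := by rw [dist_smul_unitDir hab]; abel
      calc a + α • unitDir a b + β • u - b
          = a + α • unitDir a b + β • u - (a + dist a b • unitDir a b) := by rw [← hb]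
        _ = _ := by module
    rw [e, unitDir_swap a b, inner_neg_left, (hcomb _).1, neg_neg]
    exact key _ hβ2 _ (by rw [(hcomb _).2, neg_sq])

/-- Two vectors close to two directions that form an angle at least `θ` are transversal. -/
theorem norm_add_norm_le_of_directions {θ : ℝ} (hθ : 0 < θ) (hθ' : θ < Real.pi / 2) {a b X Y : E3}
    (ha : ‖a‖ = 1) (hb : ‖b‖ = 1) (hab : |⟪a, b⟫| ≤ Real.cos θ)
    (hX : Real.cos (θ / 3) * ‖X‖ ≤ ⟪a, X⟫) (hY : Real.cos (θ / 3) * ‖Y‖ ≤ ⟪b, Y⟫) :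
    (1 - Real.cos (θ / 3)) / 2 * (‖X‖ + ‖Y‖) ^ 2 ≤ ‖X - Y‖ ^ 2 := by
  have hpi := Real.pi_pos
  have hc0 : 0 ≤ Real.cos (θ / 3) := Real.cos_nonneg_of_mem_Icc ⟨by linarith, by linarith⟩
  have hc1 : Real.cos (θ / 3) ≤ 1 := Real.cos_le_one _
  have key : ⟪X, Y⟫ ≤ Real.cos (θ / 3) * (‖X‖ * ‖Y‖) := by
    by_cases hX0 : X = 0
    · simp [hX0]
    by_cases hY0 : Y = 0
    · simp [hY0]
    have hang : ∀ d Z : E3, ‖d‖ = 1 → Z ≠ 0 → Real.cos (θ / 3) * ‖Z‖ ≤ ⟪d, Z⟫ →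
        InnerProductGeometry.angle d Z ≤ θ / 3 := by
      intro d Z hd hZ hdZ
      have hZn : 0 < ‖Z‖ := norm_pos_iff.2 hZ
      rw [InnerProductGeometry.angle, hd, one_mul, ← Real.arccos_cos (x := θ / 3) (by linarith)
        (by linarith)]
      exact Real.arccos_le_arccos (by rwa [le_div_iff₀ hZn])
    have h1 := hang a X ha hX0 hX
    have h2 := hang b Y hb hY0 hY
    have h3 : θ ≤ InnerProductGeometry.angle a b := by
      rw [InnerProductGeometry.angle, ha, hb, one_mul, div_one,
        ← Real.arccos_cos (x := θ) (by linarith) (by linarith)]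
      exact Real.arccos_le_arccos ((le_abs_self _).trans hab)
    have h4 := InnerProductGeometry.angle_le_angle_add_angle a X b
    have h5 := InnerProductGeometry.angle_le_angle_add_angle X Y b
    rw [InnerProductGeometry.angle_comm Y b] at h5
    rw [← InnerProductGeometry.cos_angle_mul_norm_mul_norm]
    gcongr
    exact Real.cos_le_cos_of_nonneg_of_le_pi (by linarith) (InnerProductGeometry.angle_le_pi _ _)
      (by linarith)
  rw [@norm_sub_sq ℝ]
  simp only [RCLike.re_to_real]
  nlinarith [mul_nonneg (sub_nonneg.2 hc1) (sq_nonneg (‖X‖ - ‖Y‖)), mul_nonneg hc0 (sq_nonneg (‖X‖ - ‖Y‖))]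

namespace NicePolygon

variable {r θ M : ℝ} {F : Set E3} {n : ℕ} {v : ZMod n → E3}

/-- The triangles over adjacent sides leave an angle of at least `θ / 3` at the common corner. -/
theorem dist_sideTriangle_adjacent (h : NicePolygon r θ M F n v) {k : ZMod n} {u u' x y : E3}
    (hu : IsInnerNormal r M F (v k) (v (k + 1)) u)
    (hu' : IsInnerNormal r M F (v (k + 1)) (v (k + 1 + 1)) u')
    (hx : x ∈ sideTriangle r (baseSlope θ M) (v k) (v (k + 1)) u)
    (hy : y ∈ sideTriangle r (baseSlope θ M) (v (k + 1)) (v (k + 1 + 1)) u') :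
    (1 - Real.cos (θ / 3)) / 2 * (dist x (v (k + 1)) + dist y (v (k + 1))) ^ 2 ≤ dist x y ^ 2 := by
  have h1 := (cos_le_of_mem_sideTriangle h.θ_pos h.θ_lt (h.corner_ne k) hu.unit hu.orth hx).2
  have h2 := (cos_le_of_mem_sideTriangle h.θ_pos h.θ_lt (h.corner_ne (k + 1)) hu'.unit hu'.orth hy).1
  have h3 := h.abs_inner_unitDir_le (k + 1)
  rw [add_sub_cancel_right, real_inner_comm] at h3
  have h4 := norm_add_norm_le_of_directions h.θ_pos h.θ_lt (norm_unitDir (h.corner_ne k).symm)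
    (norm_unitDir (h.corner_ne (k + 1))) h3 h1 h2
  rwa [sub_sub_sub_cancel_right, ← dist_eq_norm, ← dist_eq_norm, ← dist_eq_norm] at h4

end NicePolygon

/-! ### Polyhedra with Lipschitz boundary -/

/-- The properties of the polyhedra of the class that carry the argument: the faces are nice
polygons, adjacent faces are transversal, and the boundary surface is locally the graph of a
Lipschitz function that separates inside from outside. -/
structure NicePolyhedron (r θ M M₁ : ℝ) (D : Polyhedron) : Prop where
  r_pos : 0 < r
  one_le : 1 ≤ M
  θ_pos : 0 < θ
  θ_lt : θ < Real.pi / 2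
  compact : IsCompact D.carrier
  diam : ∀ x ∈ D.carrier, ∀ y ∈ D.carrier, dist x y ≤ M₁ * r
  face : ∀ j, NicePolygon r θ M (D.face j) (D.numSides j) (D.corner j)
  dihedral : ∀ i j k l n n', i ≠ j → D.side i k = D.side j l → D.IsOuterNormal i k n →
    D.IsOuterNormal j l n' → |⟪n, n'⟫| ≤ Real.cos θ
  regular : frontier D.carrier ⊆ closure (interior D.carrier)
  proj : ∀ P ∈ frontier D.carrier, ∃ pr : E3 →ₗ[ℝ] EuclideanSpace ℝ (Fin 2),
    (∀ w, ‖pr w‖ ≤ ‖w‖) ∧ ∀ x ∈ frontier D.carrier, ∀ y ∈ frontier D.carrier,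
      dist x P < r → dist y P < r → ‖x - y‖ ≤ (1 + M) * ‖pr (x - y)‖
  path : ∀ x ∈ frontier D.carrier, ∀ y ∈ frontier D.carrier, dist x y < r / (1 + M) →
    ∃ γ : ℝ → E3, γ 0 = x ∧ γ 1 = y ∧ (∀ s ∈ Set.Icc (0 : ℝ) 1, γ s ∈ frontier D.carrier) ∧
      ∀ s ∈ Set.Icc (0 : ℝ) 1, ∀ t ∈ Set.Icc (0 : ℝ) 1,
        dist (γ s) (γ t) ≤ (1 + M) * dist x y * |s - t|
  twosided : ∀ P ∈ frontier D.carrier, ∃ N A B : Set E3, IsOpen N ∧ P ∈ N ∧ IsPreconnected A ∧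
    IsPreconnected B ∧ Disjoint A (frontier D.carrier) ∧ Disjoint B (frontier D.carrier) ∧
    N \ frontier D.carrier ⊆ A ∪ B

/-- A sector angle is the angle `α` between the vectors or `2 * π - α`, so both intervals of
nondegenerate angles bound `α` away from `0` and `π` in the same way. -/
theorem abs_cos_le_of_nondegenerate {S : Set E3} {p u w : E3} {θ : ℝ} (hθ : 0 < θ)
    (h : sectorAngle S p u w ∈ nondegenerateAngles θ) :
    |⟪u, w⟫| ≤ Real.cos θ * (‖u‖ * ‖w‖) := by
  set α := InnerProductGeometry.angle u w with hα
  have h0 := InnerProductGeometry.angle_nonneg u w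
  have h1 := InnerProductGeometry.angle_le_pi u w
  have hpi := Real.pi_pos
  have hmem : θ ≤ α ∧ α ≤ Real.pi - θ := by
    rw [nondegenerateAngles] at h
    unfold sectorAngle at h
    split_ifs at h
    · rcases h with h | h
      · exact ⟨h.1.le, h.2.le⟩
      · exact ⟨by linarith [h.1], by linarith [h.1]⟩
    · rcases h with h | h
      · exact ⟨by linarith [h.2], by linarith [h.2]⟩
      · exact ⟨by linarith [h.2], by linarith [h.1]⟩
  have h2 : |Real.cos α| ≤ Real.cos θ := by
    rw [abs_le]
    constructor
    · rw [← Real.cos_pi_sub]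
      exact Real.cos_le_cos_of_nonneg_of_le_pi h0 (by linarith) hmem.2
    · exact Real.cos_le_cos_of_nonneg_of_le_pi hθ.le h1 hmem.1
  rw [← InnerProductGeometry.cos_angle_mul_norm_mul_norm, abs_mul,
    abs_of_nonneg (by positivity : 0 ≤ ‖u‖ * ‖w‖)]
  gcongr

namespace PolyhedralClass

variable {r θ M M₁ : ℝ} {Ω : Set E3} {D : Polyhedron}

theorem isCompact_carrier (D : Polyhedron) : IsCompact D.carrier := by
  obtain ⟨φ⟩ := D.homeomorphic_ball
  have : CompactSpace (Metric.closedBall (0 : E3) 1) :=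
    isCompact_iff_compactSpace.1 (isCompact_closedBall _ _)
  exact isCompact_iff_compactSpace.2 φ.symm.compactSpace

theorem carrier_nonempty (D : Polyhedron) : D.carrier.Nonempty := by
  obtain ⟨φ⟩ := D.homeomorphic_ball
  exact ⟨φ.symm ⟨0, by simp⟩, (φ.symm ⟨0, by simp⟩).2⟩

/-- A segment from `P` that leaves `Ω` would meet the boundary of `Ω` at distance less than `r`. -/
theorem ball_subset (h : PolyhedralClass r θ M Ω D) {P : E3} (hP : P ∈ D.carrier) :
    Metric.ball P r ⊆ Ω := by
  intro x hx
  by_contra hxΩ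
  have hr : 0 < r := dist_nonneg.trans_lt (Metric.mem_ball.1 hx)
  have hpre : IsPreconnected (Metric.ball P r) := (convex_ball P r).isPreconnected
  obtain ⟨y, hy, hyf⟩ : (Metric.ball P r ∩ frontier Ω).Nonempty := by
    by_contra hne
    rw [Set.not_nonempty_iff_eq_empty, ← Set.disjoint_iff_inter_eq_empty] at hne
    exact hxΩ (interior_subset (hpre.subset_of_closure_inter_subset isOpen_interior
      ⟨P, Metric.mem_ball_self hr, by
        by_contra hPi
        exact Set.disjoint_left.1 hne (Metric.mem_ball_self hr)
          ⟨subset_closure (h.subset hP), hPi⟩⟩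
      (fun z hz => by
        by_contra hzi
        exact Set.disjoint_left.1 hne hz.2
          ⟨closure_mono interior_subset hz.1, hzi⟩) hx))
  have := h.strict_inclusion P hP y hyf
  rw [Metric.mem_ball, dist_comm] at hy
  linarith

/-- Near `D` the boundaries of `D` and of `Ω \ D` agree. -/
theorem frontier_subset_frontier_diff (hΩ : IsOpen Ω) (h : PolyhedralClass r θ M Ω D) :
    frontier D.carrier ⊆ frontier (Ω \ D.carrier) := by
  have hcl := (isCompact_carrier D).isClosed
  intro x hx
  have hxD : x ∈ D.carrier := hcl.frontier_subset hx
  refine ⟨?_, fun hxi => (interior_subset hxi).2 hxD⟩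
  have h1 : x ∈ closure D.carrierᶜ := by
    rw [frontier_eq_closure_inter_closure] at hx
    exact hx.2
  exact hΩ.inter_closure ⟨h.subset hxD, h1⟩

/-- The class consists of nice polyhedra. Everything is read off from the charts of `Ω \ D`, in which
`D` is the part below the graph. -/
theorem nice (hr : 0 < r) (hM : 1 ≤ M) (hθ : 0 < θ) (hθ' : θ < Real.pi / 2)
    (hΩ : AdmissibleDomain r M₁ Ω) (h : PolyhedralClass r θ M Ω D) :
    NicePolyhedron r θ M M₁ D := by
  have hM0 : 0 < M := by linarith
  have hcomp := isCompact_carrier D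
  have hcl := hcomp.isClosed
  have hUo : IsOpen (Ω \ D.carrier) := hΩ.isOpen.sdiff hcl
  have hdis : Disjoint (frontier (Ω \ D.carrier)) (Ω \ D.carrier) :=
    disjoint_frontier_iff_isOpen.2 hUo
  -- in a chart at `P`, inside a ball of radius `r`, the boundary is the graph
  have hchart : ∀ P ∈ frontier D.carrier, ∃ (e : EuclideanSpace ℝ (Fin 3) →ᵃⁱ[ℝ] E3)
      (g : EuclideanSpace ℝ (Fin 2) → ℝ), IsChart 2 (Ω \ D.carrier) P r M e g ∧
      (∀ x, ‖x‖ < r → (e x ∈ frontier D.carrier ↔ x (Fin.last 2) = g (firstCoords x))) ∧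
      (∀ x, ‖x‖ < r → x (Fin.last 2) < g (firstCoords x) → e x ∈ interior D.carrier) := by
    intro P hP
    obtain ⟨e, g, hc⟩ := h.lipschitz.exists_isChart hr (frontier_subset_frontier_diff hΩ.isOpen h hP)
    have hball : ∀ x : EuclideanSpace ℝ (Fin 3), ‖x‖ < r → e x ∈ Ω := fun x hx =>
      h.ball_subset (hcl.frontier_subset hP) (by
        rw [Metric.mem_ball, ← hc.map_zero, e.isometry.dist_eq, dist_zero_right]; exact hx)
    have hb : ∀ x : EuclideanSpace ℝ (Fin 3), ‖x‖ < r → ‖firstCoords x‖ < r ∧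
        |x (Fin.last 2)| < 2 * M * r := fun x hx =>
      ⟨(norm_firstCoords_le x).trans_lt hx, (abs_last_le x).trans_lt (by nlinarith)⟩
    have hS : ∀ x : EuclideanSpace ℝ (Fin 3), ‖x‖ < r →
        (e x ∈ frontier D.carrier ↔ x (Fin.last 2) = g (firstCoords x)) := by
      intro x hx
      obtain ⟨h1, h2⟩ := hb x hx
      refine ⟨fun hxS => h.lipschitz.eq_graph hr hM0 hdis hc
        (frontier_subset_frontier_diff hΩ.isOpen h hxS) h1 h2, fun hxg => ?_⟩
      have hxD : e x ∈ D.carrier := by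
        by_contra hxD
        have := (hc.mem_iff x h1.le h2.le).1 ⟨hball x hx, hxD⟩
        exact this.ne' hxg
      rw [frontier_eq_closure_inter_closure]
      refine ⟨subset_closure hxD, ?_⟩
      rw [Metric.mem_closure_iff]
      intro ε hε
      obtain ⟨z, hz, hd⟩ := hc.exists_mem_near hr hM0 h1.le hxg hε
      exact ⟨z, hz.2, by rwa [dist_comm]⟩
    refine ⟨e, g, hc, hS, fun x hx hxg => ?_⟩
    obtain ⟨h1, h2⟩ := hb x hx
    have hxD : e x ∈ D.carrier := by
      by_contra hxD
      have := (hc.mem_iff x h1.le h2.le).1 ⟨hball x hx, hxD⟩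
      linarith
    by_contra hxi
    have : e x ∈ frontier D.carrier := by rw [hcl.frontier_eq]; exact ⟨hxD, hxi⟩
    exact hxg.ne ((hS x hx).1 this)
  -- the charts are defined on the whole space and, by dimension, surjective
  have hsurj : ∀ e : EuclideanSpace ℝ (Fin 3) →ᵃⁱ[ℝ] E3, Function.Surjective e := by
    intro e y
    have h1 : Function.Surjective e.linearIsometry := by
      have := LinearMap.injective_iff_surjective (f := e.linearIsometry.toLinearMap)
      exact this.1 e.linearIsometry.injective
    obtain ⟨x, hx⟩ := h1 (y - e 0)
    refine ⟨x, ?_⟩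
    have := e.map_vadd 0 x
    simp only [vadd_eq_add, add_zero] at this
    rw [this, hx]; abel
  refine ⟨hr, hM, hθ, hθ', hcomp, ?_, ?_, ?_, ?_, ?_, ?_, ?_⟩
  · intro x hx y hy
    exact (Metric.dist_le_diam_of_mem hΩ.bounded (h.subset hx) (h.subset hy)).trans hΩ.diam_le
  · exact fun j => ⟨hr, hM, hθ, hθ', D.face_polygonal j, h.face_lipschitz j, h.edge_length j,
      fun k => abs_cos_le_of_nondegenerate hθ (h.face_angle j k)⟩
  · intro i j k l n n' hij hs hn hn'
    have := abs_cos_le_of_nondegenerate hθ (h.dihedral _ ⟨i, j, k, l, n, n', hij, hs, hn, hn', rfl⟩)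
    simpa [hn.unit, hn'.unit] using this
  -- the points straight below `P` are interior points
  · intro P hP
    obtain ⟨e, g, hc, hS, hI⟩ := hchart P hP
    rw [Metric.mem_closure_iff]
    intro ε hε
    have hs : 0 < min (ε / 2) (r / 2) := lt_min (by linarith) (by linarith)
    set s := min (ε / 2) (r / 2)
    have hn : ‖(joinCoords 0 (-s) : EuclideanSpace ℝ (Fin 3))‖ ≤ s := by
      refine (norm_le_firstCoords_add _).trans ?_
      rw [firstCoords_joinCoords, joinCoords_last, norm_zero, zero_add, abs_neg, abs_of_pos hs]
    refine ⟨e (joinCoords 0 (-s)), hI _ (hn.trans_lt ?_) ?_, ?_⟩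
    · exact (min_le_right _ _).trans_lt (by linarith)
    · rw [joinCoords_last, firstCoords_joinCoords, hc.g_zero]; linarith
    · rw [← hc.map_zero, e.isometry.dist_eq, dist_zero_left]
      exact hn.trans_lt ((min_le_left _ _).trans_lt (by linarith))
  -- project to the base of the chart; on the graph the last coordinate is `M`-Lipschitz
  · intro P hP
    obtain ⟨e, g, hc, hS, hI⟩ := hchart P hP
    set L := e.linearIsometry.toLinearIsometryEquiv (by simp)
    have hL : ∀ x y, L.symm (e x - e y) = x - y := fun x y => by
      rw [LinearIsometryEquiv.symm_apply_eq]
      exact (e.map_vsub x y).symm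
    refine ⟨⟨⟨fun w => firstCoords (L.symm w), fun x y => by rw [map_add, firstCoords_add]⟩,
      fun c x => by
        show firstCoords (L.symm (c • x)) = c • firstCoords (L.symm x)
        rw [map_smul, firstCoords_smul]⟩, fun w => ?_, fun x hx y hy hxP hyP => ?_⟩
    · exact (norm_firstCoords_le _).trans_eq (L.symm.norm_map w)
    · obtain ⟨x, rfl⟩ := hsurj e x
      obtain ⟨y, rfl⟩ := hsurj e y
      rw [← hc.map_zero, e.isometry.dist_eq, dist_zero_right] at hxP hyP
      have h1 := (hS x hxP).1 hx
      have h2 := (hS y hyP).1 hy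
      have h3 := hc.lip (firstCoords x) (firstCoords y) ((norm_firstCoords_le x).trans hxP.le)
        ((norm_firstCoords_le y).trans hyP.le)
      rw [← h1, ← h2, ← firstCoords_sub] at h3
      have h4 := norm_le_firstCoords_add (x - y)
      rw [← dist_eq_norm, e.isometry.dist_eq, dist_eq_norm]
      change _ ≤ (1 + M) * ‖firstCoords (L.symm (e x - e y))‖
      rw [hL]
      rw [PiLp.sub_apply] at h4
      linarith
  -- lift the straight segment in the base of the chart to the graph
  · intro P hP y hy hPy
    obtain ⟨e, g, hc, hS, hI⟩ := hchart P hP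
    obtain ⟨y, rfl⟩ := hsurj e y
    have hd : dist P (e y) = ‖y‖ := by rw [← hc.map_zero, e.isometry.dist_eq, dist_zero_left]
    rw [hd] at hPy ⊢
    have hK : 0 < 1 + M := by linarith
    have hyr : ‖y‖ * (1 + M) < r := by rwa [lt_div_iff₀ hK] at hPy
    have hyr' : ‖y‖ < r := by nlinarith [norm_nonneg y]
    set y' := firstCoords y with hy'
    have hy'n : ‖y'‖ ≤ ‖y‖ := norm_firstCoords_le y
    have hsr : ∀ s ∈ Set.Icc (0 : ℝ) 1, ‖s • y'‖ ≤ ‖y‖ := fun s hs => by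
      rw [norm_smul, Real.norm_of_nonneg hs.1]
      nlinarith [hs.2, norm_nonneg y']
    have hlip : ∀ s ∈ Set.Icc (0 : ℝ) 1, ∀ t ∈ Set.Icc (0 : ℝ) 1,
        dist (e (joinCoords (s • y') (g (s • y')))) (e (joinCoords (t • y') (g (t • y')))) ≤
        (1 + M) * ‖y‖ * |s - t| := by
      intro s hs t ht
      rw [e.isometry.dist_eq, dist_eq_norm]
      refine (norm_le_firstCoords_add _).trans ?_
      rw [firstCoords_sub, firstCoords_joinCoords, firstCoords_joinCoords, PiLp.sub_apply,
        joinCoords_last, joinCoords_last]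
      have h3 := hc.lip (s • y') (t • y') ((hsr s hs).trans hyr'.le) ((hsr t ht).trans hyr'.le)
      rw [← sub_smul, norm_smul, Real.norm_eq_abs] at h3 ⊢
      have h4 : |s - t| * ‖y'‖ ≤ |s - t| * ‖y‖ := by gcongr
      nlinarith
    have h0 : joinCoords ((0 : ℝ) • y') (g ((0 : ℝ) • y')) = (0 : EuclideanSpace ℝ (Fin 3)) := by
      rw [zero_smul, hc.g_zero]
      have := joinCoords_firstCoords (0 : EuclideanSpace ℝ (Fin 3))
      have h00 : firstCoords (0 : EuclideanSpace ℝ (Fin 3)) = 0 := by ext; simp [firstCoords_apply]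
      rw [h00] at this
      simpa using this
    refine ⟨fun s => e (joinCoords (s • y') (g (s • y'))), ?_, ?_, ?_, hlip⟩
    · simp only [h0, hc.map_zero]
    · simp only [one_smul]
      rw [hy', ← (hS y hyr').1 hy, joinCoords_firstCoords]
    · intro s hs
      rw [hS]
      · rw [joinCoords_last, firstCoords_joinCoords]
      · have := hlip s hs 0 (by simp)
        simp only [h0] at this
        rw [e.isometry.dist_eq, dist_zero_right, sub_zero, abs_of_nonneg hs.1] at this
        refine this.trans_lt ?_
        have h5 : (1 + M) * ‖y‖ * s ≤ (1 + M) * ‖y‖ * 1 := by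
          have := hs.2; gcongr
        linarith
  -- `a` is chosen so that the cylinder of radius `a` and half-height `2 * M * a` lies in the ball of
  -- radius `r`; the graph cuts it into a part above and a part below
  · intro P hP
    obtain ⟨e, g, hc, hS, hI⟩ := hchart P hP
    set a := r / (1 + 2 * M) with ha
    have ha0 : 0 < a := by positivity
    have har : a + 2 * M * a = r := by rw [ha]; field_simp
    have har' : a < r := by nlinarith
    have hcont : ContinuousOn g (Metric.ball 0 a) :=
      (continuousOn_of_chart hM0.le hc.lip).mono
        (Metric.ball_subset_closedBall.trans (Metric.closedBall_subset_closedBall har'.le))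
    have hgb : ∀ y ∈ Metric.ball (0 : EuclideanSpace ℝ (Fin 2)) a, |g y| < 2 * M * a := by
      intro y hy
      have hy' : ‖y‖ < a := by simpa using hy
      have := hc.abs_g_le hr (hy'.le.trans har'.le)
      nlinarith
    refine ⟨Metric.ball P a, e '' {x | ‖firstCoords x‖ < a ∧ g (firstCoords x) < x (Fin.last 2) ∧
        x (Fin.last 2) < 2 * M * a},
      e '' {x | ‖firstCoords x‖ < a ∧ x (Fin.last 2) < g (firstCoords x) ∧
        -(2 * M * a) < x (Fin.last 2)}, Metric.isOpen_ball, Metric.mem_ball_self ha0,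
      (isPreconnected_above hcont fun y hy => (abs_lt.1 (hgb y hy)).2).image _
        e.continuous.continuousOn,
      (isPreconnected_below hcont fun y hy => (abs_lt.1 (hgb y hy)).1).image _
        e.continuous.continuousOn, ?_, ?_, ?_⟩
    · rw [Set.disjoint_left]
      rintro _ ⟨x, ⟨h1, h2, h3⟩, rfl⟩ hx
      have h4 := (abs_lt.1 (hgb (firstCoords x) (by simpa using h1))).1
      have h5 := norm_le_firstCoords_add x
      have h6 : |x (Fin.last 2)| < 2 * M * a := abs_lt.2 ⟨by linarith, h3⟩
      rw [hS x (by linarith)] at hx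
      linarith
    · rw [Set.disjoint_left]
      rintro _ ⟨x, ⟨h1, h2, h3⟩, rfl⟩ hx
      have h4 := (abs_lt.1 (hgb (firstCoords x) (by simpa using h1))).2
      have h5 := norm_le_firstCoords_add x
      have h6 : |x (Fin.last 2)| < 2 * M * a := abs_lt.2 ⟨h3, by linarith⟩
      rw [hS x (by linarith)] at hx
      linarith
    · rintro x ⟨hx, hxS⟩
      obtain ⟨y, rfl⟩ := hsurj e x
      rw [Metric.mem_ball, ← hc.map_zero, e.isometry.dist_eq, dist_zero_right] at hx
      have h1 := (norm_firstCoords_le y).trans_lt hx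
      have h2 := (abs_last_le y).trans_lt hx
      have h3 : |y (Fin.last 2)| < 2 * M * a := by nlinarith
      rw [hS y (hx.trans har')] at hxS
      rcases lt_or_gt_of_ne hxS with h4 | h4
      · exact Or.inr ⟨y, ⟨h1, h4, (abs_lt.1 h3).1⟩, rfl⟩
      · exact Or.inl ⟨y, ⟨h1, h4, (abs_lt.1 h3).2⟩, rfl⟩

end PolyhedralClass

/-! ### The boundary surface near faces, edges and vertices -/

theorem eq_or_eq_of_segment_eq {a b c d : E3} (hcd : c ≠ d)
    (h : segment ℝ a b = segment ℝ c d) : (a = c ∧ b = d) ∨ (a = d ∧ b = c) := by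
  have hab : a ≠ b := by
    rintro rfl
    rw [segment_same] at h
    have h1 : c ∈ ({a} : Set E3) := h ▸ left_mem_segment ℝ c d
    have h2 : d ∈ ({a} : Set E3) := h ▸ right_mem_segment ℝ c d
    exact hcd (h1.trans h2.symm)
  have ha : a ∈ segment ℝ c d := h ▸ left_mem_segment ℝ a b
  have hb : b ∈ segment ℝ c d := h ▸ right_mem_segment ℝ a b
  have hc : c ∈ segment ℝ a b := h ▸ left_mem_segment ℝ c d
  have hd : d ∈ segment ℝ a b := h ▸ right_mem_segment ℝ c d
  obtain ⟨-, -, c1⟩ := segment_param hab hc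
  obtain ⟨-, -, d1⟩ := segment_param hab hd
  obtain ⟨a1, -, a3⟩ := segment_param hcd ha
  obtain ⟨b1, -, b3⟩ := segment_param hcd hb
  have tr1 := dist_triangle a c b
  have h1 : dist a b = |dist a c - dist b c| := by
    rw [dist_eq_norm]
    nth_rewrite 1 [a1, b1]
    rw [add_sub_add_left_eq_sub, ← sub_smul, norm_smul, norm_unitDir hcd, mul_one,
      Real.norm_eq_abs]
  rw [dist_comm c a, dist_comm c b] at c1
  rw [dist_comm d a, dist_comm d b] at d1
  have h2 := @dist_nonneg _ _ a c
  have h3 := @dist_nonneg _ _ b c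
  have h4 := @dist_nonneg _ _ a d
  have h5 := @dist_nonneg _ _ b d
  rcases abs_cases (dist a c - dist b c) with ⟨h6, -⟩ | ⟨h6, -⟩
  · right
    exact ⟨dist_eq_zero.1 (by linarith), dist_eq_zero.1 (by linarith)⟩
  · left
    exact ⟨dist_eq_zero.1 (by linarith), dist_eq_zero.1 (by linarith)⟩

theorem IsInnerNormal.swap {r M : ℝ} {F : Set E3} {a b u : E3} (h : IsInnerNormal r M F a b u) :
    IsInnerNormal r M F b a u where
  mem := h.mem
  unit := h.unit
  orth := by rw [unitDir_swap, inner_neg_left, h.orth, neg_zero]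
  expand w hw := by
    rw [unitDir_swap, inner_neg_left, neg_smul_neg]
    exact h.expand w hw
  sides τ h0 h1 P hP h2 h3 := h.sides τ h0 h1 P (segment_symm ℝ b a ▸ hP) h3 h2
  deep τ h0 h1 P hP h2 h3 := h.deep τ h0 h1 P (segment_symm ℝ b a ▸ hP) h3 h2

namespace NicePolygon

variable {r θ M : ℝ} {F : Set E3} {n : ℕ} {v : ZMod n → E3}

theorem exists_interior_near (h : NicePolygon r θ M F n v) {x : E3} (hx : x ∈ F) {ε : ℝ}
    (hε : 0 < ε) : ∃ y ∈ intrinsicInterior ℝ F, dist y x < ε := by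
  rcases (mem_face_iff h.isClosed).1 hx with hx | hx
  · exact ⟨x, hx, by rwa [dist_self]⟩
  · obtain ⟨p, q, -, -, -, hq, -, -, -, hb, -⟩ := h.exists_frame hx
    have hr := h.r_pos
    have hM := h.one_le
    have hMr : 0 < 2 * M * r := by nlinarith
    have hs : 0 < min (ε / 2) (2 * M * r / 2) := lt_min (by linarith) (by linarith)
    refine ⟨_, (hb _ hs ((min_le_right _ _).trans_lt (by linarith))).1, ?_⟩
    rw [dist_eq_norm, add_sub_cancel_left, norm_smul, hq, mul_one, Real.norm_of_nonneg hs.le]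
    exact (min_le_left _ _).trans_lt (by linarith)

theorem midpoint_dist (h : NicePolygon r θ M F n v) (k : ZMod n) :
    r / 2 ≤ dist (midpoint ℝ (v k) (v (k + 1))) (v k) ∧
    r / 2 ≤ dist (midpoint ℝ (v k) (v (k + 1))) (v (k + 1)) := by
  rw [dist_midpoint_left, dist_midpoint_right, Real.norm_ofNat]
  have := h.len k
  constructor <;> linarith

end NicePolygon

/-- The segment from `a` to `b` is a common side of the `i`-th and the `j`-th face, with inner
normals `u` and `u'`. -/
structure Polyhedron.IsHinge (D : Polyhedron) (r θ M : ℝ) (a b : E3) (i j : Fin D.numFaces)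
    (u u' : E3) : Prop where
  ne : i ≠ j
  left : IsInnerNormal r M (D.face i) a b u
  right : IsInnerNormal r M (D.face j) a b u'
  angle : |⟪u, u'⟫| ≤ Real.cos θ
  side_left : ∃ k, D.side i k = segment ℝ a b
  side_right : ∃ k, D.side j k = segment ℝ a b

namespace NicePolyhedron

variable {r θ M M₁ : ℝ} {D : Polyhedron}

theorem face_subset (D : Polyhedron) (j : Fin D.numFaces) : D.face j ⊆ frontier D.carrier := by
  rw [D.boundary_eq]; exact Set.subset_iUnion _ _

theorem exists_face (D : Polyhedron) {x : E3} (hx : x ∈ frontier D.carrier) :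
    ∃ j, x ∈ D.face j := by
  rw [D.boundary_eq] at hx; exact Set.mem_iUnion.1 hx

/-- It is enough to look at the midpoint of the side, which is far from the corners. -/
theorem isOuterNormal_neg (h : NicePolyhedron r θ M M₁ D) {j : Fin D.numFaces}
    {k : ZMod (D.numSides j)} {u : E3}
    (hu : IsInnerNormal r M (D.face j) (D.corner j k) (D.corner j (k + 1)) u) :
    D.IsOuterNormal j k (-u) where
  mem_direction := Submodule.neg_mem _ hu.mem
  unit := by rw [norm_neg, hu.unit]
  orthogonal := by
    rw [← dist_smul_unitDir ((h.face j).corner_ne k), inner_neg_left, inner_smul_right,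
      real_inner_comm, hu.orth, mul_zero, neg_zero]
  outward := by
    have hr := h.r_pos
    have hM := h.one_le
    obtain ⟨h1, h2⟩ := (h.face j).midpoint_dist k
    have h3 : 0 < r / 2 / (1 + M) := by positivity
    filter_upwards [Ioo_mem_nhdsGT h3] with t ht
    refine (hu.sides (r / 2) (by linarith) (by linarith) _ (midpoint_mem_segment (𝕜 := ℝ) _ _) h1 h2
      (t • -u) (Submodule.smul_mem _ _ (Submodule.neg_mem _ hu.mem)) ?_).2 ?_
    · rw [norm_smul, norm_neg, hu.unit, mul_one, Real.norm_of_nonneg ht.1.le]; exact ht.2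
    · rw [inner_smul_right, inner_neg_right, real_inner_self_eq_norm_sq, hu.unit]
      nlinarith [ht.1]

/-- The direction of the plane orthogonal to the side is a line, so an outer normal is `u` or `-u`,
and `u` points into the face. -/
theorem eq_neg_of_isOuterNormal (h : NicePolyhedron r θ M M₁ D) {j : Fin D.numFaces}
    {k : ZMod (D.numSides j)} {u n : E3}
    (hu : IsInnerNormal r M (D.face j) (D.corner j k) (D.corner j (k + 1)) u)
    (hn : D.IsOuterNormal j k n) : n = -u := by
  have hr := h.r_pos
  have hM := h.one_le
  have hab := (h.face j).corner_ne k
  have h0 : ⟪unitDir (D.corner j k) (D.corner j (k + 1)), n⟫ = 0 := by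
    have := hn.orthogonal
    rw [← dist_smul_unitDir hab, inner_smul_right, mul_eq_zero] at this
    rw [real_inner_comm]
    exact this.resolve_left (dist_ne_zero.2 hab)
  have he := hu.expand n hn.mem_direction
  rw [h0, zero_smul, zero_add] at he
  have h1 : |⟪u, n⟫| = 1 := by
    have := hn.unit
    rw [he, norm_smul, hu.unit, mul_one, Real.norm_eq_abs] at this
    exact this
  rcases (abs_eq zero_le_one).1 h1 with h2 | h2
  · exfalso
    rw [h2, one_smul] at he
    obtain ⟨m1, m2⟩ := (h.face j).midpoint_dist k
    have h3 : 0 < r / 2 / M := by positivity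
    obtain ⟨t, ht, ht'⟩ := ((hn.outward.and (Ioo_mem_nhdsGT h3))).exists
    refine ht (intrinsicInterior_subset (𝕜 := ℝ) ?_)
    rw [he]
    exact hu.deep (r / 2) (by linarith) (by linarith) _ (midpoint_mem_segment (𝕜 := ℝ) _ _) m1 m2 t
      ht'.1 ht'.2
  · rw [he, h2, neg_smul, one_smul]

theorem exists_innerNormal_of_side_eq (h : NicePolyhedron r θ M M₁ D) {a b : E3} (hab : a ≠ b)
    {j : Fin D.numFaces} {l : ZMod (D.numSides j)} (hl : D.side j l = segment ℝ a b) :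
    ∃ u, IsInnerNormal r M (D.face j) a b u ∧ D.IsOuterNormal j l (-u) := by
  obtain ⟨u, hu⟩ := (h.face j).exists_innerNormal l
  refine ⟨u, ?_, h.isOuterNormal_neg hu⟩
  rcases eq_or_eq_of_segment_eq hab hl with ⟨h1, h2⟩ | ⟨h1, h2⟩
  · rwa [h1, h2] at hu
  · rw [h1, h2] at hu; exact hu.swap

theorem isHinge_of_side_eq (h : NicePolyhedron r θ M M₁ D) {a b : E3} (hab : a ≠ b)
    {i j : Fin D.numFaces} (hij : i ≠ j) {k : ZMod (D.numSides i)} {l : ZMod (D.numSides j)}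
    (hk : D.side i k = segment ℝ a b) (hl : D.side j l = segment ℝ a b) :
    ∃ u u', D.IsHinge r θ M a b i j u u' := by
  obtain ⟨u, hu, hn⟩ := h.exists_innerNormal_of_side_eq hab hk
  obtain ⟨u', hu', hn'⟩ := h.exists_innerNormal_of_side_eq hab hl
  refine ⟨u, u', hij, hu, hu', ?_, ⟨k, hk⟩, ⟨l, hl⟩⟩
  have := h.dihedral i j k l _ _ hij (hk.trans hl.symm) hn hn'
  rwa [inner_neg_neg] at this

theorem exists_hinge (h : NicePolyhedron r θ M M₁ D) (i : Fin D.numFaces)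
    (k : ZMod (D.numSides i)) :
    ∃ j u u', D.IsHinge r θ M (D.corner i k) (D.corner i (k + 1)) i j u u' := by
  obtain ⟨j, hj, l, hl⟩ := D.sides_shared i k
  obtain ⟨u, u', hu⟩ := h.isHinge_of_side_eq ((h.face i).corner_ne k) hj.symm rfl hl.symm
  exact ⟨j, u, u', hu⟩

/-- The projection that flattens the boundary is injective along vectors that stay on it. -/
theorem norm_le_of_add_mem {P : E3} (hP : P ∈ frontier D.carrier) (hr : 0 < r)
    {pr : E3 →ₗ[ℝ] EuclideanSpace ℝ (Fin 2)}
    (hpr : ∀ x ∈ frontier D.carrier, ∀ y ∈ frontier D.carrier,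
      dist x P < r → dist y P < r → ‖x - y‖ ≤ (1 + M) * ‖pr (x - y)‖) {w : E3} {s : ℝ}
    (hs : s ≠ 0) (hw : ‖s • w‖ < r) (hm : P + s • w ∈ frontier D.carrier) :
    ‖w‖ ≤ (1 + M) * ‖pr w‖ := by
  have := hpr _ hm P hP (by rwa [dist_eq_norm, add_sub_cancel_left]) (by rwa [dist_self])
  rw [add_sub_cancel_left, map_smul, norm_smul, norm_smul] at this
  have h1 : 0 < ‖s‖ := norm_pos_iff.2 hs
  refine le_of_mul_le_mul_left (this.trans_eq ?_) h1
  ring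

/-- Around a point where a face contains a disc, the boundary is that disc. -/
theorem mem_face_of_disc (h : NicePolyhedron r θ M M₁ D) {j : Fin D.numFaces} {p : E3} {ρ : ℝ}
    (hρ : 0 < ρ) (hρr : ρ ≤ r)
    (hd : ∀ w ∈ (affineSpan ℝ (D.face j)).direction, ‖w‖ < ρ → p + w ∈ D.face j) {x : E3}
    (hx : x ∈ frontier D.carrier) (hxp : dist x p < ρ / (1 + M)) : x ∈ D.face j := by
  have hM := h.one_le
  have hK : 0 < 1 + M := by linarith
  have hpF : p ∈ D.face j := by simpa using hd 0 (Submodule.zero_mem _) (by simpa)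
  have hpS := face_subset D j hpF
  obtain ⟨pr, hpr1, hpr⟩ := h.proj p hpS
  -- along the disc the projection does not shrink much, so it is bijective from the plane of the
  -- face to the plane of the chart
  have hle : ∀ w ∈ (affineSpan ℝ (D.face j)).direction, ‖w‖ ≤ (1 + M) * ‖pr w‖ := by
    intro w hw
    have hs : 0 < ρ / (2 * (‖w‖ + 1)) := by positivity
    have hn : ‖(ρ / (2 * (‖w‖ + 1))) • w‖ < ρ := by
      rw [norm_smul, Real.norm_of_nonneg hs.le, div_mul_eq_mul_div, div_lt_iff₀ (by positivity)]
      nlinarith [norm_nonneg w]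
    exact norm_le_of_add_mem hpS h.r_pos hpr hs.ne' (hn.trans_le hρr)
      (face_subset D j (hd _ (Submodule.smul_mem _ _ hw) hn))
  set W := (affineSpan ℝ (D.face j)).direction with hW
  have hinj : Function.Injective (pr.domRestrict W) := by
    rw [← LinearMap.ker_eq_bot, LinearMap.ker_eq_bot']
    intro w hw
    have h1 := hle w w.2
    have h2 : pr w = 0 := hw
    rw [h2, norm_zero, mul_zero] at h1
    exact Subtype.ext (norm_le_zero_iff.1 h1)
  have hsurj : Function.Surjective (pr.domRestrict W) := by
    rw [← LinearMap.injective_iff_surjective_of_finrank_eq_finrank]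
    · exact hinj
    · rw [(h.face j).region.plane]; simp
  -- the point of the disc with the same projection as `x` is `x`
  obtain ⟨⟨w, hw⟩, hwx⟩ := hsurj (pr (x - p))
  have hwx : pr w = pr (x - p) := hwx
  have hwn : ‖w‖ < ρ := by
    have h1 := hle w hw
    rw [hwx] at h1
    have h2 := hpr1 (x - p)
    rw [← dist_eq_norm] at h2
    rw [lt_div_iff₀ hK] at hxp
    nlinarith
  have hm := hd w hw hwn
  have h1 := hpr x hx _ (face_subset D j hm)
    (hxp.trans_le ((div_le_self hρ.le (by linarith)).trans hρr))
    (by rw [dist_eq_norm, add_sub_cancel_left]; exact hwn.trans_le hρr)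
  have h2 : pr (x - (p + w)) = 0 := by
    rw [show x - (p + w) = (x - p) - w by abel, map_sub, hwx, sub_self]
  rw [h2, norm_zero, mul_zero] at h1
  rw [sub_eq_zero.1 (norm_le_zero_iff.1 h1)]
  exact hm

theorem exists_disc {j : Fin D.numFaces} {p : E3} (hp : p ∈ intrinsicInterior ℝ (D.face j)) :
    ∃ ρ > 0, ∀ w ∈ (affineSpan ℝ (D.face j)).direction, ‖w‖ < ρ → p + w ∈ D.face j := by
  rw [mem_intrinsicInterior_iff_exists_ball] at hp
  obtain ⟨hp1, ε, hε, hp2⟩ := hp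
  refine ⟨ε, hε, fun w hw hwn => hp2 _ ?_ ?_⟩
  · rw [add_comm]
    exact AffineSubspace.vadd_mem_of_mem_direction hw hp1
  · rwa [dist_eq_norm, add_sub_cancel_left]

/-- A face through a relative interior point of the `i`-th face would, by `mem_face_of_disc`, be
contained in the `i`-th face nearby, but relative interiors of faces are disjoint. -/
theorem interior_disjoint_face (h : NicePolyhedron r θ M M₁ D) {i j : Fin D.numFaces}
    (hij : i ≠ j) : Disjoint (intrinsicInterior ℝ (D.face i)) (D.face j) := by
  rw [Set.disjoint_left]
  intro x hx hxj
  have hK : 0 < 1 + M := by linarith [h.one_le]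
  obtain ⟨ρ, hρ, hd⟩ := exists_disc hx
  set ρ' := min ρ r with hρ'
  have hρ'0 : 0 < ρ' := lt_min hρ h.r_pos
  have hd' : ∀ w ∈ (affineSpan ℝ (D.face i)).direction, ‖w‖ < ρ' → x + w ∈ D.face i :=
    fun w hw hwn => hd w hw (hwn.trans_le (min_le_left _ _))
  obtain ⟨y, hy, hyx⟩ := (h.face j).exists_interior_near hxj (div_pos hρ'0 hK)
  have hyi : y ∈ D.face i := h.mem_face_of_disc hρ'0 (min_le_right _ _) hd'
    (face_subset D j (intrinsicInterior_subset hy)) hyx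
  have hyx' : dist y x < ρ := hyx.trans_le
    ((div_le_self hρ'0.le (by linarith [h.one_le])).trans (min_le_left _ _))
  refine Set.disjoint_left.1 (D.faces_disjoint i j hij) ?_ hy
  rw [mem_intrinsicInterior_iff_exists_ball]
  refine ⟨subset_affineSpan ℝ _ hyi, ρ - dist y x, by linarith, fun z hz hzy => ?_⟩
  have := hd (z - x) (AffineSubspace.vsub_mem_direction hz (subset_affineSpan ℝ _
    (intrinsicInterior_subset hx))) ?_
  · rwa [add_sub_cancel] at this
  · rw [← dist_eq_norm]
    linarith [dist_triangle z y x]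

/-- Around a point of a side, the boundary consists of the two faces that share the side. -/
theorem mem_faces_of_near_hinge (h : NicePolyhedron r θ M M₁ D) {a b : E3} {i j : Fin D.numFaces}
    {u u' : E3} (hh : D.IsHinge r θ M a b i j u u') {P : E3} (hP : P ∈ segment ℝ a b) {τ : ℝ}
    (hτ : 0 < τ) (hτr : τ ≤ r) (h1 : τ ≤ dist P a) (h2 : τ ≤ dist P b) {x : E3}
    (hx : x ∈ frontier D.carrier) (hxP : dist x P < τ / (1 + M) ^ 2) :
    x ∈ D.face i ∨ x ∈ D.face j := by
  have hM := h.one_le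
  have hK : 0 < 1 + M := by linarith
  have hr := h.r_pos
  have hab : a ≠ b := by
    rintro rfl
    rw [segment_same] at hP
    rw [Set.mem_singleton_iff.1 hP, dist_self] at h1
    linarith
  set t := unitDir a b with ht
  have ht1 : ‖t‖ = 1 := norm_unitDir hab
  have hτK : τ / (1 + M) ≤ τ := div_le_self hτ.le (by linarith)
  have hsegi : segment ℝ a b ⊆ D.face i := by
    obtain ⟨k, hk⟩ := hh.side_left
    rw [← hk]; exact (h.face i).side_subset_face k
  have hsegj : segment ℝ a b ⊆ D.face j := by
    obtain ⟨k, hk⟩ := hh.side_right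
    rw [← hk]; exact (h.face j).side_subset_face k
  have hPS := face_subset D i (hsegi hP)
  obtain ⟨pr, hpr1, hpr⟩ := h.proj P hPS
  have htl : ∀ c : ℝ, |c| ≤ τ → P + c • t ∈ segment ℝ a b := fun c hc =>
    abs_le_add_smul_unitDir_mem hab hP h1 h2 hc
  -- in both half planes the projection does not shrink much
  have key : ∀ (l : Fin D.numFaces) (n : E3), IsInnerNormal r M (D.face l) a b n →
      segment ℝ a b ⊆ D.face l →
      (∀ w ∈ (affineSpan ℝ (D.face l)).direction, ‖w‖ < τ / (1 + M) → 0 ≤ ⟪n, w⟫ →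
        P + w ∈ D.face l) ∧
      ∀ w ∈ (affineSpan ℝ (D.face l)).direction, ‖w‖ ≤ (1 + M) * ‖pr w‖ := by
    intro l n hn hl
    have hA : ∀ w ∈ (affineSpan ℝ (D.face l)).direction, ‖w‖ < τ / (1 + M) → 0 ≤ ⟪n, w⟫ →
        P + w ∈ D.face l := by
      intro w hw hwn hnw
      rcases hnw.eq_or_lt with h0 | h0
      · have he := hn.expand w hw
        rw [← h0, zero_smul, add_zero] at he
        rw [he]
        refine hl (htl _ ?_)
        have := abs_real_inner_le_norm t w
        rw [ht1, one_mul] at this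
        linarith
      · exact intrinsicInterior_subset ((hn.sides τ hτ hτr P hP h1 h2 w hw hwn).1 h0)
    refine ⟨hA, fun w hw => ?_⟩
    -- either `w` or `-w` points into the half plane of the face
    obtain ⟨s, hs, hsn, hsi⟩ : ∃ s : ℝ, s ≠ 0 ∧ ‖s • w‖ < τ / (1 + M) ∧ 0 ≤ ⟪n, s • w⟫ := by
      have hs : 0 < τ / (1 + M) / (2 * (‖w‖ + 1)) := by positivity
      have hn' : ‖(τ / (1 + M) / (2 * (‖w‖ + 1))) • w‖ < τ / (1 + M) := by
        rw [norm_smul, Real.norm_of_nonneg hs.le, div_mul_eq_mul_div, div_lt_iff₀ (by positivity)]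
        have : 0 < τ / (1 + M) := by positivity
        nlinarith [norm_nonneg w]
      rcases le_total 0 ⟪n, w⟫ with h0 | h0
      · exact ⟨_, hs.ne', hn', by rw [inner_smul_right]; positivity⟩
      · refine ⟨-(τ / (1 + M) / (2 * (‖w‖ + 1))), by linarith, by rwa [neg_smul, norm_neg], ?_⟩
        rw [inner_smul_right]; nlinarith
    exact norm_le_of_add_mem hPS hr hpr hs (by linarith)
      (face_subset D l (hA _ (Submodule.smul_mem _ _ hw) hsn hsi))
  obtain ⟨hAi, hBi⟩ := key i u hh.left hsegi
  obtain ⟨hAj, hBj⟩ := key j u' hh.right hsegj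
  have htW : ∀ l : Fin D.numFaces, segment ℝ a b ⊆ D.face l →
      t ∈ (affineSpan ℝ (D.face l)).direction := fun l hl =>
    (h.face l).unitDir_mem (hl (left_mem_segment ℝ a b)) (hl (right_mem_segment ℝ a b))
  have hti := htW i hsegi
  have htj := htW j hsegj
  set W := (affineSpan ℝ (D.face i)).direction with hW
  have hinj : Function.Injective (pr.domRestrict W) := by
    rw [← LinearMap.ker_eq_bot, LinearMap.ker_eq_bot']
    intro w hw
    have h1 := hBi w w.2
    have h2 : pr w = 0 := hw
    rw [h2, norm_zero, mul_zero] at h1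
    exact Subtype.ext (norm_le_zero_iff.1 h1)
  have hsurj : Function.Surjective (pr.domRestrict W) := by
    rw [← LinearMap.injective_iff_surjective_of_finrank_eq_finrank]
    · exact hinj
    · rw [(h.face i).region.plane]; simp
  -- coordinates in the plane of the chart with respect to the projections of `t` and `u`
  have hcoord : ∀ y : E3, ∃ γ δ : ℝ, pr (γ • t + δ • u) = pr y := by
    intro y
    obtain ⟨⟨w, hw⟩, hwy⟩ := hsurj (pr y)
    refine ⟨⟪t, w⟫, ⟪u, w⟫, ?_⟩
    rw [← hh.left.expand w hw]
    exact hwy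
  have hiu : ∀ γ δ : ℝ, ⟪u, γ • t + δ • u⟫ = δ := fun γ δ => by
    rw [inner_add_right, inner_smul_right, inner_smul_right, real_inner_comm, hh.left.orth,
      real_inner_self_eq_norm_sq, hh.left.unit]; ring
  have hju : ∀ γ δ : ℝ, ⟪u', γ • t + δ • u'⟫ = δ := fun γ δ => by
    rw [inner_add_right, inner_smul_right, inner_smul_right, real_inner_comm, hh.right.orth,
      real_inner_self_eq_norm_sq, hh.right.unit]; ring
  have hWi : ∀ γ δ : ℝ, γ • t + δ • u ∈ W := fun γ δ =>
    Submodule.add_mem _ (Submodule.smul_mem _ _ hti) (Submodule.smul_mem _ _ hh.left.mem)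
  have hWj : ∀ γ δ : ℝ, γ • t + δ • u' ∈ (affineSpan ℝ (D.face j)).direction := fun γ δ =>
    Submodule.add_mem _ (Submodule.smul_mem _ _ htj) (Submodule.smul_mem _ _ hh.right.mem)
  -- two points of the boundary with the same projection coincide
  have heq : ∀ y z : E3, P + y ∈ frontier D.carrier → P + z ∈ frontier D.carrier → ‖y‖ < r →
      ‖z‖ < r → pr y = pr z → P + y = P + z := by
    intro y z hy hz hyn hzn hyz
    have := hpr _ hy _ hz (by rwa [dist_eq_norm, add_sub_cancel_left])
      (by rwa [dist_eq_norm, add_sub_cancel_left])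
    rw [add_sub_add_left_eq_sub, map_sub, hyz, sub_self, norm_zero, mul_zero] at this
    rw [sub_eq_zero.1 (norm_le_zero_iff.1 this)]
  obtain ⟨α, β, hαβ⟩ := hcoord u'
  -- the projections of the two faces lie on different sides of the projection of the edge
  have hβ0 : β < 0 := by
    by_contra hβ
    rw [not_lt] at hβ
    rcases hβ.eq_or_lt with h0 | h0
    -- the projection is injective on the plane of the `j`-th face
    · rw [← h0, zero_smul, add_zero] at hαβ
      have h3 := hBj (α • t + (-1 : ℝ) • u') (hWj _ _)
      rw [map_add, hαβ, ← map_add, neg_smul, one_smul, add_neg_cancel, map_zero, norm_zero,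
        mul_zero] at h3
      have h4 := hju α (-1)
      rw [neg_smul, one_smul, norm_le_zero_iff.1 h3, inner_zero_right] at h4
      norm_num at h4
    · -- the two half planes would overlap
      set R := ‖α • t + β • u‖ + 1 with hR
      have hR0 : 0 < R := by positivity
      set s := τ / (1 + M) / (2 * R) with hs
      have hs0 : 0 < s := by positivity
      have hsR : s * R < τ / (1 + M) := by
        rw [hs]; field_simp; linarith
      have hR1 : 1 ≤ R := by rw [hR]; linarith [norm_nonneg (α • t + β • u)]
      have n1 : ‖s • (α • t + β • u)‖ < τ / (1 + M) := by
        rw [norm_smul, Real.norm_of_nonneg hs0.le]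
        have : s * ‖α • t + β • u‖ ≤ s * R := by gcongr; linarith
        linarith
      have n2 : ‖s • u'‖ < τ / (1 + M) := by
        rw [norm_smul, Real.norm_of_nonneg hs0.le, hh.right.unit]
        nlinarith
      have m1 := (hh.left.sides τ hτ hτr P hP h1 h2 _ (Submodule.smul_mem _ s (hWi α β)) n1).1
        (by rw [inner_smul_right, hiu]; positivity)
      have m2 := (hh.right.sides τ hτ hτr P hP h1 h2 _ (Submodule.smul_mem _ s hh.right.mem)
        n2).1 (by rw [inner_smul_right, real_inner_self_eq_norm_sq, hh.right.unit]; positivity)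
      have h3 := heq _ _ (face_subset D i (intrinsicInterior_subset m1))
        (face_subset D j (intrinsicInterior_subset m2)) (by linarith) (by linarith)
        (by rw [map_smul, map_smul, hαβ])
      rw [h3] at m1
      exact Set.disjoint_left.1 (D.faces_disjoint i j hh.ne) m1 m2
  have hxn : ‖x - P‖ * (1 + M) < τ / (1 + M) := by
    rw [dist_eq_norm, lt_div_iff₀ (by positivity)] at hxP
    rw [lt_div_iff₀ hK]; linarith
  have hxn' : ‖x - P‖ < r := by
    have := norm_nonneg (x - P)
    nlinarith
  have hxe : P + (x - P) = x := by abel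
  obtain ⟨γ, δ, hγδ⟩ := hcoord (x - P)
  -- `x` is the point of the `i`-th or of the `j`-th face with the same projection, depending on the
  -- side of the projected edge on which it lies
  rcases le_or_gt 0 δ with hδ | hδ
  · left
    have n1 : ‖γ • t + δ • u‖ < τ / (1 + M) := by
      have h3 := hBi _ (hWi γ δ)
      rw [hγδ] at h3
      have h4 := hpr1 (x - P)
      nlinarith
    have m1 := hAi _ (hWi γ δ) n1 (by rw [hiu]; exact hδ)
    rw [← hxe, ← heq _ _ (face_subset D i m1) (hxe.symm ▸ hx) (by linarith) hxn' hγδ]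
    exact m1
  · right
    have hpe : pr ((γ - δ * α / β) • t + (δ / β) • u') = pr (x - P) := by
      rw [← hγδ, map_add, map_smul _ (δ / β), ← hαβ]
      simp only [map_add, map_smul]
      match_scalars <;> field_simp [hβ0.ne]
      ring
    have n1 : ‖(γ - δ * α / β) • t + (δ / β) • u'‖ < τ / (1 + M) := by
      have h3 := hBj _ (hWj (γ - δ * α / β) (δ / β))
      rw [hpe] at h3
      have h4 := hpr1 (x - P)
      nlinarith
    have m1 := hAj _ (hWj _ _) n1 (by rw [hju]; exact (div_pos_of_neg_of_neg hδ hβ0).le)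
    rw [← hxe, ← heq _ _ (face_subset D j m1) (hxe.symm ▸ hx) (by linarith) hxn' hpe]
    exact m1

/-- In the relative interior of an edge only the two faces that share it meet. -/
theorem eq_or_eq_of_mem_hinge (h : NicePolyhedron r θ M M₁ D) {a b : E3} {i j l : Fin D.numFaces}
    {u u' : E3} (hh : D.IsHinge r θ M a b i j u u') {P : E3} (hP : P ∈ segment ℝ a b)
    (ha : P ≠ a) (hb : P ≠ b) (hl : P ∈ D.face l) : l = i ∨ l = j := by
  set τ := min r (min (dist P a) (dist P b)) with hτ
  have hτ0 : 0 < τ := lt_min h.r_pos (lt_min (dist_pos.2 ha) (dist_pos.2 hb))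
  have hK : 0 < 1 + M := by linarith [h.one_le]
  obtain ⟨y, hy, hyP⟩ := (h.face l).exists_interior_near hl (ε := τ / (1 + M) ^ 2) (by positivity)
  rcases h.mem_faces_of_near_hinge hh hP hτ0 (min_le_left _ _)
    ((min_le_right _ _).trans (min_le_left _ _)) ((min_le_right _ _).trans (min_le_right _ _))
    (face_subset D l (intrinsicInterior_subset hy)) hyP with h1 | h1
  · left; by_contra hne
    exact Set.disjoint_left.1 (h.interior_disjoint_face hne) hy h1
  · right; by_contra hne
    exact Set.disjoint_left.1 (h.interior_disjoint_face hne) hy h1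

theorem not_mem_interior_of_corner (h : NicePolyhedron r θ M M₁ D) (i j : Fin D.numFaces)
    (k : ZMod (D.numSides i)) : D.corner i k ∉ intrinsicInterior ℝ (D.face j) := by
  intro hm
  by_cases hij : j = i
  · subst hij
    exact not_mem_intrinsicFrontier hm ((h.face j).corner_mem k)
  · exact Set.disjoint_left.1 (h.interior_disjoint_face hij) hm ((h.face i).corner_mem_face k)

/-- A vertex of the polyhedron that lies on a face is a corner of that face. -/
theorem exists_corner_of_mem_face (h : NicePolyhedron r θ M M₁ D) {p : E3} (hp : p ∈ D.vertices)
    {j : Fin D.numFaces} (hj : p ∈ D.face j) : ∃ k, D.corner j k = p := by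
  obtain ⟨i, m, rfl⟩ := hp
  have h1 := ((mem_face_iff (h.face j).isClosed).1 hj).resolve_left
    (h.not_mem_interior_of_corner i j m)
  rw [(h.face j).region.relBoundary] at h1
  obtain ⟨k, hk⟩ := Set.mem_iUnion.1 h1
  by_cases ha : D.corner i m = D.corner j k
  · exact ⟨k, ha.symm⟩
  by_cases hb : D.corner i m = D.corner j (k + 1)
  · exact ⟨k + 1, hb.symm⟩
  exfalso
  obtain ⟨j', u, u', hh⟩ := h.exists_hinge j k
  -- otherwise `p` is in the relative interior of a side of the `j`-th face; the only faces there
  -- have that side, and `p` is not a corner of it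
  have hend : ∀ l, i = l → (∃ s, D.side l s = segment ℝ (D.corner j k) (D.corner j (k + 1))) →
      False := by
    rintro l rfl ⟨s, hs⟩
    have h2 : D.corner i m ∈ segment ℝ (D.corner i s) (D.corner i (s + 1)) := by
      change _ ∈ D.side i s
      rw [hs]; exact hk
    rcases eq_or_eq_of_segment_eq ((h.face j).corner_ne k) hs with ⟨h3, h4⟩ | ⟨h3, h4⟩ <;>
    rcases (h.face i).corner_mem_side h2 with h5 | h5
    · exact ha (by rw [h5, h3])
    · exact hb (by rw [h5, h4])
    · exact hb (by rw [h5, h3])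
    · exact ha (by rw [h5, h4])
  rcases h.eq_or_eq_of_mem_hinge hh hk ha hb ((h.face i).corner_mem_face m) with h2 | h2
  · exact hend _ h2 hh.side_left
  · exact hend _ h2 hh.side_right

/-- Distinct vertices are separated. If they are corners of one face, this is a property of the face.
Otherwise a short path along the boundary joins them, and it has to leave the union of the faces at
`p` through the relative interior of a side at `p`; but there only two faces meet, both of them
containing `p`. -/
theorem vertex_dist (h : NicePolyhedron r θ M M₁ D) {p q : E3} (hp : p ∈ D.vertices)
    (hq : q ∈ D.vertices) (hpq : p ≠ q) : r / (1 + M) ^ 2 ≤ dist p q := by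
  have hM := h.one_le
  have hr := h.r_pos
  have hK : 0 < 1 + M := by linarith
  by_contra hlt
  rw [not_le] at hlt
  have hlt' : dist p q < r / (1 + M) := hlt.trans_le (by gcongr; nlinarith)
  -- no face contains both
  have hno : ∀ l, p ∈ D.face l → q ∉ D.face l := by
    intro l h1 h2
    obtain ⟨k, rfl⟩ := h.exists_corner_of_mem_face hp h1
    obtain ⟨m, rfl⟩ := h.exists_corner_of_mem_face hq h2
    have := (h.face l).corner_dist (k := m) (l := k) (fun h3 => hpq (by rw [h3]))
    linarith
  have hpS : p ∈ frontier D.carrier := by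
    obtain ⟨i, k, rfl⟩ := hp; exact face_subset D i ((h.face i).corner_mem_face k)
  have hqS : q ∈ frontier D.carrier := by
    obtain ⟨i, k, rfl⟩ := hq; exact face_subset D i ((h.face i).corner_mem_face k)
  obtain ⟨γ, h0, h1, hS, hL⟩ := h.path p hpS q hqS hlt'
  have hcont : ContinuousOn γ (Set.Icc 0 1) := by
    refine LipschitzOnWith.continuousOn (K := ((1 + M) * dist p q).toNNReal)
      (LipschitzOnWith.of_dist_le_mul fun s hs t ht => ?_)
    rw [Real.coe_toNNReal _ (by positivity), Real.dist_eq]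
    exact hL s hs t ht
  -- the faces containing `p`, and the other faces
  set A : Set E3 := ⋃ l : {l // p ∈ D.face l}, D.face l with hA
  set B : Set E3 := ⋃ l : {l // p ∉ D.face l}, D.face l with hB
  have hAc : IsClosed A := isClosed_iUnion_of_finite fun l => (h.face l).isClosed
  have hBc : IsClosed B := isClosed_iUnion_of_finite fun l => (h.face l).isClosed
  have hpre : IsPreconnected (γ '' Set.Icc 0 1) := isPreconnected_Icc.image _ hcont
  obtain ⟨z, ⟨s, hs, rfl⟩, hzA, hzB⟩ := isPreconnected_closed_iff.1 hpre A B hAc hBc (by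
      rintro _ ⟨s, hs, rfl⟩
      obtain ⟨l, hl⟩ := exists_face D (hS s hs)
      by_cases hpl : p ∈ D.face l
      · exact Or.inl (Set.mem_iUnion.2 ⟨⟨l, hpl⟩, hl⟩)
      · exact Or.inr (Set.mem_iUnion.2 ⟨⟨l, hpl⟩, hl⟩))
    (by
      obtain ⟨l, hl⟩ := exists_face D hpS
      exact ⟨p, ⟨0, by simp, h0⟩, Set.mem_iUnion.2 ⟨⟨l, hl⟩, hl⟩⟩)
    (by
      obtain ⟨l, hl⟩ := exists_face D hqS
      exact ⟨q, ⟨1, by simp, h1⟩, Set.mem_iUnion.2 ⟨⟨l, fun h3 => hno l h3 hl⟩, hl⟩⟩)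
  obtain ⟨⟨l, hpl⟩, hzl⟩ := Set.mem_iUnion.1 hzA
  obtain ⟨⟨m, hpm⟩, hzm⟩ := Set.mem_iUnion.1 hzB
  have hlm : l ≠ m := fun h3 => hpm (h3 ▸ hpl)
  simp only at hzl hzm
  have hzd : dist (γ s) p < r / (1 + M) := by
    have h3 := hL s hs 0 (by simp)
    rw [h0, sub_zero, abs_of_nonneg hs.1] at h3
    have h4 : (1 + M) * dist p q * s ≤ (1 + M) * dist p q * 1 := by
      have := hs.2; gcongr
    rw [lt_div_iff₀ (by positivity)] at hlt
    rw [lt_div_iff₀ hK]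
    nlinarith
  have hzp : γ s ≠ p := fun h3 => hpm (h3 ▸ hzm)
  have hzf : γ s ∈ intrinsicFrontier ℝ (D.face l) :=
    ((mem_face_iff (h.face l).isClosed).1 hzl).resolve_left fun h3 =>
      Set.disjoint_left.1 (h.interior_disjoint_face hlm) h3 hzm
  obtain ⟨k, rfl⟩ := h.exists_corner_of_mem_face hp hpl
  have hrK : r / (1 + M) ≤ r := div_le_self hr.le (by linarith)
  -- a common point of `A` and `B` cannot lie in the relative interior of a side at `p`
  have hfin : ∀ k' : ZMod (D.numSides l), γ s ∈ D.side l k' → D.corner l k ∈ D.side l k' →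
      γ s ≠ D.corner l k' → γ s ≠ D.corner l (k' + 1) → False := by
    intro k' h3 h4 h5 h6
    obtain ⟨j', u, u', hh⟩ := h.exists_hinge l k'
    rcases h.eq_or_eq_of_mem_hinge hh h3 h5 h6 hzm with h7 | h7
    · exact hlm h7.symm
    · obtain ⟨t, ht⟩ := hh.side_right
      refine hpm ?_
      rw [h7]
      refine (h.face j').side_subset_face t ?_
      change _ ∈ D.side j' t
      rw [ht]; exact h4
  rcases (h.face l).frontier_near_corner hzf hzd with h3 | h3
  -- the path is too short to reach the other end of a side at `p`
  · refine hfin k h3 (left_mem_segment ℝ _ _) hzp fun h4 => ?_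
    rw [h4, dist_comm] at hzd
    linarith [(h.face l).len k]
  · have h3' := ((h.face l).prev_mem_iff k _).1 h3
    have hk1 : k - 1 + 1 = k := by ring
    refine hfin (k - 1) h3' ?_ (fun h4 => ?_) (by rwa [hk1])
    · change _ ∈ segment ℝ _ _
      rw [hk1]; exact right_mem_segment ℝ _ _
    · rw [h4, dist_comm] at hzd
      linarith [(h.face l).prev_len k]

end NicePolyhedron

/-! ### Edges of neighbouring polyhedra -/

/-- Three directions in general position determine a unit vector: if its components along them are
at most `ε`, then `ε` is bounded below. -/
theorem sin_sq_le_of_inner_le {θ ε : ℝ} {t u₁ u₂ ν : E3} (hθ : 0 < θ) (hθ' : θ < Real.pi / 2)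
    (ht : ‖t‖ = 1) (hu₁ : ‖u₁‖ = 1) (hu₂ : ‖u₂‖ = 1) (h₁ : ⟪t, u₁⟫ = 0) (h₂ : ⟪t, u₂⟫ = 0)
    (h : |⟪u₁, u₂⟫| ≤ Real.cos θ) (hν : ‖ν‖ = 1) (h0 : |⟪t, ν⟫| ≤ ε)
    (h1 : |⟪u₁, ν⟫| ≤ ε) (h2 : |⟪u₂, ν⟫| ≤ ε) : Real.sin θ ^ 2 ≤ 6 * ε ^ 2 := by
  have hs : 0 < Real.sin θ := Real.sin_pos_of_pos_of_lt_pi hθ (by linarith [Real.pi_pos])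
  have hε : 0 ≤ ε := (abs_nonneg _).trans h0
  have htt : ⟪t, t⟫ = 1 := by rw [real_inner_self_eq_norm_sq, ht]; norm_num
  have h11 : ⟪u₁, u₁⟫ = 1 := by rw [real_inner_self_eq_norm_sq, hu₁]; norm_num
  have h22 : ⟪u₂, u₂⟫ = 1 := by rw [real_inner_self_eq_norm_sq, hu₂]; norm_num
  set c := ⟪u₁, u₂⟫ with hc
  have h21 : ⟪u₂, u₁⟫ = c := real_inner_comm _ _
  have hc2 : c ^ 2 ≤ Real.cos θ ^ 2 := by
    rw [← sq_abs]; gcongr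
  have hsc := Real.sin_sq_add_cos_sq θ
  have hcs : 0 < 1 - c ^ 2 := by nlinarith
  set s := √(1 - c ^ 2) with hsdef
  have hs2 : s ^ 2 = 1 - c ^ 2 := Real.sq_sqrt hcs.le
  have hs0 : 0 < s := Real.sqrt_pos.2 hcs
  -- the orthonormal basis `t`, `u₁`, `e` obtained from `t`, `u₁`, `u₂`
  set e : E3 := s⁻¹ • (u₂ - c • u₁) with he
  have hte : ⟪t, e⟫ = 0 := by
    rw [he, inner_smul_right, inner_sub_right, inner_smul_right, h₁, h₂]; simp
  have hue : ⟪u₁, e⟫ = 0 := by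
    rw [he, inner_smul_right, inner_sub_right, inner_smul_right, h11, ← hc]; simp
  have hee : ⟪e, e⟫ = 1 := by
    rw [he, inner_smul_right, inner_smul_left, inner_sub_right, inner_sub_left, inner_sub_left,
      inner_smul_right, inner_smul_left, inner_smul_left, inner_smul_right, h11, h22, h21, ← hc]
    simp only [conj_trivial]
    field_simp
    nlinarith
  have hort : Orthonormal ℝ ![t, u₁, e] := by
    rw [orthonormal_iff_ite]
    intro i j
    have hut : ⟪u₁, t⟫ = 0 := by rw [real_inner_comm]; exact h₁
    have het : ⟪e, t⟫ = 0 := by rw [real_inner_comm]; exact hte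
    have heu : ⟪e, u₁⟫ = 0 := by rw [real_inner_comm]; exact hue
    fin_cases i <;> fin_cases j
    exacts [htt, h₁, hte, hut, h11, hue, het, heu, hee]
  have hcard : Fintype.card (Fin 3) = Module.finrank ℝ E3 := by simp
  set b := (basisOfOrthonormalOfCardEqFinrank hort hcard).toOrthonormalBasis (by simpa using hort)
  have hb : ⇑b = ![t, u₁, e] := by simp [b]
  have hsum := b.sum_sq_norm_inner_right ν
  rw [Fin.sum_univ_three, hb, hν] at hsum
  simp only [Matrix.cons_val_zero, Matrix.cons_val_one, Matrix.cons_val_two, Matrix.head_cons,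
    Matrix.tail_cons, Real.norm_eq_abs, sq_abs] at hsum
  have q0 : ⟪t, ν⟫ ^ 2 ≤ ε ^ 2 := by rw [← sq_abs]; gcongr
  have q1 : ⟪u₁, ν⟫ ^ 2 ≤ ε ^ 2 := by rw [← sq_abs]; gcongr
  have q2 : (s * ⟪e, ν⟫) ^ 2 ≤ (2 * ε) ^ 2 := by
    have h3 : s * ⟪e, ν⟫ = ⟪u₂, ν⟫ - c * ⟪u₁, ν⟫ := by
      rw [he, inner_smul_left, inner_sub_left, inner_smul_left, conj_trivial, conj_trivial,
        mul_inv_cancel_left₀ hs0.ne']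
    have h4 : |c| ≤ 1 := h.trans (Real.cos_le_one _)
    rw [h3, ← sq_abs]
    have h5 : |⟪u₂, ν⟫ - c * ⟪u₁, ν⟫| ≤ 2 * ε := by
      refine (abs_sub _ _).trans ?_
      rw [abs_mul]
      have : |c| * |⟪u₁, ν⟫| ≤ 1 * ε := mul_le_mul h4 h1 (abs_nonneg _) zero_le_one
      linarith
    gcongr
  have hsin : Real.sin θ ^ 2 ≤ s ^ 2 := by rw [hs2]; linarith
  have hs1 : s ^ 2 ≤ 1 := by rw [hs2]; linarith [sq_nonneg c]
  have q3 : s ^ 2 * 1 = s ^ 2 * ⟪t, ν⟫ ^ 2 + s ^ 2 * ⟪u₁, ν⟫ ^ 2 + (s * ⟪e, ν⟫) ^ 2 := by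
    rw [mul_pow, ← mul_add, ← mul_add, hsum, one_pow]
  have q4 : s ^ 2 * ⟪t, ν⟫ ^ 2 ≤ 1 * ε ^ 2 := mul_le_mul hs1 q0 (sq_nonneg _) zero_le_one
  have q5 : s ^ 2 * ⟪u₁, ν⟫ ^ 2 ≤ 1 * ε ^ 2 := mul_le_mul hs1 q1 (sq_nonneg _) zero_le_one
  linarith

theorem exists_unit_normal {W : Submodule ℝ E3} (hW : Module.finrank ℝ W = 2) :
    ∃ ν : E3, ‖ν‖ = 1 ∧ ∀ w ∈ W, ⟪w, ν⟫ = 0 := by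
  have h1 := W.finrank_add_finrank_orthogonal
  rw [hW, finrank_euclideanSpace_fin] at h1
  have h2 : 0 < Module.finrank ℝ Wᗮ := by omega
  have : Nontrivial Wᗮ := Module.finrank_pos_iff.1 h2
  obtain ⟨⟨x, hx⟩, hx0⟩ := exists_ne (0 : Wᗮ)
  have hx0' : x ≠ 0 := fun h => hx0 (Subtype.ext h)
  refine ⟨‖x‖⁻¹ • x, by rw [norm_smul, norm_inv, norm_norm, inv_mul_cancel₀ (norm_ne_zero_iff.2 hx0')],
    fun w hw => ?_⟩
  rw [inner_smul_right, (Submodule.mem_orthogonal W x).1 hx w hw, mul_zero]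

/-- A point of a long segment can be moved by at most `τ` to a point far from both ends. -/
theorem exists_deep_point {a b e : E3} {τ : ℝ} (hτ : 0 ≤ τ) (hab : a ≠ b) (hL : 2 * τ ≤ dist a b)
    (he : e ∈ segment ℝ a b) :
    ∃ P ∈ segment ℝ a b, dist P e ≤ τ ∧ τ ≤ dist P a ∧ τ ≤ dist P b := by
  obtain ⟨h1, h2, h3⟩ := segment_param hab he
  have ha := @dist_nonneg _ _ e a
  have hb := @dist_nonneg _ _ e b
  obtain ⟨ε, e1, e2, e3⟩ : ∃ ε : ℝ, |ε| ≤ τ ∧ τ ≤ dist e a + ε ∧ ε + τ ≤ dist e b := by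
    rcases le_total τ (dist e a) with h4 | h4
    · rcases le_total τ (dist e b) with h5 | h5
      · exact ⟨0, by simpa, by linarith, by linarith⟩
      · exact ⟨dist e b - τ, abs_le.2 ⟨by linarith, by linarith⟩, by linarith, by linarith⟩
    · exact ⟨τ - dist e a, abs_le.2 ⟨by linarith, by linarith⟩, by linarith, by linarith⟩
  have hn := norm_unitDir hab
  refine ⟨e + ε • unitDir a b, add_smul_unitDir_mem hab he (by linarith) (by linarith), ?_, ?_, ?_⟩
  · rw [dist_eq_norm, add_sub_cancel_left, norm_smul, hn, mul_one]; exact e1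
  · have : e + ε • unitDir a b - a = (dist e a + ε) • unitDir a b := by
      nth_rewrite 1 [h1]; module
    rw [dist_eq_norm, this, norm_smul, hn, mul_one, Real.norm_eq_abs]
    exact e2.trans (le_abs_self _)
  · have : e + ε • unitDir a b - b = (-(dist e b - ε)) • unitDir a b := by
      nth_rewrite 1 [h2]; module
    rw [dist_eq_norm, this, norm_smul, hn, mul_one, Real.norm_eq_abs, abs_neg]
    exact (by linarith : τ ≤ dist e b - ε).trans (le_abs_self _)

namespace Polyhedron

/-- The union of the edges. -/
def edgeSet (D : Polyhedron) : Set E3 := {x | ∃ j k, x ∈ D.side j k}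

/-- The boundaries of `D` and `D'` lie in the closed `d`-neighbourhoods of each other. -/
structure IsClose (D D' : Polyhedron) (d : ℝ) : Prop where
  fwd : ∀ x ∈ frontier D.carrier, ∃ y ∈ frontier D'.carrier, dist x y ≤ d
  bwd : ∀ x ∈ frontier D'.carrier, ∃ y ∈ frontier D.carrier, dist x y ≤ d

theorem IsClose.symm {D D' : Polyhedron} {d : ℝ} (h : D.IsClose D' d) : D'.IsClose D d :=
  ⟨h.bwd, h.fwd⟩

theorem IsClose.mono {D D' : Polyhedron} {d δ : ℝ} (h : D.IsClose D' d) (hd : d ≤ δ) :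
    D.IsClose D' δ :=
  ⟨fun x hx => let ⟨y, hy, h1⟩ := h.fwd x hx; ⟨y, hy, h1.trans hd⟩,
    fun x hx => let ⟨y, hy, h1⟩ := h.bwd x hx; ⟨y, hy, h1.trans hd⟩⟩

end Polyhedron

namespace NicePolyhedron

variable {r θ M M₁ : ℝ} {D D' : Polyhedron}

theorem frontier_subset_edgeSet (h : NicePolyhedron r θ M M₁ D) (j : Fin D.numFaces) :
    intrinsicFrontier ℝ (D.face j) ⊆ D.edgeSet := by
  rw [(h.face j).region.relBoundary]
  exact Set.iUnion_subset fun k x hx => ⟨j, k, hx⟩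

theorem edgeSet_subset (h : NicePolyhedron r θ M M₁ D) : D.edgeSet ⊆ frontier D.carrier := by
  rintro x ⟨j, k, hx⟩
  exact face_subset D j ((h.face j).side_subset_face k hx)

theorem vertices_subset (h : NicePolyhedron r θ M M₁ D) : D.vertices ⊆ D.edgeSet := by
  rintro _ ⟨j, k, rfl⟩
  exact h.frontier_subset_edgeSet j ((h.face j).corner_mem k)

theorem not_mem_edgeSet_of_interior (h : NicePolyhedron r θ M M₁ D) {j : Fin D.numFaces} {x : E3}
    (hx : x ∈ intrinsicInterior ℝ (D.face j)) : x ∉ D.edgeSet := by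
  rintro ⟨i, k, hk⟩
  by_cases hij : j = i
  · subst hij
    exact not_mem_intrinsicFrontier hx ((h.face j).side_subset k hk)
  · exact Set.disjoint_left.1 (h.interior_disjoint_face hij) hx ((h.face i).side_subset_face k hk)

theorem mem_edgeSet_of_mem_faces (h : NicePolyhedron r θ M M₁ D) {i j : Fin D.numFaces}
    (hij : i ≠ j) {x : E3} (hi : x ∈ D.face i) (hj : x ∈ D.face j) : x ∈ D.edgeSet :=
  h.frontier_subset_edgeSet i <| ((mem_face_iff (h.face i).isClosed).1 hi).resolve_left fun h1 =>
    Set.disjoint_left.1 (h.interior_disjoint_face hij) h1 hj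

/-- A face contains the discs around its points that do not meet its boundary. -/
theorem _root_.NicePolygon.disc_subset {F : Set E3} {n : ℕ} {v : ZMod n → E3}
    (h : NicePolygon r θ M F n v) {p : E3} (hp : p ∈ F) {ρ : ℝ}
    (hd : ∀ z ∈ intrinsicFrontier ℝ F, ρ ≤ dist p z) {w : E3}
    (hw : w ∈ (affineSpan ℝ F).direction) (hwρ : ‖w‖ < ρ) : p + w ∈ intrinsicInterior ℝ F := by
  have hpre : IsPreconnected (segment ℝ p (p + w)) := (convex_segment _ _).isPreconnected
  refine hpre.subset_intrinsicInterior h.isClosed ?_ ?_ (left_mem_segment ℝ _ _) hp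
    (right_mem_segment ℝ _ _)
  · exact (affineSpan ℝ F).convex.segment_subset (subset_affineSpan ℝ F hp) (h.add_mem hp hw)
  · rw [Set.disjoint_left]
    rintro x hx hxf
    rw [segment_eq_image'] at hx
    obtain ⟨s, hs, rfl⟩ := hx
    have h1 := hd _ hxf
    rw [add_sub_cancel_left] at h1
    rw [dist_comm, dist_eq_norm, add_sub_cancel_left, norm_smul, Real.norm_of_nonneg hs.1] at h1
    nlinarith [hs.2, norm_nonneg w]

/-- No edge of a neighbouring polyhedron comes near the centre of a disc contained in a face:
the two faces meeting in the edge cannot both be nearly parallel to the disc. -/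
theorem exists_no_edge_near_disc (θ M : ℝ) (hM : 1 ≤ M) (hθ : 0 < θ) (hθ' : θ < Real.pi / 2) :
    ∃ c > 0, ∀ {r M₁ d : ℝ} {D D' : Polyhedron}, NicePolyhedron r θ M M₁ D →
      NicePolyhedron r θ M M₁ D' → D.IsClose D' d → ∀ {j : Fin D.numFaces} {p : E3} {ρ : ℝ},
      0 < ρ → ρ ≤ r → (∀ w ∈ (affineSpan ℝ (D.face j)).direction, ‖w‖ < ρ → p + w ∈ D.face j) →
      d ≤ c * ρ → ∀ e ∈ D'.edgeSet, ρ / (2 * (1 + M)) ≤ dist e p := by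
  have hs : 0 < Real.sin θ := Real.sin_pos_of_pos_of_lt_pi hθ (by linarith [Real.pi_pos])
  have hs1 := Real.sin_le_one θ
  have hK : 0 < 1 + M := by linarith
  refine ⟨Real.sin θ / (192 * M * (1 + M)), by positivity, ?_⟩
  intro r M₁ d D D' h h' hc j p ρ hρ hρr hdisc hd e he
  by_contra hlt
  rw [not_le] at hlt
  obtain ⟨i, k, he⟩ := he
  obtain ⟨i', u, u', hh⟩ := h'.exists_hinge i k
  set a := D'.corner i k
  set b := D'.corner i (k + 1)
  have hab : a ≠ b := (h'.face i).corner_ne k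
  have hlen : r ≤ dist a b := (h'.face i).len k
  -- the edge is followed for a length `τ` small enough to stay near the disc
  set τ := ρ / (16 * (1 + M)) with hτ
  have hτ0 : 0 < τ := by positivity
  have hτρ : 16 * ((1 + M) * τ) = ρ := by rw [hτ]; field_simp
  have hτr : 32 * τ ≤ r := by nlinarith
  obtain ⟨P, hP, hPe, hPa, hPb⟩ := exists_deep_point hτ0.le hab (by linarith) he
  set t := unitDir a b with ht
  have ht1 : ‖t‖ = 1 := norm_unitDir hab
  obtain ⟨ν, hν, hνW⟩ := exists_unit_normal (h.face j).region.plane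
  have hdτ : d ≤ τ := by
    refine hd.trans ?_
    rw [hτ, div_mul_eq_mul_div, div_le_div_iff₀ (by positivity) (by positivity)]
    have : Real.sin θ * ρ * (16 * (1 + M)) ≤ 1 * ρ * (16 * (1 + M)) := by gcongr
    have h2 : 0 < ρ * (1 + M) := by positivity
    nlinarith
  have hpF : p ∈ D.face j := by simpa using hdisc 0 (Submodule.zero_mem _) (by simpa)
  -- boundary points of `D'` near `p` are close to the plane of the disc
  have hplane : ∀ w : E3, ‖w‖ ≤ τ → P + w ∈ frontier D'.carrier → |⟪P + w - p, ν⟫| ≤ d := by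
    intro w hw hm
    obtain ⟨y, hy, hyd⟩ := hc.bwd _ hm
    have hyF : y ∈ D.face j := by
      refine h.mem_face_of_disc hρ hρr hdisc hy ?_
      have t1 := dist_triangle4 y (P + w) P e
      have t2 := dist_triangle y e p
      rw [dist_comm y (P + w)] at t1
      have t3 : dist (P + w) P ≤ τ := by rwa [dist_eq_norm, add_sub_cancel_left]
      have e1 : ρ / (2 * (1 + M)) = 8 * τ := by rw [hτ]; field_simp; ring
      have e2 : ρ / (1 + M) = 16 * τ := by rw [hτ]; field_simp
      rw [e1] at hlt
      rw [e2]
      linarith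
    have h1 : ⟪P + w - p, ν⟫ = ⟪P + w - y, ν⟫ := by
      rw [show P + w - p = (P + w - y) + (y - p) by abel, inner_add_left,
        hνW _ ((h.face j).sub_mem hyF hpF), add_zero]
    rw [h1]
    have := abs_real_inner_le_norm (P + w - y) ν
    rw [hν, mul_one, ← dist_eq_norm] at this
    exact this.trans hyd
  have hsegS : segment ℝ a b ⊆ frontier D'.carrier :=
    ((h'.face i).side_subset_face k).trans (face_subset D' i)
  have hP0 := hplane 0 (by simpa using hτ0.le) (by simpa using hsegS hP)
  rw [add_zero] at hP0
  -- hence steps along the boundary of `D'` are nearly orthogonal to the normal of the disc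
  have hdir : ∀ w : E3, ‖w‖ ≤ τ → P + w ∈ frontier D'.carrier → |⟪w, ν⟫| ≤ 2 * d := by
    intro w hw hm
    have h1 := hplane w hw hm
    have h2 : ⟪w, ν⟫ = ⟪P + w - p, ν⟫ - ⟪P - p, ν⟫ := by rw [← inner_sub_left]; congr 1; abel
    rw [h2]
    exact (abs_sub _ _).trans (by linarith)
  -- take a step of length `β` along the edge and into the two faces that meet there
  set β := τ / (2 * M) with hβ
  have hβ0 : 0 < β := by positivity
  have hβM : β < τ / M := by rw [hβ]; gcongr; linarith
  have hβτ : β ≤ τ := by rw [hβ]; exact div_le_self hτ0.le (by linarith)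
  have hτr' : τ ≤ r := by linarith
  have hun : ∀ w : E3, ‖w‖ = 1 → P + β • w ∈ frontier D'.carrier → |⟪w, ν⟫| ≤ 2 * d / β := by
    intro w hw hm
    have := hdir (β • w) (by rw [norm_smul, hw, mul_one, Real.norm_of_nonneg hβ0.le]; exact hβτ) hm
    rw [inner_smul_left, abs_mul, conj_trivial, abs_of_pos hβ0] at this
    rw [le_div_iff₀ hβ0]; linarith
  have h1 := hun t ht1 (hsegS (abs_le_add_smul_unitDir_mem hab hP hPa hPb
    (by rw [abs_of_pos hβ0]; exact hβτ)))
  have h2 := hun u hh.left.unit (face_subset D' _ (intrinsicInterior_subset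
    (hh.left.deep τ hτ0 hτr' P hP hPa hPb β hβ0 hβM)))
  have h3 := hun u' hh.right.unit (face_subset D' _ (intrinsicInterior_subset
    (hh.right.deep τ hτ0 hτr' P hP hPa hPb β hβ0 hβM)))
  have h4 := sin_sq_le_of_inner_le hθ hθ' ht1 hh.left.unit hh.right.unit hh.left.orth
    hh.right.orth hh.angle hν h1 h2 h3
  have hd0 : 0 ≤ d := by
    by_contra hneg
    obtain ⟨y, -, hy⟩ := hc.bwd P (hsegS hP)
    linarith [@dist_nonneg _ _ P y]
  have h5 : 2 * d / β ≤ Real.sin θ / 3 := by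
    rw [div_le_iff₀ hβ0, hβ, hτ]
    refine (mul_le_mul_of_nonneg_left hd (by norm_num)).trans_eq ?_
    field_simp
    norm_num
  have h6 : (2 * d / β) ^ 2 ≤ (Real.sin θ / 3) ^ 2 := by
    have : 0 ≤ 2 * d / β := by positivity
    gcongr
  nlinarith

end NicePolyhedron

namespace NicePolyhedron

variable {r θ M M₁ : ℝ} {D D' : Polyhedron}

/-- The edges of two neighbouring polyhedra are close to each other: a point of `D` near a point `e`
of an edge of `D'` lies in a face of `D`, and if it were far from the sides of this face,
`exists_no_edge_near_disc` would apply. -/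
theorem exists_edge_near_edge (θ M : ℝ) (hM : 1 ≤ M) (hθ : 0 < θ) (hθ' : θ < Real.pi / 2) :
    ∃ c > 0, ∃ K ≥ 1, ∀ {r M₁ δ : ℝ} {D D' : Polyhedron}, NicePolyhedron r θ M M₁ D →
      NicePolyhedron r θ M M₁ D' → D.IsClose D' δ → 0 < δ → δ ≤ c * r →
      ∀ e ∈ D'.edgeSet, ∃ P ∈ D.edgeSet, dist e P ≤ K * δ := by
  obtain ⟨c₀, hc₀, H⟩ := exists_no_edge_near_disc θ M hM hθ hθ'
  have hK : 0 < 1 + M := by linarith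
  set c := min c₀ (1 / (4 * (1 + M))) with hc
  have hcpos : 0 < c := lt_min hc₀ (by positivity)
  refine ⟨c, hcpos, 1 + 1 / c, by simp [hcpos.le], ?_⟩
  intro r M₁ δ D D' h h' hcl hδ hδr e he
  set ρ := δ / c with hρ
  have hρ0 : 0 < ρ := by positivity
  have hcρ : c * ρ = δ := by rw [hρ]; field_simp
  have hρr : ρ ≤ r := by rw [hρ, div_le_iff₀ hcpos]; linarith
  obtain ⟨y, hy, hyd⟩ := hcl.bwd e (h'.edgeSet_subset he)
  obtain ⟨j, hj⟩ := exists_face D hy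
  by_cases hz : ∃ z ∈ intrinsicFrontier ℝ (D.face j), dist y z < ρ
  · obtain ⟨z, hz, hyz⟩ := hz
    refine ⟨z, h.frontier_subset_edgeSet j hz, (dist_triangle e y z).trans ?_⟩
    have : (1 + 1 / c) * δ = δ + ρ := by rw [hρ]; ring
    linarith
  · push Not at hz
    have h1 := H h h' hcl hρ0 hρr
      (fun w hw hwn => intrinsicInterior_subset ((h.face j).disc_subset hj hz hw hwn))
      (by rw [← hcρ]; gcongr; exact min_le_left _ _) e he
    have h2 : c * ρ ≤ 1 / (4 * (1 + M)) * ρ := by gcongr; exact min_le_right _ _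
    have h3 : ρ / (2 * (1 + M)) = 2 * (1 / (4 * (1 + M)) * ρ) := by field_simp; norm_num
    have h4 : 0 < 1 / (4 * (1 + M)) * ρ := by positivity
    linarith

/-- A form of `NicePolygon.frontier_near_side` that does not depend on the orientation of the side. -/
theorem _root_.NicePolygon.frontier_near_segment {F : Set E3} {n : ℕ} {v : ZMod n → E3}
    (h : NicePolygon r θ M F n v) {k : ZMod n} {a b : E3} (hab : a ≠ b)
    (hs : segment ℝ (v k) (v (k + 1)) = segment ℝ a b) {P : E3} {τ : ℝ}
    (hP : P ∈ segment ℝ a b) (hτ : 0 < τ) (hτr : τ ≤ r) (h1 : τ ≤ dist P a)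
    (h2 : τ ≤ dist P b) {x : E3} (hx : x ∈ intrinsicFrontier ℝ F)
    (hxP : dist x P < τ / (1 + M)) : ∃ ε, |ε| < τ ∧ x = P + ε • unitDir a b := by
  have hP' := hs ▸ hP
  rcases eq_or_eq_of_segment_eq hab hs with ⟨h3, h4⟩ | ⟨h3, h4⟩
  · obtain ⟨ε, hε, hx⟩ := h.frontier_near_side hP' hτ hτr (by rwa [h3]) (by rwa [h4]) hx hxP
    exact ⟨ε, hε, by rw [hx, h3, h4]⟩
  · obtain ⟨ε, hε, hx⟩ := h.frontier_near_side hP' hτ hτr (by rwa [h3]) (by rwa [h4]) hx hxP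
    exact ⟨-ε, by rwa [abs_neg], by rw [hx, h3, h4, unitDir_swap]; module⟩

/-- Near an interior point of an edge the edge set is the line of that edge. -/
theorem edge_near_side (h : NicePolyhedron r θ M M₁ D) {i : Fin D.numFaces}
    {k : ZMod (D.numSides i)} {P : E3} {τ : ℝ} (hP : P ∈ D.side i k) (hτ : 0 < τ) (hτr : τ ≤ r)
    (h1 : τ ≤ dist P (D.corner i k)) (h2 : τ ≤ dist P (D.corner i (k + 1))) {x : E3}
    (hx : x ∈ D.edgeSet) (hxP : dist x P < τ / (1 + M) ^ 2) :
    ∃ ε, |ε| < τ ∧ x = P + ε • unitDir (D.corner i k) (D.corner i (k + 1)) := by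
  have hM := h.one_le
  obtain ⟨j, u, u', hh⟩ := h.exists_hinge i k
  have hab := (h.face i).corner_ne k
  have hxP' : dist x P < τ / (1 + M) := hxP.trans_le (by gcongr; nlinarith)
  have hfr : ∀ l, x ∈ D.face l → x ∈ intrinsicFrontier ℝ (D.face l) := fun l hl =>
    ((mem_face_iff (h.face l).isClosed).1 hl).resolve_left fun h3 =>
      h.not_mem_edgeSet_of_interior h3 hx
  rcases h.mem_faces_of_near_hinge hh hP hτ hτr h1 h2 (h.edgeSet_subset hx) hxP with h3 | h3
  · exact (h.face i).frontier_near_segment hab rfl hP hτ hτr h1 h2 (hfr _ h3) hxP'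
  · obtain ⟨l, hl⟩ := hh.side_right
    exact (h.face j).frontier_near_segment hab hl hP hτ hτr h1 h2 (hfr _ h3) hxP'

/-- Two edges start from a vertex in transversal directions. -/
theorem vertex_fan (h : NicePolyhedron r θ M M₁ D) {V : E3} (hV : V ∈ D.vertices) :
    ∃ t₁ t₂ : E3, ‖t₁‖ = 1 ∧ ‖t₂‖ = 1 ∧ |⟪t₁, t₂⟫| ≤ Real.cos θ ∧
      ∀ s, 0 ≤ s → s ≤ r → V + s • t₁ ∈ D.edgeSet ∧ V + s • t₂ ∈ D.edgeSet := by
  obtain ⟨i, k, rfl⟩ := hV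
  have hf := h.face i
  refine ⟨_, _, norm_unitDir (hf.corner_ne k), norm_unitDir (hf.prev_ne k),
    hf.abs_inner_unitDir_le k, fun s hs hsr => ⟨?_, ?_⟩⟩
  · exact ⟨i, k, (mem_segment_iff_unitDir (hf.corner_ne k)).2
      ⟨s, hs, hsr.trans (hf.len k), rfl⟩⟩
  · exact ⟨i, k - 1, (hf.prev_mem_iff k _).1 ((mem_segment_iff_unitDir (hf.prev_ne k)).2
      ⟨s, hs, hsr.trans (hf.prev_len k), rfl⟩)⟩

/-- Two segments of length `s` whose end points lie within `m` of a line are almost parallel. -/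
theorem inner_of_near_line {t t₁ t₂ : E3} {s m ε₁ ε₂ : ℝ} (ht : ‖t‖ = 1) (ht₁ : ‖t₁‖ = 1)
    (ht₂ : ‖t₂‖ = 1) (hs : 0 < s) (hms : m ≤ s) (h₁ : ‖s • t₁ - ε₁ • t‖ ≤ m)
    (h₂ : ‖s • t₂ - ε₂ • t‖ ≤ m) : s ^ 2 - 4 * s * m - 2 * m ^ 2 ≤ s ^ 2 * |⟪t₁, t₂⟫| := by
  have hm : 0 ≤ m := (norm_nonneg _).trans h₁
  have hlow : ∀ (ε : ℝ) (w : E3), ‖w‖ = 1 → ‖s • w - ε • t‖ ≤ m → s - m ≤ |ε| ∧ |ε| ≤ s + m := by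
    intro ε w hw h
    have h1 := (abs_norm_sub_norm_le (s • w) (ε • t)).trans h
    rw [norm_smul, norm_smul, hw, ht, mul_one, mul_one, Real.norm_of_nonneg hs.le,
      Real.norm_eq_abs] at h1
    have := abs_le.1 h1
    exact ⟨by linarith, by linarith⟩
  obtain ⟨l1, u1⟩ := hlow ε₁ t₁ ht₁ h₁
  obtain ⟨l2, u2⟩ := hlow ε₂ t₂ ht₂ h₂
  set η₁ := s • t₁ - ε₁ • t with hη₁
  set η₂ := s • t₂ - ε₂ • t with hη₂
  have e1 : s • t₁ = ε₁ • t + η₁ := by rw [hη₁]; abel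
  have e2 : s • t₂ = ε₂ • t + η₂ := by rw [hη₂]; abel
  have h3 : s ^ 2 * ⟪t₁, t₂⟫ = ε₁ * ε₂ + (ε₁ * ⟪t, η₂⟫ + ε₂ * ⟪η₁, t⟫ + ⟪η₁, η₂⟫) := by
    have : ⟪s • t₁, s • t₂⟫ = s ^ 2 * ⟪t₁, t₂⟫ := by
      rw [inner_smul_left, inner_smul_right, conj_trivial]; ring
    rw [← this, e1, e2]
    simp only [inner_add_left, inner_add_right, inner_smul_left, inner_smul_right, conj_trivial,
      real_inner_self_eq_norm_sq, ht]
    ring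
  have b1 : |ε₁ * ⟪t, η₂⟫| ≤ (s + m) * m := by
    rw [abs_mul]
    refine mul_le_mul u1 ((abs_real_inner_le_norm _ _).trans ?_) (abs_nonneg _) (by linarith)
    rw [ht, one_mul]; exact h₂
  have b2 : |ε₂ * ⟪η₁, t⟫| ≤ (s + m) * m := by
    rw [abs_mul]
    refine mul_le_mul u2 ((abs_real_inner_le_norm _ _).trans ?_) (abs_nonneg _) (by linarith)
    rw [ht, mul_one]; exact h₁
  have b3 : |⟪η₁, η₂⟫| ≤ m * m :=
    (abs_real_inner_le_norm _ _).trans (mul_le_mul h₁ h₂ (norm_nonneg _) hm)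
  have b4 : (s - m) * (s - m) ≤ |ε₁ * ε₂| := by
    rw [abs_mul]; exact mul_le_mul l1 l2 (by linarith) (abs_nonneg _)
  have b5 : |ε₁ * ε₂| ≤ |s ^ 2 * ⟪t₁, t₂⟫| + (|ε₁ * ⟪t, η₂⟫| + |ε₂ * ⟪η₁, t⟫| + |⟪η₁, η₂⟫|) := by
    have : ε₁ * ε₂ = s ^ 2 * ⟪t₁, t₂⟫ - (ε₁ * ⟪t, η₂⟫ + ε₂ * ⟪η₁, t⟫ + ⟪η₁, η₂⟫) := by
      rw [h3]; ring
    rw [this]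
    exact (abs_sub _ _).trans (by gcongr; exact abs_add_three _ _ _)
  rw [abs_mul (s ^ 2), abs_of_pos (by positivity : 0 < s ^ 2)] at b5
  nlinarith

/-- No vertex of a neighbouring polyhedron comes near a point in the interior of an edge: two edges
that start from it in transversal directions would have to follow the same line. -/
theorem exists_no_vertex_near_edge (θ M : ℝ) (hM : 1 ≤ M) (hθ : 0 < θ) (hθ' : θ < Real.pi / 2) :
    ∃ c > 0, ∃ κ > 0, ∀ {r M₁ δ τ : ℝ} {D D' : Polyhedron}, NicePolyhedron r θ M M₁ D →
      NicePolyhedron r θ M M₁ D' → D.IsClose D' δ → 0 < δ → τ ≤ r → δ ≤ c * τ →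
      ∀ {i : Fin D.numFaces} {k : ZMod (D.numSides i)} {P : E3}, P ∈ D.side i k →
      τ ≤ dist P (D.corner i k) → τ ≤ dist P (D.corner i (k + 1)) →
      ∀ V ∈ D'.vertices, κ * τ ≤ dist V P := by
  obtain ⟨c₀, hc₀, K, hK1, H⟩ := exists_edge_near_edge θ M hM hθ hθ'
  have hcos : Real.cos θ < 1 := by
    rw [← Real.cos_zero]
    exact Real.cos_lt_cos_of_nonneg_of_le_pi_div_two le_rfl hθ'.le hθ
  have hcos0 : 0 < Real.cos θ := Real.cos_pos_of_mem_Ioo ⟨by linarith, hθ'⟩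
  have hK : 0 < 1 + M := by linarith
  set κ := 1 / (4 * (1 + M) ^ 2) with hκ
  have hκ0 : 0 < κ := by positivity
  have hκ1 : κ ≤ 1 := by
    rw [hκ, div_le_one (by positivity)]; nlinarith
  set q := (1 - Real.cos θ) / 8 with hq
  have hq0 : 0 < q := by rw [hq]; linarith
  have hq1 : q ≤ 1 / 8 := by rw [hq]; linarith
  set c := min c₀ (q * κ / (2 * K)) with hc
  have hcpos : 0 < c := lt_min hc₀ (by positivity)
  refine ⟨c, hcpos, κ, hκ0, ?_⟩
  intro r M₁ δ τ D D' h h' hcl hδ hτr hδτ i k P hP h1 h2 V hV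
  by_contra hlt
  rw [not_le] at hlt
  have hτ : 0 < τ := pos_of_mul_pos_right (hδ.trans_le hδτ) hcpos.le
  have hδr : δ ≤ c₀ * r := hδτ.trans (mul_le_mul (min_le_left _ _) hτr hτ.le hc₀.le)
  set s := κ * τ with hs
  have hs0 : 0 < s := by positivity
  have hsτ : s ≤ τ := by rw [hs]; nlinarith
  have hm : 2 * (K * δ) ≤ q * s := by
    have h3 : δ ≤ q * κ / (2 * K) * τ := hδτ.trans (by gcongr; exact min_le_right _ _)
    calc 2 * (K * δ) ≤ 2 * (K * (q * κ / (2 * K) * τ)) := by gcongr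
      _ = q * s := by rw [hs]; field_simp
  have h4s : τ / (1 + M) ^ 2 = 4 * s := by rw [hs, hκ]; field_simp
  obtain ⟨t₁, t₂, ht₁, ht₂, hang, hmem⟩ := h'.vertex_fan hV
  set t := unitDir (D.corner i k) (D.corner i (k + 1)) with ht
  have ht1 : ‖t‖ = 1 := norm_unitDir ((h.face i).corner_ne k)
  -- edge points near `P` are close to the line through `P`
  have hline : ∀ x ∈ D'.edgeSet, dist x P < 2 * s → ∃ ε : ℝ, ‖x - (P + ε • t)‖ ≤ K * δ := by
    intro x hx hxP
    obtain ⟨y, hy, hyx⟩ := H h h' hcl hδ hδr x hx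
    obtain ⟨ε, -, he⟩ := h.edge_near_side hP hτ hτr h1 h2 hy (by
      have := dist_triangle y x P
      rw [dist_comm y x] at this
      rw [h4s]
      nlinarith)
    exact ⟨ε, by rw [← he, ← dist_eq_norm]; exact hyx⟩
  -- so both edges at `V` are nearly parallel to that line
  obtain ⟨ε₀, h0⟩ := hline V (h'.vertices_subset hV) (by linarith)
  have hray : ∀ w : E3, ‖w‖ = 1 → V + s • w ∈ D'.edgeSet →
      ∃ ε : ℝ, ‖s • w - ε • t‖ ≤ 2 * (K * δ) := by
    intro w hw hm
    obtain ⟨ε, hε⟩ := hline _ hm (by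
      have h3 := dist_triangle (V + s • w) V P
      have h4 : dist (V + s • w) V = s := by
        rw [dist_eq_norm, add_sub_cancel_left, norm_smul, hw, mul_one, Real.norm_of_nonneg hs0.le]
      linarith)
    refine ⟨ε - ε₀, ?_⟩
    have : s • w - (ε - ε₀) • t = (V + s • w - (P + ε • t)) - (V - (P + ε₀ • t)) := by module
    rw [this]
    exact (norm_sub_le _ _).trans (by linarith)
  obtain ⟨m1, m2⟩ := hmem s hs0.le (hsτ.trans hτr)
  obtain ⟨ε₁, he1⟩ := hray t₁ ht₁ m1
  obtain ⟨ε₂, he2⟩ := hray t₂ ht₂ m2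
  have h3 := inner_of_near_line ht1 ht₁ ht₂ hs0 (by nlinarith : q * s ≤ s) (he1.trans hm)
    (he2.trans hm)
  have h4 : s ^ 2 * |⟪t₁, t₂⟫| ≤ s ^ 2 * Real.cos θ := by gcongr
  have h5 : Real.cos θ = 1 - 8 * q := by rw [hq]; ring
  rw [h5] at h4
  have h6 : 0 < s ^ 2 * q := by positivity
  have h7 : s ^ 2 * q * q ≤ s ^ 2 * q * (1 / 8) := by gcongr
  nlinarith

/-- Vertices of neighbouring polyhedra are close to each other: a vertex is close to an edge, and
by `exists_no_vertex_near_edge` it is close to an end of that edge. -/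
theorem exists_vertex_near_vertex (θ M : ℝ) (hM : 1 ≤ M) (hθ : 0 < θ) (hθ' : θ < Real.pi / 2) :
    ∃ c > 0, ∃ K ≥ 1, ∀ {r M₁ δ : ℝ} {D D' : Polyhedron}, NicePolyhedron r θ M M₁ D →
      NicePolyhedron r θ M M₁ D' → D.IsClose D' δ → 0 < δ → δ ≤ c * r →
      ∀ V ∈ D'.vertices, ∃ W ∈ D.vertices, dist V W ≤ K * δ := by
  obtain ⟨c₁, hc₁, K₁, hK₁, H₁⟩ := exists_edge_near_edge θ M hM hθ hθ'
  obtain ⟨c₂, hc₂, κ, hκ, H₂⟩ := exists_no_vertex_near_edge θ M hM hθ hθ'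
  -- `B * δ` is the depth at which `exists_no_vertex_near_edge` excludes vertices within `2 * K₁ * δ`
  set B := 1 / c₂ + 2 * K₁ / κ with hB
  have hB0 : 0 < B := by positivity
  refine ⟨min c₁ (1 / B), lt_min hc₁ (by positivity), K₁ + B, by linarith, ?_⟩
  intro r M₁ δ D D' h h' hcl hδ hδr V hV
  have hr := h.r_pos
  obtain ⟨P, ⟨i, k, hP⟩, hPV⟩ := H₁ h h' hcl hδ
    (hδr.trans (by gcongr; exact min_le_left _ _)) V (h'.vertices_subset hV)
  by_contra hno
  push Not at hno
  have hBr : B * δ ≤ r := by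
    have : δ ≤ 1 / B * r := hδr.trans (by gcongr; exact min_le_right _ _)
    calc B * δ ≤ B * (1 / B * r) := by gcongr
      _ = r := by field_simp
  have hfar : ∀ W ∈ D.vertices, B * δ ≤ dist P W := by
    intro W hW
    have := hno W hW
    have := dist_triangle V P W
    linarith
  have h1 := H₂ h h' hcl hδ hBr (by
    have : c₂ * (1 / c₂ * δ) ≤ c₂ * (B * δ) := by
      gcongr; rw [hB]; linarith [div_pos (by linarith : 0 < 2 * K₁) hκ]
    calc δ = c₂ * (1 / c₂ * δ) := by field_simp
      _ ≤ _ := this) hP (hfar _ ⟨i, k, rfl⟩) (hfar _ ⟨i, k + 1, rfl⟩) V hV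
  have h2 : κ * (2 * K₁ / κ * δ) ≤ κ * (B * δ) := by
    gcongr; rw [hB]; linarith [div_pos one_pos hc₂]
  have h3 : κ * (2 * K₁ / κ * δ) = 2 * (K₁ * δ) := by field_simp
  have h4 : 0 < K₁ * δ := by positivity
  linarith

end NicePolyhedron

/-- A nearly parallel segment whose end points cannot lie beside the interior of `[a, b]`, while
`b` cannot lie beside its interior, ends near `b`. -/
theorem dist_end_le {a b A B P e : E3} {ζ τ κ Λ : ℝ} (hτ : 0 ≤ τ) (hab : a ≠ b) (hAB : A ≠ B)
    (hP : P ∈ segment ℝ a b) (he : e ∈ segment ℝ A B)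
    (hnear : ∀ l, 0 ≤ l → l ≤ Λ →
      dist (e + l • unitDir A B) (P + l • unitDir a b) ≤ ζ)
    (hΛ : dist P b ≤ Λ) (hΛ' : dist e B ≤ Λ) (hζ : ζ < κ * τ) (h1 : τ ≤ dist P a)
    (h2 : τ ≤ dist P b)
    (H : ∀ Q ∈ segment ℝ a b, τ ≤ dist Q a → τ ≤ dist Q b → κ * τ ≤ dist B Q)
    (H' : ∀ Q ∈ segment ℝ A B, τ ≤ dist Q A → τ ≤ dist Q B → κ * τ ≤ dist b Q) :
    dist B b ≤ ζ + τ := by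
  obtain ⟨P1, P2, P3⟩ := segment_param hab hP
  obtain ⟨e1, e2, e3⟩ := segment_param hAB he
  set l := dist e B with hl
  set m := dist P b with hm
  have hl0 : 0 ≤ l := dist_nonneg
  have hm0 : 0 ≤ m := dist_nonneg
  have ht := norm_unitDir hab
  have ht' := norm_unitDir hAB
  have hB : B = e + l • unitDir A B := by
    rw [e2]; abel
  have hb : b = P + m • unitDir a b := by
    rw [P2]; abel
  -- if the segment from `e` were too short, `B` would lie beside the interior of `[a, b]`
  rcases le_or_gt l (m - τ) with hlm | hlm
  · exfalso
    have hQ := add_smul_unitDir_mem hab hP (ε := l) (by linarith [@dist_nonneg _ _ P a])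
      (by linarith)
    have h3 := H _ hQ
      (by
        have : P + l • unitDir a b - a = (dist P a + l) • unitDir a b := by
          nth_rewrite 1 [P1]; module
        rw [dist_eq_norm, this, norm_smul, ht, mul_one, Real.norm_eq_abs]
        exact (by linarith : τ ≤ dist P a + l).trans (le_abs_self _))
      (by
        have : P + l • unitDir a b - b = (-(m - l)) • unitDir a b := by
          nth_rewrite 1 [P2]; module
        rw [dist_eq_norm, this, norm_smul, ht, mul_one, Real.norm_eq_abs, abs_neg]
        exact (by linarith : τ ≤ m - l).trans (le_abs_self _))
    rw [hB] at h3
    linarith [hnear l hl0 hΛ']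
  -- if it were too long, `b` would lie beside the interior of `[A, B]`
  rcases le_or_gt (m + τ) l with hml | hml
  · exfalso
    have he0 : 0 ≤ dist e A := dist_nonneg
    have hQ := add_smul_unitDir_mem hAB he (ε := m) (by linarith) (by linarith)
    have h3 := H' _ hQ
      (by
        have : e + m • unitDir A B - A = (dist e A + m) • unitDir A B := by
          nth_rewrite 1 [e1]; module
        rw [dist_eq_norm, this, norm_smul, ht', mul_one, Real.norm_eq_abs]
        exact (by linarith : τ ≤ dist e A + m).trans (le_abs_self _))
      (by
        have : e + m • unitDir A B - B = (-(l - m)) • unitDir A B := by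
          nth_rewrite 1 [e2]; module
        rw [dist_eq_norm, this, norm_smul, ht', mul_one, Real.norm_eq_abs, abs_neg]
        exact (by linarith : τ ≤ l - m).trans (le_abs_self _))
    rw [hb, dist_comm] at h3
    linarith [hnear m hm0 hΛ]
  · have h3 := hnear l hl0 hΛ'
    have h4 : dist (P + l • unitDir a b) (P + m • unitDir a b) = |l - m| := by
      rw [dist_eq_norm, add_sub_add_left_eq_sub, ← sub_smul, norm_smul, ht, mul_one,
        Real.norm_eq_abs]
    have h5 : |l - m| ≤ τ := abs_le.2 ⟨by linarith, by linarith⟩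
    have h6 := dist_triangle (e + l • unitDir A B) (P + l • unitDir a b) (P + m • unitDir a b)
    rw [← hB, ← hb] at h6
    rw [← hb] at h4
    rw [← hB] at h3
    linarith

/-- Two segments with close points `P`, `e` and close directions, such that no end of one lies beside
the interior of the other, have close ends. -/
theorem dist_ends_le {a b A B P e : E3} {ζ₀ ξ τ κ Λ : ℝ} (hτ : 0 ≤ τ) (hab : a ≠ b) (hAB : A ≠ B)
    (hP : P ∈ segment ℝ a b) (he : e ∈ segment ℝ A B) (heP : dist e P ≤ ζ₀)
    (hξ : ‖unitDir A B - unitDir a b‖ ≤ ξ) (hΛ : dist a b ≤ Λ) (hΛ' : dist A B ≤ Λ)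
    (hζ : ζ₀ + Λ * ξ < κ * τ) (h1 : τ ≤ dist P a) (h2 : τ ≤ dist P b)
    (H : ∀ V, V = A ∨ V = B → ∀ Q ∈ segment ℝ a b, τ ≤ dist Q a → τ ≤ dist Q b →
      κ * τ ≤ dist V Q)
    (H' : ∀ V, V = a ∨ V = b → ∀ Q ∈ segment ℝ A B, τ ≤ dist Q A → τ ≤ dist Q B →
      κ * τ ≤ dist V Q) :
    dist A a ≤ ζ₀ + Λ * ξ + τ ∧ dist B b ≤ ζ₀ + Λ * ξ + τ := by
  obtain ⟨-, -, P3⟩ := segment_param hab hP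
  obtain ⟨-, -, e3⟩ := segment_param hAB he
  have d1 := @dist_nonneg _ _ P a
  have d2 := @dist_nonneg _ _ P b
  have d3 := @dist_nonneg _ _ e A
  have d4 := @dist_nonneg _ _ e B
  have near : ∀ t t' : E3, ‖t' - t‖ ≤ ξ → ∀ l, 0 ≤ l → l ≤ Λ →
      dist (e + l • t') (P + l • t) ≤ ζ₀ + Λ * ξ := by
    intro t t' h l hl hlΛ
    have : e + l • t' - (P + l • t) = (e - P) + l • (t' - t) := by module
    rw [dist_eq_norm, this]
    refine (norm_add_le _ _).trans (add_le_add (by rwa [← dist_eq_norm]) ?_)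
    rw [norm_smul, Real.norm_of_nonneg hl]
    exact mul_le_mul hlΛ h (norm_nonneg _) (hl.trans hlΛ)
  constructor
  · refine dist_end_le hτ hab.symm hAB.symm (segment_symm ℝ a b ▸ hP) (segment_symm ℝ A B ▸ he)
      (near _ _ ?_) (by linarith) (by linarith) hζ h2 h1
      (fun Q hQ h3 h4 => H A (Or.inl rfl) Q (segment_symm ℝ b a ▸ hQ) h4 h3)
      (fun Q hQ h3 h4 => H' a (Or.inl rfl) Q (segment_symm ℝ B A ▸ hQ) h4 h3)
    rw [unitDir_swap, unitDir_swap a b, neg_sub_neg, norm_sub_rev]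
    exact hξ
  · exact dist_end_le hτ hab hAB hP he (near _ _ hξ) (by linarith) (by linarith) hζ h1 h2
      (H B (Or.inr rfl)) (H' b (Or.inr rfl))

namespace NicePolyhedron

variable {r θ M M₁ : ℝ} {D D' : Polyhedron}

theorem corner_mem_vertices (D : Polyhedron) (i : Fin D.numFaces) (k : ZMod (D.numSides i)) :
    D.corner i k ∈ D.vertices := ⟨i, k, rfl⟩

theorem edgeSet_subset_carrier (h : NicePolyhedron r θ M M₁ D) : D.edgeSet ⊆ D.carrier :=
  h.edgeSet_subset.trans h.compact.isClosed.frontier_subset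

theorem dist_corner_le (h : NicePolyhedron r θ M M₁ D) (i : Fin D.numFaces)
    (k : ZMod (D.numSides i)) : dist (D.corner i k) (D.corner i (k + 1)) ≤ M₁ * r :=
  h.diam _ (h.edgeSet_subset_carrier (h.vertices_subset (corner_mem_vertices D i k))) _
    (h.edgeSet_subset_carrier (h.vertices_subset (corner_mem_vertices D i (k + 1))))

/-- The vertices of a neighbouring polyhedron near the ends of an edge are the ends of an edge. Near
the midpoint of the given edge there is an edge of `D'`, it is nearly parallel to the given one, and
`dist_ends_le` applies since vertices do not come near interior points of edges. -/
theorem exists_side_of_side (θ M M₁ : ℝ) (hM : 1 ≤ M) (hM₁ : 0 < M₁) (hθ : 0 < θ)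
    (hθ' : θ < Real.pi / 2) :
    ∃ c > 0, ∀ {r δ : ℝ} {D D' : Polyhedron}, NicePolyhedron r θ M M₁ D →
      NicePolyhedron r θ M M₁ D' → D.IsClose D' δ → 0 < δ → δ ≤ c * r →
      ∀ (i : Fin D.numFaces) (k : ZMod (D.numSides i)), ∀ a' ∈ D'.vertices, ∀ b' ∈ D'.vertices,
      dist (D.corner i k) a' ≤ r / (4 * (1 + M) ^ 2) →
      dist (D.corner i (k + 1)) b' ≤ r / (4 * (1 + M) ^ 2) →
      ∃ i' k', D'.side i' k' = segment ℝ a' b' := by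
  obtain ⟨c₁, hc₁, K, hK1, H₁⟩ := exists_edge_near_edge θ M hM hθ hθ'
  obtain ⟨c₂, hc₂, κ, hκ, H₂⟩ := exists_no_vertex_near_edge θ M hM hθ hθ'
  have hM0 : 0 < 1 + M := by linarith
  set N := 8 * (1 + M) ^ 2 with hN
  have hN32 : 32 ≤ N := by rw [hN]; nlinarith
  have hN0 : 0 < N := by linarith
  -- `δ * B` bounds the distance between corresponding points of the two edges; `τ` is the depth below
  -- which points count as near an end
  set B := K * (1 + 4 * M₁ * N) with hB
  have hB0 : 0 < B := by positivity
  refine ⟨min c₁ (min (c₂ / N) (min (κ / (2 * B * N)) (1 / (2 * B * N)))),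
    by positivity, ?_⟩
  intro r δ D D' h h' hcl hδ hδr i k a' ha' b' hb' haa hbb
  have hr := h.r_pos
  have hδ1 : δ ≤ c₁ * r := hδr.trans (by gcongr; exact min_le_left _ _)
  set τ := r / N with hτ
  have hτ0 : 0 < τ := by positivity
  have hτN : τ * N = r := by rw [hτ]; field_simp
  have hδ2 : δ ≤ c₂ * τ := by
    have : δ ≤ c₂ / N * r := hδr.trans (by
      gcongr; exact (min_le_right _ _).trans (min_le_left _ _))
    rw [hτ]; calc δ ≤ _ := this
      _ = _ := by ring
  have hδ3 : δ * B ≤ κ * τ / 2 := by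
    have : δ ≤ κ / (2 * B * N) * r := hδr.trans (by
      gcongr; exact (min_le_right _ _).trans ((min_le_right _ _).trans (min_le_left _ _)))
    calc δ * B ≤ κ / (2 * B * N) * r * B := by gcongr
      _ = _ := by rw [hτ]; field_simp
  have hδ4 : δ * B ≤ τ / 2 := by
    have : δ ≤ 1 / (2 * B * N) * r := hδr.trans (by
      gcongr; exact (min_le_right _ _).trans ((min_le_right _ _).trans (min_le_right _ _)))
    calc δ * B ≤ 1 / (2 * B * N) * r * B := by gcongr
      _ = _ := by rw [hτ]; field_simp
  have hτr : τ ≤ r := div_le_self hr.le (by linarith)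
  have h32 : 32 * τ ≤ r := by nlinarith
  have hKB : K ≤ B := by
    have : 0 < K * (4 * M₁ * N) := by positivity
    rw [hB, mul_add, mul_one]; linarith
  have hKδ : K * δ ≤ τ / 2 := by nlinarith
  set a := D.corner i k with ha
  set b := D.corner i (k + 1) with hb
  have hab : a ≠ b := (h.face i).corner_ne k
  set P := midpoint ℝ a b with hPdef
  obtain ⟨hPa, hPb⟩ := (h.face i).midpoint_dist k
  have hPm : P ∈ segment ℝ a b := midpoint_mem_segment (𝕜 := ℝ) _ _
  obtain ⟨e, ⟨i', k', he⟩, heP⟩ := H₁ h' h hcl.symm hδ hδ1 P ⟨i, k, hPm⟩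
  rw [dist_comm] at heP
  set A := D'.corner i' k' with hA
  set C := D'.corner i' (k' + 1) with hC
  have hAC : A ≠ C := (h'.face i').corner_ne k'
  have hAClen : r ≤ dist A C := (h'.face i').len k'
  set t := unitDir a b with ht
  set t' := unitDir A C with ht'
  have ht1 : ‖t‖ = 1 := norm_unitDir hab
  have ht1' : ‖t'‖ = 1 := norm_unitDir hAC
  have h4τ : r / 2 / (1 + M) ^ 2 = 4 * τ := by rw [hτ, hN]; field_simp; norm_num
  have hline : ∀ x ∈ D'.edgeSet, dist x P < 2 * τ → ∃ ε : ℝ, ‖x - (P + ε • t)‖ ≤ K * δ := by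
    intro x hx hxP
    obtain ⟨y, hy, hyx⟩ := H₁ h h' hcl hδ hδ1 x hx
    obtain ⟨ε, -, he⟩ := h.edge_near_side hPm (by linarith : 0 < r / 2) (by linarith) hPa hPb hy (by
      have := dist_triangle y x P
      rw [dist_comm y x] at this
      rw [h4τ]
      linarith)
    exact ⟨ε, by rw [← he, ← dist_eq_norm]; exact hyx⟩
  -- the direction of the side of `D'` through `e`
  obtain ⟨s, hs, hsm⟩ : ∃ s : ℝ, |s| = τ ∧ e + s • t' ∈ segment ℝ A C := by
    obtain ⟨-, -, h3⟩ := segment_param hAC he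
    rcases le_total (r / 2) (dist e C) with h4 | h4
    · exact ⟨τ, abs_of_pos hτ0, add_smul_unitDir_mem hAC he
        (by linarith [@dist_nonneg _ _ e A]) (by linarith)⟩
    · exact ⟨-τ, by rw [abs_neg, abs_of_pos hτ0], add_smul_unitDir_mem hAC he (by linarith)
        (by linarith [@dist_nonneg _ _ e C])⟩
  -- two points of that side at distance `τ` are close to the line through `P`
  obtain ⟨ε₀, h0⟩ := hline e ⟨i', k', he⟩ (by linarith)
  obtain ⟨ε₁, h1⟩ := hline (e + s • t') ⟨i', k', hsm⟩ (by
    have h3 := dist_triangle (e + s • t') e P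
    have h4 : dist (e + s • t') e = τ := by
      rw [dist_eq_norm, add_sub_cancel_left, norm_smul, ht1', mul_one, Real.norm_eq_abs, hs]
    linarith)
  set ξ := 4 * (K * δ) / τ with hξ
  -- the two directions agree up to sign
  have hdir : ‖t' - t‖ ≤ ξ ∨ ‖-t' - t‖ ≤ ξ := by
    have h2 : ‖s • t' - (ε₁ - ε₀) • t‖ ≤ 2 * (K * δ) := by
      have : s • t' - (ε₁ - ε₀) • t =
        (e + s • t' - (P + ε₁ • t)) - (e - (P + ε₀ • t)) := by module
      rw [this]
      exact (norm_sub_le _ _).trans (by linarith)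
    set ε := ε₁ - ε₀ with hε
    have h3 := (abs_norm_sub_norm_le (s • t') (ε • t)).trans h2
    rw [norm_smul, norm_smul, ht1, ht1', mul_one, mul_one, Real.norm_eq_abs, Real.norm_eq_abs,
      hs] at h3
    have hfin : ∀ (w : E3) (ε : ℝ), 0 ≤ ε → |τ - ε| ≤ 2 * (K * δ) →
        ‖τ • w - ε • t‖ ≤ 2 * (K * δ) → ‖w - t‖ ≤ ξ := by
      intro w ε hε h4 h5
      rw [hξ, le_div_iff₀ hτ0, mul_comm]
      have h6 : τ * ‖w - t‖ = ‖(τ • w - ε • t) - (τ - ε) • t‖ := by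
        rw [← Real.norm_of_nonneg hτ0.le, ← norm_smul, Real.norm_of_nonneg hτ0.le]
        congr 1; module
      rw [h6]
      refine (norm_sub_le _ _).trans ?_
      rw [norm_smul, ht1, mul_one, Real.norm_eq_abs]
      linarith
    have hsign : s = τ ∨ s = -τ := eq_or_eq_neg_of_abs_eq hs
    rcases hsign with hs | hs <;> rcases le_total 0 ε with h4 | h4
    · rw [abs_of_nonneg h4] at h3
      exact Or.inl (hfin _ ε h4 h3 (by rwa [hs] at h2))
    · rw [abs_of_nonpos h4] at h3
      refine Or.inr (hfin _ (-ε) (by linarith) h3 ?_)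
      rw [show τ • -t' - (-ε) • t = -(s • t' - ε • t) by rw [hs]; module, norm_neg]
      exact h2
    · rw [abs_of_nonneg h4] at h3
      refine Or.inr (hfin _ ε h4 h3 ?_)
      rw [hs] at h2
      convert h2 using 2; module
    · rw [abs_of_nonpos h4] at h3
      refine Or.inl (hfin _ (-ε) (by linarith) h3 ?_)
      rw [show τ • t' - (-ε) • t = -(s • t' - ε • t) by rw [hs]; module, norm_neg]
      exact h2
  have hζ : K * δ + M₁ * r * ξ = δ * B := by
    rw [hξ, hB, ← hτN]; field_simp
  have hζ' : K * δ + M₁ * r * ξ < κ * τ := by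
    rw [hζ]
    have : 0 < κ * τ := by positivity
    linarith
  have hV : ∀ V, V = A ∨ V = C → V ∈ D'.vertices := by
    rintro V (rfl | rfl)
    exacts [corner_mem_vertices _ _ _, corner_mem_vertices _ _ _]
  have hW : ∀ V, V = a ∨ V = b → V ∈ D.vertices := by
    rintro V (rfl | rfl)
    exacts [corner_mem_vertices _ _ _, corner_mem_vertices _ _ _]
  have G : ∀ V, V = A ∨ V = C → ∀ Q ∈ segment ℝ a b, τ ≤ dist Q a → τ ≤ dist Q b →
      κ * τ ≤ dist V Q := fun V hVV Q hQ h1 h2 =>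
    H₂ h h' hcl hδ hτr hδ2 hQ h1 h2 V (hV V hVV)
  have G' : ∀ V, V = a ∨ V = b → ∀ Q ∈ segment ℝ A C, τ ≤ dist Q A → τ ≤ dist Q C →
      κ * τ ≤ dist V Q := fun V hVV Q hQ h1 h2 =>
    H₂ h' h hcl.symm hδ hτr hδ2 hQ h1 h2 V (hW V hVV)
  -- vertices of `D'` this close coincide
  have heq : ∀ p ∈ D'.vertices, ∀ q ∈ D'.vertices, ∀ z, dist p z ≤ K * δ + M₁ * r * ξ + τ →
      dist z q ≤ r / (4 * (1 + M) ^ 2) → p = q := by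
    intro p hp q hq z h1 h2
    by_contra hne
    have h3 := h'.vertex_dist hp hq hne
    have h4 : r / (1 + M) ^ 2 = 8 * τ := by rw [hτ, hN]; field_simp
    have h5 : r / (4 * (1 + M) ^ 2) = 2 * τ := by rw [hτ, hN]; field_simp; norm_num
    have := dist_triangle p z q
    rw [hζ] at h1
    linarith
  refine ⟨i', k', ?_⟩
  change segment ℝ A C = _
  rcases hdir with hd | hd
  · obtain ⟨q1, q2⟩ := dist_ends_le hτ0.le hab hAC hPm he heP hd (h.dist_corner_le i k)
      (h'.dist_corner_le i' k') hζ' (by linarith) (by linarith) G G'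
    rw [heq A (hV _ (Or.inl rfl)) a' ha' a q1 haa, heq C (hV _ (Or.inr rfl)) b' hb' b q2 hbb]
  · rw [ht', ← unitDir_swap] at hd
    obtain ⟨q1, q2⟩ := dist_ends_le hτ0.le hab hAC.symm hPm (segment_symm ℝ A C ▸ he) heP hd
      (h.dist_corner_le i k) ((dist_comm C A).trans_le (h'.dist_corner_le i' k')) hζ' (by linarith)
      (by linarith) (fun V hVV => G V hVV.symm)
      (fun V hVV Q hQ h1 h2 => G' V hVV Q (segment_symm ℝ C A ▸ hQ) h2 h1)
    rw [← heq C (hV _ (Or.inr rfl)) a' ha' a q1 haa, ← heq A (hV _ (Or.inl rfl)) b' hb' b q2 hbb,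
      segment_symm]

end NicePolyhedron

/-! ### Faces of neighbouring polyhedra -/

/-- The points of the face `F` at distance at least `ρ` from its boundary. -/
def deepPart (F : Set E3) (ρ : ℝ) : Set E3 :=
  {x | x ∈ F ∧ ∀ z ∈ intrinsicFrontier ℝ F, ρ ≤ dist x z}

namespace NicePolygon

variable {r θ M : ℝ} {F : Set E3} {n : ℕ} {v : ZMod n → E3}

/-- A segment from a point of the face that stays away from its boundary stays in the face. -/
theorem joinedIn_deepPart (h : NicePolygon r θ M F n v) {ρ : ℝ} (hρ : 0 < ρ) {x w : E3}
    (hx : x ∈ F) (hw : w ∈ (affineSpan ℝ F).direction)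
    (hd : ∀ s ∈ Set.Icc (0 : ℝ) 1, ∀ z ∈ intrinsicFrontier ℝ F, ρ ≤ dist (x + s • w) z) :
    JoinedIn (deepPart F ρ) x (x + w) := by
  have hsub : segment ℝ x (x + w) ⊆ {y | ∀ z ∈ intrinsicFrontier ℝ F, ρ ≤ dist y z} := by
    intro y hy
    rw [segment_eq_image'] at hy
    obtain ⟨s, hs, rfl⟩ := hy
    simp only [add_sub_cancel_left]
    exact hd s hs
  refine JoinedIn.of_segment_subset fun y hy => ⟨intrinsicInterior_subset (𝕜 := ℝ) ?_, hsub hy⟩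
  refine (convex_segment x (x + w)).isPreconnected.subset_intrinsicInterior h.isClosed
    ((affineSpan ℝ F).convex.segment_subset (subset_affineSpan ℝ F hx) (h.add_mem hx hw)) ?_
    (left_mem_segment ℝ _ _) hx hy
  rw [Set.disjoint_left]
  intro z hz hzf
  have := hsub hz z hzf
  rw [dist_self] at this
  linarith

/-- Beside a side and away from its ends, the component along the inner normal bounds the distance
from the boundary. -/
theorem le_dist_of_inner (h : NicePolygon r θ M F n v) {a b u : E3}
    (hu : IsInnerNormal r M F a b u) (hseg : segment ℝ a b ⊆ intrinsicFrontier ℝ F) {P w : E3}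
    (hP : P ∈ segment ℝ a b) {τ ρ η : ℝ} (hτ : 0 < τ) (hτr : τ ≤ r) (h1 : τ ≤ dist P a)
    (h2 : τ ≤ dist P b) (hwη : ‖w‖ ≤ η)
    (hη : 2 * η < τ / (1 + M)) (hρ : ρ ≤ ⟪u, w⟫) :
    ∀ z ∈ intrinsicFrontier ℝ F, ρ ≤ dist (P + w) z := by
  intro z hz
  by_contra hlt
  rw [not_le, dist_comm, dist_eq_norm] at hlt
  have hPF := h.frontier_subset (hseg hP)
  have hzW := h.sub_mem (h.frontier_subset hz) hPF
  have e1 : z - P = w + (z - (P + w)) := by abel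
  have h3 : |⟪u, z - (P + w)⟫| ≤ ‖z - (P + w)‖ := by
    have := abs_real_inner_le_norm u (z - (P + w))
    rwa [hu.unit, one_mul] at this
  have h4 : ⟪u, w⟫ ≤ ‖w‖ := by
    have := real_inner_le_norm u w
    rwa [hu.unit, one_mul] at this
  have h5 : ‖z - P‖ < τ / (1 + M) := by
    rw [e1]
    exact (norm_add_le _ _).trans_lt (by linarith)
  have h6 : 0 < ⟪u, z - P⟫ := by
    rw [e1, inner_add_right]
    linarith [(abs_le.1 h3).1]
  have h7 := (hu.sides τ hτ hτr P hP h1 h2 _ hzW h5).1 h6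
  rw [add_sub_cancel] at h7
  exact not_mem_intrinsicFrontier h7 hz

/-- From a corner one can go to the middle of an adjacent side at a definite distance from the
boundary of the face: the side is translated by the direction of a chart at the corner, and then
by the inner normal. -/
theorem joinedIn_corner_midpoint (h : NicePolygon r θ M F n v) {a b u p q : E3} {η : ℝ}
    (hab : a ≠ b) (hlen : r ≤ dist a b) (hu : IsInnerNormal r M F a b u)
    (hseg : segment ℝ a b ⊆ intrinsicFrontier ℝ F) (hp : ‖p‖ = 1) (hq : ‖q‖ = 1)
    (hqW : q ∈ (affineSpan ℝ F).direction) (hpq : ⟪p, q⟫ = 0)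
    (hslope : ∀ x ∈ intrinsicFrontier ℝ F, ∀ y ∈ intrinsicFrontier ℝ F, dist x a < r →
      dist y a < r → |⟪q, x - y⟫| ≤ M * |⟪p, x - y⟫|)
    (hη : 0 < η) (hηr : η ≤ r / (16 * (1 + M))) (hin : a + η • q ∈ F) :
    JoinedIn (deepPart F (η / (1 + M))) (a + η • q) (midpoint ℝ a b + η • u) := by
  have hr := h.r_pos
  have hM := h.one_le
  have hK : 0 < 1 + M := by linarith
  set t := unitDir a b with ht
  have ht1 : ‖t‖ = 1 := norm_unitDir hab
  have hηK : η * (16 * (1 + M)) ≤ r := by rwa [le_div_iff₀ (by positivity)] at hηr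
  have hη32 : 32 * η ≤ r := by nlinarith
  have hηρ : η / (1 + M) ≤ η := div_le_self hη.le (by linarith)
  have hρ0 : 0 < η / (1 + M) := by positivity
  have hτK : 2 * η < r / 4 / (1 + M) := by
    rw [lt_div_iff₀ hK]; nlinarith
  have htW : t ∈ (affineSpan ℝ F).direction :=
    h.unitDir_mem (h.frontier_subset (hseg (left_mem_segment ℝ a b)))
      (h.frontier_subset (hseg (right_mem_segment ℝ a b)))
  have hmem : ∀ s, 0 ≤ s → s ≤ dist a b → a + s • t ∈ segment ℝ a b := fun s h1 h2 =>
    (mem_segment_iff_unitDir hab).2 ⟨s, h1, h2, rfl⟩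
  have hdista : ∀ s, 0 ≤ s → dist (a + s • t) a = s := fun s hs => by
    rw [dist_eq_norm, add_sub_cancel_left, norm_smul, ht1, mul_one, Real.norm_of_nonneg hs]
  have hdistb : ∀ s, s ≤ dist a b → dist (a + s • t) b = dist a b - s := fun s hs => by
    have hb : a + s • t - b = (s - dist a b) • t := by
      rw [sub_smul, ht, dist_smul_unitDir hab]; abel
    rw [dist_eq_norm, hb, norm_smul, ht1, mul_one, Real.norm_of_nonpos (by linarith)]
    ring
  have hy := hmem (r / 4) (by linarith) (by linarith)
  have hya := hdista (r / 4) (by linarith)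
  have hyb := hdistb (r / 4) (by linarith)
  set y := a + (r / 4) • t with hydef
  -- along the translate of the side
  have d1 : ∀ s ∈ Set.Icc (0 : ℝ) 1, ∀ z ∈ intrinsicFrontier ℝ F,
      η / (1 + M) ≤ dist (a + η • q + s • ((r / 4) • t)) z := by
    intro s hs z hz
    rw [smul_smul]
    have hsr : 0 ≤ s * (r / 4) := mul_nonneg hs.1 (by linarith)
    have hsr' : s * (r / 4) ≤ r / 4 := mul_le_of_le_one_left (by linarith) hs.2
    have hx := hmem (s * (r / 4)) hsr (by linarith)
    have hxa := hdista (s * (r / 4)) hsr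
    set x := a + (s * (r / 4)) • t with hxdef
    have e1 : a + η • q + (s * (r / 4)) • t = x + η • q := by rw [hxdef]; abel
    rw [e1]
    -- near the corner the boundary is a graph of slope at most `M` over the direction `p`; farther away
    -- it is too far
    rcases lt_or_ge (dist z a) r with h1 | h1
    · have h2 := hslope x (hseg hx) z hz (by linarith) h1
      set w := x + η • q - z with hw
      have e2 : ⟪q, w⟫ = ⟪q, x - z⟫ + η := by
        rw [hw, show x + η • q - z = (x - z) + η • q by abel, inner_add_right, inner_smul_right,
          real_inner_self_eq_norm_sq, hq]; ring
      have e3 : ⟪p, w⟫ = ⟪p, x - z⟫ := by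
        rw [hw, show x + η • q - z = (x - z) + η • q by abel, inner_add_right, inner_smul_right,
          hpq]; ring
      have n1 := abs_real_inner_le_norm q w
      have n2 := abs_real_inner_le_norm p w
      rw [hq, one_mul, e2] at n1
      rw [hp, one_mul, e3] at n2
      rw [dist_eq_norm, div_le_iff₀ hK]
      have n3 := abs_le.1 n1
      have n4 := abs_le.1 h2
      nlinarith
    · have h2 := dist_triangle4 z (x + η • q) x a
      have h3 : dist (x + η • q) x = η := by
        rw [dist_eq_norm, add_sub_cancel_left, norm_smul, hq, mul_one, Real.norm_of_nonneg hη.le]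
      rw [dist_comm z (x + η • q)] at h2
      linarith
  have j1 := h.joinedIn_deepPart hρ0 hin (Submodule.smul_mem _ (r / 4) htW) d1
  have e1 : a + η • q + (r / 4) • t = y + η • q := by rw [hydef]; abel
  rw [e1] at j1
  -- the chart direction has a definite component along the inner normal
  have huq : η / (1 + M) ≤ ⟪u, η • q⟫ := by
    have hqη : ‖η • q‖ = η := by rw [norm_smul, hq, mul_one, Real.norm_of_nonneg hη.le]
    have hqm := Submodule.smul_mem _ η hqW
    have he := hu.expand _ hqm
    have hc : |⟪t, η • q⟫| ≤ r / 4 := by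
      have := abs_real_inner_le_norm t (η • q)
      rw [ht1, one_mul, hqη] at this
      linarith
    have hz := abs_le_add_smul_unitDir_mem hab hy (τ := r / 4) (by rw [hya]) (by rw [hyb]; linarith) hc
    have h2 := j1.target_mem.2 _ (hseg hz)
    have h3 : y + η • q - (y + ⟪t, η • q⟫ • t) = ⟪u, η • q⟫ • u := by
      nth_rewrite 1 [he]; abel
    rw [dist_eq_norm, h3, norm_smul, hu.unit, mul_one, Real.norm_eq_abs] at h2
    rcases abs_cases ⟪u, η • q⟫ with ⟨h4, -⟩ | ⟨h4, h5⟩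
    · rwa [h4] at h2
    · exact absurd j1.target_mem.1 ((hu.sides (r / 4) (by linarith) (by linarith) y hy
        (by rw [hya]) (by rw [hyb]; linarith) _ hqm (by rw [hqη]; linarith)).2 h5)
  have huu : ⟪u, η • u⟫ = η := by
    rw [inner_smul_right, real_inner_self_eq_norm_sq, hu.unit]; ring
  -- turn from the chart direction to the inner normal, then move along the side
  have j2 := h.joinedIn_deepPart hρ0 j1.target_mem.1
    (Submodule.sub_mem _ (Submodule.smul_mem _ η hu.mem) (Submodule.smul_mem _ η hqW)) (by
      intro s hs
      rw [show y + η • q + s • (η • u - η • q) = y + ((1 - s) • η • q + s • η • u) by module]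
      refine h.le_dist_of_inner hu hseg hy (τ := r / 4) (η := η) (by linarith) (by linarith)
        (by rw [hya]) (by rw [hyb]; linarith) ?_ hτK ?_
      · refine (norm_add_le _ _).trans ?_
        rw [norm_smul, norm_smul, norm_smul, norm_smul, hq, hu.unit, Real.norm_of_nonneg hη.le,
          Real.norm_of_nonneg hs.1, Real.norm_of_nonneg (by linarith [hs.2] : 0 ≤ 1 - s)]
        linarith
      · rw [inner_add_right, inner_smul_right, inner_smul_right _ _ s, huu]
        have := hs.1
        have := hs.2
        nlinarith)
  rw [show y + η • q + (η • u - η • q) = y + η • u by abel] at j2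
  have hmid : midpoint ℝ a b = y + (dist a b / 2 - r / 4) • t := by
    have hb : b = a + dist a b • t := by rw [ht, dist_smul_unitDir hab]; abel
    rw [midpoint_eq_smul_add]
    nth_rewrite 1 [hb]
    rw [hydef, invOf_eq_inv]
    module
  have j3 := h.joinedIn_deepPart hρ0 j2.target_mem.1
    (Submodule.smul_mem _ (dist a b / 2 - r / 4) htW) (by
      intro s hs
      have hs1 := hs.1
      have hs2 := hs.2
      have h0 : 0 ≤ s * (dist a b / 2 - r / 4) := mul_nonneg hs1 (by linarith)
      have h1 : s * (dist a b / 2 - r / 4) ≤ dist a b / 2 - r / 4 :=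
        mul_le_of_le_one_left (by linarith) hs2
      rw [show y + η • u + s • ((dist a b / 2 - r / 4) • t) =
        (a + (r / 4 + s * (dist a b / 2 - r / 4)) • t) + η • u by rw [hydef]; module]
      refine fun z hz => hηρ.trans (h.le_dist_of_inner hu hseg
        (hmem _ (by linarith) (by linarith)) (τ := r / 4) (η := η) (by linarith) (by linarith)
        ?_ ?_ ?_ hτK huu.ge z hz)
      · rw [hdista _ (by linarith)]; linarith
      · rw [hdistb _ (by linarith)]; linarith
      · rw [norm_smul, hu.unit, mul_one, Real.norm_of_nonneg hη.le])
  rw [show y + η • u + (dist a b / 2 - r / 4) • t = midpoint ℝ a b + η • u by rw [hmid]; abel] at j3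
  exact (j1.trans j2).trans j3

/-- From the middle of a side one can go to the middle of the next side, around their common corner,
at a definite distance from the boundary of the face. -/
theorem joinedIn_midpoints (h : NicePolygon r θ M F n v) {k : ZMod n} {u u' : E3} {η : ℝ}
    (hu : IsInnerNormal r M F (v k) (v (k + 1)) u)
    (hu' : IsInnerNormal r M F (v (k + 1)) (v (k + 1 + 1)) u') (hη : 0 < η)
    (hηr : η ≤ r / (16 * (1 + M))) :
    JoinedIn (deepPart F (η / (1 + M))) (midpoint ℝ (v k) (v (k + 1)) + η • u)
      (midpoint ℝ (v (k + 1)) (v (k + 1 + 1)) + η • u') := by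
  have hr := h.r_pos
  have hM := h.one_le
  obtain ⟨p, q, hp, hq, hp1, hq1, hpq, hexp, hs, hin, -⟩ := h.exists_frame (h.corner_mem (k + 1))
  have hηr' : η < 2 * M * r := by
    have : r / (16 * (1 + M)) ≤ r := div_le_self hr.le (by linarith)
    nlinarith
  have hin' := intrinsicInterior_subset (hin η hη hηr').1
  have hsl : ∀ x ∈ intrinsicFrontier ℝ F, ∀ y ∈ intrinsicFrontier ℝ F, dist x (v (k + 1)) < r →
      dist y (v (k + 1)) < r → |⟪q, x - y⟫| ≤ M * |⟪p, x - y⟫| := by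
    have hb : ∀ x, dist x (v (k + 1)) < r → |⟪p, x - v (k + 1)⟫| < r ∧
        |⟪q, x - v (k + 1)⟫| < 2 * M * r := by
      intro x hx
      rw [dist_eq_norm] at hx
      have h1 := abs_real_inner_le_norm p (x - v (k + 1))
      have h2 := abs_real_inner_le_norm q (x - v (k + 1))
      rw [hp1, one_mul] at h1
      rw [hq1, one_mul] at h2
      exact ⟨by linarith, by nlinarith⟩
    exact fun x hx y hy hxd hyd =>
      hs x hx y hy (hb x hxd).1 (hb x hxd).2 (hb y hyd).1 (hb y hyd).2
  have j1 := h.joinedIn_corner_midpoint (h.corner_ne k).symm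
    ((h.len k).trans_eq (dist_comm _ _)) hu.swap (segment_symm ℝ (v k) (v (k + 1)) ▸ h.side_subset k)
    hp1 hq1 hq hpq hsl hη hηr hin'
  have j2 := h.joinedIn_corner_midpoint (h.corner_ne (k + 1)) (h.len (k + 1)) hu'
    (h.side_subset (k + 1)) hp1 hq1 hq hpq hsl hη hηr hin'
  rw [midpoint_comm] at j1
  exact j1.symm.trans j2

end NicePolygon

namespace NicePolyhedron

variable {r θ M M₁ : ℝ} {D D' : Polyhedron}

/-- Along a connected part of a face, away from its boundary, the boundary of a neighbouring
polyhedron runs in a single face: passing to another face it would have to cross an edge, which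
`exists_no_edge_near_disc` excludes. -/
theorem exists_near_face_const (θ M : ℝ) (hM : 1 ≤ M) (hθ : 0 < θ) (hθ' : θ < Real.pi / 2) :
    ∃ c > 0, ∀ {r M₁ δ ρ : ℝ} {D D' : Polyhedron}, NicePolyhedron r θ M M₁ D →
      NicePolyhedron r θ M M₁ D' → D.IsClose D' δ → 0 < ρ → ρ ≤ r → δ ≤ c * ρ →
      ∀ {j : Fin D.numFaces},
      (∀ x ∈ deepPart (D.face j) ρ, ∀ e ∈ D'.edgeSet, δ < dist e x) ∧
      ∀ {Y : Set E3}, IsPreconnected Y → Y ⊆ deepPart (D.face j) ρ → ∀ {g : Fin D'.numFaces},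
      (∃ x ∈ Y, ∃ x' ∈ D'.face g, dist x x' ≤ δ) → ∀ y ∈ Y, ∃ y' ∈ D'.face g, dist y y' ≤ δ := by
  obtain ⟨c₀, hc₀, H⟩ := exists_no_edge_near_disc θ M hM hθ hθ'
  have hK : 0 < 1 + M := by linarith
  set c := min c₀ (1 / (4 * (1 + M) * (2 * (1 + M) + 1))) with hc
  refine ⟨c, lt_min hc₀ (by positivity), ?_⟩
  intro r M₁ δ ρ D D' h h' hcl hρ hρr hδ j
  have hδ1 : δ ≤ c₀ * ρ := hδ.trans (by gcongr; exact min_le_left _ _)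
  have hδ2 : (2 * (1 + M) + 1) * δ < ρ / (2 * (1 + M)) := by
    have : δ ≤ 1 / (4 * (1 + M) * (2 * (1 + M) + 1)) * ρ :=
      hδ.trans (by gcongr; exact min_le_right _ _)
    calc (2 * (1 + M) + 1) * δ
        ≤ (2 * (1 + M) + 1) * (1 / (4 * (1 + M) * (2 * (1 + M) + 1)) * ρ) := by gcongr
      _ = ρ / (2 * (1 + M)) / 2 := by field_simp; norm_num
      _ < _ := half_lt_self (by positivity)
  have hno : ∀ x ∈ deepPart (D.face j) ρ, ∀ e ∈ D'.edgeSet, (2 * (1 + M) + 1) * δ < dist e x := by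
    intro x hx e he
    exact hδ2.trans_le (H h h' hcl hρ hρr (fun w hw hwn => intrinsicInterior_subset
      ((h.face j).disc_subset hx.1 hx.2 hw hwn)) hδ1 e he)
  have hδr : (1 + M) * (2 * δ) < r := by
    have : ρ / (2 * (1 + M)) ≤ ρ / 2 := by gcongr; linarith
    have hδ0 : 0 ≤ δ ∨ δ < 0 := le_or_gt 0 δ
    rcases hδ0 with h0 | h0 <;> nlinarith
  constructor
  · intro x hx e he
    have h1 := hno x hx e he
    obtain ⟨y, -, hy⟩ := hcl.fwd x (face_subset D j hx.1)
    have := dist_nonneg.trans hy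
    nlinarith
  -- only one face of `D'` is near a given point
  have huniq : ∀ x ∈ deepPart (D.face j) ρ, ∀ g g' : Fin D'.numFaces, ∀ y ∈ D'.face g,
      ∀ y' ∈ D'.face g', dist x y ≤ δ → dist x y' ≤ δ → g = g' := by
    intro x hx g g' y hy y' hy' hxy hxy'
    by_contra hne
    have hδ0 : 0 ≤ δ := dist_nonneg.trans hxy
    have hyy : dist y y' ≤ 2 * δ := by
      have := dist_triangle_left y y' x
      linarith
    obtain ⟨γ, h0, h1, hS, hL⟩ := h'.path y (face_subset D' g hy) y' (face_subset D' g' hy') (by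
      rw [lt_div_iff₀ hK]; nlinarith)
    have hcont : ContinuousOn γ (Set.Icc 0 1) := by
      refine LipschitzOnWith.continuousOn (K := ((1 + M) * dist y y').toNNReal)
        (LipschitzOnWith.of_dist_le_mul fun s hs t ht => ?_)
      rw [Real.coe_toNNReal _ (by positivity), Real.dist_eq]
      exact hL s hs t ht
    have hpre : IsPreconnected (γ '' Set.Icc 0 1) := isPreconnected_Icc.image _ hcont
    obtain ⟨z, ⟨s, hs, rfl⟩, hzA, hzB⟩ := isPreconnected_closed_iff.1 hpre (D'.face g)
      (⋃ l : {l // l ≠ g}, D'.face l) (h'.face g).isClosed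
      (isClosed_iUnion_of_finite fun l => (h'.face l).isClosed) (by
        rintro _ ⟨s, hs, rfl⟩
        obtain ⟨l, hl⟩ := exists_face D' (hS s hs)
        by_cases hlg : l = g
        · exact Or.inl (hlg ▸ hl)
        · exact Or.inr (Set.mem_iUnion.2 ⟨⟨l, hlg⟩, hl⟩))
      ⟨y, ⟨0, by simp, h0⟩, hy⟩ ⟨y', ⟨1, by simp, h1⟩, Set.mem_iUnion.2 ⟨⟨g', Ne.symm hne⟩, hy'⟩⟩
    obtain ⟨⟨l, hlg⟩, hzl⟩ := Set.mem_iUnion.1 hzB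
    have h3 := hno x hx _ (h'.mem_edgeSet_of_mem_faces (Ne.symm hlg) hzA hzl)
    have h4 := hL s hs 0 (by simp)
    rw [h0, sub_zero, abs_of_nonneg hs.1] at h4
    have h5 : (1 + M) * dist y y' * s ≤ (1 + M) * (2 * δ) * 1 := by
      have := hs.2
      have := hs.1
      gcongr
    have h6 := dist_triangle (γ s) y x
    rw [dist_comm y x] at h6
    nlinarith
  -- the sets of points near a given face are closed, and they are disjoint on the deep part
  intro Y hY hYs g ⟨x, hxY, x', hx', hxx⟩ y hy
  have hcmp : ∀ l, IsCompact (D'.face l) := fun l => (h'.face l).region.compact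
  have hcls : ∀ l, IsClosed {x : E3 | ∃ x' ∈ D'.face l, dist x x' ≤ δ} := by
    intro l
    by_cases hne : (D'.face l).Nonempty
    · have : {x : E3 | ∃ x' ∈ D'.face l, dist x x' ≤ δ} =
          {x | Metric.infDist x (D'.face l) ≤ δ} := by
        ext x
        constructor
        · rintro ⟨x', hx', hd⟩
          exact (Metric.infDist_le_dist_of_mem hx').trans hd
        · intro hx
          obtain ⟨x', hx', hd⟩ := (hcmp l).exists_infDist_eq_dist hne x
          exact ⟨x', hx', hd ▸ hx⟩
      rw [this]
      exact isClosed_le (Metric.continuous_infDist_pt _) continuous_const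
    · convert isClosed_empty
      ext x
      constructor
      · rintro ⟨x', hx', -⟩; exact hne ⟨x', hx'⟩
      · exact fun h => h.elim
  by_contra hyn
  obtain ⟨l, y', hl, hyl⟩ : ∃ l, ∃ y' ∈ D'.face l, dist y y' ≤ δ := by
    obtain ⟨y', hy', hd⟩ := hcl.fwd y (face_subset D j (hYs hy).1)
    obtain ⟨l, hl⟩ := exists_face D' hy'
    exact ⟨l, y', hl, hd⟩
  have hlg : l ≠ g := fun h3 => hyn ⟨y', h3 ▸ hl, hyl⟩
  obtain ⟨z, hzY, ⟨z₁, hz₁, hd₁⟩, hz2⟩ := isPreconnected_closed_iff.1 hY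
    {x : E3 | ∃ x' ∈ D'.face g, dist x x' ≤ δ}
    (⋃ l : {l // l ≠ g}, {x : E3 | ∃ x' ∈ D'.face l, dist x x' ≤ δ}) (hcls g)
    (isClosed_iUnion_of_finite fun l => hcls l) (by
      intro z hz
      obtain ⟨z', hz', hd⟩ := hcl.fwd z (face_subset D j (hYs hz).1)
      obtain ⟨l, hl⟩ := exists_face D' hz'
      by_cases hlg : l = g
      · exact Or.inl ⟨z', hlg ▸ hl, hd⟩
      · exact Or.inr (Set.mem_iUnion.2 ⟨⟨l, hlg⟩, z', hl, hd⟩))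
    ⟨x, hxY, x', hx', hxx⟩ ⟨y, hy, Set.mem_iUnion.2 ⟨⟨l, hlg⟩, y', hl, hyl⟩⟩
  obtain ⟨⟨l', hlg'⟩, z₂, hz₂, hd₂⟩ := Set.mem_iUnion.1 hz2
  exact hlg' (huniq z (hYs hzY) g l' z₁ hz₁ z₂ hz₂ hd₁ hd₂).symm

/-- If the sides of a face correspond to sides of `D'`, the latter all belong to one face. A walk
along the sides of the face inside its deep part is accompanied by a single face `g` of `D'`; beside
the middle of each side only two faces of `D'` meet in the corresponding side, and `g` is one of
them. -/
theorem exists_face_of_sides (θ M : ℝ) (hM : 1 ≤ M) (hθ : 0 < θ) (hθ' : θ < Real.pi / 2) :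
    ∃ c > 0, ∀ {r M₁ δ : ℝ} {D D' : Polyhedron}, NicePolyhedron r θ M M₁ D →
      NicePolyhedron r θ M M₁ D' → D.IsClose D' δ → δ ≤ c * r →
      ∀ (j : Fin D.numFaces) (w : ZMod (D.numSides j) → E3),
      (∀ k, dist (D.corner j k) (w k) ≤ r / (4 * (1 + M) ^ 2)) →
      (∀ k, ∃ i l, D'.side i l = segment ℝ (w k) (w (k + 1))) →
      ∃ g, ∀ k, ∃ l, D'.side g l = segment ℝ (w k) (w (k + 1)) := by
  obtain ⟨c₀, hc₀, H⟩ := exists_near_face_const θ M hM hθ hθ'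
  have hK : 0 < 1 + M := by linarith
  refine ⟨min (c₀ / (16 * (1 + M) ^ 3)) (1 / (16 * (1 + M) ^ 2)), by positivity, ?_⟩
  intro r M₁ δ D D' h h' hcl hδ j w hw hside
  have hr := h.r_pos
  set η := r / (16 * (1 + M) ^ 2) with hη
  have hη0 : 0 < η := by positivity
  have hηr : η ≤ r / (16 * (1 + M)) := by rw [hη]; gcongr; nlinarith
  set ρ := η / (1 + M) with hρ
  have hρ0 : 0 < ρ := by positivity
  have hρr : ρ ≤ r := (div_le_self hη0.le (by linarith)).trans
    (hηr.trans (div_le_self hr.le (by linarith)))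
  have hδ1 : δ ≤ c₀ * ρ := by
    refine (hδ.trans (mul_le_mul_of_nonneg_right (min_le_left _ _) hr.le)).trans_eq ?_
    rw [hρ, hη]; field_simp
  have hδ2 : δ ≤ η := by
    refine (hδ.trans (mul_le_mul_of_nonneg_right (min_le_right _ _) hr.le)).trans_eq ?_
    rw [hη]; ring
  obtain ⟨H1, H2⟩ := H h h' hcl hρ0 hρr hδ1 (j := j)
  choose u hu using fun k => (h.face j).exists_innerNormal k
  -- the stations of the walk, beside the midpoints of the sides
  set p : ZMod (D.numSides j) → E3 := fun k =>
    midpoint ℝ (D.corner j k) (D.corner j (k + 1)) + η • u k with hp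
  have hjoin : ∀ k, JoinedIn (deepPart (D.face j) ρ) (p k) (p (k + 1)) := fun k =>
    (h.face j).joinedIn_midpoints (hu k) (hu (k + 1)) hη0 hηr
  have hpm : ∀ k, p k ∈ deepPart (D.face j) ρ := fun k => (hjoin k).source_mem
  obtain ⟨x', hx', hd⟩ := hcl.fwd (p 0) (face_subset D j (hpm 0).1)
  obtain ⟨g, hg⟩ := exists_face D' hx'
  have hstep : ∀ k, (∃ x' ∈ D'.face g, dist (p k) x' ≤ δ) →
      ∃ x' ∈ D'.face g, dist (p (k + 1)) x' ≤ δ := by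
    intro k hk
    obtain ⟨γ, hγ⟩ := hjoin k
    exact H2 (isPreconnected_range γ.continuous) (Set.range_subset_iff.2 hγ)
      ⟨p k, ⟨0, γ.source⟩, hk⟩ _ ⟨1, γ.target⟩
  have hall : ∀ m : ℕ, ∃ x' ∈ D'.face g, dist (p (m : ZMod (D.numSides j))) x' ≤ δ := by
    intro m
    induction m with
    | zero => exact ⟨x', hg, by simpa using hd⟩
    | succ m ih => rw [Nat.cast_succ]; exact hstep _ ih
  have : NeZero (D.numSides j) := ⟨by have := (h.face j).region.three_le; omega⟩
  refine ⟨g, fun k => ?_⟩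
  obtain ⟨y, hy, hyd⟩ := hall k.val
  rw [ZMod.natCast_zmod_val] at hyd
  obtain ⟨i, l, hil⟩ := hside k
  obtain ⟨i', n, n', hh⟩ := h'.exists_hinge i l
  have hab := (h'.face i).corner_ne l
  have hmid : midpoint ℝ (D'.corner i l) (D'.corner i (l + 1)) = midpoint ℝ (w k) (w (k + 1)) := by
    rcases eq_or_eq_of_segment_eq hab hil.symm with ⟨h1, h2⟩ | ⟨h1, h2⟩
    · rw [h1, h2]
    · rw [h1, h2, midpoint_comm]
  obtain ⟨m1, m2⟩ := (h'.face i).midpoint_dist l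
  have hyE : y ∉ D'.edgeSet := fun hyE => by
    have := H1 (p k) (hpm k) y hyE
    rw [dist_comm] at this
    linarith
  have hnear : dist y (midpoint ℝ (D'.corner i l) (D'.corner i (l + 1))) < r / 2 / (1 + M) ^ 2 := by
    rw [hmid]
    have d1 := dist_triangle4 y (p k) (midpoint ℝ (D.corner j k) (D.corner j (k + 1)))
      (midpoint ℝ (w k) (w (k + 1)))
    have d2 : dist (p k) (midpoint ℝ (D.corner j k) (D.corner j (k + 1))) = η := by
      rw [hp, dist_eq_norm, add_sub_cancel_left, norm_smul, (hu k).unit, mul_one,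
        Real.norm_of_nonneg hη0.le]
    have d3 := dist_midpoint_midpoint_le (D.corner j k) (D.corner j (k + 1)) (w k) (w (k + 1))
    have d4 := hw k
    have d5 := hw (k + 1)
    rw [dist_comm y (p k)] at d1
    have e1 : r / (4 * (1 + M) ^ 2) = 4 * η := by rw [hη]; field_simp; norm_num
    have e2 : r / 2 / (1 + M) ^ 2 = 8 * η := by rw [hη]; field_simp; norm_num
    rw [e1] at d4 d5
    rw [e2]
    linarith
  -- `y` lies in no other face than `g`
  have hface : ∀ i'', y ∈ D'.face i'' → g = i'' := by
    intro i'' hi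
    by_contra hne
    exact hyE (h'.mem_edgeSet_of_mem_faces hne hy hi)
  rcases h'.mem_faces_of_near_hinge hh (midpoint_mem_segment (𝕜 := ℝ) _ _) (by linarith)
    (by linarith) m1 m2 (face_subset D' g hy) hnear with h1 | h1
  · have := hface _ h1
    subst this
    obtain ⟨l', hl'⟩ := hh.side_left
    exact ⟨l', hl'.trans hil⟩
  · have := hface _ h1
    subst this
    obtain ⟨l', hl'⟩ := hh.side_right
    exact ⟨l', hl'.trans hil⟩

end NicePolyhedron

/-! ### The correspondence of vertices, edges and faces -/

/-- If every side of a closed polygon `w` is a side of the closed polygon `v`, then the two polygons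
agree up to numbering. -/
theorem exists_side_of_cyclic {α : Type*} {n m : ℕ} (hn : 3 ≤ n) {w : ZMod n → α}
    {v : ZMod m → α} (hm : m ≠ 0) (hw : Function.Injective w) (hv : Function.Injective v)
    (H : ∀ k, ∃ l, (v l = w k ∧ v (l + 1) = w (k + 1)) ∨ (v l = w (k + 1) ∧ v (l + 1) = w k)) :
    ∀ l, ∃ k, (v l = w k ∧ v (l + 1) = w (k + 1)) ∨ (v l = w (k + 1) ∧ v (l + 1) = w k) := by
  -- `φ` numbers the corners of `w` within `v`; it takes neighbours to neighbours
  have hidx : ∀ k, ∃ i, v i = w k := fun k => by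
    obtain ⟨l, h | h⟩ := H k
    exacts [⟨l, h.1⟩, ⟨l + 1, h.2⟩]
  choose φ hφ using hidx
  have hφi : Function.Injective φ := fun a b h => hw (by rw [← hφ, ← hφ, h])
  have hadj : ∀ k, φ (k + 1) = φ k + 1 ∨ φ k = φ (k + 1) + 1 := by
    intro k
    obtain ⟨l, ⟨h1, h2⟩ | ⟨h1, h2⟩⟩ := H k
    · rw [← hφ] at h1 h2
      exact Or.inl (by rw [← hv h1, ← hv h2])
    · rw [← hφ] at h1 h2
      exact Or.inr (by rw [← hv h1, ← hv h2])
  -- the two neighbours of a corner are distinct because `3 ≤ n`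
  have hne : ∀ k : ZMod n, k + 1 ≠ k - 1 := by
    intro k h
    have h2 : ((2 : ℕ) : ZMod n) = 0 := by
      have : (2 : ZMod n) = (k + 1) - (k - 1) := by ring
      rw [Nat.cast_two, this, h, sub_self]
    rw [ZMod.natCast_eq_zero_iff] at h2
    exact absurd (Nat.le_of_dvd two_pos h2) (by omega)
  -- the numbers of `w` in `v` are closed under passing to the next corner
  have hnext : ∀ k, ∃ k', (k' = k + 1 ∨ k = k' + 1) ∧ φ k' = φ k + 1 := by
    intro k
    have h1 := hadj k
    have h2 := hadj (k - 1)
    rw [sub_add_cancel] at h2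
    rcases h1 with h1 | h1
    · exact ⟨k + 1, Or.inl rfl, h1⟩
    rcases h2 with h2 | h2
    · exact absurd (hφi (add_right_cancel (h1.symm.trans h2))) (hne k)
    · exact ⟨k - 1, Or.inr (by ring), h2⟩
  have hsurj : Function.Surjective φ := by
    have : NeZero m := ⟨hm⟩
    have hnat : ∀ a : ℕ, ∃ k, φ k = φ 0 + a := by
      intro a
      induction a with
      | zero => exact ⟨0, by simp⟩
      | succ a ih =>
        obtain ⟨k, hk⟩ := ih
        obtain ⟨k', -, hk'⟩ := hnext k
        exact ⟨k', by rw [hk', hk]; push_cast; ring⟩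
    intro l
    obtain ⟨k, hk⟩ := hnat (l - φ 0).val
    exact ⟨k, by rw [hk, ZMod.natCast_zmod_val]; ring⟩
  intro l
  obtain ⟨k, rfl⟩ := hsurj l
  obtain ⟨k', h | h, hk'⟩ := hnext k
  · exact ⟨k, Or.inl ⟨hφ k, by rw [← hk', hφ, h]⟩⟩
  · exact ⟨k', Or.inr ⟨by rw [hφ, h], by rw [← hk', hφ]⟩⟩

/-- The map `φ` from the vertices of `D` to those of `D'` takes sides to sides and faces to
faces. -/
structure Polyhedron.IsMatching (D D' : Polyhedron) (φ : E3 → E3) : Prop where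
  mapsTo : ∀ p ∈ D.vertices, φ p ∈ D'.vertices
  injOn : Set.InjOn φ D.vertices
  side : ∀ i k, ∃ i' k',
    D'.side i' k' = segment ℝ (φ (D.corner i k)) (φ (D.corner i (k + 1)))
  face : ∀ j, ∃ g, Set.range (D'.corner g) = φ '' Set.range (D.corner j) ∧
    intrinsicFrontier ℝ (D'.face g) =
      ⋃ k, segment ℝ (φ (D.corner j k)) (φ (D.corner j (k + 1)))

namespace NicePolyhedron

variable {r θ M M₁ : ℝ} {D D' : Polyhedron}

theorem isMatching_of_sides (h : NicePolyhedron r θ M M₁ D) (h' : NicePolyhedron r θ M M₁ D')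
    {φ : E3 → E3} (hφ : ∀ p ∈ D.vertices, φ p ∈ D'.vertices) (hinj : Set.InjOn φ D.vertices)
    (hside : ∀ i k, ∃ i' k',
      D'.side i' k' = segment ℝ (φ (D.corner i k)) (φ (D.corner i (k + 1))))
    (hface : ∀ j, ∃ g, ∀ k, ∃ l,
      D'.side g l = segment ℝ (φ (D.corner j k)) (φ (D.corner j (k + 1)))) :
    D.IsMatching D' φ := by
  refine ⟨hφ, hinj, hside, fun j => ?_⟩
  obtain ⟨g, hg⟩ := hface j
  have hrev := exists_side_of_cyclic (w := fun k => φ (D.corner j k)) (v := D'.corner g)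
    (h.face j).region.three_le (by have := (h'.face g).region.three_le; omega)
    (fun a b hab => (h.face j).region.corners_injective
      (hinj (corner_mem_vertices D j a) (corner_mem_vertices D j b) hab))
    (h'.face g).region.corners_injective (fun k => by
      obtain ⟨l, hl⟩ := hg k
      refine ⟨l, eq_or_eq_of_segment_eq (fun h1 => ?_) hl⟩
      exact (h.face j).corner_ne k (hinj (corner_mem_vertices D j _) (corner_mem_vertices D j _) h1))
  refine ⟨g, Set.Subset.antisymm ?_ ?_, ?_⟩
  · rintro _ ⟨l, rfl⟩
    obtain ⟨k, h1 | h1⟩ := hrev l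
    · exact ⟨_, ⟨k, rfl⟩, h1.1.symm⟩
    · exact ⟨_, ⟨k + 1, rfl⟩, h1.1.symm⟩
  · rintro _ ⟨_, ⟨k, rfl⟩, rfl⟩
    obtain ⟨l, hl⟩ := hg k
    rcases eq_or_eq_of_segment_eq (fun h1 => (h.face j).corner_ne k
      (hinj (corner_mem_vertices D j _) (corner_mem_vertices D j _) h1)) hl with h1 | h1
    · exact ⟨l, h1.1⟩
    · exact ⟨l + 1, h1.2⟩
  · rw [(h'.face g).region.relBoundary]
    refine Set.Subset.antisymm (Set.iUnion_subset fun l => ?_) (Set.iUnion_subset fun k => ?_)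
    · obtain ⟨k, h1 | h1⟩ := hrev l
      · rw [h1.1, h1.2]
        exact Set.subset_iUnion (fun k => segment ℝ (φ (D.corner j k)) (φ (D.corner j (k + 1)))) k
      · rw [h1.1, h1.2, segment_symm]
        exact Set.subset_iUnion (fun k => segment ℝ (φ (D.corner j k)) (φ (D.corner j (k + 1)))) k
    · obtain ⟨l, hl⟩ := hg k
      rw [← hl]
      exact Set.subset_iUnion (fun l => segment ℝ (D'.corner g l) (D'.corner g (l + 1))) l

/-- Neighbouring polyhedra are combinatorially equivalent, and corresponding vertices are as close
as the boundaries. The vertex corresponding to `p` is the only vertex of the other polyhedron near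
`p`, by `vertex_dist`; hence the correspondences in both directions are inverse to each other. -/
theorem exists_matching (θ M M₁ : ℝ) (hM : 1 ≤ M) (hM₁ : 0 < M₁) (hθ : 0 < θ)
    (hθ' : θ < Real.pi / 2) :
    ∃ c > 0, ∃ K ≥ 1, ∀ {r d : ℝ} {D D' : Polyhedron}, NicePolyhedron r θ M M₁ D →
      NicePolyhedron r θ M M₁ D' → D.IsClose D' d → 0 ≤ d → d ≤ c * r →
      ∃ φ ψ : E3 → E3, D.IsMatching D' φ ∧ D'.IsMatching D ψ ∧ (∀ p ∈ D.vertices, ψ (φ p) = p) ∧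
        (∀ p ∈ D'.vertices, φ (ψ p) = p) ∧ (∀ p ∈ D.vertices, dist p (φ p) ≤ K * d) := by
  obtain ⟨c₁, hc₁, K, hK, H₁⟩ := exists_vertex_near_vertex θ M hM hθ hθ'
  obtain ⟨c₂, hc₂, H₂⟩ := exists_side_of_side θ M M₁ hM hM₁ hθ hθ'
  obtain ⟨c₃, hc₃, H₃⟩ := exists_face_of_sides θ M hM hθ hθ'
  have hM0 : 0 < 1 + M := by linarith
  set c := min c₁ (min c₂ (min c₃ (1 / (4 * K * (1 + M) ^ 2)))) with hc
  have hc0 : 0 < c := by positivity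
  refine ⟨c, hc0, K, hK, ?_⟩
  intro r d D D' h h' hcl hd0 hd
  have hr := h.r_pos
  -- the correspondence is found at the scale `c * r`, which is positive even if `d = 0`
  set δ := c * r with hδ
  have hδ0 : 0 < δ := by positivity
  have h1 : δ ≤ c₁ * r := by rw [hδ]; gcongr; exact min_le_left _ _
  have h2 : δ ≤ c₂ * r := by
    rw [hδ]; gcongr; exact (min_le_right _ _).trans (min_le_left _ _)
  have h3 : δ ≤ c₃ * r := by
    rw [hδ]; gcongr
    exact (min_le_right _ _).trans ((min_le_right _ _).trans (min_le_left _ _))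
  have h4 : K * δ ≤ r / (4 * (1 + M) ^ 2) := by
    have : δ ≤ 1 / (4 * K * (1 + M) ^ 2) * r := by
      rw [hδ]; gcongr
      exact (min_le_right _ _).trans ((min_le_right _ _).trans (min_le_right _ _))
    calc K * δ ≤ K * (1 / (4 * K * (1 + M) ^ 2) * r) := by gcongr
      _ = _ := by field_simp
  have hsep : r / (1 + M) ^ 2 = 4 * (r / (4 * (1 + M) ^ 2)) := by field_simp
  have hpos : 0 < r / (4 * (1 + M) ^ 2) := by positivity
  have hclδ := hcl.mono hd
  have key : ∀ {D D' : Polyhedron}, NicePolyhedron r θ M M₁ D → NicePolyhedron r θ M M₁ D' →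
      D.IsClose D' d → ∃ φ : E3 → E3, ∀ p ∈ D.vertices, φ p ∈ D'.vertices ∧
        dist p (φ p) ≤ K * δ ∧ dist p (φ p) ≤ K * d := by
    intro D D' h h' hcl
    have hex : ∀ p : E3, ∃ q : E3, p ∈ D.vertices → q ∈ D'.vertices ∧ dist p q ≤ K * δ := by
      intro p
      by_cases hp : p ∈ D.vertices
      · obtain ⟨q, hq, hpq⟩ := H₁ h' h (hcl.mono hd).symm hδ0 h1 p hp
        exact ⟨q, fun _ => ⟨hq, hpq⟩⟩
      · exact ⟨0, fun hp' => absurd hp' hp⟩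
    choose φ hφ using hex
    refine ⟨φ, fun p hp => ⟨(hφ p hp).1, (hφ p hp).2, ?_⟩⟩
    -- applying the estimate for vertices at scales slightly above `d` gives the same vertex
    refine le_of_forall_pos_le_add fun ε hε => ?_
    set δ' := min δ (d + ε / K) with hδ'
    have hεK : 0 < ε / K := by positivity
    obtain ⟨q, hq, hpq⟩ := H₁ h' h (hcl.mono (le_min hd (by linarith))).symm
      (lt_min hδ0 (by linarith) : 0 < δ') ((min_le_left _ _).trans h1) p hp
    have : q = φ p := by
      by_contra hne
      have h5 := h'.vertex_dist hq (hφ p hp).1 hne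
      have h6 := dist_triangle_left q (φ p) p
      have h7 : K * δ' ≤ K * δ := by gcongr; exact min_le_left _ _
      have h8 := (hφ p hp).2
      linarith
    rw [← this]
    refine hpq.trans ?_
    have : K * δ' ≤ K * (d + ε / K) := by gcongr; exact min_le_right _ _
    calc K * δ' ≤ K * (d + ε / K) := this
      _ = _ := by field_simp
  obtain ⟨φ, hφ⟩ := key h h' hcl
  obtain ⟨ψ, hψ⟩ := key h' h hcl.symm
  have hψφ : ∀ p ∈ D.vertices, ψ (φ p) = p := by
    intro p hp
    by_contra hne
    have h5 := h.vertex_dist (hψ _ (hφ p hp).1).1 hp hne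
    have h6 := dist_triangle_left (ψ (φ p)) p (φ p)
    have h7 := (hφ p hp).2.1
    have h8 := (hψ _ (hφ p hp).1).2.1
    rw [dist_comm (φ p) p] at h6
    linarith
  have hφψ : ∀ p ∈ D'.vertices, φ (ψ p) = p := by
    intro p hp
    by_contra hne
    have h5 := h'.vertex_dist (hφ _ (hψ p hp).1).1 hp hne
    have h6 := dist_triangle_left (φ (ψ p)) p (ψ p)
    have h7 := (hψ p hp).2.1
    have h8 := (hφ _ (hψ p hp).1).2.1
    rw [dist_comm (ψ p) p] at h6
    linarith
  have hmatch : ∀ {D D' : Polyhedron} (φ ψ : E3 → E3), NicePolyhedron r θ M M₁ D →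
      NicePolyhedron r θ M M₁ D' → D.IsClose D' δ →
      (∀ p ∈ D.vertices, φ p ∈ D'.vertices ∧ dist p (φ p) ≤ K * δ ∧ dist p (φ p) ≤ K * d) →
      (∀ p ∈ D.vertices, ψ (φ p) = p) → D.IsMatching D' φ := by
    intro D D' φ ψ h h' hcl hφ hψφ
    have hs : ∀ i k, ∃ i' k',
        D'.side i' k' = segment ℝ (φ (D.corner i k)) (φ (D.corner i (k + 1))) := fun i k => by
      have q1 := hφ _ (corner_mem_vertices D i k)
      have q2 := hφ _ (corner_mem_vertices D i (k + 1))
      exact H₂ h h' hcl hδ0 h2 i k _ q1.1 _ q2.1 (q1.2.1.trans h4) (q2.2.1.trans h4)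
    refine h.isMatching_of_sides h' (fun p hp => (hφ p hp).1) ?_ hs fun j => ?_
    · intro p hp q hq hpq
      rw [← hψφ p hp, hpq, hψφ q hq]
    · exact H₃ h h' hcl h3 j (fun k => φ (D.corner j k))
        (fun k => (hφ _ (corner_mem_vertices D j k)).2.1.trans h4) (fun k => hs j k)
  exact ⟨φ, ψ, hmatch φ ψ h h' hclδ hφ hψφ, hmatch ψ φ h' h hclδ.symm hψ hφψ, hψφ, hφψ,
    fun p hp => (hφ p hp).2.2⟩

end NicePolyhedron

/-! ### The displacement field on a face -/

/-- The affine interpolation along the segment from `a` to `b` of the values `p` and `q`, constant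
in the directions orthogonal to the segment. -/
noncomputable def sideInterp (a b p q : E3) : E3 →ᵃ[ℝ] E3 where
  toFun x := p + (⟪unitDir a b, x - a⟫ / dist a b) • (q - p)
  linear := (innerₗ E3 ((dist a b)⁻¹ • unitDir a b)).smulRight (q - p)
  map_vadd' x w := by
    simp only [vadd_eq_add, LinearMap.smulRight_apply, innerₗ_apply_apply, inner_smul_left,
      conj_trivial]
    rw [show w + x - a = w + (x - a) by abel, inner_add_right, add_div, add_smul]
    rw [div_eq_inv_mul]
    abel

theorem sideInterp_apply (a b p q x : E3) :
    sideInterp a b p q x = p + (⟪unitDir a b, x - a⟫ / dist a b) • (q - p) := rfl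

theorem sideInterp_segment {a b x : E3} (p q : E3) (hab : a ≠ b) (hx : x ∈ segment ℝ a b) :
    sideInterp a b p q x = p + (dist x a / dist a b) • (q - p) := by
  obtain ⟨h1, -, -⟩ := segment_param hab hx
  have : ⟪unitDir a b, x - a⟫ = dist x a := by
    nth_rewrite 1 [h1]
    rw [add_sub_cancel_left, inner_smul_right, real_inner_self_eq_norm_sq, norm_unitDir hab]
    ring
  rw [sideInterp_apply, this]

theorem sideInterp_left {a b : E3} (p q : E3) : sideInterp a b p q a = p := by
  rw [sideInterp_apply, sub_self, inner_zero_right, zero_div, zero_smul, add_zero]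

theorem sideInterp_right {a b : E3} (p q : E3) (hab : a ≠ b) : sideInterp a b p q b = q := by
  rw [sideInterp_segment p q hab (right_mem_segment ℝ a b), dist_comm,
    div_self (dist_ne_zero.2 hab), one_smul, add_sub_cancel]

theorem norm_sideInterp_sub_le {a b p q : E3} {r μ : ℝ} (hr : 0 < r) (hab : r ≤ dist a b)
    (hp : ‖p‖ ≤ μ) (hq : ‖q‖ ≤ μ) (x y : E3) :
    ‖sideInterp a b p q x - sideInterp a b p q y‖ ≤ 2 * μ / r * dist x y := by
  have hne : a ≠ b := dist_pos.1 (hr.trans_le hab)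
  have e1 : sideInterp a b p q x - sideInterp a b p q y =
      (⟪unitDir a b, x - y⟫ / dist a b) • (q - p) := by
    rw [sideInterp_apply, sideInterp_apply, add_sub_add_left_eq_sub, ← sub_smul, ← sub_div,
      ← inner_sub_right, sub_sub_sub_cancel_right]
  have h1 : ‖q - p‖ ≤ 2 * μ := (norm_sub_le _ _).trans (by linarith)
  have h2 : |⟪unitDir a b, x - y⟫| ≤ dist x y := by
    have := abs_real_inner_le_norm (unitDir a b) (x - y)
    rwa [norm_unitDir hne, one_mul, ← dist_eq_norm] at this
  rw [e1, norm_smul, Real.norm_eq_abs, abs_div, abs_of_pos (hr.trans_le hab)]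
  have hμ : 0 ≤ μ := (norm_nonneg _).trans hp
  calc |⟪unitDir a b, x - y⟫| / dist a b * ‖q - p‖ ≤ dist x y / r * (2 * μ) := by gcongr
    _ = _ := by ring

/-- On the triangle the coordinate along the side stays between the two ends. -/
theorem norm_sideInterp_le {r m a b u p q x μ} (hm : 0 < m) (hab : a ≠ b) (hp : ‖p‖ ≤ μ)
    (hq : ‖q‖ ≤ μ) (hut : ⟪unitDir a b, u⟫ = 0) (hx : x ∈ sideTriangle r m a b u) :
    ‖sideInterp a b p q x‖ ≤ 3 * μ := by
  obtain ⟨α, β, rfl, h0, h1, h2, -⟩ := hx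
  have hα : 0 ≤ α := by by_contra hneg; nlinarith
  have hα' : α ≤ dist a b := by by_contra hneg; nlinarith
  have hd : 0 < dist a b := dist_pos.2 hab
  have e1 : ⟪unitDir a b, a + α • unitDir a b + β • u - a⟫ = α := by
    rw [show a + α • unitDir a b + β • u - a = α • unitDir a b + β • u by abel, inner_add_right,
      inner_smul_right, inner_smul_right, hut, real_inner_self_eq_norm_sq, norm_unitDir hab]
    ring
  rw [sideInterp_apply, e1]
  refine (norm_add_le _ _).trans ?_
  rw [norm_smul, Real.norm_of_nonneg (by positivity)]
  have h3 : ‖q - p‖ ≤ 2 * μ := (norm_sub_le _ _).trans (by linarith)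
  have h4 : α / dist a b ≤ 1 := (div_le_one hd).2 hα'
  have h5 : α / dist a b * ‖q - p‖ ≤ 1 * (2 * μ) := by gcongr
  linarith

namespace NicePolygon

variable {r θ M : ℝ} {F : Set E3} {n : ℕ} {v : ZMod n → E3}

/-- The interpolations along the sides fit together to a Lipschitz field on the union of the
triangles over the sides: interpolations over adjacent sides agree at the common corner, where the
triangles leave an angle, and triangles over nonadjacent sides are at a definite distance. -/
theorem exists_interp (θ M : ℝ) (hM : 1 ≤ M) (hθ : 0 < θ) (hθ' : θ < Real.pi / 2) :
    ∃ C > 0, ∀ {r μ : ℝ} {F : Set E3} {n : ℕ} {v : ZMod n → E3}, NicePolygon r θ M F n v →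
      ∀ {disp u : ZMod n → E3}, (∀ k, IsInnerNormal r M F (v k) (v (k + 1)) (u k)) →
      (∀ k, ‖disp k‖ ≤ μ) → ∃ G : E3 → E3, (∀ x y, dist (G x) (G y) ≤ C * μ / r * dist x y) ∧
        ∀ k, Set.EqOn G (sideInterp (v k) (v (k + 1)) (disp k) (disp (k + 1)))
          (sideTriangle r (baseSlope θ M) (v k) (v (k + 1)) (u k)) := by
  have hcos : Real.cos (θ / 3) < 1 := by
    rw [← Real.cos_zero]
    exact Real.cos_lt_cos_of_nonneg_of_le_pi_div_two le_rfl (by linarith) (by linarith)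
  -- the constant of `NicePolygon.dist_sideTriangle_adjacent`
  set B := (1 - Real.cos (θ / 3)) / 2 with hB
  have hB0 : 0 < B := by rw [hB]; linarith
  set L := lipschitzExtensionConstant E3
  have hL : 0 < (L : ℝ) := by exact_mod_cast lipschitzExtensionConstant_pos E3
  set C := 2 + 2 / √B + 15 * M with hC
  have hC0 : 0 < C := by positivity
  refine ⟨L * C, by positivity, ?_⟩
  intro r μ F n v h disp u hu hd
  have hr := h.r_pos
  have hμ : 0 ≤ μ := (norm_nonneg _).trans (hd 0)
  set m := baseSlope θ M with hm
  have hm0 : 0 < m := baseSlope_pos hθ hθ'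
  set T : ZMod n → Set E3 := fun k => sideTriangle r m (v k) (v (k + 1)) (u k) with hT
  set A : ZMod n → (E3 →ᵃ[ℝ] E3) := fun k => sideInterp (v k) (v (k + 1)) (disp k) (disp (k + 1))
    with hA
  have hAl : ∀ k x y, ‖A k x - A k y‖ ≤ 2 * μ / r * dist x y := fun k x y =>
    norm_sideInterp_sub_le hr (h.len k) (hd k) (hd (k + 1)) x y
  have hμr : 0 ≤ μ / r := by positivity
  -- adjacent triangles
  have hadj : ∀ k, ∀ x ∈ T k, ∀ y ∈ T (k + 1),
      ‖A k x - A (k + 1) y‖ ≤ C * μ / r * dist x y := by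
    intro k x hx y hy
    have h1 := h.dist_sideTriangle_adjacent (hu k) (hu (k + 1)) hx hy
    set V := v (k + 1)
    have hAV : A k V = A (k + 1) V := by
      rw [hA]; simp only
      rw [sideInterp_right _ _ (h.corner_ne k), sideInterp_left]
    have h2 : dist x V + dist y V ≤ 1 / √B * dist x y := by
      rw [div_mul_eq_mul_div, one_mul, le_div_iff₀ (Real.sqrt_pos.2 hB0), mul_comm]
      refine abs_le_of_sq_le_sq' ?_ dist_nonneg |>.2
      rw [mul_pow, Real.sq_sqrt hB0.le]; exact h1
    have h3 : A k x - A (k + 1) y = (A k x - A k V) - (A (k + 1) y - A (k + 1) V) := by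
      rw [hAV]; abel
    rw [h3]
    calc _ ≤ ‖A k x - A k V‖ + ‖A (k + 1) y - A (k + 1) V‖ := norm_sub_le _ _
      _ ≤ 2 * μ / r * dist x V + 2 * μ / r * dist y V := add_le_add (hAl _ _ _) (hAl _ _ _)
      _ = 2 * (μ / r) * (dist x V + dist y V) := by ring
      _ ≤ 2 * (μ / r) * (1 / √B * dist x y) := by gcongr
      _ = (2 / √B) * (μ / r * dist x y) := by ring
      _ ≤ C * (μ / r * dist x y) := by gcongr; rw [hC]; linarith
      _ = _ := by ring
  have hall : ∀ k l, ∀ x ∈ T k, ∀ y ∈ T l, ‖A k x - A l y‖ ≤ C * μ / r * dist x y := by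
    intro k l x hx y hy
    by_cases h0 : l = k
    · subst h0
      refine (hAl l x y).trans ?_
      have hb : 0 < 2 / √B := div_pos two_pos (Real.sqrt_pos.2 hB0)
      have : 2 ≤ C := by rw [hC]; linarith
      gcongr
    by_cases h1 : l = k + 1
    · subst h1; exact hadj k x hx y hy
    by_cases h2 : l = k - 1
    · have h3 : k = l + 1 := by rw [h2]; ring
      subst h3
      rw [norm_sub_rev, dist_comm]
      exact hadj l y hy x hx
    · have h3 := h.dist_sideTriangle_nonadjacent h0 h1 h2 (hu k).unit (hu l).unit hx hy
      have n1 : ‖A k x‖ ≤ 3 * μ :=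
        norm_sideInterp_le hm0 (h.corner_ne k) (hd k) (hd (k + 1)) (hu k).orth hx
      have n2 : ‖A l y‖ ≤ 3 * μ :=
        norm_sideInterp_le hm0 (h.corner_ne l) (hd l) (hd (l + 1)) (hu l).orth hy
      rw [dist_comm y x] at h3
      calc ‖A k x - A l y‖ ≤ 6 * μ := (norm_sub_le _ _).trans (by linarith)
        _ = 15 * M * (μ / r) * (2 * r / (5 * M)) := by field_simp; ring
        _ ≤ 15 * M * (μ / r) * dist x y := by gcongr
        _ ≤ C * (μ / r) * dist x y := by
          have hb : 0 < 2 / √B := div_pos two_pos (Real.sqrt_pos.2 hB0)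
          have : 15 * M ≤ C := by rw [hC]; linarith
          gcongr
        _ = _ := by ring
  classical
  -- the common field on the union, which is then extended to the whole space
  set G₀ : E3 → E3 := fun x => if hx : ∃ k, x ∈ T k then A hx.choose x else 0 with hG₀
  have hG₀e : ∀ k, ∀ x ∈ T k, G₀ x = A k x := by
    intro k x hx
    have hex : ∃ k, x ∈ T k := ⟨k, hx⟩
    rw [hG₀]
    simp only [dif_pos hex]
    have := hall _ k x hex.choose_spec x hx
    rw [dist_self, mul_zero] at this
    exact sub_eq_zero.1 (norm_le_zero_iff.1 this)
  have hlip : LipschitzOnWith (C * μ / r).toNNReal G₀ {x | ∃ k, x ∈ T k} := by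
    refine LipschitzOnWith.of_dist_le_mul ?_
    rintro x ⟨k, hk⟩ y ⟨l, hl⟩
    rw [Real.coe_toNNReal _ (by positivity), dist_eq_norm, hG₀e k x hk, hG₀e l y hl]
    exact hall k l x hk y hl
  obtain ⟨G, hG, hGe⟩ := hlip.extend_finite_dimension
  refine ⟨G, fun x y => ?_, fun k x hx => ?_⟩
  · have := hG.dist_le_mul x y
    rw [NNReal.coe_mul, Real.coe_toNNReal _ (by positivity)] at this
    calc _ ≤ _ := this
      _ = _ := by ring
  · rw [← hGe ⟨k, hx⟩, hG₀e k x hx]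

/-- If the corners of the face move by at most `μ` to points of the plane `o + W'`, the plane of
the face is nearly parallel to `W'`. -/
theorem exists_tilt_bound (θ : ℝ) (hθ : 0 < θ) (hθ' : θ < Real.pi / 2) :
    ∃ C > 0, ∀ {r μ M : ℝ} {F : Set E3} {n : ℕ} {v : ZMod n → E3}, NicePolygon r θ M F n v →
      ∀ {disp : ZMod n → E3} {W' : Submodule ℝ E3}, (∀ k, ‖disp k‖ ≤ μ) →
      (∀ k l, v k + disp k - (v l + disp l) ∈ W') → ∀ w ∈ (affineSpan ℝ F).direction,
      ‖W'.starProjection w - w‖ ≤ C * μ / r * ‖w‖ := by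
  have hs : 0 < Real.sin θ := Real.sin_pos_of_pos_of_lt_pi hθ (by linarith [Real.pi_pos])
  refine ⟨2 * (1 + 2 / Real.sin θ), by positivity, ?_⟩
  intro r μ M F n v h disp W' hd hW w hw
  have hr := h.r_pos
  have hμ : 0 ≤ μ := (norm_nonneg _).trans (hd 0)
  obtain ⟨u, hu⟩ := h.exists_innerNormal 0
  -- write `w` in terms of the directions `t`, `s` of the two sides at a corner
  set t := unitDir (v 0) (v (0 + 1)) with ht
  set s := unitDir (v 0) (v (0 - 1)) with hsd
  have ht1 : ‖t‖ = 1 := norm_unitDir (h.corner_ne 0)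
  have hs1 : ‖s‖ = 1 := norm_unitDir (h.prev_ne 0)
  have hsW : s ∈ (affineSpan ℝ F).direction :=
    h.unitDir_mem (h.corner_mem_face 0) (h.corner_mem_face (0 - 1))
  have hse := hu.expand s hsW
  have hang := h.abs_inner_unitDir_le 0
  set a := ⟪t, s⟫ with ha
  set b := ⟪u, s⟫ with hb
  have hab : a ^ 2 + b ^ 2 = 1 := by
    have h1 : ‖s‖ ^ 2 = a ^ 2 + b ^ 2 := by
      rw [← real_inner_self_eq_norm_sq]
      nth_rewrite 2 [hse]
      rw [inner_add_right, inner_smul_right, inner_smul_right, real_inner_comm, ← ha,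
        real_inner_comm, ← hb]
      ring
    rw [← h1, hs1]; norm_num
  have ha1 : |a| ≤ 1 := hang.trans (Real.cos_le_one _)
  have hbs : Real.sin θ ≤ |b| := by
    refine abs_le_of_sq_le_sq' ?_ (abs_nonneg b) |>.2
    rw [sq_abs]
    have : a ^ 2 ≤ Real.cos θ ^ 2 := by rw [← sq_abs]; gcongr
    have := Real.sin_sq_add_cos_sq θ
    linarith
  have hb0 : b ≠ 0 := fun h0 => by rw [h0, abs_zero] at hbs; linarith
  set β := ⟪u, w⟫ / b with hβ
  set α := ⟪t, w⟫ - β * a with hα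
  have hwe : w = α • t + β • s := by
    have h1 : β • s = (β * a) • t + ⟪u, w⟫ • u := by
      nth_rewrite 1 [hse]
      rw [smul_add, smul_smul, smul_smul, hβ, div_mul_cancel₀ _ hb0]
    rw [h1, hα, sub_smul]
    nth_rewrite 1 [hu.expand w hw]
    abel
  have hβn : |β| ≤ 1 / Real.sin θ * ‖w‖ := by
    rw [hβ, abs_div, div_mul_eq_mul_div, one_mul]
    have h1 := abs_real_inner_le_norm u w
    rw [hu.unit, one_mul] at h1
    gcongr
  have hαn : |α| ≤ (1 + 1 / Real.sin θ) * ‖w‖ := by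
    rw [hα]
    refine (abs_sub _ _).trans ?_
    have h1 := abs_real_inner_le_norm t w
    rw [ht1, one_mul] at h1
    rw [abs_mul]
    have h2 : |β| * |a| ≤ 1 / Real.sin θ * ‖w‖ * 1 := by gcongr
    linarith
  -- the images of the two directions
  have himg : ∀ k, r ≤ dist (v 0) (v k) → ∃ w' ∈ W', ‖unitDir (v 0) (v k) - w'‖ ≤ 2 * μ / r := by
    intro k hk
    have hpos : 0 < dist (v 0) (v k) := hr.trans_le hk
    refine ⟨(dist (v 0) (v k))⁻¹ • (v k + disp k - (v 0 + disp 0)),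
      Submodule.smul_mem _ _ (hW k 0), ?_⟩
    have e1 : unitDir (v 0) (v k) = (dist (v 0) (v k))⁻¹ • (v k - v 0) := by
      rw [← dist_smul_unitDir (dist_pos.1 hpos), inv_smul_smul₀ hpos.ne']
    rw [e1, ← smul_sub, show v k - v 0 - (v k + disp k - (v 0 + disp 0)) = disp 0 - disp k by abel,
      norm_smul, norm_inv, Real.norm_of_nonneg hpos.le]
    have h1 : ‖disp 0 - disp k‖ ≤ 2 * μ := (norm_sub_le _ _).trans (by linarith [hd 0, hd k])
    calc (dist (v 0) (v k))⁻¹ * ‖disp 0 - disp k‖ ≤ r⁻¹ * (2 * μ) := by gcongr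
      _ = _ := by ring
  obtain ⟨t', ht', htt⟩ := himg (0 + 1) (h.len 0)
  obtain ⟨s', hs', hss⟩ := himg (0 - 1) (h.prev_len 0)
  have hw' : α • t' + β • s' ∈ W' :=
    Submodule.add_mem _ (Submodule.smul_mem _ _ ht') (Submodule.smul_mem _ _ hs')
  -- the orthogonal projection gives the nearest point of `W'`
  have hproj : ‖W'.starProjection w - w‖ ≤ ‖w - (α • t' + β • s')‖ := by
    have e1 : w - W'.starProjection w = W'ᗮ.starProjection (w - (α • t' + β • s')) := by
      rw [Submodule.starProjection_orthogonal', sub_apply, one_apply_eq_self, map_sub,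
        Submodule.starProjection_eq_self_iff.2 hw']
      abel
    rw [norm_sub_rev, e1]
    exact Submodule.norm_starProjection_apply_le _ _
  refine hproj.trans ?_
  have e2 : w - (α • t' + β • s') = α • (t - t') + β • (s - s') := by
    nth_rewrite 1 [hwe]; module
  rw [e2]
  refine (norm_add_le _ _).trans ?_
  rw [norm_smul, norm_smul, Real.norm_eq_abs, Real.norm_eq_abs]
  calc |α| * ‖t - t'‖ + |β| * ‖s - s'‖
      ≤ (1 + 1 / Real.sin θ) * ‖w‖ * (2 * μ / r) + 1 / Real.sin θ * ‖w‖ * (2 * μ / r) := by gcongr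
    _ = _ := by ring

/-- A displacement of the corners into a plane `P'` extends to a small Lipschitz displacement of
the face into `P'` that is affine along the sides and on the triangles over them. -/
theorem exists_face_field (θ M : ℝ) (hM : 1 ≤ M) (hθ : 0 < θ) (hθ' : θ < Real.pi / 2) :
    ∃ C > 0, ∀ {r μ : ℝ} {F : Set E3} {n : ℕ} {v : ZMod n → E3}, NicePolygon r θ M F n v →
      ∀ {disp : ZMod n → E3} {P' : AffineSubspace ℝ E3}, (∀ k, ‖disp k‖ ≤ μ) →
      (∀ k, v k + disp k ∈ P') → ∃ U : E3 → E3,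
        (∀ x ∈ affineSpan ℝ F, ∀ y ∈ affineSpan ℝ F,
          dist (U x) (U y) ≤ C * μ / r * dist x y) ∧
        (∀ x, x + U x ∈ P') ∧
        (∀ k, ∀ x ∈ segment ℝ (v k) (v (k + 1)),
          U x = sideInterp (v k) (v (k + 1)) (disp k) (disp (k + 1)) x) ∧
        ∀ k, ∃ u, IsInnerNormal r M F (v k) (v (k + 1)) u ∧ ∃ a : E3 →ᵃ[ℝ] E3,
          Set.EqOn U a (sideTriangle r (baseSlope θ M) (v k) (v (k + 1)) u) := by
  obtain ⟨C₁, hC₁, H₁⟩ := exists_interp θ M hM hθ hθ'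
  obtain ⟨C₂, hC₂, H₂⟩ := exists_tilt_bound θ hθ hθ'
  refine ⟨C₁ + C₂, by positivity, ?_⟩
  intro r μ F n v h disp P' hd hP
  have hr := h.r_pos
  choose u hu using h.exists_innerNormal
  obtain ⟨G, hG, hGe⟩ := H₁ h hu hd
  set W' := P'.direction with hW'
  set o := v 0 + disp 0 with ho
  have hoP : o ∈ P' := hP 0
  have htilt := H₂ h (W' := W') hd (fun k l => AffineSubspace.vsub_mem_direction (hP k) (hP l))
  -- project the displaced points `x + G x` orthogonally to `P'`
  set U : E3 → E3 := fun x => o + W'.starProjection (x + G x - o) - x with hU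
  refine ⟨U, fun x hx y hy => ?_, fun x => ?_, fun k x hx => ?_, fun k => ⟨u k, hu k, ?_⟩⟩
  · have hw : x - y ∈ (affineSpan ℝ F).direction := AffineSubspace.vsub_mem_direction hx hy
    have e1 : U x - U y = (W'.starProjection (x - y) - (x - y)) +
        W'.starProjection (G x - G y) := by
      simp only [hU, map_sub, map_add]; abel
    rw [dist_eq_norm, e1]
    refine (norm_add_le _ _).trans ?_
    have h1 := htilt _ hw
    have h2 := (Submodule.norm_starProjection_apply_le W' (G x - G y))
    have h3 := hG x y
    rw [dist_eq_norm] at h3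
    rw [← dist_eq_norm x y] at h1
    have e2 : (C₁ + C₂) * μ / r * dist x y =
      C₁ * μ / r * dist x y + C₂ * μ / r * dist x y := by ring
    rw [e2]
    linarith
  · have e1 : x + U x = W'.starProjection (x + G x - o) + o := by
      simp only [hU]; abel
    rw [e1]
    exact AffineSubspace.vadd_mem_of_mem_direction (Submodule.starProjection_apply_mem _ _) hoP
  · have h1 := hGe k (segment_subset_sideTriangle hr.le (baseSlope_pos hθ hθ').le (h.corner_ne k)
      (u k) hx)
    -- on the sides the displaced points are in `P'` already
    have h2 : x + G x ∈ P' := by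
      have hne := h.corner_ne k
      rw [h1, sideInterp_segment _ _ hne hx]
      have h3 : x = v k + (dist x (v k) / dist (v k) (v (k + 1))) • (v (k + 1) - v k) := by
        obtain ⟨h4, -, -⟩ := segment_param hne hx
        nth_rewrite 1 [h4]
        rw [← dist_smul_unitDir hne, smul_smul, div_mul_cancel₀ _ (dist_ne_zero.2 hne)]
      set c := dist x (v k) / dist (v k) (v (k + 1)) with hc
      have h5 : x + (disp k + c • (disp (k + 1) - disp k)) =
          c • ((v (k + 1) + disp (k + 1)) - (v k + disp k)) + (v k + disp k) := by
        nth_rewrite 1 [h3]; module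
      rw [h5]
      exact AffineSubspace.vadd_mem_of_mem_direction (Submodule.smul_mem _ _
        (AffineSubspace.vsub_mem_direction (hP (k + 1)) (hP k))) (hP k)
    have h3 : x + G x - o ∈ W' := AffineSubspace.vsub_mem_direction h2 hoP
    simp only [hU]
    rw [Submodule.starProjection_eq_self_iff.2 h3, ← h1]
    abel
  · set A := sideInterp (v k) (v (k + 1)) (disp k) (disp (k + 1)) with hA
    refine ⟨AffineMap.const ℝ E3 o + (W'.starProjection.toLinearMap.toAffineMap.comp
      (AffineMap.id ℝ E3 + A - AffineMap.const ℝ E3 o)) - AffineMap.id ℝ E3, fun x hx => ?_⟩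
    have h1 := hGe k hx
    simp only [hU, h1]
    rfl

end NicePolygon

/-! ### The displacement field in space -/

/-- A function on an interval that is Lipschitz on each member of a finite closed cover is
Lipschitz. -/
theorem dist_le_of_finite_closed_cover {ι X : Type*} [PseudoMetricSpace X] {f : ℝ → X}
    {C : ι → Set ℝ} {L : ℝ} (s : Finset ι) {a b : ℝ} (hC : ∀ i, IsClosed (C i)) (hab : a ≤ b)
    (hcov : Set.Icc a b ⊆ ⋃ i ∈ s, C i)
    (hL : ∀ i, ∀ x ∈ C i, ∀ y ∈ C i, dist (f x) (f y) ≤ L * |x - y|) :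
    dist (f a) (f b) ≤ L * (b - a) := by
  classical
  induction s using Finset.strongInduction generalizing a with
  | H s ih =>
    obtain ⟨i, hi, hai⟩ : ∃ i ∈ s, a ∈ C i := by
      simpa using hcov (Set.left_mem_Icc.2 hab)
    have hcl : IsCompact (C i ∩ Set.Icc a b) := isCompact_Icc.inter_left (hC i)
    -- the last point of the interval in a member containing `a`; that member is not needed after it
    obtain ⟨m, ⟨hmi, hm⟩, hmax⟩ := hcl.exists_isGreatest ⟨a, hai, Set.left_mem_Icc.2 hab⟩
    have h1 := hL i a hai m hmi
    rw [abs_sub_comm, abs_of_nonneg (sub_nonneg.2 hm.1)] at h1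
    rcases hm.2.eq_or_lt with h2 | h2
    · rwa [h2] at h1
    · have hcov' : Set.Icc m b ⊆ ⋃ k ∈ s.erase i, C k := by
        have hc : IsClosed (⋃ k ∈ s.erase i, C k) :=
          (s.erase i).finite_toSet.isClosed_biUnion fun k _ => hC k
        rw [← closure_Ioc h2.ne]
        refine closure_minimal (fun x hx => ?_) hc
        obtain ⟨k, hk, hxk⟩ : ∃ k ∈ s, x ∈ C k := by
          simpa using hcov ⟨hm.1.trans hx.1.le, hx.2⟩
        have hki : k ≠ i := by
          rintro rfl
          exact absurd (hmax ⟨hxk, hm.1.trans hx.1.le, hx.2⟩) (not_le.2 hx.1)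
        exact Set.mem_biUnion (Finset.mem_coe.2 (Finset.mem_erase.2 ⟨hki, hk⟩)) hxk
      have h3 := ih (s.erase i) (Finset.erase_ssubset hi) h2.le hcov'
      have := dist_triangle (f a) (f m) (f b)
      linarith

/-- The interpolation on a side depends only on the values at the ends, not on the face. -/
theorem sideInterp_swap {a b x : E3} (p q : E3) (hab : a ≠ b) (hx : x ∈ segment ℝ a b) :
    sideInterp b a q p x = sideInterp a b p q x := by
  obtain ⟨-, -, h3⟩ := segment_param hab hx
  rw [sideInterp_segment p q hab hx,
    sideInterp_segment q p hab.symm (segment_symm ℝ a b ▸ hx), dist_comm b a]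
  have hd : dist a b ≠ 0 := dist_ne_zero.2 hab
  have : dist x b / dist a b = 1 - dist x a / dist a b := by
    rw [eq_sub_iff_add_eq, ← add_div, div_eq_one_iff_eq hd]; linarith
  rw [this]
  module

namespace NicePolyhedron

variable {r θ M M₁ : ℝ} {D D' : Polyhedron}

/-- A nonempty compact set is not open. -/
theorem frontier_nonempty (h : NicePolyhedron r θ M M₁ D) (hv : D.carrier.Nonempty) :
    (frontier D.carrier).Nonempty := by
  by_contra hne
  rw [Set.not_nonempty_iff_eq_empty] at hne
  have hcl : IsClopen D.carrier := isClopen_iff_frontier_eq_empty.2 hne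
  rcases isClopen_iff.1 hcl with h1 | h1
  · rw [h1] at hv; exact Set.not_nonempty_empty hv
  · have := h.compact
    rw [h1] at this
    exact noncompact_univ E3 this

/-- A matching of the vertices is induced by a small Lipschitz displacement field that maps the
faces into the planes of the corresponding faces. The fields on the faces agree along the edges. The
boundary being Lipschitz, short paths along it pass through finitely many faces, so the union of the
fields is Lipschitz; it is extended to space and cut off near the polyhedron. -/
theorem exists_field (θ M M₁ : ℝ) (hM : 1 ≤ M) (hM₁ : 0 < M₁) (hθ : 0 < θ)
    (hθ' : θ < Real.pi / 2) :
    ∃ C > 0, ∀ {r μ : ℝ} {D D' : Polyhedron}, NicePolyhedron r θ M M₁ D →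
      NicePolyhedron r θ M M₁ D' → ∀ {φ : E3 → E3}, D.IsMatching D' φ → 0 ≤ μ →
      (∀ p ∈ D.vertices, dist p (φ p) ≤ μ) → ∃ U : E3 → E3,
        (∀ x y, dist (U x) (U y) ≤ C * μ / r * dist x y) ∧ (∀ x, ‖U x‖ ≤ C * μ) ∧
        (∀ x, r / 8 ≤ Metric.infDist x D.carrier → U x = 0) ∧
        (∀ p ∈ D.vertices, U p = φ p - p) ∧
        ∀ j, (∃ g, intrinsicFrontier ℝ (D'.face g) =
            ⋃ k, segment ℝ (φ (D.corner j k)) (φ (D.corner j (k + 1))) ∧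
          ∃ Uj : E3 → E3, Set.EqOn U Uj (D.face j) ∧
            (∀ x ∈ affineSpan ℝ (D.face j), ∀ y ∈ affineSpan ℝ (D.face j),
              dist (Uj x) (Uj y) ≤ C * μ / r * dist x y) ∧
            (∀ x, x + Uj x ∈ affineSpan ℝ (D'.face g)) ∧
            ∀ k, ∀ x ∈ segment ℝ (D.corner j k) (D.corner j (k + 1)),
              Uj x = sideInterp (D.corner j k) (D.corner j (k + 1))
                (φ (D.corner j k) - D.corner j k)
                (φ (D.corner j (k + 1)) - D.corner j (k + 1)) x) ∧
          ∀ k, ∃ u, IsInnerNormal r M (D.face j) (D.corner j k) (D.corner j (k + 1)) u ∧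
            ∃ a : E3 →ᵃ[ℝ] E3, Set.EqOn U a
              (sideTriangle r (baseSlope θ M) (D.corner j k) (D.corner j (k + 1)) u) := by
  obtain ⟨C₀, hC₀, H⟩ := NicePolygon.exists_face_field θ M hM hθ hθ'
  have hK : 0 < 1 + M := by linarith
  set L := lipschitzExtensionConstant E3
  have hL : 0 < (L : ℝ) := by exact_mod_cast lipschitzExtensionConstant_pos E3
  -- `B` and `C₁` bound the field on the boundary and its Lipschitz constant, `B₂` bounds the extension
  -- near the polyhedron
  set B := 1 + C₀ * M₁ with hB
  have hB0 : 0 < B := by positivity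
  set C₁ := (1 + M) * C₀ + 2 * B * (1 + M) with hC₁
  have hC₁0 : 0 < C₁ := by positivity
  set B₂ := B + L * C₁ * (M₁ + 1) with hB₂
  have hB₂0 : 0 < B₂ := by positivity
  set C := C₀ + B₂ + 8 * B₂ + L * C₁ with hC
  refine ⟨C, by positivity, ?_⟩
  intro r μ D D' h h' φ hφ hμ hd
  have hr := h.r_pos
  have hμr : 0 ≤ μ / r := by positivity
  choose g hgr hgf using hφ.face
  have hface : ∀ j, ∃ Uj : E3 → E3,
        (∀ x ∈ affineSpan ℝ (D.face j), ∀ y ∈ affineSpan ℝ (D.face j),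
          dist (Uj x) (Uj y) ≤ C₀ * μ / r * dist x y) ∧
        (∀ x, x + Uj x ∈ affineSpan ℝ (D'.face (g j))) ∧
        (∀ k, ∀ x ∈ segment ℝ (D.corner j k) (D.corner j (k + 1)),
          Uj x = sideInterp (D.corner j k) (D.corner j (k + 1))
            (φ (D.corner j k) - D.corner j k)
            (φ (D.corner j (k + 1)) - D.corner j (k + 1)) x) ∧
        ∀ k, ∃ u, IsInnerNormal r M (D.face j) (D.corner j k) (D.corner j (k + 1)) u ∧
          ∃ a : E3 →ᵃ[ℝ] E3, Set.EqOn Uj a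
            (sideTriangle r (baseSlope θ M) (D.corner j k) (D.corner j (k + 1)) u) := by
    intro j
    refine H (h.face j) (disp := fun k => φ (D.corner j k) - D.corner j k) (fun k => ?_) fun k => ?_
    · rw [← dist_eq_norm, dist_comm]; exact hd _ (corner_mem_vertices D j k)
    · rw [add_sub_cancel]
      have : φ (D.corner j k) ∈ Set.range (D'.corner (g j)) := by
        rw [hgr]; exact ⟨_, ⟨k, rfl⟩, rfl⟩
      obtain ⟨l, hl⟩ := this
      rw [← hl]
      exact subset_affineSpan ℝ _ ((h'.face (g j)).corner_mem_face l)
  -- `V j` is the field of the `j`-th face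
  choose V hVlip hVmem hVside hVtri using hface
  have hVc : ∀ j k, V j (D.corner j k) = φ (D.corner j k) - D.corner j k := fun j k => by
    rw [hVside j k _ (left_mem_segment ℝ _ _), sideInterp_left]
  -- the fields of two faces agree where the faces meet
  have hVV : ∀ i j, ∀ x ∈ D.face i, x ∈ D.face j → V i x = V j x := by
    intro i j x hi hj
    by_cases hij : i = j
    · rw [hij]
    -- at a vertex both are the displacement of that vertex
    have hvert : x ∈ D.vertices → V i x = V j x := by
      intro hx
      obtain ⟨k, rfl⟩ := h.exists_corner_of_mem_face hx hi
      rw [hVc]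
      obtain ⟨l, hl⟩ := h.exists_corner_of_mem_face hx hj
      rw [← hl, hVc]
    have hif : x ∈ intrinsicFrontier ℝ (D.face i) :=
      ((mem_face_iff (h.face i).isClosed).1 hi).resolve_left fun h1 =>
        Set.disjoint_left.1 (h.interior_disjoint_face hij) h1 hj
    rw [(h.face i).region.relBoundary] at hif
    obtain ⟨k, hk⟩ := Set.mem_iUnion.1 hif
    by_cases ha : x = D.corner i k
    · exact hvert ⟨i, k, ha.symm⟩
    by_cases hb : x = D.corner i (k + 1)
    · exact hvert ⟨i, k + 1, hb.symm⟩
    obtain ⟨j', u, u', hh⟩ := h.exists_hinge i k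
    -- at other common points both are the interpolation along the common side
    have hjj : j = j' := (h.eq_or_eq_of_mem_hinge hh hk ha hb hj).resolve_left (Ne.symm hij)
    subst hjj
    obtain ⟨l, hl⟩ := hh.side_right
    have hxl : x ∈ D.side j l := hl ▸ hk
    rw [hVside i k x hk, hVside j l x hxl]
    rcases eq_or_eq_of_segment_eq ((h.face i).corner_ne k) hl with ⟨h1, h2⟩ | ⟨h1, h2⟩
    · rw [h1, h2]
    · rw [h1, h2, sideInterp_swap _ _ ((h.face i).corner_ne k) hk]
  classical
  -- the field on the boundary surface
  set U₀ : E3 → E3 := fun x => if hx : ∃ j, x ∈ D.face j then V hx.choose x else 0 with hU₀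
  have hU₀e : ∀ j, ∀ x ∈ D.face j, U₀ x = V j x := by
    intro j x hx
    have hex : ∃ j, x ∈ D.face j := ⟨j, hx⟩
    rw [hU₀]
    simp only [dif_pos hex]
    exact hVV _ j x hex.choose_spec hx
  have hcl := h.compact.isClosed
  have hbound : ∀ x ∈ frontier D.carrier, ‖U₀ x‖ ≤ B * μ := by
    intro x hx
    obtain ⟨j, hj⟩ := exists_face D hx
    have h0 := (h.face j).corner_mem_face 0
    have h1 := hVlip j x (subset_affineSpan ℝ _ hj) _ (subset_affineSpan ℝ _ h0)
    have h2 : dist x (D.corner j 0) ≤ M₁ * r :=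
      h.diam _ (hcl.frontier_subset hx) _ (hcl.frontier_subset (face_subset D j h0))
    have h3 : ‖V j (D.corner j 0)‖ ≤ μ := by
      rw [hVc, ← dist_eq_norm, dist_comm]; exact hd _ (corner_mem_vertices D j 0)
    rw [hU₀e j x hj]
    have h4 : ‖V j x‖ ≤ ‖V j (D.corner j 0)‖ + dist (V j x) (V j (D.corner j 0)) := by
      rw [dist_eq_norm]; exact norm_le_insert' _ _
    calc ‖V j x‖ ≤ μ + C₀ * μ / r * (M₁ * r) := h4.trans (add_le_add h3 (h1.trans (by gcongr)))
      _ = B * μ := by rw [hB]; field_simp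
  have hlip : ∀ x ∈ frontier D.carrier, ∀ y ∈ frontier D.carrier,
      dist (U₀ x) (U₀ y) ≤ C₁ * μ / r * dist x y := by
    intro x hx y hy
    -- close points are joined by a short path, and for distant points the bound of the field suffices
    rcases lt_or_ge (dist x y) (r / (1 + M)) with hxy | hxy
    · obtain ⟨γ, h0, h1, hS, hγ⟩ := h.path x hx y hy hxy
      have hcont : ContinuousOn γ (Set.Icc 0 1) := by
        refine LipschitzOnWith.continuousOn (K := ((1 + M) * dist x y).toNNReal)
          (LipschitzOnWith.of_dist_le_mul fun s hs t ht => ?_)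
        rw [Real.coe_toNNReal _ (by positivity), Real.dist_eq]
        exact hγ s hs t ht
      have key := dist_le_of_finite_closed_cover (f := U₀ ∘ γ)
        (C := fun j => Set.Icc 0 1 ∩ γ ⁻¹' D.face j)
        (L := C₀ * μ / r * ((1 + M) * dist x y)) Finset.univ
        (fun j => hcont.preimage_isClosed_of_isClosed isClosed_Icc (h.face j).isClosed)
        zero_le_one (fun s hs => by
          obtain ⟨j, hj⟩ := exists_face D (hS s hs)
          exact Set.mem_biUnion (Finset.mem_coe.2 (Finset.mem_univ j)) ⟨hs, hj⟩)
        (fun j s hs t ht => by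
          rw [Function.comp, Function.comp, hU₀e j _ hs.2, hU₀e j _ ht.2]
          refine (hVlip j _ (subset_affineSpan ℝ _ hs.2) _ (subset_affineSpan ℝ _ ht.2)).trans ?_
          rw [mul_assoc (C₀ * μ / r)]
          gcongr
          exact hγ s hs.1 t ht.1)
      simp only [Function.comp, h0, h1] at key
      refine key.trans ?_
      have : 0 ≤ 2 * B * (1 + M) * (μ / r) * dist x y := by positivity
      calc _ = (1 + M) * C₀ * (μ / r) * dist x y := by ring
        _ ≤ (1 + M) * C₀ * (μ / r) * dist x y + 2 * B * (1 + M) * (μ / r) * dist x y := by linarith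
        _ = _ := by rw [hC₁]; ring
    · have h1 : dist (U₀ x) (U₀ y) ≤ 2 * (B * μ) := by
        rw [dist_eq_norm]
        exact (norm_sub_le _ _).trans (by linarith [hbound x hx, hbound y hy])
      calc _ ≤ 2 * (B * μ) := h1
        _ = 2 * B * (1 + M) * (μ / r) * (r / (1 + M)) := by field_simp
        _ ≤ 2 * B * (1 + M) * (μ / r) * dist x y := by gcongr
        _ ≤ C₁ * (μ / r) * dist x y := by
          have : 0 < (1 + M) * C₀ := by positivity
          gcongr; rw [hC₁]; linarith
        _ = _ := by ring
  have hlipOn : LipschitzOnWith (C₁ * μ / r).toNNReal U₀ (frontier D.carrier) :=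
    LipschitzOnWith.of_dist_le_mul fun x hx y hy => by
      rw [Real.coe_toNNReal _ (by positivity)]; exact hlip x hx y hy
  obtain ⟨G, hG, hGe⟩ := hlipOn.extend_finite_dimension
  have hG' : ∀ x y, dist (G x) (G y) ≤ L * C₁ * μ / r * dist x y := fun x y => by
    have := hG.dist_le_mul x y
    rw [NNReal.coe_mul, Real.coe_toNNReal _ (by positivity)] at this
    calc _ ≤ _ := this
      _ = _ := by ring
  -- the cutoff function
  set χ : E3 → ℝ := fun x => max 0 (1 - 8 / r * Metric.infDist x D.carrier) with hχ
  have hχ0 : ∀ x, 0 ≤ χ x := fun x => le_max_left _ _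
  have hχ1 : ∀ x, χ x ≤ 1 := fun x => max_le zero_le_one (by
    have : 0 ≤ 8 / r * Metric.infDist x D.carrier := mul_nonneg (by positivity) Metric.infDist_nonneg
    linarith)
  have hχl : ∀ x y, |χ x - χ y| ≤ 8 / r * dist x y := by
    intro x y
    have h1 := abs_max_sub_max_le_max 0 (1 - 8 / r * Metric.infDist x D.carrier) 0
      (1 - 8 / r * Metric.infDist y D.carrier)
    refine h1.trans (max_le (by rw [sub_self, abs_zero]; positivity) ?_)
    rw [sub_sub_sub_cancel_left, ← mul_sub, abs_mul, abs_of_pos (by positivity : 0 < 8 / r)]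
    gcongr
    have := (Metric.lipschitz_infDist_pt D.carrier).dist_le_mul y x
    rwa [NNReal.coe_one, one_mul, Real.dist_eq, dist_comm] at this
  have hχS : ∀ x ∈ D.carrier, χ x = 1 := fun x hx => by
    simp only [hχ, Metric.infDist_zero_of_mem hx, mul_zero, sub_zero]
    exact max_eq_right zero_le_one
  have hχz : ∀ x, r / 8 ≤ Metric.infDist x D.carrier → χ x = 0 := fun x hx => by
    refine max_eq_left ?_
    have : 8 / r * (r / 8) ≤ 8 / r * Metric.infDist x D.carrier := by gcongr
    rw [show 8 / r * (r / 8) = 1 by field_simp] at this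
    linarith
  have hne := PolyhedralClass.carrier_nonempty D
  obtain ⟨z₀, hz₀⟩ := h.frontier_nonempty hne
  have hGb : ∀ x, χ x ≠ 0 → ‖G x‖ ≤ B₂ * μ := by
    intro x hx
    have h1 : Metric.infDist x D.carrier < r / 8 := by
      by_contra hge; exact hx (hχz x (not_lt.1 hge))
    obtain ⟨z, hz, hxz⟩ := (Metric.infDist_lt_iff hne).1 h1
    have h2 : dist x z₀ ≤ (M₁ + 1) * r := by
      have := dist_triangle x z z₀
      have := h.diam z hz z₀ (hcl.frontier_subset hz₀)
      linarith
    have h3 := hG' x z₀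
    have h4 : ‖G x‖ ≤ ‖G z₀‖ + dist (G x) (G z₀) := by
      rw [dist_eq_norm]; exact norm_le_insert' _ _
    have h5 : ‖G z₀‖ ≤ B * μ := by rw [← hGe hz₀]; exact hbound z₀ hz₀
    calc ‖G x‖ ≤ B * μ + L * C₁ * μ / r * ((M₁ + 1) * r) :=
          h4.trans (add_le_add h5 (h3.trans (by gcongr)))
      _ = B₂ * μ := by rw [hB₂]; field_simp
  have hUS : ∀ j, ∀ x ∈ D.face j, χ x • G x = V j x := by
    intro j x hx
    have hxS := face_subset D j hx
    rw [hχS x (hcl.frontier_subset hxS), one_smul, ← hGe hxS, hU₀e j x hx]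
  refine ⟨fun x => χ x • G x, fun x y => ?_, fun x => ?_, fun x hx => ?_, fun p hp => ?_,
    fun j => ⟨⟨g j, hgf j, V j, hUS j, fun x hx y hy => ?_, hVmem j, hVside j⟩, fun k => ?_⟩⟩
  -- the product rule, with the bound of `G` used at a point where the cutoff does not vanish
  · have key : ∀ x y, χ x ≠ 0 → dist (χ x • G x) (χ y • G y) ≤ C * μ / r * dist x y := by
      intro x y hx
      have e1 : χ x • G x - χ y • G y = (χ x - χ y) • G x + χ y • (G x - G y) := by module
      rw [dist_eq_norm, e1]
      refine (norm_add_le _ _).trans ?_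
      rw [norm_smul, norm_smul, Real.norm_eq_abs, Real.norm_of_nonneg (hχ0 y), ← dist_eq_norm]
      have h1 : |χ x - χ y| * ‖G x‖ ≤ 8 / r * dist x y * (B₂ * μ) :=
        mul_le_mul (hχl x y) (hGb x hx) (norm_nonneg _) (by positivity)
      have h2 : χ y * dist (G x) (G y) ≤ 1 * (L * C₁ * μ / r * dist x y) :=
        mul_le_mul (hχ1 y) (hG' x y) dist_nonneg zero_le_one
      have h3 : 0 ≤ (C₀ + B₂) * (μ / r) * dist x y := by positivity
      calc _ ≤ 8 / r * dist x y * (B₂ * μ) + 1 * (L * C₁ * μ / r * dist x y) := add_le_add h1 h2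
        _ = (8 * B₂ + L * C₁) * (μ / r) * dist x y := by ring
        _ ≤ (8 * B₂ + L * C₁) * (μ / r) * dist x y + (C₀ + B₂) * (μ / r) * dist x y := by linarith
        _ = _ := by rw [hC]; ring
    change dist (χ x • G x) (χ y • G y) ≤ _
    by_cases hx : χ x = 0
    · by_cases hy : χ y = 0
      · rw [hx, hy, zero_smul, zero_smul, dist_self]; positivity
      · rw [dist_comm, dist_comm x y]; exact key y x hy
    · exact key x y hx
  · by_cases hx : χ x = 0
    · simp only [hx, zero_smul, norm_zero]; positivity
    · simp only
      rw [norm_smul, Real.norm_of_nonneg (hχ0 x)]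
      have h1 := hGb x hx
      have h2 : χ x * ‖G x‖ ≤ 1 * (B₂ * μ) := mul_le_mul (hχ1 x) h1 (norm_nonneg _) zero_le_one
      have h3 : 0 ≤ (C₀ + 8 * B₂ + L * C₁) * μ := by positivity
      have h4 : C * μ = B₂ * μ + (C₀ + 8 * B₂ + L * C₁) * μ := by rw [hC]; ring
      linarith
  · simp only [hχz x hx, zero_smul]
  · obtain ⟨j, k, rfl⟩ := hp
    rw [← hVc]
    exact hUS j _ ((h.face j).corner_mem_face k)
  · refine (hVlip j x hx y hy).trans ?_
    have : 0 ≤ 9 * B₂ + L * C₁ := by positivity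
    have hCC : C₀ ≤ C := by rw [hC]; linarith
    gcongr
  · obtain ⟨u, hu, a, ha⟩ := hVtri j k
    refine ⟨u, hu, a, fun x hx => ?_⟩
    rw [← ha hx]
    exact hUS j x ((h.face j).sideTriangle_subset hu hx)

end NicePolyhedron

/-! ### The image of the polyhedron -/

theorem IsPreconnected.subset_interior_or_compl {X : Type*} [TopologicalSpace X] {Y A : Set X}
    (hY : IsPreconnected Y) (hd : Disjoint Y (frontier A)) :
    Y ⊆ interior A ∨ Y ⊆ (closure A)ᶜ := by
  refine hY.subset_or_subset isOpen_interior isClosed_closure.isOpen_compl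
    (Set.disjoint_left.2 fun x h1 h2 => h2 (interior_subset_closure h1)) fun x hx => ?_
  by_cases h1 : x ∈ closure A
  · left
    by_contra h2
    exact Set.disjoint_left.1 hd hx ⟨h1, h2⟩
  · exact Or.inr h1

/-- Two regular closed sets with the same boundary, which locally has two sides, agree near each
point of the boundary or are complementary there. In a connected space one of these alternatives
holds throughout, so the sets coincide if some point lies in neither of them. -/
theorem eq_of_frontier_eq {X : Type*} [TopologicalSpace X] [PreconnectedSpace X] {A B : Set X}
    (hA : IsClosed A) (hB : IsClosed B) (hAB : frontier A = frontier B)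
    (rA : frontier A ⊆ closure (interior A)) (rB : frontier B ⊆ closure (interior B))
    (htwo : ∀ P ∈ frontier B, ∃ N Y Z : Set X, IsOpen N ∧ P ∈ N ∧ IsPreconnected Y ∧
      IsPreconnected Z ∧ Disjoint Y (frontier B) ∧ Disjoint Z (frontier B) ∧
      N \ frontier B ⊆ Y ∪ Z)
    (hz : ∃ z, z ∉ A ∧ z ∉ B) : A = B := by
  set Γ := frontier B with hΓ
  have hΓA : Γ ⊆ A := hAB ▸ hA.frontier_subset
  have hΓB : Γ ⊆ B := hB.frontier_subset
  -- the points near which `A` and `B` agree, or are complementary, off the boundary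
  set O₁ : Set X := {x | ∃ N, IsOpen N ∧ x ∈ N ∧ ∀ y ∈ N \ Γ, (y ∈ A ↔ y ∈ B)} with hO₁
  set O₂ : Set X := {x | ∃ N, IsOpen N ∧ x ∈ N ∧ ∀ y ∈ N \ Γ, ¬(y ∈ A ↔ y ∈ B)} with hO₂
  have ho₁ : IsOpen O₁ := isOpen_iff_forall_mem_open.2 fun x ⟨N, hN, hx, h⟩ =>
    ⟨N, fun y hy => ⟨N, hN, hy, h⟩, hN, hx⟩
  have ho₂ : IsOpen O₂ := isOpen_iff_forall_mem_open.2 fun x ⟨N, hN, hx, h⟩ =>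
    ⟨N, fun y hy => ⟨N, hN, hy, h⟩, hN, hx⟩
  have hdense : ∀ N, IsOpen N → ∀ x ∈ N, (N \ Γ).Nonempty := by
    intro N hN x hx
    by_cases hxΓ : x ∈ Γ
    · obtain ⟨y, hyN, hyB⟩ := mem_closure_iff.1 (rB hxΓ) N hN hx
      exact ⟨y, hyN, fun h => h.2 hyB⟩
    · exact ⟨x, hx, hxΓ⟩
  have hcov : ∀ x, x ∈ O₁ ∪ O₂ := by
    intro x
    by_cases hxΓ : x ∈ Γ
    · obtain ⟨N, Y, Z, hN, hxN, hY, hZ, hYd, hZd, hNs⟩ := htwo x hxΓ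
      -- for each of the two sets, exactly one of the sides lies inside
      have side : ∀ E : Set X, IsClosed E → frontier E = Γ → Γ ⊆ closure (interior E) →
          (Y ⊆ E ∧ Z ⊆ Eᶜ) ∨ (Y ⊆ Eᶜ ∧ Z ⊆ E) := by
        intro E hE hEΓ hEr
        obtain ⟨y, hyN, hyE⟩ := mem_closure_iff.1 (hEr hxΓ) N hN hxN
        have hyΓ : y ∉ Γ := fun h => by rw [← hEΓ] at h; exact h.2 hyE
        have hxE : x ∈ closure Eᶜ := by
          have : x ∈ frontier E := hEΓ ▸ hxΓ
          rw [frontier_eq_closure_inter_closure] at this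
          exact this.2
        obtain ⟨z, hzN, hzE⟩ := mem_closure_iff.1 hxE N hN hxN
        have hzΓ : z ∉ Γ := fun h => hzE (hE.frontier_subset (hEΓ ▸ h))
        have hy := hNs ⟨hyN, hyΓ⟩
        have hz := hNs ⟨hzN, hzΓ⟩
        have hY' := hY.subset_interior_or_compl (hEΓ ▸ hYd)
        have hZ' := hZ.subset_interior_or_compl (hEΓ ▸ hZd)
        rw [hE.closure_eq] at hY' hZ'
        have hyE' := interior_subset hyE
        rcases hY' with hY' | hY' <;> rcases hZ' with hZ' | hZ'
        · exact absurd (hz.elim (fun h => interior_subset (hY' h))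
            fun h => interior_subset (hZ' h)) hzE
        · exact Or.inl ⟨hY'.trans interior_subset, hZ'⟩
        · exact Or.inr ⟨hY', hZ'.trans interior_subset⟩
        · exact absurd hyE' (hy.elim (fun h => hY' h) fun h => hZ' h)
      have sA := side A hA hAB (hAB ▸ rA)
      have sB := side B hB rfl rB
      rcases sA with ⟨a1, a2⟩ | ⟨a1, a2⟩ <;> rcases sB with ⟨b1, b2⟩ | ⟨b1, b2⟩
      · exact Or.inl ⟨N, hN, hxN, fun y hy => (hNs hy).elim
          (fun h => iff_of_true (a1 h) (b1 h)) fun h => iff_of_false (a2 h) (b2 h)⟩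
      · exact Or.inr ⟨N, hN, hxN, fun y hy => (hNs hy).elim
          (fun h h' => b1 h (h'.1 (a1 h))) fun h h' => a2 h (h'.2 (b2 h))⟩
      · exact Or.inr ⟨N, hN, hxN, fun y hy => (hNs hy).elim
          (fun h h' => a1 h (h'.2 (b1 h))) fun h h' => b2 h (h'.1 (a2 h))⟩
      · exact Or.inl ⟨N, hN, hxN, fun y hy => (hNs hy).elim
          (fun h => iff_of_false (a1 h) (b1 h)) fun h => iff_of_true (a2 h) (b2 h)⟩
    · have hloc : ∀ E : Set X, IsClosed E → frontier E = Γ →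
          ∃ N, IsOpen N ∧ x ∈ N ∧ ∀ y ∈ N, (y ∈ E ↔ x ∈ E) := by
        intro E hE hEΓ
        by_cases hxE : x ∈ E
        · refine ⟨interior E, isOpen_interior, ?_, fun y hy =>
            iff_of_true (interior_subset hy) hxE⟩
          by_contra h
          exact hxΓ (hEΓ ▸ ⟨subset_closure hxE, h⟩)
        · exact ⟨Eᶜ, hE.isOpen_compl, hxE, fun y hy => iff_of_false hy hxE⟩
      obtain ⟨N₁, hN₁, hx₁, h₁⟩ := hloc A hA hAB
      obtain ⟨N₂, hN₂, hx₂, h₂⟩ := hloc B hB rfl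
      by_cases hx : x ∈ A ↔ x ∈ B
      · exact Or.inl ⟨N₁ ∩ N₂, hN₁.inter hN₂, ⟨hx₁, hx₂⟩, fun y hy => by
          rw [h₁ y hy.1.1, h₂ y hy.1.2]; exact hx⟩
      · exact Or.inr ⟨N₁ ∩ N₂, hN₁.inter hN₂, ⟨hx₁, hx₂⟩, fun y hy => by
          rw [h₁ y hy.1.1, h₂ y hy.1.2]; exact hx⟩
  have hdisj : Disjoint O₁ O₂ := by
    rw [Set.disjoint_left]
    rintro x ⟨N₁, hN₁, hx₁, h₁⟩ ⟨N₂, hN₂, hx₂, h₂⟩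
    obtain ⟨y, hy, hyΓ⟩ := hdense _ (hN₁.inter hN₂) x ⟨hx₁, hx₂⟩
    exact h₂ y ⟨hy.2, hyΓ⟩ (h₁ y ⟨hy.1, hyΓ⟩)
  obtain ⟨z, hzA, hzB⟩ := hz
  rcases isPreconnected_univ.subset_or_subset ho₁ ho₂ hdisj (fun x _ => hcov x) with h | h
  · ext x
    by_cases hx : x ∈ Γ
    · exact iff_of_true (hΓA hx) (hΓB hx)
    · obtain ⟨N, -, hxN, hN⟩ := h (Set.mem_univ x)
      exact hN x ⟨hxN, hx⟩
  · obtain ⟨N, -, hxN, hN⟩ := h (Set.mem_univ z)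
    exact absurd (iff_of_false hzA hzB) (hN z ⟨hxN, fun h => hzB (hΓB h)⟩)

/-- A perturbation of the identity by a contraction is a homeomorphism, by the quantitative inverse
function theorem. -/
theorem exists_homeomorph_of_lipschitz_perturbation {E : Type*} [NormedAddCommGroup E]
    [NormedSpace ℝ E] [CompleteSpace E] {f : E → E} {ε : ℝ} (hε0 : 0 ≤ ε) (hε : ε < 1)
    (hf : ∀ x y, ‖f x - f y - (x - y)‖ ≤ ε * ‖x - y‖) : ∃ Ψ : E ≃ₜ E, ∀ x, Ψ x = f x := by
  have happ : ApproximatesLinearOn f ((ContinuousLinearEquiv.refl ℝ E : E ≃L[ℝ] E) : E →L[ℝ] E)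
      Set.univ ⟨ε, hε0⟩ := fun x _ y _ => hf x y
  refine ⟨happ.toHomeomorph f ?_, fun x => rfl⟩
  rcases subsingleton_or_nontrivial E with h | h
  · exact Or.inl h
  · right
    have : ‖((ContinuousLinearEquiv.refl ℝ E).symm : E →L[ℝ] E)‖₊ = 1 := by
      apply NNReal.eq
      exact ContinuousLinearMap.norm_id
    rw [this, inv_one]
    exact_mod_cast hε

namespace NicePolygon

variable {r θ M : ℝ}

/-- A displacement that contracts distances maps the plane of `F` homeomorphically onto the plane
containing the image. -/
theorem exists_plane_homeomorph {P P' : AffineSubspace ℝ E3} {o : E3} (ho : o ∈ P)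
    (hP : Module.finrank ℝ P.direction = 2) (hP' : Module.finrank ℝ P'.direction = 2)
    {U : E3 → E3} {ε : ℝ} (hε0 : 0 ≤ ε) (hε : ε < 1)
    (hU : ∀ x ∈ P, ∀ y ∈ P, dist (U x) (U y) ≤ ε * dist x y) (hm : ∀ x ∈ P, x + U x ∈ P') :
    ∃ H : P ≃ₜ P', ∀ x : P, (H x : E3) = x + U x := by
  set W := P.direction with hW
  set W' := P'.direction with hW'
  set o' := o + U o with ho'
  have ho'P : o' ∈ P' := hm o ho
  have hadd : ∀ w : W, o + (w : E3) ∈ P := fun w => by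
    rw [add_comm]; exact AffineSubspace.vadd_mem_of_mem_direction w.2 ho
  -- `f` is the map between the planes in coordinates at `o` and `o'`; composed with the orthogonal
  -- projection `R` to `W` it is a perturbation of the identity by a contraction
  set f : W → W' := fun w => ⟨o + w + U (o + w) - o',
    AffineSubspace.vsub_mem_direction (hm _ (hadd w)) ho'P⟩ with hf
  set R : W' →ₗ[ℝ] W := (W.orthogonalProjectionOnto : E3 →ₗ[ℝ] W) ∘ₗ W'.subtype with hR
  obtain ⟨Ψ, hΨ⟩ := exists_homeomorph_of_lipschitz_perturbation (f := fun w => R (f w)) hε0 hε (by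
    intro x y
    have e1 : R (f x) - R (f y) - (x - y) =
        W.orthogonalProjectionOnto (U (o + x) - U (o + y)) := by
      rw [← map_sub]
      have e2 : ((f x - f y : W') : E3) = ((x - y : W) : E3) + (U (o + x) - U (o + y)) := by
        simp only [hf, Submodule.coe_sub]; abel
      have e3 : R (f x - f y) = W.orthogonalProjectionOnto ((f x - f y : W') : E3) := rfl
      rw [e3, e2, map_add, Submodule.orthogonalProjectionOnto_mem_subspace_eq_self]
      abel
    rw [e1]
    refine (Submodule.norm_orthogonalProjectionOnto_apply_le W _).trans ?_
    rw [← dist_eq_norm]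
    refine (hU _ (hadd x) _ (hadd y)).trans_eq ?_
    rw [dist_add_left, dist_eq_norm]; rfl)
  -- so `R` is surjective, hence bijective, and `f` is a homeomorphism
  have hRs : Function.Surjective R := fun w => ⟨f (Ψ.symm w), by rw [← hΨ, Ψ.apply_symm_apply]⟩
  have hRi : Function.Injective R :=
    (LinearMap.injective_iff_surjective_of_finrank_eq_finrank (hP'.trans hP.symm)).2 hRs
  have hUc : ContinuousOn U (P : Set E3) := by
    refine LipschitzOnWith.continuousOn (K := ⟨ε, hε0⟩) (LipschitzOnWith.of_dist_le_mul ?_)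
    exact fun x hx y hy => hU x hx y hy
  have hvs : ∀ y : P', (y : E3) - o' ∈ W' := fun y =>
    AffineSubspace.vsub_mem_direction y.2 ho'P
  have hRc : Continuous R := LinearMap.continuous_of_finiteDimensional R
  have hvs' : ∀ x : P, (x : E3) - o ∈ W := fun x => AffineSubspace.vsub_mem_direction x.2 ho
  have hfx : ∀ x : P, f ⟨x - o, hvs' x⟩ = ⟨x + U x - o', hvs ⟨_, hm x x.2⟩⟩ := by
    intro x
    apply Subtype.ext
    simp only [hf, add_sub_cancel]
  have hleft : ∀ x : P, o + (Ψ.symm (R ⟨x + U x - o', hvs ⟨_, hm x x.2⟩⟩) : E3) = x := by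
    intro x
    rw [← hfx, ← hΨ, Ψ.symm_apply_apply]
    simp
  refine ⟨⟨⟨fun x => ⟨x + U x, hm x x.2⟩, fun y => ⟨o + Ψ.symm (R ⟨y - o', hvs y⟩), hadd _⟩,
    fun x => Subtype.ext (hleft x), fun y => ?_⟩, ?_, ?_⟩, fun x => rfl⟩
  · set x : P := ⟨o + Ψ.symm (R ⟨y - o', hvs y⟩), hadd _⟩ with hx
    have h1 : R ⟨x + U x - o', hvs ⟨_, hm x x.2⟩⟩ = R ⟨y - o', hvs y⟩ := by
      apply Ψ.symm.injective
      apply Subtype.ext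
      have hxv : (x : E3) = o + (Ψ.symm (R ⟨y - o', hvs y⟩) : E3) := rfl
      exact add_left_cancel ((hleft x).trans hxv)
    have h2 := congrArg (Subtype.val) (hRi h1)
    exact Subtype.ext (sub_left_injective h2)
  · exact (continuous_subtype_val.add (hUc.domRestrict)).subtype_mk _
  · exact (continuous_const.add (continuous_subtype_val.comp (Ψ.symm.continuous.comp
      (hRc.comp ((continuous_subtype_val.sub continuous_const).subtype_mk _))))).subtype_mk _

/-- In its plane a polygon is a regular closed set. -/
theorem frontier_subset_closure_interior {F : Set E3} {n : ℕ} {v : ZMod n → E3}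
    (h : NicePolygon r θ M F n v) :
    frontier ((↑) ⁻¹' F : Set (affineSpan ℝ F)) ⊆
      closure (interior ((↑) ⁻¹' F : Set (affineSpan ℝ F))) := by
  intro x hx
  have hxF : (x : E3) ∈ F := (h.isClosed.preimage continuous_subtype_val).frontier_subset hx
  rw [Metric.mem_closure_iff]
  intro ε hε
  obtain ⟨_, ⟨y, hy, rfl⟩, hyx⟩ := h.exists_interior_near hxF hε
  exact ⟨y, hy, by rwa [dist_comm]⟩

/-- A homeomorphism between the planes of two polygons that maps boundary onto boundary maps
polygon onto polygon. This is `eq_of_frontier_eq` in the plane of the second polygon; the two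
polygons do not cover the plane, which is not compact. -/
theorem image_eq_of_frontier {F F' : Set E3} {n n' : ℕ} {v : ZMod n → E3} {v' : ZMod n' → E3}
    (h : NicePolygon r θ M F n v) (h' : NicePolygon r θ M F' n' v')
    (H : affineSpan ℝ F ≃ₜ affineSpan ℝ F') {Φ : E3 → E3} (hΦ : ∀ x, (H x : E3) = Φ x)
    (hf : Φ '' intrinsicFrontier ℝ F = intrinsicFrontier ℝ F') : Φ '' F = F' := by
  set A₀ : Set (affineSpan ℝ F) := (↑) ⁻¹' F with hA₀
  set B : Set (affineSpan ℝ F') := (↑) ⁻¹' F' with hB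
  have hcoe : ∀ s : Set (affineSpan ℝ F), (↑) '' (H '' s) = Φ '' ((↑) '' s : Set E3) := fun s => by
    rw [Set.image_image, Set.image_image]; simp only [hΦ]
  have hpi : ∀ (P : AffineSubspace ℝ E3) (s : Set E3), s ⊆ P →
      (↑) '' ((↑) ⁻¹' s : Set P) = s := fun P s hs =>
    Set.image_preimage_eq_of_subset (by rwa [Subtype.range_coe])
  have hFe : (↑) '' A₀ = F := by
    exact hpi _ _ (subset_affineSpan ℝ F)
  have hFe' : (↑) '' B = F' := by
    exact hpi _ _ (subset_affineSpan ℝ F')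
  have hcA : IsCompact A₀ := Topology.IsEmbedding.subtypeVal.isCompact_iff.2
    (by rw [hFe]; exact h.region.compact)
  have hcB : IsCompact B := Topology.IsEmbedding.subtypeVal.isCompact_iff.2
    (by rw [hFe']; exact h'.region.compact)
  have hfr : frontier (H '' A₀) = frontier B := by
    apply Subtype.val_injective.image_injective
    rw [← H.image_frontier, hcoe]
    exact hf
  have : ConnectedSpace (affineSpan ℝ F') := by
    refine isConnected_iff_connectedSpace.1 ((affineSpan ℝ F').convex.isConnected ?_)
    exact ⟨v' 0, subset_affineSpan ℝ _ (h'.corner_mem_face 0)⟩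
  have key : H '' A₀ = B := by
    refine eq_of_frontier_eq (H.isClosed_image.2 (h.isClosed.preimage continuous_subtype_val))
      (h'.isClosed.preimage continuous_subtype_val) hfr ?_ h'.frontier_subset_closure_interior ?_ ?_
    · rw [← H.image_frontier, ← H.image_interior, ← H.image_closure]
      exact Set.image_mono h.frontier_subset_closure_interior
    · intro P hP
      have hPf : (P : E3) ∈ intrinsicFrontier ℝ F' := ⟨P, hP, rfl⟩
      obtain ⟨-, -, -, -, -, -, -, -, -, -, Y, Z, hY, hZ, hYs, hZs, hYd, hZd, hN⟩ :=
        h'.exists_frame hPf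
      have hpre : ∀ Y : Set E3, IsPreconnected Y → Y ⊆ affineSpan ℝ F' →
          IsPreconnected ((↑) ⁻¹' Y : Set (affineSpan ℝ F')) := fun Y hY hYs => by
        refine Topology.IsInducing.subtypeVal.isPreconnected_image.1 ?_
        exact (congrArg IsPreconnected (hpi _ _ hYs)).mpr hY
      have hdis : ∀ Y : Set E3, Disjoint Y (intrinsicFrontier ℝ F') →
          Disjoint ((↑) ⁻¹' Y : Set (affineSpan ℝ F')) (frontier B) := fun Y hY =>
        Set.disjoint_left.2 fun x h1 h2 => Set.disjoint_left.1 hY h1 ⟨x, h2, rfl⟩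
      refine ⟨Metric.ball P r, (↑) ⁻¹' Y, (↑) ⁻¹' Z, Metric.isOpen_ball,
        Metric.mem_ball_self h.r_pos, hpre Y hY hYs, hpre Z hZ hZs, hdis Y hYd, hdis Z hZd, ?_⟩
      rintro x ⟨hx, hxf⟩
      refine hN x x.2 hx ?_
      rintro ⟨y, hy, hyx⟩
      exact hxf (Subtype.ext hyx ▸ hy)
    · by_contra hno
      push Not at hno
      have hcu : IsCompact (Set.univ : Set (affineSpan ℝ F')) := by
        convert (hcA.image H.continuous).union hcB
        refine (Set.eq_univ_of_forall fun z => ?_).symm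
        by_cases hz : z ∈ H '' A₀
        · exact Or.inl hz
        · exact Or.inr (hno z hz)
      -- the plane is unbounded
      have hcu' : IsCompact (affineSpan ℝ F' : Set E3) := by
        have := hcu.image continuous_subtype_val
        rwa [Set.image_univ, Subtype.range_coe] at this
      obtain ⟨R, hR⟩ := hcu'.isBounded.subset_closedBall (v' 0)
      have hv0 := h'.corner_mem_face 0
      have hw := h'.unitDir_mem hv0 (h'.corner_mem_face (0 + 1))
      have h1 := hR (h'.add_mem hv0 (Submodule.smul_mem _ (|R| + 1) hw))
      rw [Metric.mem_closedBall, dist_eq_norm, add_sub_cancel_left, norm_smul,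
        norm_unitDir (h'.corner_ne 0), mul_one, Real.norm_of_nonneg (by positivity)] at h1
      linarith [le_abs_self R]
  rw [← hFe, ← hcoe, key, hFe']

end NicePolygon

/-- Adding the interpolated displacement of the ends of a segment gives an affine map. -/
theorem image_segment_add_sideInterp {a b p q : E3} (hab : a ≠ b) {f : E3 → E3}
    (hf : ∀ x ∈ segment ℝ a b, f x = sideInterp a b (p - a) (q - b) x) :
    (fun x => x + f x) '' segment ℝ a b = segment ℝ p q := by
  set A : E3 →ᵃ[ℝ] E3 := AffineMap.id ℝ E3 + sideInterp a b (p - a) (q - b) with hA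
  have e : (fun x => x + f x) '' segment ℝ a b = A '' segment ℝ a b :=
    Set.image_congr fun x hx => by simp [hA, hf x hx]
  have ha : A a = p := by simp [hA, sideInterp_left]
  have hb : A b = q := by simp [hA, sideInterp_right _ _ hab]
  rw [e, image_segment, ha, hb]

namespace NicePolyhedron

variable {r θ M M₁ : ℝ} {D D' : Polyhedron}

/-- The displacement field maps a face onto the corresponding face, since it maps the plane of the
one homeomorphically to the plane of the other and sides onto sides. -/
theorem image_face (h : NicePolyhedron r θ M M₁ D) (h' : NicePolyhedron r θ M M₁ D')
    {φ U Uj : E3 → E3} {ε : ℝ} (hε0 : 0 ≤ ε) (hε : ε < 1) {j : Fin D.numFaces}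
    {g : Fin D'.numFaces} (hg : intrinsicFrontier ℝ (D'.face g) =
      ⋃ k, segment ℝ (φ (D.corner j k)) (φ (D.corner j (k + 1))))
    (hE : Set.EqOn U Uj (D.face j))
    (hL : ∀ x ∈ affineSpan ℝ (D.face j), ∀ y ∈ affineSpan ℝ (D.face j),
      dist (Uj x) (Uj y) ≤ ε * dist x y)
    (hm : ∀ x, x + Uj x ∈ affineSpan ℝ (D'.face g))
    (hs : ∀ k, ∀ x ∈ segment ℝ (D.corner j k) (D.corner j (k + 1)),
      Uj x = sideInterp (D.corner j k) (D.corner j (k + 1))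
        (φ (D.corner j k) - D.corner j k) (φ (D.corner j (k + 1)) - D.corner j (k + 1)) x) :
    (fun x => x + U x) '' D.face j = D'.face g := by
  have hj := h.face j
  have hj' := h'.face g
  obtain ⟨H, hH⟩ := NicePolygon.exists_plane_homeomorph
    (subset_affineSpan ℝ _ (hj.corner_mem_face 0)) hj.region.plane hj'.region.plane hε0 hε hL
    fun x _ => hm x
  have e : (fun x => x + U x) '' D.face j = (fun x => x + Uj x) '' D.face j :=
    Set.image_congr fun x hx => by rw [hE hx]
  rw [e]
  refine hj.image_eq_of_frontier hj' H hH ?_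
  rw [hg, hj.region.relBoundary, Set.image_iUnion]
  exact Set.iUnion_congr fun k => image_segment_add_sideInterp (hj.corner_ne k) (hs k)

/-- Distinct faces have distinct images, because their relative interiors are disjoint. -/
theorem face_map_injective {Φ : E3 → E3} (hΦ : Function.Injective Φ)
    {g : Fin D.numFaces → Fin D'.numFaces} (hg : ∀ j, Φ '' D.face j = D'.face (g j)) :
    Function.Injective g := by
  intro i j hij
  have h1 : D.face i = D.face j := hΦ.image_injective (by rw [hg, hg, hij])
  by_contra hne
  have h2 := D.faces_disjoint i j hne
  rw [h1, disjoint_self] at h2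
  exact (D.face_polygonal j).relInterior_nonempty.ne_empty h2

/-- A homeomorphism of space that maps boundary onto boundary maps polyhedron onto polyhedron,
by `eq_of_frontier_eq`; the two polyhedra do not cover space, which is not compact. -/
theorem image_carrier (h : NicePolyhedron r θ M M₁ D) (h' : NicePolyhedron r θ M M₁ D')
    (Φ : E3 ≃ₜ E3) (hf : Φ '' frontier D.carrier = frontier D'.carrier) :
    Φ '' D.carrier = D'.carrier := by
  refine eq_of_frontier_eq (Φ.isClosed_image.2 h.compact.isClosed) h'.compact.isClosed
    (by rw [← Φ.image_frontier, hf]) ?_ h'.regular h'.twosided ?_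
  · rw [← Φ.image_frontier, ← Φ.image_interior, ← Φ.image_closure]
    exact Set.image_mono h.regular
  · by_contra hno
    push Not at hno
    refine noncompact_univ E3 ?_
    convert (h.compact.image Φ.continuous).union h'.compact
    refine (Set.eq_univ_of_forall fun z => ?_).symm
    by_cases hz : z ∈ Φ '' D.carrier
    · exact Or.inl hz
    · exact Or.inr (hno z hz)

/-- Combinatorial correspondence of two close polyhedra, together with a small Lipschitz vector
field that realises it. Surjectivity of the induced map on faces follows by counting, since the
correspondence in the opposite direction is realised by a field as well. -/
theorem exists_matching_field (θ M M₁ : ℝ) (hM : 1 ≤ M) (hM₁ : 0 < M₁) (hθ : 0 < θ)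
    (hθ' : θ < Real.pi / 2) :
    ∃ c > 0, ∃ K > 0, ∃ C > 0, ∀ {r d : ℝ} {D D' : Polyhedron}, NicePolyhedron r θ M M₁ D →
      NicePolyhedron r θ M M₁ D' → D.IsClose D' d → 0 ≤ d → d ≤ c * r →
      ∃ φ ψ U : E3 → E3, D.IsMatching D' φ ∧ D'.IsMatching D ψ ∧
        (∀ p ∈ D.vertices, ψ (φ p) = p) ∧ (∀ p ∈ D'.vertices, φ (ψ p) = p) ∧
        (∀ p ∈ D.vertices, dist p (φ p) ≤ K * d) ∧
        (∀ x y, dist (U x) (U y) ≤ C * d / r * dist x y) ∧ (∀ x, ‖U x‖ ≤ C * d) ∧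
        (∀ x, r / 8 ≤ Metric.infDist x D.carrier → U x = 0) ∧
        (∀ p ∈ D.vertices, U p = φ p - p) ∧
        (∀ j k, ∃ u, IsInnerNormal r M (D.face j) (D.corner j k) (D.corner j (k + 1)) u ∧
          ∃ a : E3 →ᵃ[ℝ] E3, Set.EqOn U a
            (sideTriangle r (baseSlope θ M) (D.corner j k) (D.corner j (k + 1)) u)) ∧
        (C * d / r < 1 → (fun x => x + U x) '' D.carrier = D'.carrier) := by
  obtain ⟨c, hc, K, hK, Hm⟩ := exists_matching θ M M₁ hM hM₁ hθ hθ'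
  obtain ⟨C, hC, HF⟩ := exists_field θ M M₁ hM hM₁ hθ hθ'
  have hK0 : 0 < K := by linarith
  refine ⟨c, hc, K, hK0, C * K, by positivity, ?_⟩
  intro r d D D' h h' hcl hd hdc
  have hr := h.r_pos
  obtain ⟨φ, ψ, hφ, hψ, hψφ, hφψ, hdist⟩ := Hm h h' hcl hd hdc
  have hdist' : ∀ q ∈ D'.vertices, dist q (ψ q) ≤ K * d := fun q hq => by
    have := hdist _ (hψ.mapsTo q hq)
    rwa [hφψ q hq, dist_comm] at this
  have hμ : 0 ≤ K * d := by positivity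
  obtain ⟨U, hUL, hUb, hU0, hUv, hUf⟩ := HF h h' hφ hμ hdist
  obtain ⟨U', hUL', -, -, -, hUf'⟩ := HF h' h hψ hμ hdist'
  rw [← mul_assoc] at hUL hUb hUL' hUf hUf'
  refine ⟨φ, ψ, U, hφ, hψ, hψφ, hφψ, hdist, hUL, hUb, hU0, hUv, fun j k => (hUf j).2 k, ?_⟩
  intro hε
  have hε0 : 0 ≤ C * K * d / r := by positivity
  have hpert : ∀ V : E3 → E3, (∀ x y, dist (V x) (V y) ≤ C * K * d / r * dist x y) →
      ∃ Ψ : E3 ≃ₜ E3, ∀ x, Ψ x = x + V x := fun V hV =>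
    exists_homeomorph_of_lipschitz_perturbation hε0 hε fun x y => by
      have e : x + V x - (y + V y) - (x - y) = V x - V y := by abel
      rw [e, ← dist_eq_norm, ← dist_eq_norm]
      exact hV x y
  obtain ⟨Φ, hΦ⟩ := hpert U hUL
  obtain ⟨Φ', hΦ'⟩ := hpert U' hUL'
  have hfun : (fun x => x + U x) = Φ := funext fun x => (hΦ x).symm
  have hfun' : (fun x => x + U' x) = Φ' := funext fun x => (hΦ' x).symm
  have hfaces : ∀ j, ∃ g, Φ '' D.face j = D'.face g := fun j => by
    obtain ⟨⟨g, hg, Uj, hE, hL, hm, hs⟩, -⟩ := hUf j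
    exact ⟨g, hfun ▸ image_face h h' hε0 hε hg hE hL hm hs⟩
  have hfaces' : ∀ j, ∃ g, Φ' '' D'.face j = D.face g := fun j => by
    obtain ⟨⟨g, hg, Uj, hE, hL, hm, hs⟩, -⟩ := hUf' j
    exact ⟨g, hfun' ▸ image_face h' h hε0 hε hg hE hL hm hs⟩
  choose g hg using hfaces
  choose g' hg' using hfaces'
  have hgi := face_map_injective Φ.injective hg
  have hcard' := Fintype.card_le_of_injective g' (face_map_injective Φ'.injective hg')
  have hgb : Function.Bijective g := (Fintype.bijective_iff_injective_and_card g).2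
    ⟨hgi, le_antisymm (Fintype.card_le_of_injective g hgi) hcard'⟩
  rw [hfun]
  refine image_carrier h h' Φ ?_
  rw [D.boundary_eq, D'.boundary_eq, Set.image_iUnion]
  simp only [hg]
  exact hgb.surjective.iUnion_comp D'.face

end NicePolyhedron

/-! ### Matrices near the identity -/

theorem frobNorm_nonneg (A : Matrix (Fin 3) (Fin 3) ℝ) : 0 ≤ frobNorm A := Real.sqrt_nonneg _

theorem frobNorm_eq_norm (A : Matrix (Fin 3) (Fin 3) ℝ) :
    frobNorm A = ‖(WithLp.toLp 2 fun p : Fin 3 × Fin 3 => A p.1 p.2 :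
      EuclideanSpace ℝ (Fin 3 × Fin 3))‖ := by
  rw [EuclideanSpace.norm_eq, frobNorm, Fintype.sum_prod_type]
  simp

theorem frobNorm_add_le (A B : Matrix (Fin 3) (Fin 3) ℝ) :
    frobNorm (A + B) ≤ frobNorm A + frobNorm B := by
  simp only [frobNorm_eq_norm]
  exact norm_add_le (WithLp.toLp 2 fun p : Fin 3 × Fin 3 => A p.1 p.2 :
      EuclideanSpace ℝ (Fin 3 × Fin 3)) (WithLp.toLp 2 fun p : Fin 3 × Fin 3 => B p.1 p.2)

theorem frobNorm_smul (t : ℝ) (A : Matrix (Fin 3) (Fin 3) ℝ) :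
    frobNorm (t • A) = |t| * frobNorm A := by
  simp only [frobNorm_eq_norm]
  exact norm_smul t (WithLp.toLp 2 fun p : Fin 3 × Fin 3 => A p.1 p.2 :
      EuclideanSpace ℝ (Fin 3 × Fin 3))

theorem frobNorm_one : frobNorm 1 = √3 := by
  simp [frobNorm, Matrix.one_apply]

theorem abs_entry_le_frobNorm (A : Matrix (Fin 3) (Fin 3) ℝ) (i j : Fin 3) :
    |A i j| ≤ frobNorm A := by
  rw [frobNorm_eq_norm]
  exact PiLp.norm_apply_le (WithLp.toLp 2 fun p : Fin 3 × Fin 3 => A p.1 p.2) (i, j)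

theorem frobNorm_le {A : Matrix (Fin 3) (Fin 3) ℝ} {δ : ℝ} (hδ : 0 ≤ δ)
    (hA : ∀ i j, |A i j| ≤ δ) : frobNorm A ≤ 3 * δ := by
  refine Real.sqrt_le_iff.2 ⟨by positivity, ?_⟩
  have : ∀ i j, A i j ^ 2 ≤ δ ^ 2 := fun i j => sq_le_sq' (abs_le.1 (hA i j)).1 (abs_le.1 (hA i j)).2
  calc ∑ i, ∑ j, A i j ^ 2 ≤ ∑ _i : Fin 3, ∑ _j : Fin 3, δ ^ 2 :=
        Finset.sum_le_sum fun i _ => Finset.sum_le_sum fun j _ => this i j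
    _ = (3 * δ) ^ 2 := by simp; ring

theorem norm_toEuclideanCLM_apply_le (A : Matrix (Fin 3) (Fin 3) ℝ) (v : E3) :
    ‖Matrix.toEuclideanCLM (n := Fin 3) (𝕜 := ℝ) A v‖ ≤ frobNorm A * ‖v‖ := by
  refine le_of_sq_le_sq ?_ (mul_nonneg (frobNorm_nonneg A) (norm_nonneg v))
  have e : frobNorm A ^ 2 = ∑ i, ∑ j, A i j ^ 2 :=
    Real.sq_sqrt (Finset.sum_nonneg fun i _ => Finset.sum_nonneg fun j _ => sq_nonneg _)
  rw [mul_pow, e, EuclideanSpace.norm_sq_eq, EuclideanSpace.norm_sq_eq, Finset.sum_mul]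
  refine Finset.sum_le_sum fun i _ => ?_
  simp only [Real.norm_eq_abs, sq_abs, Matrix.ofLp_toEuclideanCLM]
  exact Finset.sum_mul_sq_le_sq_mul_sq Finset.univ (fun j => A i j) fun j => v j

/-- The determinant is a polynomial in `t` with constant term `1` and linear term `trace A`; the other
two coefficients are sums of six products each. -/
theorem abs_det_one_add_smul_sub_le {A : Matrix (Fin 3) (Fin 3) ℝ} {m t : ℝ} (hm : 0 ≤ m)
    (hA : ∀ i j, |A i j| ≤ m) (ht : 0 ≤ t) :
    |(1 + t • A).det - 1 - t * A.trace| ≤ 6 * t ^ 2 * m ^ 2 + 6 * t ^ 3 * m ^ 3 := by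
  have e : (1 + t • A).det - 1 - t * A.trace = t ^ 2 * (A 0 0 * A 1 1 + A 0 0 * A 2 2 +
      A 1 1 * A 2 2 + -(A 0 1 * A 1 0) + -(A 0 2 * A 2 0) + -(A 1 2 * A 2 1)) +
      t ^ 3 * (A 0 0 * A 1 1 * A 2 2 + -(A 0 0 * A 1 2 * A 2 1) + -(A 0 1 * A 1 0 * A 2 2) +
        A 0 1 * A 1 2 * A 2 0 + A 0 2 * A 1 0 * A 2 1 + -(A 0 2 * A 1 1 * A 2 0)) := by
    rw [Matrix.det_fin_three, Matrix.trace_fin_three]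
    simp
    ring
  have h2 : ∀ i j k l, |A i j * A k l| ≤ m ^ 2 := fun i j k l => by
    rw [abs_mul, sq]; exact mul_le_mul (hA i j) (hA k l) (abs_nonneg _) hm
  have h3 : ∀ i j k l p q, |A i j * A k l * A p q| ≤ m ^ 3 := fun i j k l p q => by
    rw [abs_mul, pow_succ]; exact mul_le_mul (h2 i j k l) (hA p q) (abs_nonneg _) (by positivity)
  have six : ∀ {a b c d e f B : ℝ}, |a| ≤ B → |b| ≤ B → |c| ≤ B → |d| ≤ B → |e| ≤ B → |f| ≤ B →
      |a + b + c + d + e + f| ≤ 6 * B := by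
    intro a b c d e f B ha hb hc hd he hf
    rw [abs_le] at *
    constructor <;> linarith [ha.1, hb.1, hc.1, hd.1, he.1, hf.1, ha.2, hb.2, hc.2, hd.2, he.2, hf.2]
  rw [e]
  refine (abs_add_le _ _).trans (add_le_add ?_ ?_)
  · rw [abs_mul, abs_of_nonneg (by positivity : 0 ≤ t ^ 2)]
    have h := six (h2 0 0 1 1) (h2 0 0 2 2) (h2 1 1 2 2) ((abs_neg _).trans_le (h2 0 1 1 0))
      ((abs_neg _).trans_le (h2 0 2 2 0)) ((abs_neg _).trans_le (h2 1 2 2 1))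
    exact (mul_le_mul_of_nonneg_left h (by positivity)).trans_eq (by ring)
  · rw [abs_mul, abs_of_nonneg (by positivity : 0 ≤ t ^ 3)]
    have h := six (h3 0 0 1 1 2 2) ((abs_neg _).trans_le (h3 0 0 1 2 2 1))
      ((abs_neg _).trans_le (h3 0 1 1 0 2 2)) (h3 0 1 1 2 2 0) (h3 0 2 1 0 2 1)
      ((abs_neg _).trans_le (h3 0 2 1 1 2 0))
    exact (mul_le_mul_of_nonneg_left h (by positivity)).trans_eq (by ring)

theorem det_one_add_smul_mem_Icc {A : Matrix (Fin 3) (Fin 3) ℝ} {t : ℝ}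
    (hA : ∀ i j, |A i j| ≤ 1 / 12) (ht0 : 0 ≤ t) (ht1 : t ≤ 1) :
    (1 + t • A).det ∈ Set.Icc (1 / 2 : ℝ) (3 / 2) := by
  have h1 := abs_det_one_add_smul_sub_le (by norm_num) hA ht0
  have h2 : |A.trace| ≤ 1 / 4 := by
    rw [Matrix.trace_fin_three]
    have h0 := abs_le.1 (hA 0 0)
    have h1 := abs_le.1 (hA 1 1)
    have h2 := abs_le.1 (hA 2 2)
    exact abs_le.2 ⟨by linarith [h0.1, h1.1, h2.1], by linarith [h0.2, h1.2, h2.2]⟩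
  have h3 : |t * A.trace| ≤ 1 / 4 := by
    rw [abs_mul, abs_of_nonneg ht0]
    exact (mul_le_of_le_one_left (abs_nonneg _) ht1).trans h2
  have h4 : t ^ 2 ≤ 1 := pow_le_one₀ ht0 ht1
  have h5 : t ^ 3 ≤ 1 := pow_le_one₀ ht0 ht1
  rw [abs_le] at h1 h3
  constructor <;> linarith [h1.1, h1.2, h3.1, h3.2]

theorem inv_one_add_smul {A : Matrix (Fin 3) (Fin 3) ℝ} {t : ℝ} (h : (1 + t • A).det ≠ 0) :
    (1 + t • A)⁻¹ = 1 - t • (A * (1 + t • A)⁻¹) := by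
  have h1 := Matrix.mul_nonsing_inv (1 + t • A) (isUnit_iff_ne_zero.2 h)
  rw [add_mul, one_mul, smul_mul_assoc] at h1
  exact eq_sub_of_add_eq h1

theorem opNorm_inv_one_add_smul_le {A : Matrix (Fin 3) (Fin 3) ℝ} {t : ℝ}
    (hdet : (1 + t • A).det ≠ 0) (hA : frobNorm A ≤ 1 / 3) (ht0 : 0 ≤ t) (ht1 : t ≤ 1) :
    opNorm (1 + t • A)⁻¹ ≤ 3 / 2 := by
  refine ContinuousLinearMap.opNorm_le_bound _ (by norm_num) fun v => ?_
  set T := Matrix.toEuclideanCLM (n := Fin 3) (𝕜 := ℝ) with hT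
  set w := T (1 + t • A)⁻¹ v with hw
  have e : w = v - t • T A w := by
    have h1 := congrArg (fun B => T B v) (inv_one_add_smul hdet)
    simp only [map_sub, map_one, map_smul, map_mul] at h1
    exact h1
  have h2 : ‖t • T A w‖ ≤ 1 / 3 * ‖w‖ := by
    rw [norm_smul, Real.norm_of_nonneg ht0]
    exact (mul_le_of_le_one_left (norm_nonneg _) ht1).trans
      ((norm_toEuclideanCLM_apply_le A w).trans (by gcongr))
  have h3 : ‖w‖ ≤ ‖v‖ + ‖t • T A w‖ := (congrArg norm e).le.trans (norm_sub_le _ _)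
  linarith

/-! ### Lipschitz fields as Sobolev fields -/

/-- The matrix of the partial derivatives of `f`, with entry `0` where a partial derivative does
not exist. -/
noncomputable def partialJac (f : E3 → E3) (x : E3) : Matrix (Fin 3) (Fin 3) ℝ :=
  Matrix.of fun i j => lineDeriv ℝ (fun y => f y i) x (EuclideanSpace.single j 1)

theorem lipschitzWith_coord {K : NNReal} {f : E3 → E3} (hf : LipschitzWith K f) (i : Fin 3) :
    LipschitzWith K fun y => f y i :=
  LipschitzWith.of_dist_le_mul fun x y => by
    refine le_trans ?_ (hf.dist_le_mul x y)
    rw [dist_eq_norm, dist_eq_norm]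
    exact PiLp.norm_apply_le (f x - f y) i

theorem abs_partialJac_le {K : NNReal} {f : E3 → E3} (hf : LipschitzWith K f) (x : E3)
    (i j : Fin 3) : |partialJac f x i j| ≤ K := by
  have := norm_lineDeriv_le_of_lipschitz ℝ (x₀ := x) (v := EuclideanSpace.single j (1 : ℝ))
    (lipschitzWith_coord hf i)
  rwa [PiLp.norm_single, norm_one, mul_one] at this

theorem memLp_partialJac {K : NNReal} {f : E3 → E3} (hf : LipschitzWith K f) (O : Set E3)
    (i j : Fin 3) : MemLp (fun x => partialJac f x i j) ∞ (volume.restrict O) :=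
  ((lipschitzWith_coord hf i).memLp_lineDeriv _)

/-- A Lipschitz field has its partial derivatives as weak derivatives, by integration by parts. -/
theorem LipschitzWith.hasW1InfDeriv {K : NNReal} {f : E3 → E3} (hf : LipschitzWith K f)
    {O : Set E3} (hm : MemLp f ∞ (volume.restrict O)) : HasW1InfDeriv O f (partialJac f) := by
  refine ⟨hm, memLp_partialJac hf O, fun φ hφ hc hs i j => ?_⟩
  obtain ⟨C, hC⟩ := hφ.lipschitzWith_of_hasCompactSupport hc (by simp)
  have h := LipschitzWith.integral_lineDeriv_mul_eq (μ := volume) (lipschitzWith_coord hf i) hC hc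
    (EuclideanSpace.single j 1)
  have hd : ∀ x, lineDeriv ℝ φ x (-EuclideanSpace.single j 1) * f x i =
      -(f x i * fderiv ℝ φ x (EuclideanSpace.single j 1)) := fun x => by
    rw [((hφ.differentiable (by simp)) x).lineDeriv_eq_fderiv, map_neg]; ring
  have h0 : ∀ x ∉ O, x ∉ tsupport φ := fun x hx h => hx (hs h)
  rw [setIntegral_eq_integral_of_forall_compl_eq_zero fun x hx => by
      rw [fderiv_of_notMem_tsupport ℝ (h0 x hx), zero_apply, mul_zero],
    setIntegral_eq_integral_of_forall_compl_eq_zero fun x hx => by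
      rw [image_eq_zero_of_notMem_tsupport (h0 x hx), mul_zero]]
  simp only [hd, integral_neg] at h
  have h' : ∫ x, partialJac f x i j * φ x = -∫ x, f x i * fderiv ℝ φ x (EuclideanSpace.single j 1) :=
    h
  rw [h', neg_neg]

theorem partialJac_id (x : E3) : partialJac id x = 1 := by
  ext i j
  have h : HasFDerivAt (fun y : E3 => y i) (EuclideanSpace.proj i : E3 →L[ℝ] ℝ) x :=
    (EuclideanSpace.proj i : E3 →L[ℝ] ℝ).hasFDerivAt
  have : partialJac id x i j = lineDeriv ℝ (fun y : E3 => y i) x (EuclideanSpace.single j 1) := rfl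
  rw [this, h.differentiableAt.lineDeriv_eq_fderiv, h.fderiv]
  simp [Matrix.one_apply]

theorem HasW1InfDeriv.add_smul {O : Set E3} {f g : E3 → E3}
    {A B : E3 → Matrix (Fin 3) (Fin 3) ℝ} (hf : HasW1InfDeriv O f A) (hg : HasW1InfDeriv O g B)
    (t : ℝ) : HasW1InfDeriv O (fun x => f x + t • g x) (fun x => A x + t • B x) := by
  refine ⟨hf.memLp.add (hg.memLp.const_smul t),
    fun i j => (hf.deriv_memLp i j).add ((hg.deriv_memLp i j).const_smul t), ?_⟩
  intro φ hφ hc hs i j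
  have hcoord : ∀ {f : E3 → E3}, MemLp f ∞ (volume.restrict O) →
      MemLp (fun x => f x i) ∞ (volume.restrict O) := fun {f} h =>
    h.of_le (((EuclideanSpace.proj i : E3 →L[ℝ] ℝ).continuous.comp_aestronglyMeasurable h.1))
      (Eventually.of_forall fun x => PiLp.norm_apply_le (f x) i)
  have hi1 : Integrable (fun x => fderiv ℝ φ x (EuclideanSpace.single j 1))
      (volume.restrict O) :=
    (((hφ.continuous_fderiv (by simp)).clm_apply continuous_const).integrable_of_hasCompactSupport
      (hc.fderiv_apply ℝ _))
  have hi2 : Integrable φ (volume.restrict O) :=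
    hφ.continuous.integrable_of_hasCompactSupport hc
  have a1 : Integrable (fun x => f x i * fderiv ℝ φ x (EuclideanSpace.single j 1))
    (volume.restrict O) := hi1.mul_of_top_right (hcoord hf.memLp)
  have a2 : Integrable (fun x => g x i * fderiv ℝ φ x (EuclideanSpace.single j 1))
    (volume.restrict O) := hi1.mul_of_top_right (hcoord hg.memLp)
  have a3 : Integrable (fun x => A x i j * φ x) (volume.restrict O) :=
    hi2.mul_of_top_right (hf.deriv_memLp i j)
  have a4 : Integrable (fun x => B x i j * φ x) (volume.restrict O) :=
    hi2.mul_of_top_right (hg.deriv_memLp i j)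
  have e1 := hf.weak_deriv φ hφ hc hs i j
  have e2 := hg.weak_deriv φ hφ hc hs i j
  have s1 : ∫ x in O, (f x + t • g x) i * fderiv ℝ φ x (EuclideanSpace.single j 1) =
      (∫ x in O, f x i * fderiv ℝ φ x (EuclideanSpace.single j 1)) +
        t * ∫ x in O, g x i * fderiv ℝ φ x (EuclideanSpace.single j 1) := by
    rw [← integral_const_mul, ← integral_add a1 (a2.const_mul t)]
    refine integral_congr_ae (Eventually.of_forall fun x => ?_)
    simp; ring
  have s2 : ∫ x in O, (A x + t • B x) i j * φ x =
      (∫ x in O, A x i j * φ x) + t * ∫ x in O, B x i j * φ x := by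
    rw [← integral_const_mul, ← integral_add a3 (a4.const_mul t)]
    refine integral_congr_ae (Eventually.of_forall fun x => ?_)
    simp; ring
  rw [s1, s2, e1, e2]
  ring

theorem eLpNorm_top_le {α F : Type*} [MeasurableSpace α] {μ : Measure α} [NormedAddCommGroup F]
    {f : α → F} {B : ℝ} (h : ∀ x, ‖f x‖ ≤ B) : eLpNorm f ∞ μ ≤ ENNReal.ofReal B := by
  rw [eLpNorm_exponent_top]
  exact eLpNormEssSup_le_of_ae_bound (Eventually.of_forall h)

theorem hasW1InfDeriv_homotopyMap {K : NNReal} {U : E3 → E3} (hU : LipschitzWith K U) {B : ℝ}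
    (hB : ∀ x, ‖U x‖ ≤ B) {O : Set E3} (hO : MeasurableSet O) (hb : Bornology.IsBounded O) (t : ℝ) :
    HasW1InfDeriv O (homotopyMap U t) (homotopyJac (partialJac U) t) := by
  have h1 : HasW1InfDeriv O id (partialJac id) := by
    refine (LipschitzWith.id).hasW1InfDeriv ?_
    obtain ⟨R, hR⟩ := hb.subset_closedBall 0
    exact memLp_top_of_bound continuous_id.aestronglyMeasurable R
      ((ae_restrict_mem hO).mono fun x hx => by simpa using hR hx)
  have h2 := h1.add_smul (hU.hasW1InfDeriv (memLp_top_of_bound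
    hU.continuous.aestronglyMeasurable B (Eventually.of_forall hB))) t
  simp only [partialJac_id] at h2
  exact h2

/-- A perturbation of the identity by a contraction that vanishes outside `Ω` is a bi-Lipschitz
bijection of `Ω`: it is a homeomorphism of space that fixes the points outside `Ω`. -/
theorem isBiLipschitzSelfMap_of_contraction {Ω : Set E3} {V : E3 → E3} {ε : ℝ} (hε0 : 0 ≤ ε)
    (hε : ε ≤ 1 / 2) (hV : ∀ x y, dist (V x) (V y) ≤ ε * dist x y) (h0 : ∀ x ∉ Ω, V x = 0) :
    IsBiLipschitzSelfMap Ω fun x => x + V x := by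
  have key : ∀ x y, ‖x + V x - (y + V y) - (x - y)‖ ≤ ε * ‖x - y‖ := fun x y => by
    have e : x + V x - (y + V y) - (x - y) = V x - V y := by abel
    rw [e, ← dist_eq_norm, ← dist_eq_norm]
    exact hV x y
  obtain ⟨Φ, hΦ⟩ := exists_homeomorph_of_lipschitz_perturbation hε0 (by linarith) key
  have hfun : (fun x => x + V x) = Φ := funext fun x => (hΦ x).symm
  have hfix : ∀ x ∉ Ω, Φ x = x := fun x hx => by rw [hΦ, h0 x hx, add_zero]
  refine ⟨hfun ▸ ⟨fun x hx => ?_, Φ.injective.injOn, fun y hy => ?_⟩, 2, by norm_num,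
    fun x _ y _ => ?_⟩
  · by_contra hno
    exact hno ((Φ.injective (hfix _ hno)).symm ▸ hx)
  · refine ⟨Φ.symm y, ?_, Φ.apply_symm_apply y⟩
    by_contra hno
    have := hfix _ hno
    rw [Φ.apply_symm_apply] at this
    exact hno (this ▸ hy)
  · have h1 := key x y
    have h2 : ε * ‖x - y‖ ≤ 1 / 2 * ‖x - y‖ := by gcongr
    have h3 := norm_sub_norm_le (x + V x - (y + V y)) (x - y)
    have h4 := norm_sub_norm_le (x - y) (x + V x - (y + V y))
    rw [norm_sub_rev (x - y) (x + V x - (y + V y))] at h4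
    have h5 := norm_nonneg (x - y)
    simp only [dist_eq_norm]
    constructor <;> linarith

/-! ### Numbering of the vertices -/

namespace Polyhedron

theorem finite_vertices (D : Polyhedron) : D.vertices.Finite := by
  have e : D.vertices = ⋃ j, Set.range (D.corner j) := by
    ext p; simp [vertices]
  rw [e]
  refine Set.finite_iUnion fun j => ?_
  have : NeZero (D.numSides j) := ⟨by have := (D.face_polygonal j).three_le; omega⟩
  exact Set.finite_range _

theorem isClose_hausdorffDist {D D' : Polyhedron} (hc : IsCompact (frontier D.carrier))
    (hc' : IsCompact (frontier D'.carrier)) (hn : (frontier D.carrier).Nonempty)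
    (hn' : (frontier D'.carrier).Nonempty) :
    D.IsClose D' (Metric.hausdorffDist (frontier D.carrier) (frontier D'.carrier)) := by
  -- for compact sets the infimum in the distance to a set is attained
  have key : ∀ {s t : Set E3}, IsCompact s → IsCompact t → s.Nonempty → t.Nonempty →
      ∀ x ∈ s, ∃ y ∈ t, dist x y ≤ Metric.hausdorffDist s t := by
    intro s t hs ht hs0 ht0 x hx
    obtain ⟨y, hy, h1⟩ := ht.exists_infDist_eq_dist ht0 x
    exact ⟨y, hy, h1 ▸ Metric.infDist_le_hausdorffDist_of_mem hx
      (Metric.hausdorffEDist_ne_top_of_nonempty_of_bounded hs0 ht0 hs.isBounded ht.isBounded)⟩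
  refine ⟨key hc hc' hn hn', ?_⟩
  rw [Metric.hausdorffDist_comm]
  exact key hc' hc hn' hn

theorem IsMatching.isEdge {D D' : Polyhedron} {φ : E3 → E3} (h : D.IsMatching D' φ)
    {a b : E3} (hab : D.IsEdge a b) : D'.IsEdge (φ a) (φ b) := by
  obtain ⟨j, k, hjk⟩ := hab
  obtain ⟨i, l, hil⟩ := h.side j k
  have hne : D.corner j k ≠ D.corner j (k + 1) := fun hk => by
    have h3 := (D.face_polygonal j).three_le
    have : Fact (1 < D.numSides j) := ⟨by omega⟩
    have h1 := (D.face_polygonal j).corners_injective hk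
    simp at h1
  refine ⟨i, l, hil.trans ?_⟩
  rcases eq_or_eq_of_segment_eq hne hjk.symm with ⟨rfl, rfl⟩ | ⟨rfl, rfl⟩
  · rfl
  · exact segment_symm ℝ _ _

theorem IsMatching.isFaceVertexSet {D D' : Polyhedron} {φ : E3 → E3} (h : D.IsMatching D' φ)
    {A : Set E3} (hA : D.IsFaceVertexSet A) : D'.IsFaceVertexSet (φ '' A) := by
  obtain ⟨j, rfl⟩ := hA
  obtain ⟨g, hg, -⟩ := h.face j
  exact ⟨g, hg⟩

theorem exists_numbering {D D' : Polyhedron} {φ ψ : E3 → E3} (hφ : D.IsMatching D' φ)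
    (hψ : D'.IsMatching D ψ) (hψφ : ∀ p ∈ D.vertices, ψ (φ p) = p)
    (hφψ : ∀ p ∈ D'.vertices, φ (ψ p) = p) :
    ∃ (N : ℕ) (V : Fin N → E3), Function.Injective V ∧ Function.Injective (φ ∘ V) ∧
      Set.range V = D.vertices ∧ Set.range (φ ∘ V) = D'.vertices ∧
      (∀ i j, D.IsEdge (V i) (V j) ↔ D'.IsEdge ((φ ∘ V) i) ((φ ∘ V) j)) ∧
      ∀ I : Set (Fin N), D.IsFaceVertexSet (V '' I) ↔ D'.IsFaceVertexSet ((φ ∘ V) '' I) := by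
  obtain ⟨N, V, hV, hr⟩ := D.finite_vertices.fin_param
  have hmem : ∀ i, V i ∈ D.vertices := fun i => hr ▸ Set.mem_range_self i
  have hinv : ∀ i, ψ ((φ ∘ V) i) = V i := fun i => hψφ _ (hmem i)
  refine ⟨N, V, hV, fun i j hij => hV (hφ.injOn (hmem i) (hmem j) hij), hr, ?_,
    fun i j => ⟨hφ.isEdge, fun h => ?_⟩, fun I => ⟨fun h => ?_, fun h => ?_⟩⟩
  · rw [Set.range_comp, hr]
    refine Set.Subset.antisymm (Set.image_subset_iff.2 hφ.mapsTo) fun q hq =>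
      ⟨ψ q, hψ.mapsTo q hq, hφψ q hq⟩
  · have := hψ.isEdge h
    rwa [hinv, hinv] at this
  · rw [Set.image_comp]; exact hφ.isFaceVertexSet h
  · have := hψ.isFaceVertexSet h
    rw [Set.image_image] at this
    simpa only [hinv] using this

end Polyhedron

/-! ### The vector field and the homotopy -/

/-- The isosceles triangles lie in the triangles `sideTriangle`, since the side has length at least `r`. -/
theorem NicePolyhedron.exists_sideTriangle {r θ M M₁ : ℝ} {D : Polyhedron}
    (h : NicePolyhedron r θ M M₁ D) {T : Set E3} (hT : T ∈ D.triangles (triangleHeight r θ M)) :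
    ∃ j k, ∀ u, IsInnerNormal r M (D.face j) (D.corner j k) (D.corner j (k + 1)) u →
      T ⊆ sideTriangle r (baseSlope θ M) (D.corner j k) (D.corner j (k + 1)) u := by
  obtain ⟨j, k, n, hn, rfl⟩ := hT
  refine ⟨j, k, fun u hu => ?_⟩
  have e : D.sideMid j k - triangleHeight r θ M • n =
      midpoint ℝ (D.corner j k) (D.corner j (k + 1)) + (baseSlope θ M * (r / 2)) • u := by
    rw [h.eq_neg_of_isOuterNormal hu hn, smul_neg, sub_neg_eq_add, triangleHeight,
      mul_comm (r / 2)]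
    rfl
  rw [e]
  exact convexHull_subset_sideTriangle h.r_pos.le (baseSlope_pos h.θ_pos h.θ_lt).le
    ((h.face j).corner_ne k) ((h.face j).len k) u

theorem mainTheorem10 (M₀ M₁ θ₀ : ℝ) (hM₀ : 1 ≤ M₀) (hM₁ : 1 < M₁) (hθ₀ : 0 < θ₀)
    (hθ₀' : θ₀ < Real.pi / 2) :
    ∃ c C₄ C : ℝ, 0 < c ∧ 0 < C₄ ∧ 0 < C ∧
      ∀ (r₀ : ℝ) (Ω : Set E3) (D₀ D₁ : Polyhedron), 0 < r₀ → AdmissibleDomain r₀ M₁ Ω →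
        PolyhedralClass r₀ θ₀ M₀ Ω D₀ → PolyhedralClass r₀ θ₀ M₀ Ω D₁ →
        Metric.hausdorffDist (frontier D₀.carrier) (frontier D₁.carrier) ≤ c * r₀ →
        -- the numbering of the vertices of the two polyhedra
        ∃ (N : ℕ) (V₀ V₁ : Fin N → E3),
          Function.Injective V₀ ∧ Function.Injective V₁ ∧
          Set.range V₀ = D₀.vertices ∧ Set.range V₁ = D₁.vertices ∧
          (∀ i, dist (V₀ i) (V₁ i) ≤
            C₄ * Metric.hausdorffDist (frontier D₀.carrier) (frontier D₁.carrier)) ∧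
          (∀ i j, D₀.IsEdge (V₀ i) (V₀ j) ↔ D₁.IsEdge (V₁ i) (V₁ j)) ∧
          (∀ I : Set (Fin N), D₀.IsFaceVertexSet (V₀ '' I) ↔ D₁.IsFaceVertexSet (V₁ '' I)) ∧
          -- the vector field
          ∃ (U : E3 → E3) (DU : E3 → Matrix (Fin 3) (Fin 3) ℝ),
            Continuous U ∧ HasW1InfDeriv Set.univ U DU ∧
            (∀ i, U (V₀ i) = V₁ i - V₀ i) ∧
            tsupport U ⊆ closure (Metric.thickening (r₀ / 4) D₀.carrier) ∧
            (∀ T ∈ D₀.triangles (triangleHeight r₀ θ₀ M₀), ∃ a : E3 →ᵃ[ℝ] E3, Set.EqOn U a T) ∧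
            eLpNorm U ∞ volume +
                ENNReal.ofReal r₀ * eLpNorm (fun x => frobNorm (DU x)) ∞ volume ≤
              ENNReal.ofReal
                (C * Metric.hausdorffDist (frontier D₀.carrier) (frontier D₁.carrier)) ∧
            -- the homotopy
            (Metric.hausdorffDist (frontier D₀.carrier) (frontier D₁.carrier) ≤
                1 / (3 * C) * r₀ →
              eLpNorm (fun x => frobNorm (DU x)) ∞ volume ≤ ENNReal.ofReal (1 / 3) ∧
              homotopyMap U 1 '' D₀.carrier = D₁.carrier ∧
              ∀ t ∈ Set.Icc (0 : ℝ) 1,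
                IsBiLipschitzSelfMap Ω (homotopyMap U t) ∧
                HasW1InfDeriv Ω (homotopyMap U t) (homotopyJac DU t) ∧
                eLpNorm (fun x => frobNorm (homotopyJac DU t x)) ∞ (volume.restrict Ω) ≤
                  ENNReal.ofReal (√3 + 1 / 3) ∧
                eLpNorm (fun x => opNorm (homotopyJac DU t x)⁻¹) ∞ (volume.restrict Ω) ≤
                  ENNReal.ofReal (3 / 2) ∧
                ∀ᵐ x ∂(volume.restrict Ω),
                  1 / 2 ≤ (homotopyJac DU t x).det ∧ (homotopyJac DU t x).det ≤ 3 / 2 ∧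
                  (homotopyJac DU t x)⁻¹ = 1 - t • (DU x * (homotopyJac DU t x)⁻¹) ∧
                  |(homotopyJac DU t x).det - 1 - t * (DU x).trace| ≤
                    6 * t ^ 2 * frobNorm (DU x) ^ 2 + 6 * t ^ 3 * frobNorm (DU x) ^ 3) := by
  obtain ⟨c, hc, K, hK, C, hC, H⟩ := NicePolyhedron.exists_matching_field θ₀ M₀ M₁ hM₀
    (by linarith) hθ₀ hθ₀'
  -- the norm of the field is at most `C * d`; its partial derivatives are at most `C * d / r₀`, so
  -- that `r₀` times their Frobenius norm is at most `3 * C * d`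
  refine ⟨c, K, 4 * C, hc, hK, by positivity, ?_⟩
  intro r₀ Ω D₀ D₁ hr hΩ hD₀ hD₁ hd
  have h₀ := hD₀.nice hr hM₀ hθ₀ hθ₀' hΩ
  have h₁ := hD₁.nice hr hM₀ hθ₀ hθ₀' hΩ
  have hfc : ∀ {D : Polyhedron}, NicePolyhedron r₀ θ₀ M₀ M₁ D → IsCompact (frontier D.carrier) :=
    fun h => h.compact.of_isClosed_subset isClosed_frontier h.compact.isClosed.frontier_subset
  have hclose := Polyhedron.isClose_hausdorffDist (hfc h₀) (hfc h₁)
    (h₀.frontier_nonempty (PolyhedralClass.carrier_nonempty D₀))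
    (h₁.frontier_nonempty (PolyhedralClass.carrier_nonempty D₁))
  set d := Metric.hausdorffDist (frontier D₀.carrier) (frontier D₁.carrier) with hdd
  have hd0 : 0 ≤ d := Metric.hausdorffDist_nonneg
  obtain ⟨φ, ψ, U, hφ, hψ, hψφ, hφψ, hdist, hUL, hUb, hU0, hUv, hUt, himg⟩ :=
    H h₀ h₁ hclose hd0 hd
  obtain ⟨N, V, hV, hV', hVr, hVr', hedge, hface⟩ := Polyhedron.exists_numbering hφ hψ hψφ hφψ
  have hmem : ∀ i, V i ∈ D₀.vertices := fun i => hVr ▸ Set.mem_range_self i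
  set L := C * d / r₀ with hL
  have hL0 : 0 ≤ L := by positivity
  have hLip : LipschitzWith ⟨L, hL0⟩ U := LipschitzWith.of_dist_le_mul hUL
  have hent : ∀ x i j, |partialJac U x i j| ≤ L := abs_partialJac_le hLip
  have hfrob : ∀ x, frobNorm (partialJac U x) ≤ 3 * L := fun x => frobNorm_le hL0 (hent x)
  have hUm : ∀ O, MemLp U ∞ (volume.restrict O) := fun O =>
    memLp_top_of_bound hLip.continuous.aestronglyMeasurable _ (Eventually.of_forall hUb)
  have hnorm : ∀ {A : Matrix (Fin 3) (Fin 3) ℝ}, ‖frobNorm A‖ = frobNorm A := fun {A} =>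
    Real.norm_of_nonneg (frobNorm_nonneg A)
  refine ⟨N, V, φ ∘ V, hV, hV', hVr, hVr', fun i => hdist _ (hmem i), hedge, hface, U,
    partialJac U, hLip.continuous, hLip.hasW1InfDeriv (hUm _), fun i => hUv _ (hmem i), ?_, ?_,
    ?_, ?_⟩
  · refine closure_mono fun x hx => ?_
    rw [Metric.mem_thickening_iff_infDist_lt (PolyhedralClass.carrier_nonempty D₀)]
    by_contra hno
    exact hx (hU0 x (by linarith))
  · intro T hT
    obtain ⟨j, k, hjk⟩ := h₀.exists_sideTriangle hT
    obtain ⟨u, hu, a, ha⟩ := hUt j k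
    exact ⟨a, ha.mono (hjk u hu)⟩
  · have e : 4 * C * d = C * d + r₀ * (3 * L) := by
      rw [hL]; field_simp; ring
    rw [e, ENNReal.ofReal_add (by positivity) (by positivity), ENNReal.ofReal_mul hr.le]
    gcongr
    · exact eLpNorm_top_le hUb
    · exact eLpNorm_top_le fun x => hnorm.trans_le (hfrob x)
  · intro hsmall
    -- with this choice of the constant the partial derivatives are at most `1 / 12`
    have hL12 : L ≤ 1 / 12 := by
      rw [hL, div_le_iff₀ hr]
      calc C * d ≤ C * (1 / (3 * (4 * C)) * r₀) := by gcongr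
        _ = 1 / 12 * r₀ := by field_simp; ring
    have hfrob3 : ∀ x, frobNorm (partialJac U x) ≤ 1 / 3 := fun x =>
      (hfrob x).trans (by linarith)
    refine ⟨eLpNorm_top_le fun x => hnorm.trans_le (hfrob3 x), ?_, ?_⟩
    · have e : homotopyMap U 1 = fun x => x + U x := funext fun x => by
        rw [homotopyMap, one_smul]
      rw [e]
      exact himg (by linarith)
    intro t ⟨ht0, ht1⟩
    have hdet : ∀ x, (homotopyJac (partialJac U) t x).det ∈ Set.Icc (1 / 2 : ℝ) (3 / 2) :=
      fun x => det_one_add_smul_mem_Icc (fun i j => (hent x i j).trans hL12) ht0 ht1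
    have hne : ∀ x, (homotopyJac (partialJac U) t x).det ≠ 0 := fun x => by
      linarith [(hdet x).1]
    refine ⟨?_, hasW1InfDeriv_homotopyMap hLip hUb hΩ.isOpen.measurableSet hΩ.bounded t, ?_, ?_,
      ?_⟩
    · refine isBiLipschitzSelfMap_of_contraction (V := fun x => t • U x) hL0 (by linarith)
        (fun x y => ?_) fun x hx => ?_
      · rw [dist_smul₀, Real.norm_of_nonneg ht0]
        exact (mul_le_of_le_one_left dist_nonneg ht1).trans (hUL x y)
      · rw [hU0 x, smul_zero]
        refine le_trans (by linarith : r₀ / 8 ≤ r₀) ?_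
        refine (Metric.le_infDist (PolyhedralClass.carrier_nonempty D₀)).2 fun {y} hy => ?_
        by_contra hno
        exact hx (hD₀.ball_subset hy (Metric.mem_ball.2 (not_le.1 hno)))
    · refine eLpNorm_top_le fun x => hnorm.trans_le ((frobNorm_add_le _ _).trans ?_)
      rw [frobNorm_one, frobNorm_smul, abs_of_nonneg ht0]
      have := mul_le_of_le_one_left (frobNorm_nonneg (partialJac U x)) ht1
      linarith [hfrob3 x]
    · refine eLpNorm_top_le fun x => ?_
      refine (Real.norm_of_nonneg (norm_nonneg _)).trans_le ?_
      exact opNorm_inv_one_add_smul_le (hne x) (hfrob3 x) ht0 ht1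
    · refine Eventually.of_forall fun x => ⟨(hdet x).1, (hdet x).2, inv_one_add_smul (hne x), ?_⟩
      exact abs_det_one_add_smul_sub_le (frobNorm_nonneg _) (abs_entry_le_frobNorm _) ht0
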